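/- Let $\mathbb{T}^2=(\mathbb{R}/\mathbb{Z})^2$, $\alpha\in(\tfrac12,1]$, $e_2=(0,1)^T$, and let $\Lambda^{2\alpha}=(-\Delta)^\alpha$ be the Fourier multiplier with symbol $|\xi|^{2\alpha}$. For $\varepsilon\in(0,1]$ consider the Boussinesq--Navier--Stokes system $$(\mathrm{B}_\alpha)\qquad \partial_t\theta+u\cdot\nabla\theta=0,\qquad \varepsilon(\partial_t u+u\cdot\nabla u)+\Lambda^{2\alpha}u=-\nabla p+\theta e_2,\qquad \nabla\cdot u=0,\qquad (u,\theta)|_{t=0}=(u_0^\varepsilon,\theta_0^\varepsilon)$$ on $[0,\infty)\times\mathbb{T}^2$. A global regular solution is a pair $(u,\theta)$ that satisfies $(\mathrm{B}_\alpha)$ in the sense of distributions (the momentum equation being tested against divergence-free fields) with $u\in L^\infty([0,T];H^1(\mathbb{T}^2))\cap L^1([0,T];W^{1,\infty}(\mathbb{T}^2))$ and $\theta\in L^\infty([0,T]\times\mathbb{T}^2)$ for all $T>0$. For each $\varepsilon\in(0,1]$ let $(u^\varepsilon,\theta^\varepsilon)$ be a global regular solution of $(\mathrm{B}_\alpha)$,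 with initial data $(u_0^\varepsilon,\theta_0^\varepsilon)$ bounded in $H^1(\mathbb{T}^2)\times L^\infty(\mathbb{T}^2)$ uniformly in $\varepsilon$, $\nabla\cdot u_0^\varepsilon=0$ and $\int_{\mathbb{T}^2}\theta_0^\varepsilon\,dx=0$. Suppose that $(u_0^\varepsilon,\theta_0^\varepsilon)\to(u_0,\theta_0)$ in $H^1(\mathbb{T}^2)\times L^\infty(\mathbb{T}^2)$ as $\varepsilon\to0$. Consider the (fractional) Stokes--transport system $$(\mathrm{ST}_\alpha)\qquad \partial_t\theta+u\cdot\nabla\theta=0,\qquad \Lambda^{2\alpha}u=-\nabla p+\theta e_2,\qquad \nabla\cdot u=0,\qquad \theta|_{t=0}=\theta_0 ,$$ whose global weak solutions are the pairs $(u,\theta)$ that satisfy it in the sense of distributions with $u\in L^\infty([0,T];H^1(\mathbb{T}^2))$ and $\theta\in L^\infty([0,T]\times\mathbb{T}^2)$ for all $T>0$. Then $(\mathrm{ST}_\alpha)$ has exactly one global weak solution $(u,\theta)$ (up to equality almost everywhere) such that $\int_{\mathbb{T}^2}u(x,t)\,dx=\int_{\mathbb{T}^2}u_0\,dx$ for almost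 every $t>0$. Moreover, every sequence in $(0,1]$ that tends to $0$ has a subsequence $(\varepsilon_n)$ along which, for every $T>0$, $$u^{\varepsilon_n}\rightharpoonup^* u\ \text{ in } L^\infty([0,T];H^1(\mathbb{T}^2)),\qquad \theta^{\varepsilon_n}\rightharpoonup^*\theta\ \text{ in } L^\infty([0,T]\times\mathbb{T}^2),$$ and $\theta^{\varepsilon_n}\to\theta$ strongly in $L^r([0,T];L^q(\mathbb{T}^2))$ for all $1\le q,r<\infty$. -/

import Mathlib

open Set Filter Topology MeasureTheory
open scoped ENNReal NNReal ContDiff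

noncomputable section

namespace PrandtlLimit

/-- The two-dimensional torus `(ℝ / ℤ)²`. -/
abbrev T2 : Type := UnitAddTorus (Fin 2)

/-- Lebesgue measure on the torus, of total mass one (the measure of Mathlib's `mFourierCoeff`). -/
abbrev vol : Measure T2 := Measure.pi fun _ => AddCircle.haarAddCircle

/-- Lebesgue measure on `[0, T] × 𝕋²`. -/
abbrev volUpTo (T : ℝ) : Measure (ℝ × T2) := (volume.restrict (Icc 0 T)).prod vol

/-- Time-dependent scalar functions on the torus. -/
abbrev ScalarField : Type := ℝ → T2 → ℝ

/-- Time-dependent vector fields on the torus. -/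
abbrev VectorField : Type := ℝ → T2 → Fin 2 → ℝ

/-! ### Fourier side: Sobolev norms and the fractional Laplacian -/

/-- Fourier coefficient of a real function on the torus. -/
def coeff (f : T2 → ℝ) (k : Fin 2 → ℤ) : ℂ :=
  UnitAddTorus.mFourierCoeff (fun x => (f x : ℂ)) k

/-- The modulus `2π|k|` of the frequency of the character `x ↦ exp (2πi k·x)`. -/
def freq (k : Fin 2 → ℤ) : ℝ := 2 * Real.pi * Real.sqrt (∑ i, (k i : ℝ) ^ 2)

/-- `‖f‖²` in `H¹(𝕋²)`, for `f ∈ L²`. -/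
def h1NormSq (f : T2 → ℝ) : ℝ≥0∞ :=
  ∑' k, ENNReal.ofReal ((1 + freq k ^ 2) * ‖coeff f k‖ ^ 2)

/-- `f ∈ H¹(𝕋²)`. -/
def MemH1 (f : T2 → ℝ) : Prop := MemLp f 2 vol ∧ h1NormSq f < ⊤

/-- `Λ^{2α} f = (-Δ)^α f`, the Fourier multiplier with symbol `|ξ|^{2α}`; applied below to smooth
functions only, for which the series converges absolutely and is real. -/
def fracLaplacian (α : ℝ) (f : T2 → ℝ) (x : T2) : ℝ :=
  (∑' k, ((freq k ^ (2 * α) : ℝ) : ℂ) * coeff f k * UnitAddTorus.mFourier k x).re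

/-! ### Test functions -/

/-- The partial derivative `∂ᵢ f` on the torus. -/
def pd (i : Fin 2) (f : T2 → ℝ) (x : T2) : ℝ :=
  deriv (fun s : ℝ => f (x + Pi.single i (s : UnitAddCircle))) 0

/-- Smooth functions on the torus. -/
def IsSmooth (f : T2 → ℝ) : Prop :=
  ContDiff ℝ ∞ fun y : Fin 2 → ℝ => f fun i => (y i : UnitAddCircle)

/-- Test functions in `C_c^∞([0, ∞) × 𝕋²)`: smooth in `(t, x)`, vanishing for large `t`, and not
necessarily zero at `t = 0`. -/
def IsTest (φ : ScalarField) : Prop :=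
  ContDiff ℝ ∞ (fun p : ℝ × (Fin 2 → ℝ) => φ p.1 fun i => (p.2 i : UnitAddCircle)) ∧
    ∃ T : ℝ, ∀ t, T ≤ t → ∀ x, φ t x = 0

/-- Divergence-free vector-valued test functions. -/
def IsSolenoidalTest (φ : VectorField) : Prop :=
  (∀ i, IsTest fun t x => φ t x i) ∧ ∀ t x, ∑ i, pd i (fun y => φ t y i) x = 0

/-! ### Function classes -/

/-- `∇ · v = 0` in the sense of distributions. -/
def IsDivFree (v : T2 → Fin 2 → ℝ) : Prop :=
  ∀ ψ : T2 → ℝ, IsSmooth ψ → ∫ x, ∑ i, v x i * pd i ψ x ∂vol = 0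

/-- `u ∈ L^∞([0, T]; H¹(𝕋²))`. -/
def MemLinftyH1 (T : ℝ) (u : VectorField) : Prop :=
  AEStronglyMeasurable (Function.uncurry u) (volUpTo T) ∧
    ∃ C : ℝ≥0, ∀ᵐ t ∂volume.restrict (Icc 0 T), ∀ i,
      MemLp (fun x => u t x i) 2 vol ∧ h1NormSq (fun x => u t x i) ≤ C

/-- `θ ∈ L^∞([0, T] × 𝕋²)`. -/
def MemLinfty (T : ℝ) (θ : ScalarField) : Prop :=
  MemLp (Function.uncurry θ) ⊤ (volUpTo T)

/-- The Lipschitz seminorm of `u(t)` is dominated by an integrable function on `[0, T]`; for fields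
in `L^∞([0, T]; H¹)` this means `u ∈ L¹([0, T]; W^{1,∞}(𝕋²))`. -/
def MemL1Lip (T : ℝ) (u : VectorField) : Prop :=
  ∃ L : ℝ → ℝ, IntegrableOn L (Icc 0 T) ∧
    ∀ᵐ t ∂volume.restrict (Icc 0 T), ∃ w : T2 → Fin 2 → ℝ, w =ᵐ[vol] u t ∧
      ∀ x y i, |w x i - w y i| ≤ L t * dist x y

/-! ### The two systems -/

/-- `∂ₜθ + ∇·(uθ) = 0`, `θ(0) = θ₀`, in the sense of distributions on `[0, ∞) × 𝕋²`. -/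
def SolvesTransport (u : VectorField) (θ : ScalarField) (θ₀ : T2 → ℝ) : Prop :=
  ∀ φ : ScalarField, IsTest φ →
    (∫ t in Ioi (0 : ℝ), ∫ x,
        θ t x * (deriv (fun s => φ s x) t + ∑ i, u t x i * pd i (φ t) x) ∂vol)
      + ∫ x, θ₀ x * φ 0 x ∂vol = 0

/-- `ε (∂ₜu + ∇·(u ⊗ u)) + Λ^{2α}u = -∇p + θ e₂`, `u(0) = u₀`, in the sense of distributions on
`[0, ∞) × 𝕋²`; the pressure is eliminated by divergence-free test functions. -/
def SolvesMomentum (α ε : ℝ) (u : VectorField) (θ : ScalarField) (u₀ : T2 → Fin 2 → ℝ) : Prop :=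
  ∀ φ : VectorField, IsSolenoidalTest φ →
    (∫ t in Ioi (0 : ℝ), ∫ x,
        (ε * (∑ i, u t x i * deriv (fun s => φ s x i) t
            + ∑ i, ∑ j, u t x j * u t x i * pd j (fun y => φ t y i) x)
          - ∑ i, u t x i * fracLaplacian α (fun y => φ t y i) x
          + θ t x * φ t x 1) ∂vol)
      + ε * ∫ x, ∑ i, u₀ x i * φ 0 x i ∂vol = 0

/-- `Λ^{2α}u = -∇p + θ e₂` in the sense of distributions on `(0, ∞) × 𝕋²`; the pressure is
eliminated by divergence-free test functions. -/
def SolvesStokes (α : ℝ) (u : VectorField) (θ : ScalarField) : Prop :=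
  ∀ φ : VectorField, IsSolenoidalTest φ →
    ∫ t in Ioi (0 : ℝ), ∫ x,
      (θ t x * φ t x 1 - ∑ i, u t x i * fracLaplacian α (fun y => φ t y i) x) ∂vol = 0

/-- Global regular solutions of the Boussinesq-Navier-Stokes system `(B_α)` with Prandtl number
`1/ε` and viscosity one: for every `T`, `u ∈ L^∞_T H¹ ∩ L¹_T W^{1,∞}` and `θ ∈ L^∞_T L^∞`. -/
structure IsRegularBoussinesq (α ε : ℝ) (u : VectorField) (θ : ScalarField)
    (u₀ : T2 → Fin 2 → ℝ) (θ₀ : T2 → ℝ) : Prop where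
  velocity_mem : ∀ T > 0, MemLinftyH1 T u
  velocity_lip : ∀ T > 0, MemL1Lip T u
  temperature_mem : ∀ T > 0, MemLinfty T θ
  divFree : ∀ᵐ t ∂volume.restrict (Ioi (0 : ℝ)), IsDivFree (u t)
  transport : SolvesTransport u θ θ₀
  momentum : SolvesMomentum α ε u θ u₀

/-- Global weak solutions of the (fractional) Stokes-transport system `(ST_α)` with initial
temperature `θ₀`: for every `T`, `u ∈ L^∞_T H¹` and `θ ∈ L^∞([0, T] × 𝕋²)`. -/
structure IsWeakStokesTransport (α : ℝ) (u : VectorField) (θ : ScalarField)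
    (θ₀ : T2 → ℝ) : Prop where
  velocity_mem : ∀ T > 0, MemLinftyH1 T u
  temperature_mem : ∀ T > 0, MemLinfty T θ
  divFree : ∀ᵐ t ∂volume.restrict (Ioi (0 : ℝ)), IsDivFree (u t)
  transport : SolvesTransport u θ θ₀
  stokes : SolvesStokes α u θ

/-- The spatial mean of `u(t)` equals that of `u₀` for almost every `t > 0`. -/
def HasMeanOf (u : VectorField) (u₀ : T2 → Fin 2 → ℝ) : Prop :=
  ∀ᵐ t ∂volume.restrict (Ioi (0 : ℝ)), ∀ i, ∫ x, u t x i ∂vol = ∫ x, u₀ x i ∂vol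

/-! ### Convergence -/

/-- `g ∈ L¹([0, T]; H^{-1}(𝕋²))`, where `g t k` is the `k`-th Fourier coefficient of `g(t)`. -/
def MemL1Hneg1 (T : ℝ) (g : ℝ → (Fin 2 → ℤ) → ℂ) : Prop :=
  (∀ k, AEStronglyMeasurable (fun t => g t k) (volume.restrict (Icc 0 T))) ∧
    ∫⁻ t in Icc 0 T, (∑' k, ENNReal.ofReal ((1 + freq k ^ 2)⁻¹ * ‖g t k‖ ^ 2)) ^ (1 / 2 : ℝ) < ⊤

/-- Weak-* convergence `uₙ ⇀ u` in `L^∞([0, T]; H¹(𝕋²))`, the dual of `L¹([0, T]; H^{-1}(𝕋²))`. -/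
def WeakStarLinftyH1 (T : ℝ) (un : ℕ → VectorField) (u : VectorField) : Prop :=
  ∀ g : ℝ → (Fin 2 → ℤ) → ℂ, MemL1Hneg1 T g → ∀ i,
    Tendsto
      (fun n => ∫ t in Icc 0 T, ∑' k, g t k * starRingEnd ℂ (coeff (fun x => un n t x i) k))
      atTop
      (𝓝 (∫ t in Icc 0 T, ∑' k, g t k * starRingEnd ℂ (coeff (fun x => u t x i) k)))

/-- Weak-* convergence `θₙ ⇀ θ` in `L^∞([0, T] × 𝕋²)`, the dual of `L¹([0, T] × 𝕋²)`. -/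
def WeakStarLinfty (T : ℝ) (θn : ℕ → ScalarField) (θ : ScalarField) : Prop :=
  ∀ g : ℝ × T2 → ℝ, Integrable g (volUpTo T) →
    Tendsto (fun n => ∫ p, θn n p.1 p.2 * g p ∂volUpTo T) atTop
      (𝓝 (∫ p, θ p.1 p.2 * g p ∂volUpTo T))

/-- Strong convergence `θₙ → θ` in `L^r([0, T]; L^q(𝕋²))`. -/
def StrongLrLq (T r q : ℝ) (θn : ℕ → ScalarField) (θ : ScalarField) : Prop :=
  Tendsto
    (fun n => ∫⁻ t in Icc 0 T,
      (eLpNorm (fun x => θn n t x - θ t x) (ENNReal.ofReal q) vol) ^ r)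
    atTop (𝓝 0)

end PrandtlLimit

end

open PrandtlLimit

noncomputable section

namespace PrandtlLimit

open UnitAddTorus ComplexConjugate
open scoped Real
open Function (uncurry)
open ENNReal (ofReal_le_ofReal measurable_ofReal rpow_natCast rpow_mul coe_toNNReal tsum_le_tsum
  mul_ne_top ofReal_mul ofReal_pow ofReal_ofNat ofReal_add tsum_add ofReal_sum_of_nonneg
  ofReal_le_one ofReal_ne_top ofReal_one sum_le_tsum ofReal_add_le coe_ne_top summable
  tendsto_ofReal rpow_two ofNat_ne_top rpow_le_rpow le_tsum tendsto_toReal mul_eq_top ofReal)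
open Complex (ofReal_zero mul_conj norm_ofNat norm_real norm_I ofRealCLM reCLM hasSum_re
  conj_ofReal continuous_ofReal ofReal_re conjCLE re_ofReal_mul add_re conj_I re_sum exp_zero
  sub_re conj_conj conj_re I)
open Real (exp_add rpow_one exp norm_eq_abs pi_pos exp_pos sq_sqrt pi_ne_zero norm_of_nonneg
  continuous_sqrt sqrt_nonneg rpow_neg Gamma mul_rpow rpow_add_one rpow_pos_of_pos rpow_nonneg
  zero_rpow rpow_add volume_Ioc toNNReal)
open intervalIntegral (integral_of_le integral_eq_sub_of_hasDerivAt integral_congr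
  intervalIntegrable_rpow')
open Finset (mul_sum sum_congr sum_nonneg sum_mul sum_le_sum single_le_sum sum_add_distrib)
open MeasureTheory.Measure (restrict_restrict restrict_univ prod_restrict ae_ae_of_ae_prod
  ae_ae_comm ae_prod_iff_ae_ae)
open Fin (sum_univ_two)
open Pi (single)

/-- The circle `ℝ / ℤ`. -/
notation "𝕊" => UnitAddCircle

/-- Lebesgue measure on the positive half-line. -/
notation "ℓ" => Measure.restrict volume (Ioi (0 : ℝ))

/-- Lebesgue measure on `(0, T]`. -/
notation "ℓ(" T ")" => Measure.restrict volume (Ioc (0 : ℝ) T)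

/-- Convergence of sequences. -/
notation:50 f:51 "⇝" l:51 => Tendsto f atTop (𝓝 l)

/-- The frequency lattice. -/
abbrev Z2 : Type := Fin 2 → ℤ

variable {f g θ₀ : T2 → ℝ} {α ε M C B L T s t δ a b : ℝ} {k : Z2} {c : Z2 → ℂ} {u u' : VectorField}
  {θ θ' : ScalarField} {v w u₀ : T2 → Fin 2 → ℝ} {χ : ℝ → ℝ} {K : ℝ≥0}

lemma ae_mem_Ioc : ∀ᵐ t ∂volume.restrict (Ioc a b), t ∈ Ioc a b :=
  ae_restrict_mem measurableSet_Ioc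

lemma ae_mem_Ioi : ∀ᵐ t ∂volume.restrict (Ioi a), t ∈ Ioi a :=
  ae_restrict_mem measurableSet_Ioi

lemma _root_.MeasureTheory.MemLp.l1 {X E : Type*} [MeasurableSpace X] {μ : Measure X}
    [IsFiniteMeasure μ] [NormedAddCommGroup E] {f : X → E} (h : MemLp f 2 μ) : Integrable f μ :=
  h.integrable one_le_two

/-! ### Characters -/

lemma norm_mFourier_apply (k : Z2) (x : T2) : ‖mFourier k x‖ = 1 := by
  simp [mFourier, fourier_apply, Circle.norm_coe]

lemma mFourier_add_apply (k : Z2) (x y : T2) :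
    mFourier k (x + y) = mFourier k x * mFourier k y := by
  simp [mFourier, fourier_apply, AddCircle.toCircle_add, smul_add]
  ring

lemma mFourier_coe (k : Z2) (y : Fin 2 → ℝ) :
    mFourier k (fun i => (y i : 𝕊)) =
      Complex.exp (2 * π * I * ((∑ i, (k i : ℝ) * y i : ℝ) : ℂ)) := by
  simp only [mFourier, ContinuousMap.coe_mk, fourier_coe_apply, Fin.prod_univ_two,
    sum_univ_two, ← Complex.exp_add]
  congr 1
  push_cast
  ring

lemma mFourier_pi_single (k : Z2) (i : Fin 2) (s : ℝ) :
    mFourier k (single i (s : 𝕊)) =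
      Complex.exp (2 * π * I * (k i) * s) := by
  have : (single i (s : 𝕊) : T2) =
      fun j => (((single i s : Fin 2 → ℝ) j : ℝ) : 𝕊) := by
    ext j
    by_cases h : j = i
    · subst h; simp
    · simp [h]
  rw [this, mFourier_coe]
  congr 1
  fin_cases i <;> simp <;> ring

lemma integral_mFourier_of_ne (hk : k ≠ 0) : ∫ x, mFourier k x ∂vol = 0 := by
  obtain ⟨i, hi⟩ : ∃ i, k i ≠ 0 := by
    by_contra h; push Not at h; exact hk (funext h)
  have hs : ∀ s : ℝ, ∫ x, mFourier k x ∂vol =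
      (∫ x, mFourier k x ∂vol) * Complex.exp (2 * π * I * (k i) * s) := by
    intro s
    conv_lhs => rw [← integral_add_right_eq_self _ (single i (s : 𝕊))]
    simp_rw [mFourier_add_apply, mFourier_pi_single]
    rw [integral_mul_const]
  have h := hs (1 / (2 * k i))
  have hk' : ((k i : ℤ) : ℂ) ≠ 0 := by exact_mod_cast hi
  have : Complex.exp (2 * π * I * (k i) * ((1 / (2 * k i) : ℝ) : ℂ)) = -1 := by
    rw [← Complex.exp_pi_mul_I]
    congr 1
    push_cast
    field_simp
  rw [this] at h
  have : (2 : ℂ) * ∫ x, mFourier k x ∂vol = 0 := by linear_combination h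
  simpa using this

/-! ### Fourier coefficients of real functions -/

lemma coeff_eq (f : T2 → ℝ) (k : Z2) :
    coeff f k = ∫ x, mFourier (-k) x * (f x : ℂ) ∂vol := rfl

lemma conj_mFourier (k : Z2) (x : T2) : conj (mFourier k x) = mFourier (-k) x :=
  mFourier_neg.symm

lemma integrable_mFourier_mul (hf : Integrable f vol) (k : Z2) :
    Integrable (fun x => mFourier k x * (f x : ℂ)) vol := by
  exact hf.ofReal.bdd_mul (c := 1) (mFourier k).continuous.aestronglyMeasurable <|
    ae_of_all _ fun x => (norm_mFourier_apply k x).le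

lemma coeff_congr (h : f =ᵐ[vol] g) (k : Z2) : coeff f k = coeff g k := by
  rw [coeff_eq, coeff_eq]
  exact integral_congr_ae (h.mono fun x hx => by simp only [hx])

lemma coeff_add (hf : Integrable f vol) (hg : Integrable g vol) (k : Z2) :
    coeff (fun x => f x + g x) k = coeff f k + coeff g k := by
  rw [coeff_eq, coeff_eq, coeff_eq,
    ← integral_add (integrable_mFourier_mul hf _) (integrable_mFourier_mul hg _)]
  simp [mul_add]

lemma coeff_sub (hf : Integrable f vol) (hg : Integrable g vol) (k : Z2) :
    coeff (fun x => f x - g x) k = coeff f k - coeff g k := by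
  rw [coeff_eq, coeff_eq, coeff_eq,
    ← integral_sub (integrable_mFourier_mul hf _) (integrable_mFourier_mul hg _)]
  simp [mul_sub]

lemma coeff_const_mul (c : ℝ) (f : T2 → ℝ) (k : Z2) :
    coeff (fun x => c * f x) k = c * coeff f k := by
  rw [coeff_eq, coeff_eq, ← integral_const_mul]
  congr 1 with x
  push_cast
  ring

lemma coeff_const (c : ℝ) (k : Z2) : coeff (fun _ => c) k = if k = 0 then (c : ℂ) else 0 := by
  rw [coeff_eq, integral_mul_const]
  split_ifs with h
  · subst h
    simp [mFourier_zero]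
  · rw [integral_mFourier_of_ne (by simpa using h), zero_mul]

lemma norm_coeff_le (f : T2 → ℝ) (k : Z2) : ‖coeff f k‖ ≤ ∫ x, |f x| ∂vol := by
  rw [coeff_eq]
  refine (norm_integral_le_integral_norm _).trans (le_of_eq ?_)
  simp [norm_mFourier_apply]

lemma coeff_zero_eq (f : T2 → ℝ) : coeff f 0 = ((∫ x, f x ∂vol : ℝ) : ℂ) := by
  rw [coeff_eq, ← integral_complex_ofReal]
  simp [mFourier_zero]

lemma coeff_translate (h : T2) (k : Z2) :
    coeff (fun x => f (x + h)) k = mFourier k h * coeff f k := by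
  rw [coeff_eq, coeff_eq, ← integral_add_right_eq_self (fun x => mFourier (-k) x * (f x : ℂ)) h,
    ← integral_const_mul]
  congr 1 with x
  rw [mFourier_add_apply]
  have : mFourier k h * mFourier (-k) h = 1 := by
    rw [← mFourier_add]; simp [mFourier_zero]
  linear_combination (-(mFourier (-k) x * (f (x + h) : ℂ))) * this

lemma hasSum_coeff_mul_conj (hf : MemLp f 2 vol) (hg : MemLp g 2 vol) :
    HasSum (fun k => coeff f k * conj (coeff g k)) ((∫ x, f x * g x ∂vol : ℝ) : ℂ) := by
  have hf' : MemLp (fun x => (f x : ℂ)) 2 vol := hf.ofReal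
  have hg' : MemLp (fun x => (g x : ℂ)) 2 vol := hg.ofReal
  have hc : ∀ {h : T2 → ℝ} (hh : MemLp (fun x => (h x : ℂ)) 2 vol) (k : Z2),
      mFourierCoeff (hh.toLp : T2 → ℂ) k = coeff h k := fun hh k =>
    integral_congr_ae (hh.coeFn_toLp.mono fun x hx => by simp only [hx])
  have := UnitAddTorus.hasSum_prod_mFourierCoeff (d := Fin 2) hg'.toLp hf'.toLp
  simp_rw [hc hf', hc hg'] at this
  convert this using 1
  · ext k; ring
  · rw [← integral_complex_ofReal]
    refine integral_congr_ae ?_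
    filter_upwards [hf'.coeFn_toLp, hg'.coeFn_toLp] with x hx hy
    rw [hx, hy]
    simp [mul_comm]

lemma hasSum_sq_coeff (hf : MemLp f 2 vol) :
    HasSum (fun k => ‖coeff f k‖ ^ 2) (∫ x, f x ^ 2 ∂vol) := by
  have := hasSum_coeff_mul_conj hf hf
  simp_rw [mul_conj, Complex.normSq_eq_norm_sq, ← pow_two] at this
  exact_mod_cast this

lemma ae_eq_of_coeff_eq (hf : MemLp f 2 vol) (hg : MemLp g 2 vol)
    (h : ∀ k, coeff f k = coeff g k) : f =ᵐ[vol] g := by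
  have h1 := hasSum_sq_coeff (hf.sub hg)
  have h2 : (fun k => ‖coeff (f - g) k‖ ^ 2) = fun _ => 0 := by
    ext k
    rw [show f - g = fun x => f x - g x from rfl,
      coeff_sub (hf.l1) (hg.l1), h k]
    simp
  rw [h2] at h1
  have h3 := h1.unique hasSum_zero
  rw [integral_eq_zero_iff_of_nonneg (fun x => sq_nonneg _) (hf.sub hg).integrable_sq] at h3
  filter_upwards [h3] with x hx
  have : f x - g x = 0 := by simpa using hx
  linarith

/-! ### Smooth trigonometric series -/

/-- The real part of the trigonometric series with coefficients `c`. -/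
def fser (c : Z2 → ℂ) (x : T2) : ℝ := (∑' k, c k * mFourier k x).re

/-- Coefficients decaying faster than any power. -/
def Rapid (c : Z2 → ℂ) : Prop := ∀ n : ℕ, Summable fun k : Z2 => ‖k‖ ^ n * ‖c k‖

lemma Rapid.summable_norm (hc : Rapid c) : Summable fun k => ‖c k‖ := by
  simpa using hc 0

lemma norm_int_le (k : Z2) (i : Fin 2) : |(k i : ℝ)| ≤ ‖k‖ := by
  simpa [Int.norm_eq_abs] using norm_le_pi_norm k i

lemma Rapid.of_finite (s : Finset Z2) (h : ∀ k ∉ s, c k = 0) : Rapid c := by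
  intro n
  exact summable_of_ne_finset_zero (s := s) fun k hk => by simp [h k hk]

lemma Rapid.deriv (hc : Rapid c) (i : Fin 2) :
    Rapid fun k => 2 * π * I * (k i) * c k := by
  intro n
  refine Summable.of_nonneg_of_le (fun k => by positivity) (fun k => ?_)
    ((hc (n + 1)).mul_left (2 * π))
  have h1 := norm_int_le k i
  simp only [norm_mul, norm_ofNat, norm_real, norm_eq_abs, norm_I,
    mul_one, Complex.norm_intCast, abs_of_pos pi_pos]
  calc ‖k‖ ^ n * (2 * π * |(k i : ℝ)| * ‖c k‖)
      ≤ ‖k‖ ^ n * (2 * π * ‖k‖ * ‖c k‖) := by gcongr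
    _ = 2 * π * (‖k‖ ^ (n + 1) * ‖c k‖) := by ring

lemma summable_mul_mFourier (hc : Summable fun k => ‖c k‖) (x : T2) :
    Summable fun k => c k * mFourier k x :=
  Summable.of_norm (by simpa [norm_mFourier_apply] using hc)

lemma continuous_tsum_mFourier (hc : Summable fun k => ‖c k‖) :
    Continuous fun x : T2 => ∑' k, c k * mFourier k x :=
  continuous_tsum (fun k => continuous_const.mul (mFourier k).continuous) hc fun k x => by
    simp [norm_mFourier_apply]

lemma continuous_fser (hc : Summable fun k => ‖c k‖) : Continuous (fser c) :=
  Complex.continuous_re.comp (continuous_tsum_mFourier hc)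

lemma iteratedDeriv_cexp_mul (a : ℂ) (n : ℕ) :
    iteratedDeriv n (fun s : ℝ => Complex.exp (a * s)) = fun s : ℝ => a ^ n * Complex.exp (a * s) :=
        by
  induction n with
  | zero => simp
  | succ n ih =>
    rw [iteratedDeriv_succ, ih]
    ext s
    have h : HasDerivAt (fun s : ℝ => Complex.exp (a * s)) (Complex.exp (a * s) * (a * 1)) s :=
      ((ofRealCLM.hasDerivAt (x := s)).const_mul a).cexp
    rw [(h.const_mul (a ^ n)).deriv]
    ring

lemma isSmooth_fser (hc : Rapid c) : IsSmooth (fser c) := by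
  unfold IsSmooth fser
  have key : ContDiff ℝ ((⊤ : ℕ∞) : ℕ∞ω) fun y : Fin 2 → ℝ =>
      ∑' k, c k * mFourier k (fun i => (y i : 𝕊)) := by
    let l : Z2 → (Fin 2 → ℝ) →L[ℝ] ℝ := fun k =>
      ∑ i, (k i : ℝ) • ContinuousLinearMap.proj (R := ℝ) (φ := fun _ : Fin 2 => ℝ) i
    have hl : ∀ k, ‖l k‖ ≤ 2 * ‖k‖ := by
      intro k
      refine (l k).opNorm_le_bound (by positivity) fun y => ?_
      have h0 := norm_le_pi_norm y 0
      have h1 := norm_le_pi_norm y 1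
      have k0 := norm_int_le k 0
      have k1 := norm_int_le k 1
      rw [show l k y = k 0 * y 0 + k 1 * y 1 by simp [l, sum_univ_two]]
      refine (norm_add_le _ _).trans ?_
      rw [norm_mul, norm_mul, norm_eq_abs (k 0 : ℝ), norm_eq_abs (k 1 : ℝ)]
      calc |(k 0 : ℝ)| * ‖y 0‖ + |(k 1 : ℝ)| * ‖y 1‖ ≤ ‖k‖ * ‖y‖ + ‖k‖ * ‖y‖ := by gcongr
        _ = 2 * ‖k‖ * ‖y‖ := by ring
    let E : ℝ → ℂ := fun s => Complex.exp (2 * π * I * s)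
    have hE : ContDiff ℝ ((⊤ : ℕ∞) : ℕ∞ω) E :=
      (contDiff_const.mul ofRealCLM.contDiff).cexp
    have hf : ∀ k, (fun y : Fin 2 → ℝ => c k * mFourier k (fun i => (y i : 𝕊))) =
        fun y => c k • (E ∘ l k) y := by
      intro k
      ext y
      simp [E, l, mFourier_coe]
    simp_rw [fun k => hf k |> fun h => congrFun h]
    refine contDiff_tsum (v := fun n k => ‖c k‖ * ((2 * π) ^ n * (2 * ‖k‖) ^ n)) ?_ ?_ ?_
    · intro k
      exact (hE.comp (l k).contDiff).const_smul (c k)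
    · intro n _
      refine ((hc n).mul_left ((2 * π) ^ n * 2 ^ n)).congr fun k => ?_
      rw [mul_pow 2 ‖k‖]; ring
    · intro n k y hn
      rw [iteratedFDeriv_const_smul_apply' ((hE.comp (l k).contDiff).of_le (by exact_mod_cast
          hn)).contDiffAt,
        norm_smul, (l k).iteratedFDeriv_comp_right hE y (by exact_mod_cast le_top)]
      gcongr
      refine (ContinuousMultilinearMap.norm_compContinuousLinearMap_le _ _).trans ?_
      rw [norm_iteratedFDeriv_eq_norm_iteratedDeriv, iteratedDeriv_cexp_mul]
      simp only [Finset.prod_const, Finset.card_univ, Fintype.card_fin]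
      gcongr
      · simp only [norm_mul, norm_pow, norm_ofNat, norm_real, norm_eq_abs,
          norm_I, mul_one, abs_of_pos pi_pos]
        rw [show 2 * (π : ℂ) * I * ((l k y : ℝ) : ℂ) =
          ((2 * π * l k y : ℝ) : ℂ) * I by push_cast; ring,
          Complex.norm_exp_ofReal_mul_I, mul_one]
      · exact hl k
  exact reCLM.contDiff.comp key

lemma pd_fser (hc : Rapid c) (i : Fin 2) (x : T2) :
    pd i (fser c) x = fser (fun k => 2 * π * I * (k i) * c k) x := by
  have h : HasDerivAt (fun s : ℝ => ∑' k : Z2, c k * mFourier k x *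
      Complex.exp (2 * π * I * (k i) * s))
      (∑' k : Z2, 2 * π * I * (k i) * c k * mFourier k x *
        Complex.exp (2 * π * I * (k i) * (0 : ℝ))) 0 := by
    have hn : ∀ (k : Z2) (s : ℝ), ‖Complex.exp (2 * π * I * (k i) * s)‖ = 1 :=
      fun k s => by rw [← mFourier_pi_single, norm_mFourier_apply]
    have h1 : ∀ (k : Z2) (s : ℝ), HasDerivAt (fun s : ℝ => c k * mFourier k x *
        Complex.exp (2 * π * I * (k i) * s))
        (2 * π * I * (k i) * c k * mFourier k x *
        Complex.exp (2 * π * I * (k i) * s)) s := fun k s => by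
      have h := (((ofRealCLM.hasDerivAt (x := s)).const_mul
        (2 * π * I * (k i))).cexp).const_mul (c k * mFourier k x)
      refine h.congr_deriv ?_
      simp only [Complex.ofRealCLM_apply, Complex.ofReal_one]
      ring
    refine hasDerivAt_tsum (u := fun k => ‖2 * π * I * (k i) * c k‖) (y₀ := 0)
      (hc.deriv i).summable_norm h1 (fun k s => ?_) ?_ 0
    · rw [norm_mul, norm_mul _ (mFourier k x), norm_mFourier_apply, hn, mul_one, mul_one]
    · simpa using summable_mul_mFourier hc.summable_norm x
  have h2 := (reCLM.hasFDerivAt.comp_hasDerivAt (0 : ℝ) h).deriv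
  simp only [Function.comp_def, Complex.reCLM_apply] at h2
  unfold pd fser
  simp_rw [mFourier_add_apply, mFourier_pi_single, ← mul_assoc]
  rw [h2]
  simp

lemma hasSum_integral_mul_fser (hf : Integrable f vol)
    (hc : Summable fun k => ‖c k‖) :
    HasSum (fun k => (c k * conj (coeff f k)).re) (∫ x, f x * fser c x ∂vol) := by
  have h : HasSum (fun k => ∫ x, (f x : ℂ) * (c k * mFourier k x) ∂vol)
      (∫ x, ∑' k, (f x : ℂ) * (c k * mFourier k x) ∂vol) := by
    refine hasSum_integral_of_summable_integral_norm (fun k => ?_) ?_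
    · exact ((integrable_mFourier_mul hf k).const_mul (c k)).congr
        (ae_of_all _ fun x => by ring)
    · refine (hc.mul_left (∫ x, |f x| ∂vol)).congr fun k => ?_
      simp only [norm_mul, norm_mFourier_apply, norm_real, norm_eq_abs, mul_one]
      rw [integral_mul_const]
  have h2 := hasSum_re h
  have e1 : ∀ k, ∫ x, (f x : ℂ) * (c k * mFourier k x) ∂vol = c k * conj (coeff f k) := by
    intro k
    rw [coeff_eq, ← integral_conj, ← integral_const_mul]
    congr 1 with x
    simp only [map_mul, conj_ofReal, conj_mFourier, neg_neg]
    ring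
  simp_rw [e1] at h2
  convert h2 using 1
  rw [← RCLike.re_eq_complex_re, ← integral_re]
  · congr 1 with x
    rw [tsum_mul_left]
    simp [fser]
  · simp_rw [tsum_mul_left]
    refine hf.ofReal.mul_bdd (c := ∑' k, ‖c k‖)
      (continuous_tsum_mFourier hc).aestronglyMeasurable (ae_of_all _ fun x => ?_)
    refine (norm_tsum_le_tsum_norm ?_).trans (le_of_eq ?_) <;> simp [norm_mFourier_apply, hc]

/-! ### Indefinite integrals in time -/

lemma integral_triangle_add {𝕜 : Type*} [RCLike 𝕜] {f g : ℝ → 𝕜} (ht : 0 ≤ t) (hf : IntegrableOn f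
    (Ioc 0 t)) (hg : IntegrableOn g (Ioc 0 t)) : (∫ s in 0..t, f s * ∫ r in 0..s, g r) + (∫ s in
    0..t, (∫ r in 0..s, f r) * g s) = (∫ s in 0..t, f s) * ∫ s in 0..t, g s := by
  set μ := (ℓ(t) : Measure ℝ) with hμ
  have hfg : Integrable (fun p : ℝ × ℝ => f p.1 * g p.2) (μ.prod μ) := hf.mul_prod hg
  have hS : MeasurableSet {p : ℝ × ℝ | p.2 ≤ p.1} := measurableSet_le measurable_snd measurable_fst
  have h1 : ∫ s in 0..t, f s * ∫ r in 0..s, g r =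
      ∫ p in {p : ℝ × ℝ | p.2 ≤ p.1}, f p.1 * g p.2 ∂(μ.prod μ) := by
    rw [← integral_indicator hS, integral_prod _ (hfg.indicator hS), integral_of_le ht]
    refine setIntegral_congr_fun measurableSet_Ioc fun s hs => ?_
    rw [integral_of_le hs.1.le, ← integral_const_mul]
    have : ∀ r, ({p : ℝ × ℝ | p.2 ≤ p.1}.indicator (fun p => f p.1 * g p.2) (s, r)) =
        (Iic s).indicator (fun r => f s * g r) r := fun r => by
      simp [indicator]
    simp_rw [this]
    rw [integral_indicator measurableSet_Iic, hμ, restrict_restrict measurableSet_Iic]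
    congr 2
    ext r
    simp only [mem_Iic, mem_Ioc]
    exact ⟨fun h => ⟨h.2, h.1, h.2.trans hs.2⟩, fun h => ⟨h.2.1, h.1⟩⟩
  have h2 : ∫ s in 0..t, (∫ r in 0..s, f r) * g s =
      ∫ p in {p : ℝ × ℝ | p.2 ≤ p.1}ᶜ, f p.1 * g p.2 ∂(μ.prod μ) := by
    rw [← integral_indicator hS.compl, integral_prod_symm _ (hfg.indicator hS.compl),
      integral_of_le ht]
    refine setIntegral_congr_fun measurableSet_Ioc fun s hs => ?_
    rw [integral_of_le hs.1.le, ← integral_mul_const]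
    have : ∀ r, ({p : ℝ × ℝ | p.2 ≤ p.1}ᶜ.indicator (fun p => f p.1 * g p.2) (r, s)) =
        (Iio s).indicator (fun r => f r * g s) r := fun r => by
      simp [indicator]
    simp_rw [this]
    rw [integral_indicator measurableSet_Iio, hμ, restrict_restrict measurableSet_Iio,
      show Iio s ∩ Ioc 0 t = Ioo 0 s by
        ext r
        simp only [mem_inter_iff, mem_Iio, mem_Ioc, mem_Ioo]
        exact ⟨fun h => ⟨h.2.1, h.1⟩, fun h => ⟨h.2, h.1, h.2.le.trans hs.2⟩⟩,
      integral_Ioc_eq_integral_Ioo]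
  rw [h1, h2, integral_add_compl hS hfg, integral_prod_mul, integral_of_le ht, integral_of_le ht]

lemma interval_of_Ioc {E : Type*} [NormedAddCommGroup E] {f : ℝ → E}
    (ht : 0 ≤ t) (hf : IntegrableOn f (Ioc 0 t)) : IntervalIntegrable f volume 0 t :=
  (intervalIntegrable_iff_integrableOn_Ioc_of_le ht).2 hf

lemma continuousOn_primitive' {𝕜 : Type*} [RCLike 𝕜] {f : ℝ → 𝕜} (ht : 0 ≤ t)
    (hf : IntegrableOn f (Ioc 0 t)) : ContinuousOn (fun s => ∫ r in 0..s, f r) (Icc 0 t) := by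
  have := intervalIntegral.continuousOn_primitive_interval' (interval_of_Ioc ht hf) (left_mem_uIcc)
  rwa [uIcc_of_le ht] at this

/-- Product rule for indefinite integrals. -/
lemma mul_primitive {𝕜 : Type*} [RCLike 𝕜] {f g : ℝ → 𝕜} {y₀ z₀ : 𝕜} (ht : 0 ≤ t) (hf : IntegrableOn
    f (Ioc 0 t)) (hg : IntegrableOn g (Ioc 0 t)) : (y₀ + ∫ s in 0..t, f s) * (z₀ + ∫ s in 0..t, g s)
    = y₀ * z₀ + ∫ s in 0..t, (f s * (z₀ + ∫ r in 0..s, g r) + (y₀ + ∫ r in 0..s, f r) * g s) := by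
  have hf' := interval_of_Ioc ht hf
  have hg' := interval_of_Ioc ht hg
  have cf : ContinuousOn (fun s => ∫ r in 0..s, f r) (uIcc 0 t) := by
    rw [uIcc_of_le ht]; exact continuousOn_primitive' ht hf
  have cg : ContinuousOn (fun s => ∫ r in 0..s, g r) (uIcc 0 t) := by
    rw [uIcc_of_le ht]; exact continuousOn_primitive' ht hg
  have i1 : IntervalIntegrable (fun s => f s * ∫ r in 0..s, g r) volume 0 t :=
    hf'.mul_continuousOn cg
  have e : ∀ s, f s * (z₀ + ∫ r in 0..s, g r) + (y₀ + ∫ r in 0..s, f r) * g s =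
      ((f s * z₀ + y₀ * g s) + (f s * ∫ r in 0..s, g r)) + (∫ r in 0..s, f r) * g s := fun s => by
    ring
  simp_rw [e]
  rw [intervalIntegral.integral_add (((hf'.mul_const z₀).add (hg'.const_mul y₀)).add i1)
      (hg'.continuousOn_mul cf),
    intervalIntegral.integral_add ((hf'.mul_const z₀).add (hg'.const_mul y₀)) i1,
    intervalIntegral.integral_add (hf'.mul_const z₀) (hg'.const_mul y₀),
    intervalIntegral.integral_mul_const, intervalIntegral.integral_const_mul]
  have := integral_triangle_add ht hf hg
  linear_combination -this

lemma ae_eq_zero_of_cutoff {F : ℝ → ℂ} (hF : ∀ T, IntegrableOn F (Ioc 0 T)) (h : ∀ g : ℝ → ℝ,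
    ContDiff ℝ ∞ g → ∀ B, 0 ≤ B → (∀ t, B ≤ t → g t = 0) → ∫ t in Ioi (0 : ℝ), (g t : ℂ) * F t = 0)
    : ∀ᵐ t ∂ℓ, F t = 0 := by
  refine (ae_restrict_iff' measurableSet_Ioi).2
    (IsOpen.ae_eq_zero_of_integral_contDiff_smul_eq_zero isOpen_Ioi (fun t ht => ⟨Ioc 0 (t + 1),
        mem_nhdsWithin_of_mem_nhds (mem_of_superset (Ioo_mem_nhds ht (lt_add_one t))
          Ioo_subset_Ioc_self), hF _⟩) fun g hg hgc hgs => ?_)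
  obtain ⟨B, hB⟩ := hgc.isCompact.bddAbove
  rw [← setIntegral_eq_integral_of_forall_compl_eq_zero (s := Ioi 0) fun t ht => by
    rw [image_eq_zero_of_notMem_tsupport fun hm => ht (hgs hm), zero_smul]]
  simp only [Complex.real_smul]
  refine h g hg (max (B + 1) 0) (le_max_right _ _) fun t ht =>
    image_eq_zero_of_notMem_tsupport fun hm => ?_
  linarith [hB hm, le_max_left (B + 1) 0]

/-- A scalar differential equation in the sense of distributions on `[0, ∞)`, with its initial
value, holds in integrated form. -/
lemma ae_eq_primitive_of_weak {y f : ℝ → ℂ} {y₀ : ℂ} (hy : ∀ T, IntegrableOn y (Ioc 0 T)) (hf : ∀ T,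
    IntegrableOn f (Ioc 0 T)) (h : ∀ χ : ℝ → ℝ, ContDiff ℝ ∞ χ → (∃ T, ∀ t, T ≤ t → χ t = 0) → (∫ t
    in Ioi (0 : ℝ), (((deriv χ t : ℝ) : ℂ) * y t + χ t * f t)) + χ 0 * y₀ = 0) : ∀ᵐ t ∂ℓ, y t = y₀ +
    ∫ s in 0..t, f s := by
  set Y : ℝ → ℂ := fun t => y₀ + ∫ s in 0..t, f s with hY
  have hYi : ∀ T, IntegrableOn Y (Ioc 0 T) := fun T => by
    rcases le_or_gt 0 T with hT | hT
    · exact (((fun T hT =>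
        continuousOn_const.add (continuousOn_primitive' hT (hf
            T))) T hT).integrableOn_compact isCompact_Icc).mono_set Ioc_subset_Icc_self
    · simp [Ioc_eq_empty hT.le.not_gt]
  refine (ae_eq_zero_of_cutoff (fun T => (hy T).sub (hYi T)) fun g hg B hB0 hB => ?_).mono
    fun t ht => sub_eq_zero.1 ht
  simp only [Pi.sub_apply]
  set χ : ℝ → ℝ := fun t => ∫ s in B..t, g s with hχ
  have hd : ∀ t, HasDerivAt χ (g t) t := fun t =>
    intervalIntegral.integral_hasDerivAt_right (hg.continuous.intervalIntegrable _ _)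
      (hg.continuous.stronglyMeasurableAtFilter _ _) hg.continuous.continuousAt
  have hdχ : deriv χ = g := funext fun t => (hd t).deriv
  have hχs : ContDiff ℝ ∞ χ := by
    rw [contDiff_infty_iff_deriv]
    exact ⟨fun t => (hd t).differentiableAt, by rwa [hdχ]⟩
  have hχ0 : ∀ t, B ≤ t → χ t = 0 := fun t ht => by
    simp only [hχ]
    refine intervalIntegral.integral_zero_ae (ae_of_all _ fun s hs => hB s ?_)
    rw [uIoc_of_le ht] at hs
    exact hs.1.le
  have hχc : Continuous fun t => (χ t : ℂ) := continuous_ofReal.comp hχs.continuous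
  have hgcc : Continuous fun t => (g t : ℂ) := continuous_ofReal.comp hg.continuous
  have hprim : ∀ s, ((χ 0 : ℂ) + ∫ r in 0..s, (g r : ℂ)) = χ s := fun s => by
    rw [intervalIntegral.integral_ofReal, ← Complex.ofReal_add]
    congr 1
    exact intervalIntegral.integral_add_adjacent_intervals
      (hg.continuous.intervalIntegrable _ _) (hg.continuous.intervalIntegrable _ _)
  have hmul := mul_primitive (y₀ := y₀) (z₀ := (χ 0 : ℂ)) hB0 (hf B)
    ((hgcc.integrableOn_Icc (a := 0) (b := B)).mono_set Ioc_subset_Icc_self)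
  simp_rw [hprim] at hmul
  rw [hχ0 B le_rfl, ofReal_zero, mul_zero] at hmul
  have hweak := h χ hχs ⟨B, hχ0⟩
  rw [hdχ] at hweak
  have cut : ∀ F : ℝ → ℂ, (∀ t, B < t → F t = 0) →
      ∫ t in Ioi (0 : ℝ), F t = ∫ t in 0..B, F t := fun F hF => by
    rw [integral_of_le hB0, ← Ioc_union_Ioi_eq_Ioi hB0]
    exact (setIntegral_eq_of_subset_of_forall_sdiff_eq_zero (measurableSet_Ioc.union
      measurableSet_Ioi) subset_union_left fun t ht => hF t (by
        rcases ht.1 with h' | h'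
        · exact absurd h' ht.2
        · exact h'))
  rw [cut _ fun t ht => by simp [hB t ht.le, hχ0 t ht.le]] at hweak
  have iY := interval_of_Ioc hB0 (hYi B)
  have if' := interval_of_Ioc hB0 (hf B)
  have j1 : IntervalIntegrable (fun t => (g t : ℂ) * y t) volume 0 B :=
    (interval_of_Ioc hB0 (hy B)).continuousOn_mul hgcc.continuousOn
  have j2 : IntervalIntegrable (fun t => (χ t : ℂ) * f t) volume 0 B :=
    if'.continuousOn_mul hχc.continuousOn
  have j3 : IntervalIntegrable (fun t => (y₀ + ∫ s in 0..t, f s) * (g t : ℂ)) volume 0 B :=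
    iY.mul_continuousOn hgcc.continuousOn
  have j4 : IntervalIntegrable (fun t => f t * (χ t : ℂ)) volume 0 B :=
    if'.mul_continuousOn hχc.continuousOn
  rw [intervalIntegral.integral_add j1 j2] at hweak
  rw [intervalIntegral.integral_add j4 j3] at hmul
  rw [cut _ fun t ht => by simp [hB t ht.le]]
  have e2 : ∀ t, (g t : ℂ) * (y t - Y t) = g t * y t - Y t * g t := fun t => by ring
  simp_rw [e2]
  rw [intervalIntegral.integral_sub j1 j3]
  have e3 : ∫ t in 0..B, f t * (χ t : ℂ) = ∫ t in 0..B, (χ t : ℂ) * f t := by congr 1; ext t; ring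
  rw [e3] at hmul
  linear_combination hweak + hmul

/-- Variation of constants. -/
lemma ae_eq_duhamel {y f : ℝ → ℂ} {y₀ : ℂ} (a : ℝ) (hy : ∀ T, IntegrableOn y (Ioc 0 T)) (hf : ∀ T,
    IntegrableOn f (Ioc 0 T)) (h : ∀ᵐ t ∂ℓ, y t = y₀ + ∫ s in 0..t, (-a * y s + f s)) : ∀ᵐ t ∂ℓ, y t
    = exp (-a * t) * y₀ + ∫ s in 0..t, (exp (-a * (t - s)) : ℂ) * f s := by
  rw [ae_restrict_iff' measurableSet_Ioi] at h ⊢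
  filter_upwards [h] with t ht h0
  have h0' : (0 : ℝ) ≤ t := le_of_lt h0
  rw [ht h0]
  have hF : IntegrableOn (fun s => -a * y s + f s) (Ioc 0 t) := ((hy t).const_mul _).add (hf t)
  have hc : Continuous fun s : ℝ => ((a * exp (a * s) : ℝ) : ℂ) := by fun_prop
  have hprim : ∀ s, (1 : ℂ) + ∫ r in 0..s, ((a * exp (a * r) : ℝ) : ℂ) = exp (a * s) := by
    intro s
    rw [intervalIntegral.integral_ofReal, integral_eq_sub_of_hasDerivAt (f := fun r => exp (a * r))]
    · simp
    · intro r _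
      simpa [mul_comm] using ((hasDerivAt_id r).const_mul a).exp
    · exact Continuous.intervalIntegrable (by fun_prop) _ _
  have hmul := mul_primitive (y₀ := y₀) (z₀ := (1 : ℂ)) h0' hF
    ((hc.integrableOn_Icc (a := 0) (b := t)).mono_set Ioc_subset_Icc_self)
  simp_rw [hprim] at hmul
  have e1 : ∫ s in 0..t, ((-a * y s + f s) * (exp (a * s) : ℂ) +
      (y₀ + ∫ r in 0..s, (-a * y r + f r)) * ((a * exp (a * s) : ℝ) : ℂ)) =
      ∫ s in 0..t, f s * (exp (a * s) : ℂ) := by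
    refine intervalIntegral.integral_congr_ae ?_
    filter_upwards [h] with s hs hmem
    rw [uIoc_of_le h0'] at hmem
    rw [← hs hmem.1]
    push_cast
    ring
  rw [e1] at hmul
  have e2 : ∫ s in 0..t, (exp (-a * (t - s)) : ℂ) * f s =
      exp (-a * t) * ∫ s in 0..t, f s * (exp (a * s) : ℂ) := by
    rw [← intervalIntegral.integral_const_mul]
    congr 1
    ext s
    rw [show -a * (t - s) = -a * t + a * s by ring, exp_add]
    push_cast
    ring
  rw [e2]
  have e3 : (exp (-a * t) : ℂ) * exp (a * t) = 1 := by rw [← Complex.ofReal_mul, ← exp_add]; simp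
  linear_combination (exp (-a * t) : ℂ) * hmul - (y₀ + ∫ s in 0..t, (-a * y s + f s)) * e3

lemma lintegral_exp_decay_le (ha : 0 < a) (t : ℝ) :
    ∫⁻ s in Ioc 0 t, ofReal (exp (-a * (t - s))) ≤ ofReal (1 / a) := by
  rcases le_or_gt t 0 with ht | ht
  · simp [Ioc_eq_empty ht.not_gt]
  have hd : ∀ s, HasDerivAt (fun s => exp (-a * (t - s)) / a) (exp (-a * (t - s))) s := by
    intro s
    have h1 : HasDerivAt (fun s => -a * (t - s)) a s := by
      simpa using ((hasDerivAt_id s).const_sub t).const_mul (-a)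
    refine (h1.exp.div_const a).congr_deriv ?_
    field_simp
  have hi : IntegrableOn (fun s => exp (-a * (t - s))) (Ioc 0 t) :=
    (Continuous.integrableOn_Icc (by fun_prop)).mono_set Ioc_subset_Icc_self
  rw [← ofReal_integral_eq_lintegral_ofReal hi (ae_of_all _ fun s => (exp_pos _).le),
    ← integral_of_le ht.le,
    integral_eq_sub_of_hasDerivAt (fun s _ => hd s) (interval_of_Ioc ht.le hi)]
  refine ofReal_le_ofReal ?_
  simp only [sub_self, mul_zero, Real.exp_zero]
  have : 0 ≤ exp (-a * (t - 0)) / a := by positivity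
  linarith

lemma enorm_duhamel_sq_le (ha : 0 < a) (ht : 0 ≤ t) {f : ℝ → ℂ} (hf : AEStronglyMeasurable f ℓ(t)) :
    ‖∫ s in 0..t, (exp (-a * (t - s)) : ℂ) * f s‖ₑ ^ 2 ≤ ofReal (1 / a) * ∫⁻ s in Ioc 0 t, ofReal
    (exp (-a * (t - s))) * ‖f s‖ₑ ^ 2 := by
  rw [integral_of_le ht]
  set w : ℝ → ℝ≥0∞ := fun s => ofReal (exp (-a * (t - s))) with hw
  have hwm : Measurable w := by refine measurable_ofReal.comp (Continuous.measurable (by fun_prop))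
  have h1 : ‖∫ s in Ioc 0 t, (exp (-a * (t - s)) : ℂ) * f s‖ₑ ≤
      ∫⁻ s in Ioc 0 t, (w s ^ (1 / 2 : ℝ)) * (w s ^ (1 / 2 : ℝ) * ‖f s‖ₑ) := by
    refine (enorm_integral_le_lintegral_enorm _).trans (lintegral_mono fun s => le_of_eq ?_)
    rw [← mul_assoc, ← ENNReal.rpow_add_of_nonneg _ _ (by norm_num) (by norm_num), enorm_mul,
      show (1 / 2 + 1 / 2 : ℝ) = 1 by norm_num, ENNReal.rpow_one, ← ofReal_norm,
      norm_real, norm_eq_abs, abs_of_pos (exp_pos _)]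
  have h3 := h1.trans (ENNReal.lintegral_mul_le_Lp_mul_Lq ℓ(t)
      (Real.HolderConjugate.two_two) (f := fun s => w s ^ (1 / 2 : ℝ))
      (g := fun s => w s ^ (1 / 2 : ℝ) * ‖f s‖ₑ) (hwm.pow_const _).aemeasurable
      ((hwm.pow_const _).aemeasurable.mul hf.enorm))
  calc _ ≤ _ := pow_le_pow_left' h3 2
    _ = (∫⁻ s in Ioc 0 t, w s) * ∫⁻ s in Ioc 0 t, w s * ‖f s‖ₑ ^ 2 := by
      rw [mul_pow, ← rpow_natCast, ← rpow_natCast, ← rpow_mul, ← rpow_mul]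
      norm_num
      congr 1
      · refine lintegral_congr fun s => ?_
        rw [← rpow_natCast, ← rpow_mul]; norm_num
      · refine lintegral_congr fun s => ?_
        rw [mul_pow, ← rpow_natCast (w s ^ _), ← rpow_mul]; norm_num
    _ ≤ _ := by
      gcongr
      exact lintegral_exp_decay_le ha t

lemma lintegral_conv_le {K F : ℝ → ℝ≥0∞} (hK : Measurable K) (T : ℝ) (hF : AEMeasurable F ℓ(T)) : ∫⁻
    t in Ioc 0 T, ∫⁻ s in Ioc 0 t, K (t - s) * F s ≤ (∫⁻ σ in Ioi (0 : ℝ), K σ) * ∫⁻ s in Ioc 0 T, F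
    s := by
  have e : ∀ t ∈ Ioc 0 T, ∫⁻ s in Ioc 0 t, K (t - s) * F s =
      ∫⁻ s in Ioc 0 T, (Ici (0 : ℝ)).indicator K (t - s) * F s := by
    intro t ht
    rw [← lintegral_indicator measurableSet_Ioc, ← lintegral_indicator measurableSet_Ioc]
    refine lintegral_congr fun s => ?_
    by_cases h1 : s ∈ Ioc 0 t
    · have h2 : s ∈ Ioc 0 T := ⟨h1.1, h1.2.trans ht.2⟩
      simp [h1, h2, (sub_nonneg.2 h1.2)]
    · by_cases h2 : s ∈ Ioc 0 T
      · have h3 : (t - s) ∉ Ici (0 : ℝ) := fun h => h1 ⟨h2.1, sub_nonneg.1 h⟩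
        simp only [h1, h2, indicator_of_notMem, indicator_of_mem, not_false_eq_true, h3, zero_mul]
      · simp [h1, h2]
  have hKm : Measurable ((Ici (0 : ℝ)).indicator K) := hK.indicator measurableSet_Ici
  rw [setLIntegral_congr_fun measurableSet_Ioc e, lintegral_lintegral_swap]
  · calc ∫⁻ s in Ioc 0 T, ∫⁻ t in Ioc 0 T, (Ici (0 : ℝ)).indicator K (t - s) * F s
        ≤ ∫⁻ s in Ioc 0 T, (∫⁻ σ in Ioi (0 : ℝ), K σ) * F s := by
          refine lintegral_mono fun s => ?_
          have hm : Measurable fun t => (Ici (0 : ℝ)).indicator K (t - s) :=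
            hKm.comp (measurable_id.sub_const s)
          rw [lintegral_mul_const _ hm]
          refine mul_le_mul_left ?_ _
          calc ∫⁻ t in Ioc 0 T, (Ici (0 : ℝ)).indicator K (t - s)
              ≤ ∫⁻ t, (Ici (0 : ℝ)).indicator K (t - s) := setLIntegral_le_lintegral _ _
            _ = ∫⁻ t, (Ici (0 : ℝ)).indicator K t := lintegral_sub_right_eq_self _ s
            _ = ∫⁻ σ in Ioi (0 : ℝ), K σ := by
              rw [lintegral_indicator measurableSet_Ici, setLIntegral_congr Ioi_ae_eq_Ici]
      _ = _ := lintegral_const_mul'' _ hF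
  · refine AEMeasurable.mul ?_ ?_
    · exact (hKm.comp (measurable_fst.sub measurable_snd)).aemeasurable
    · exact hF.comp_snd

/-! ### Admissible pairs and their measurable versions -/

/-- Jointly measurable fields with `u ∈ L^∞_T H¹` and `θ ∈ L^∞_T L^∞` for every `T`. -/
structure Adm (u : VectorField) (θ : ScalarField) : Prop where
  meas_u : Measurable (uncurry u)
  meas_θ : Measurable (uncurry θ)
  bound : ∀ T > 0, ∃ C : ℝ≥0, ∀ᵐ t ∂ℓ(T),
    (∀ i, MemLp (u t · i) 2 vol ∧ h1NormSq (u t · i) ≤ C) ∧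
      ∀ᵐ x ∂vol, |θ t x| ≤ C

lemma ae_Ioi_of_forall_Ioc {P : ℝ → Prop} (h : ∀ T > 0, ∀ᵐ t ∂ℓ(T), P t) : ∀ᵐ t ∂ℓ, P t := by
  have : Ioi (0 : ℝ) = ⋃ n : ℕ, Ioc (0 : ℝ) (n + 1) := by
    ext t
    simp only [mem_iUnion]
    refine ⟨fun h => ?_, fun ⟨n, h, _⟩ => h⟩
    obtain ⟨n, hn⟩ := exists_nat_ge t
    exact ⟨n, h, hn.trans (by linarith)⟩
  rw [this, ae_restrict_iUnion_iff]
  exact fun n => h _ (by positivity)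

lemma ae_Ioc {P : ℝ → Prop} (h : ∀ᵐ t ∂ℓ, P t) (T : ℝ) : ∀ᵐ t ∂ℓ(T), P t :=
  ae_restrict_of_ae_restrict_of_subset Ioc_subset_Ioi_self h

lemma restrict_Icc (T : ℝ) : (volume.restrict (Icc 0 T) : Measure ℝ) = ℓ(T) :=
  Measure.restrict_congr_set Ioc_ae_eq_Icc.symm

lemma exists_measurable_version {E : Type*} [TopologicalSpace E] [MeasurableSpace E] [BorelSpace E]
    [TopologicalSpace.PseudoMetrizableSpace E] {f : ℝ → T2 → E} (h : ∀ T > 0, AEStronglyMeasurable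
    (uncurry f) (volUpTo T)) : ∃ g : ℝ → T2 → E, Measurable (uncurry g) ∧ ∀ᵐ p ∂(ℓ).prod vol, f p.1
    p.2 = g p.1 p.2 := by
  have hm : AEStronglyMeasurable (uncurry f) ((ℓ).prod vol) := by
    have e : (ℓ).prod vol =
        ((volume : Measure ℝ).prod vol).restrict (⋃ n : ℕ, Icc (0 : ℝ) (n + 1) ×ˢ univ ∩
          Ioi (0 : ℝ) ×ˢ univ) := by
      rw [← restrict_univ (μ := vol), prod_restrict, restrict_univ]
      congr 1
      ext p
      simp only [mem_prod, mem_Ioi, mem_univ, and_true, mem_iUnion, mem_inter_iff, mem_Icc]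
      refine ⟨fun h => ?_, fun ⟨n, _, h⟩ => h⟩
      obtain ⟨n, hn⟩ := exists_nat_ge p.1
      exact ⟨n, ⟨h.le, hn.trans (by linarith)⟩, h⟩
    rw [e, aestronglyMeasurable_iUnion_iff]
    intro n
    have := h (n + 1) (by positivity)
    have e2 : volUpTo (n + 1 : ℝ) =
        ((volume : Measure ℝ).prod vol).restrict (Icc (0 : ℝ) (n + 1) ×ˢ univ) := by
      rw [volUpTo, ← restrict_univ (μ := vol), prod_restrict, restrict_univ]
    rw [e2] at this
    exact this.mono_set inter_subset_left
  exact ⟨fun t x => hm.mk _ (t, x), hm.stronglyMeasurable_mk.measurable, hm.ae_eq_mk⟩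

lemma exists_adm (hu : ∀ T > 0, MemLinftyH1 T u) (hθ : ∀ T > 0, MemLinfty T θ) : ∃ u' θ', Adm u' θ'
    ∧ (∀ᵐ p ∂(ℓ).prod vol, u p.1 p.2 = u' p.1 p.2) ∧ ∀ᵐ p ∂(ℓ).prod vol, θ p.1 p.2 = θ' p.1 p.2 :=
    by
  obtain ⟨u', hu', hu2⟩ := exists_measurable_version fun T hT => (hu T hT).1
  obtain ⟨θ', hθ', hθ2⟩ := exists_measurable_version fun T hT => (hθ T hT).1
  refine ⟨u', θ', ⟨hu', hθ', fun T hT => ?_⟩, hu2, hθ2⟩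
  obtain ⟨C, hC⟩ := (hu T hT).2
  rw [restrict_Icc] at hC
  have hb : ∀ᵐ t ∂volume.restrict (Icc 0 T), ∀ᵐ x ∂vol,
      ‖θ t x‖ₑ ≤ eLpNorm (uncurry θ) ⊤ (volUpTo T) := by
    refine ae_ae_of_ae_prod (p := fun p : ℝ × T2 => ‖θ p.1 p.2‖ₑ ≤ _) ?_
    rw [eLpNorm_exponent_top]
    exact ae_le_eLpNormEssSup (f := uncurry θ)
  rw [restrict_Icc] at hb
  refine ⟨C + (eLpNorm (uncurry θ) ⊤ (volUpTo T)).toNNReal, ?_⟩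
  filter_upwards [hC, hb, ae_Ioc (ae_ae_of_ae_prod hu2) T, ae_Ioc (ae_ae_of_ae_prod hθ2) T] with t
      h1 h2 h3 h4
  refine ⟨fun i => ?_, ?_⟩
  · have e : (u t · i) =ᵐ[vol] fun x => u' t x i := h3.mono fun x hx => by simp only [hx]
    refine ⟨(memLp_congr_ae e).1 (h1 i).1, ?_⟩
    have : h1NormSq (u' t · i) = h1NormSq (u t · i) := by
      unfold h1NormSq
      simp_rw [coeff_congr e]
    rw [this]
    refine (h1 i).2.trans ?_
    push_cast
    exact le_self_add
  · filter_upwards [h2, h4] with x hx hx'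
    rw [← hx']
    have h5 : ‖θ t x‖ₑ ≤ ((eLpNorm (uncurry θ) ⊤ (volUpTo T)).toNNReal : ℝ≥0∞) := by
      rwa [coe_toNNReal (hθ T hT).2.ne]
    have h6 : ‖θ t x‖₊ ≤ (eLpNorm (uncurry θ) ⊤ (volUpTo T)).toNNReal := by exact_mod_cast h5
    have h7 : ‖θ t x‖ ≤ ((eLpNorm (uncurry θ) ⊤ (volUpTo T)).toNNReal : ℝ) := by exact_mod_cast h6
    rw [← norm_eq_abs]
    push_cast
    linarith [C.2]

lemma solvesTransport_congr (hu : ∀ᵐ t ∂ℓ, u t =ᵐ[vol] u' t) (hθ : ∀ᵐ t ∂ℓ, θ t =ᵐ[vol] θ' t) (h :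
    SolvesTransport u θ θ₀) : SolvesTransport u' θ' θ₀ := by
  intro φ hφ
  refine Eq.trans ?_ (h φ hφ)
  congr 1
  refine integral_congr_ae ?_
  filter_upwards [hu, hθ] with t h1 h2
  refine integral_congr_ae ?_
  filter_upwards [h1, h2] with x h3 h4
  simp only [h3, h4]

lemma solvesMomentum_congr (hu : ∀ᵐ t ∂ℓ, u t =ᵐ[vol] u' t) (hθ : ∀ᵐ t ∂ℓ, θ t =ᵐ[vol] θ' t) (h :
    SolvesMomentum α ε u θ u₀) : SolvesMomentum α ε u' θ' u₀ := by
  intro φ hφ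
  refine Eq.trans ?_ (h φ hφ)
  congr 1
  refine integral_congr_ae ?_
  filter_upwards [hu, hθ] with t h1 h2
  refine integral_congr_ae ?_
  filter_upwards [h1, h2] with x h3 h4
  simp only [h3, h4]

lemma solvesStokes_congr (hu : ∀ᵐ t ∂ℓ, u t =ᵐ[vol] u' t) (hθ : ∀ᵐ t ∂ℓ, θ t =ᵐ[vol] θ' t) (h :
    SolvesStokes α u θ) : SolvesStokes α u' θ' := by
  intro φ hφ
  refine Eq.trans ?_ (h φ hφ)
  refine integral_congr_ae ?_
  filter_upwards [hu, hθ] with t h1 h2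
  refine integral_congr_ae ?_
  filter_upwards [h1, h2] with x h3 h4
  simp only [h3, h4]

lemma isDivFree_congr {v' : T2 → Fin 2 → ℝ} (h : v =ᵐ[vol] v') (hv : IsDivFree v) :
    IsDivFree v' := by
  intro ψ hψ
  refine Eq.trans ?_ (hv ψ hψ)
  refine integral_congr_ae ?_
  filter_upwards [h] with x hx
  simp only [hx]

/-! ### Bounds and measurability of coefficients -/

lemma meas_coeff {f : ℝ → T2 → ℝ} (hf : Measurable (uncurry f)) (k : Z2) :
    Measurable fun t => coeff (f t) k := by
  have h : StronglyMeasurable fun p : ℝ × T2 => mFourier (-k) p.2 * ((f p.1 p.2 : ℝ) : ℂ) := by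
    refine Measurable.stronglyMeasurable ?_
    exact ((mFourier (-k)).continuous.measurable.comp measurable_snd).mul
      (Complex.measurable_ofReal.comp hf)
  exact (h.integral_prod_right (ν := vol)).measurable

lemma measurable_coord (hu : Measurable (uncurry u)) (i : Fin 2) :
    Measurable (uncurry fun t x => u t x i) :=
  (measurable_pi_apply i).comp hu

lemma meas_slice {f : ℝ → T2 → ℝ} (hf : Measurable (uncurry f)) (t : ℝ) :
    Measurable (f t) := hf.comp measurable_prodMk_left

lemma tsum_sq_coeff_le_h1NormSq (f : T2 → ℝ) : ∑' k, ofReal (‖coeff f k‖ ^ 2) ≤ h1NormSq f := by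
  refine tsum_le_tsum fun k => ofReal_le_ofReal ?_
  nlinarith [sq_nonneg ‖coeff f k‖]

lemma ofReal_integral_sq_eq (hf : MemLp f 2 vol) :
    ofReal (∫ x, f x ^ 2 ∂vol) = ∑' k, ofReal (‖coeff f k‖ ^ 2) := by
  rw [← (hasSum_sq_coeff hf).tsum_eq,
    ENNReal.ofReal_tsum_of_nonneg (fun k => by positivity) (hasSum_sq_coeff hf).summable]

lemma integral_sq_le_of_h1NormSq (hf : MemLp f 2 vol) {C : ℝ≥0}
    (h : h1NormSq f ≤ C) : ∫ x, f x ^ 2 ∂vol ≤ C := by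
  have h1 := (ofReal_integral_sq_eq hf).le.trans ((tsum_sq_coeff_le_h1NormSq f).trans h)
  rw [← ENNReal.ofReal_coe_nnreal] at h1
  exact (ENNReal.ofReal_le_ofReal_iff C.2).1 h1

lemma integrableOn_of_ae_bound {y : ℝ → ℂ} (hy : Measurable y) (h : ∀ T > 0, ∃ C : ℝ, ∀ᵐ t ∂ℓ(T), ‖y
    t‖ ≤ C) (T : ℝ) : IntegrableOn y (Ioc 0 T) := by
  rcases le_or_gt T 0 with hT | hT
  · simp [Ioc_eq_empty hT.not_gt]
  · obtain ⟨C, hC⟩ := h T hT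
    exact Integrable.of_bound hy.aestronglyMeasurable C hC

lemma integrable_mul_L2 (hf : MemLp f 2 vol) (hg : MemLp g 2 vol) :
    Integrable (fun x => f x * g x) vol := hf.integrable_mul hg

lemma memLp_bdd (hf : Measurable f) (h : ∀ᵐ x ∂vol, |f x| ≤ C) : MemLp f 2 vol :=
  MemLp.of_bound hf.aestronglyMeasurable C h

lemma memLp_two_bdd_mul (hf : Measurable f) (h : ∀ᵐ x ∂vol, |f x| ≤ C)
    (hg : MemLp g 2 vol) : MemLp (fun x => f x * g x) 2 vol :=
  MemLp.of_le_mul (c := C) hg (hf.aestronglyMeasurable.mul hg.1) <| by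
    filter_upwards [h] with x hx
    rw [norm_mul, norm_eq_abs (f x)]
    gcongr

lemma norm_coeff_sq_le (hf : MemLp f 2 vol) (k : Z2) : ‖coeff f k‖ ^ 2 ≤ ∫ x, f x ^ 2 ∂vol :=
  le_hasSum (hasSum_sq_coeff hf) k fun j _ => by positivity

lemma norm_coeff_mul_le (hf : MemLp f 2 vol) (hg : MemLp g 2 vol) (k : Z2) :
    ‖coeff (fun x => f x * g x) k‖ ≤ (∫ x, f x ^ 2 ∂vol) + ∫ x, g x ^ 2 ∂vol := by
  refine (norm_coeff_le _ k).trans ?_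
  rw [← integral_add hf.integrable_sq hg.integrable_sq]
  refine integral_mono (hf.integrable_mul hg).abs (hf.integrable_sq.add hg.integrable_sq)
    fun x => ?_
  simp only
  rw [abs_mul, ← sq_abs (f x), ← sq_abs (g x)]
  nlinarith [sq_nonneg (|f x|)]

section AdmFacts

variable (h : Adm u θ)
include h

lemma Adm.slice : ∀ᵐ t ∂ℓ, (∀ i, MemLp (u t · i) 2 vol) ∧ ∃ C : ℝ, ∀ᵐ x ∂vol, |θ t x| ≤ C := by
  refine ae_Ioi_of_forall_Ioc fun T hT => ?_
  obtain ⟨C, hC⟩ := h.bound T hT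
  filter_upwards [hC] with t ht
  exact ⟨fun i => (ht.1 i).1, C, ht.2⟩

lemma Adm.integrableOn_coeff_θ (k : Z2) (T : ℝ) :
    IntegrableOn (fun t => coeff (θ t) k) (Ioc 0 T) := by
  refine integrableOn_of_ae_bound (meas_coeff h.meas_θ k) (fun T hT => ?_) T
  obtain ⟨C, hC⟩ := h.bound T hT
  refine ⟨C, ?_⟩
  filter_upwards [hC] with t ht
  refine (norm_coeff_le _ k).trans ?_
  refine (integral_mono_of_nonneg (ae_of_all _ fun x => abs_nonneg _) (integrable_const (C : ℝ))
    ht.2).trans (by simp)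

lemma Adm.integrableOn_coeff_u (i : Fin 2) (k : Z2) (T : ℝ) :
    IntegrableOn (fun t => coeff (u t · i) k) (Ioc 0 T) := by
  refine integrableOn_of_ae_bound (meas_coeff (measurable_coord h.meas_u i) k) (fun T hT => ?_) T
  obtain ⟨C, hC⟩ := h.bound T hT
  refine ⟨1 + C, ?_⟩
  filter_upwards [hC] with t ht
  have := (norm_coeff_sq_le (ht.1 i).1 k).trans (integral_sq_le_of_h1NormSq (ht.1 i).1 (ht.1 i).2)
  nlinarith

lemma Adm.meas_θu (i : Fin 2) : Measurable (uncurry fun t x => θ t x * u t x i) :=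
  h.meas_θ.mul (measurable_coord h.meas_u i)

lemma Adm.meas_uu (i j : Fin 2) : Measurable (uncurry fun t x => u t x j * u t x i) :=
  (measurable_coord h.meas_u j).mul (measurable_coord h.meas_u i)

lemma Adm.integrableOn_coeff_θu (i : Fin 2) (k : Z2) (T : ℝ) :
    IntegrableOn (fun t => coeff (fun x => θ t x * u t x i) k) (Ioc 0 T) := by
  refine integrableOn_of_ae_bound (meas_coeff (h.meas_θu i) k) (fun T hT => ?_) T
  obtain ⟨C, hC⟩ := h.bound T hT
  refine ⟨C ^ 2 + C, ?_⟩
  filter_upwards [hC] with t ht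
  refine (norm_coeff_mul_le (memLp_bdd (meas_slice h.meas_θ t) ht.2) (ht.1 i).1 k).trans ?_
  gcongr
  · refine (integral_mono_of_nonneg (ae_of_all _ fun x => sq_nonneg _)
      (integrable_const ((C : ℝ) ^ 2)) ?_).trans (by simp)
    filter_upwards [ht.2] with x hx
    rw [← sq_abs]
    gcongr
  · exact integral_sq_le_of_h1NormSq (ht.1 i).1 (ht.1 i).2

lemma Adm.integrableOn_coeff_uu (i j : Fin 2) (k : Z2) (T : ℝ) :
    IntegrableOn (fun t => coeff (fun x => u t x j * u t x i) k) (Ioc 0 T) := by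
  refine integrableOn_of_ae_bound (meas_coeff (h.meas_uu i j) k) (fun T hT => ?_) T
  obtain ⟨C, hC⟩ := h.bound T hT
  refine ⟨C + C, ?_⟩
  filter_upwards [hC] with t ht
  refine (norm_coeff_mul_le (ht.1 j).1 (ht.1 i).1 k).trans ?_
  gcongr
  · exact integral_sq_le_of_h1NormSq (ht.1 j).1 (ht.1 j).2
  · exact integral_sq_le_of_h1NormSq (ht.1 i).1 (ht.1 i).2

end AdmFacts

/-! ### Testing with characters -/

lemma rapid_single (k : Z2) (w : ℂ) : Rapid (single k w) := Rapid.of_finite {k} fun j hj => by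
    rw [Pi.single_apply, if_neg (by simpa using hj)]

lemma fser_single (k : Z2) (w : ℂ) (x : T2) : fser (single k w) x = (w * mFourier k x).re := by
  unfold fser
  rw [tsum_eq_single k fun j hj => by rw [Pi.single_eq_of_ne hj, zero_mul], Pi.single_eq_same]

lemma pd_fser_single (k : Z2) (w : ℂ) (i : Fin 2) (x : T2) :
    pd i (fser (single k w)) x = fser (single k (2 * π * I * (k i) * w)) x := by
  rw [pd_fser (rapid_single k w)]
  congr 1
  ext j
  by_cases hj : j = k
  · subst hj; simp
  · simp [hj]

lemma integral_mul_fser_single (hf : Integrable f vol) (k : Z2) (w : ℂ) :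
    ∫ x, f x * fser (single k w) x ∂vol = (w * conj (coeff f k)).re := by
  have := hasSum_integral_mul_fser hf (rapid_single k w).summable_norm
  refine this.unique ?_
  simpa using (hasSum_single (f := fun j => ((single k w : Z2 → ℂ) j * conj (coeff f j)).re) k
      fun j hj => by simp [Pi.single_eq_of_ne hj])

lemma pd_const_mul (a : ℝ) (f : T2 → ℝ) (i : Fin 2) (x : T2) :
    pd i (fun y => a * f y) x = a * pd i f x := by
  simp [pd]

lemma isTest_mul_fser (hχ : ContDiff ℝ ∞ χ) (hχ' : ∃ T, ∀ t, T ≤ t → χ t = 0) (hc : Rapid c) :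
    IsTest fun t x => χ t * fser c x := by
  refine ⟨(hχ.comp contDiff_fst).mul ((isSmooth_fser hc).comp contDiff_snd), ?_⟩
  obtain ⟨T, hT⟩ := hχ'
  exact ⟨T, fun t ht x => by simp [hT t ht]⟩

lemma integrable_fser_mul (hf : Integrable f vol)
    (hc : Summable fun k => ‖c k‖) : Integrable (fun x => f x * fser c x) vol := by
  obtain ⟨C, hC⟩ := isCompact_univ.exists_bound_of_continuousOn (continuous_fser hc).continuousOn
  exact hf.mul_bdd (continuous_fser hc).aestronglyMeasurable (ae_of_all _ fun x => hC x (mem_univ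
      x))

lemma freq_neg (k : Z2) : freq (-k) = freq k := by simp [freq]

lemma coeff_fser_single (k j : Z2) (w : ℂ) : coeff (fser (single k w)) j = (single k (w / 2) : Z2 →
    ℂ) j + (single (-k) (conj w / 2) : Z2 → ℂ) j := by
  have e : ∀ x, ((fser (single k w) x : ℝ) : ℂ) =
      w / 2 * mFourier k x + conj w / 2 * mFourier (-k) x := fun x => by
    rw [fser_single, Complex.re_eq_add_conj, map_mul, conj_mFourier]
    ring
  have hint : ∀ m : Z2, Integrable (fun x => mFourier m x) vol := fun m =>
    (mFourier m).continuous.integrable_of_hasCompactSupport (HasCompactSupport.of_compactSpace _)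
  have e2 : ∀ m : Z2, ∫ x, mFourier m x ∂vol = if m = 0 then 1 else 0 := fun m => by
    split_ifs with hm
    · subst hm; simp [mFourier_zero]
    · exact integral_mFourier_of_ne hm
  rw [coeff_eq]
  simp_rw [e, mul_add]
  have e3 : ∀ (m : Z2) (z : ℂ) (x : T2), mFourier (-j) x * (z * mFourier m x) =
      z * mFourier (-j + m) x := fun m z x => by rw [mFourier_add]; ring
  simp_rw [e3]
  rw [integral_add ((hint _).const_mul _) ((hint _).const_mul _), integral_const_mul,
    integral_const_mul, e2, e2]
  congr 1
  · by_cases h : j = k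
    · subst h; simp
    · rw [Pi.single_eq_of_ne h, if_neg (fun h' => h (by linear_combination -h')), mul_zero]
  · by_cases h : j = -k
    · subst h; simp
    · rw [Pi.single_eq_of_ne h, if_neg (fun h' => h (by linear_combination -h')), mul_zero]

lemma fracLaplacian_fser_single (α a : ℝ) (k : Z2) (w : ℂ) (x : T2) : fracLaplacian α (fun y => a *
    fser (single k w) y) x = freq k ^ (2 * α) * (a * fser (single k w) x) := by
  unfold fracLaplacian
  simp_rw [coeff_const_mul, coeff_fser_single]
  have e : ∀ j, ((freq j ^ (2 * α) : ℝ) : ℂ) * ((a : ℂ) * ((single k (w / 2) : Z2 → ℂ) j +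
      (single (-k) (conj w / 2) : Z2 → ℂ) j)) * mFourier j x =
      (single k (((freq k ^ (2 * α) : ℝ) : ℂ) * a * (w / 2) * mFourier k x) : Z2 → ℂ) j +
      (single (-k) (((freq k ^ (2 * α) : ℝ) : ℂ) * a * (conj w / 2) * mFourier (-k) x) :
        Z2 → ℂ) j := by
    intro j
    have h1 : ((freq j ^ (2 * α) : ℝ) : ℂ) * ((a : ℂ) * (single k (w / 2) : Z2 → ℂ) j) *
        mFourier j x =
        (single k (((freq k ^ (2 * α) : ℝ) : ℂ) * a * (w / 2) * mFourier k x) : Z2 → ℂ) j := by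
      by_cases h : j = k
      · subst h; simp only [Pi.single_eq_same]; ring
      · simp [h]
    have h2 : ((freq j ^ (2 * α) : ℝ) : ℂ) * ((a : ℂ) * (single (-k) (conj w / 2) : Z2 → ℂ) j) *
        mFourier j x = (single (-k) (((freq k ^ (2 * α) : ℝ) : ℂ) * a * (conj w / 2) *
          mFourier (-k) x) : Z2 → ℂ) j := by
      by_cases h : j = -k
      · subst h; simp only [Pi.single_eq_same, freq_neg]; ring
      · simp [h]
    rw [← h1, ← h2]
    ring
  simp_rw [e]
  rw [((hasSum_pi_single k _).add (hasSum_pi_single (-k) _)).tsum_eq, fser_single, ← conj_mFourier]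
  have : ((freq k ^ (2 * α) : ℝ) : ℂ) * a * (w / 2) * mFourier k x +
      ((freq k ^ (2 * α) : ℝ) : ℂ) * a * (conj w / 2) * conj (mFourier k x) =
      ((freq k ^ (2 * α) * (a * (w * mFourier k x).re) : ℝ) : ℂ) := by
    push_cast
    rw [Complex.re_eq_add_conj, map_mul]
    ring
  rw [this, ofReal_re]

lemma eq_zero_of_forall_re_mul_conj {w : ℂ} (h : ∀ z : ℂ, (z * conj w).re = 0) : w = 0 := by
  have := h w
  rw [mul_conj, ofReal_re, Complex.normSq_eq_zero] at this
  exact this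

lemma integral_re_mul_conj {f : ℝ → ℂ} {s : Set ℝ} (hf : IntegrableOn f s) (z : ℂ) :
    ∫ t in s, (z * conj (f t)).re = (z * conj (∫ t in s, f t)).re := by
  rw [← integral_conj, ← integral_const_mul]
  exact integral_re (𝕜 := ℂ) (((conjCLE.toContinuousLinearMap.integrable_comp hf)).const_mul z)

lemma integrableOn_cutoff_mul {y : ℝ → ℂ} (hy : ∀ T, IntegrableOn y (Ioc 0 T)) (hχ : Continuous χ)
    (hχ' : ∃ T, ∀ t, T ≤ t → χ t = 0) : IntegrableOn (fun t => (χ t : ℂ) * y t) (Ioi 0) := by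
  obtain ⟨T, hT⟩ := hχ'
  set S := max T 0
  have h1 : IntegrableOn (fun t => (χ t : ℂ) * y t) (Ioc 0 S) :=
    (intervalIntegrable_iff_integrableOn_Ioc_of_le (le_max_right _ _)).1
      ((interval_of_Ioc (le_max_right _ _) (hy S)).continuousOn_mul
        (continuous_ofReal.comp hχ).continuousOn)
  refine h1.of_forall_sdiff_eq_zero measurableSet_Ioi fun t ht => ?_
  have : S < t := by
    by_contra h'
    exact ht.2 ⟨ht.1, not_lt.1 h'⟩
  rw [hT t ((le_max_left _ _).trans this.le)]
  simp

lemma deriv_eventually_zero (hχ' : ∃ T, ∀ t, T ≤ t → χ t = 0) :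
    ∃ T, ∀ t, T ≤ t → deriv χ t = 0 := by
  obtain ⟨T, hT⟩ := hχ'
  refine ⟨T + 1, fun t ht => ?_⟩
  have : χ =ᶠ[𝓝 t] fun _ => 0 := by
    filter_upwards [lt_mem_nhds (show T < t by linarith)] with s hs using hT s hs.le
  rw [this.deriv_eq]
  simp

/-- The forcing of the `k`-th Fourier mode in the transport equation. -/
def transForce (u : VectorField) (θ : ScalarField) (k : Z2) (t : ℝ) : ℂ :=
  -∑ i, 2 * π * I * (k i) * coeff (fun x => θ t x * u t x i) k

lemma Adm.integrableOn_transForce (h : Adm u θ) (k : Z2)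
    (T : ℝ) : IntegrableOn (transForce u θ k) (Ioc 0 T) := by
  unfold transForce
  exact (integrable_finsetSum _ fun i _ => (h.integrableOn_coeff_θu i k T).const_mul _).neg

lemma coeff_transport (h : Adm u θ) (hθ₀ : Integrable θ₀ vol) (ht : SolvesTransport u θ θ₀) (k : Z2)
    : ∀ᵐ t ∂ℓ, coeff (θ t) k = coeff θ₀ k + ∫ s in 0..t, transForce u θ k s := by
  refine ae_eq_primitive_of_weak (h.integrableOn_coeff_θ k)
    (h.integrableOn_transForce k) fun χ hχ hχ' => ?_
  refine eq_zero_of_forall_re_mul_conj fun z => ?_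
  have hw := ht _ (isTest_mul_fser hχ hχ' (rapid_single k z))
  have e0 : ∫ x, θ₀ x * (χ 0 * fser (single k z) x) ∂vol =
      (z * conj ((χ 0 : ℂ) * coeff θ₀ k)).re := by
    simp_rw [mul_left_comm _ (χ 0)]
    rw [integral_const_mul, integral_mul_fser_single hθ₀, map_mul, conj_ofReal,
      mul_left_comm, re_ofReal_mul]
  rw [e0] at hw
  have hsum := (integral_re_mul_conj (f := fun t => ((deriv χ t : ℝ) : ℂ) * coeff (θ t) k +
    (χ t : ℂ) * transForce u θ k t) ((integrableOn_cutoff_mul (h.integrableOn_coeff_θ k)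
        ((contDiff_infty_iff_deriv.1 hχ).2.continuous) (deriv_eventually_zero hχ')).add
        (integrableOn_cutoff_mul (h.integrableOn_transForce k) hχ.continuous hχ')) z).symm
  rw [map_add, mul_add, add_re, hsum]
  refine Eq.trans ?_ hw
  congr 1
  refine integral_congr_ae ?_
  filter_upwards [h.slice] with t hs
  obtain ⟨hu, C, hC⟩ := hs
  have hθ2 := memLp_bdd (meas_slice h.meas_θ t) hC
  have hθi := hθ2.l1
  have hθu : ∀ i, Integrable (fun x => θ t x * u t x i) vol := fun i => hθ2.integrable_mul (hu i)
  simp_rw [(fun x =>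
      deriv_mul_const ((contDiff_infty_iff_deriv.1 hχ).1 t) _), pd_const_mul, pd_fser_single]
  have e1 : ∀ x, θ t x * (deriv χ t * fser (single k z) x +
      ∑ i, u t x i * (χ t * fser (single k (2 * π * I * (k i) * z)) x)) =
      deriv χ t * (θ t x * fser (single k z) x) + ∑ i, χ t * ((θ t x * u t x i) *
        fser (single k (2 * π * I * (k i) * z)) x) := fun x => by
    rw [mul_add, mul_sum]
    congr 1
    · ring
    · exact sum_congr rfl fun i _ => by ring
  simp_rw [e1]
  have hI := fun (w : ℂ) i => integrable_fser_mul (hθu i) (rapid_single k w).summable_norm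
  rw [integral_add ((integrable_fser_mul hθi (rapid_single k z).summable_norm).const_mul _)
    (integrable_finsetSum _ fun i _ => (hI _ i).const_mul _),
    integral_finsetSum _ fun i _ => (hI _ i).const_mul _]
  simp_rw [integral_const_mul]
  rw [integral_mul_fser_single hθi]
  simp_rw [fun i w => integral_mul_fser_single (hθu i) k w]
  rw [transForce]
  simp only [sum_univ_two, map_add, map_mul, map_neg, conj_ofReal, conj_I,
    map_ofNat, map_intCast, ← re_ofReal_mul]
  rw [← add_re, ← add_re]
  congr 1
  ring

/-! ### The Leray projector and the modes of the velocity -/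

/-- The frequency rotated by a right angle. -/
def perp (k : Z2) : Fin 2 → ℝ := ![-(k 1 : ℝ), (k 0 : ℝ)]

/-- `|k|²`. -/
def ksq (k : Z2) : ℝ := ∑ i, (k i : ℝ) ^ 2

/-- The symbol of the Leray projector, for `k ≠ 0`. -/
def leray (k : Z2) (i j : Fin 2) : ℝ := perp k i * perp k j / ksq k

lemma ksq_eq (k : Z2) : ksq k = (k 0 : ℝ) ^ 2 + (k 1 : ℝ) ^ 2 := by simp [ksq]

lemma one_le_ksq (hk : k ≠ 0) : 1 ≤ ksq k := by
  have : (1 : ℤ) ≤ k 0 ^ 2 + k 1 ^ 2 := by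
    by_contra h
    have h0 : k 0 = 0 := by nlinarith [sq_nonneg (k 0), sq_nonneg (k 1)]
    have h1 : k 1 = 0 := by nlinarith [sq_nonneg (k 0), sq_nonneg (k 1)]
    exact hk (funext fun i => by fin_cases i <;> simp [h0, h1])
  rw [ksq_eq]
  exact_mod_cast this

lemma ksq_pos (hk : k ≠ 0) : 0 < ksq k := zero_lt_one.trans_le (one_le_ksq hk)

lemma freq_sq (k : Z2) : freq k ^ 2 = 4 * π ^ 2 * ksq k := by
  rw [freq, mul_pow, sq_sqrt (sum_nonneg fun i _ => sq_nonneg _), ksq]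
  ring

lemma freq_nonneg (k : Z2) : 0 ≤ freq k := by unfold freq; positivity

lemma two_pi_le_freq (hk : k ≠ 0) : 2 * π ≤ freq k := by
  have h := one_le_ksq hk
  have := freq_sq k
  have hp := pi_pos
  nlinarith [freq_nonneg k, sq_nonneg (freq k - 2 * π)]

lemma one_le_freq (hk : k ≠ 0) : 1 ≤ freq k := by
  have := two_pi_le_freq hk
  have := Real.pi_gt_three
  linarith

lemma freq_zero : freq 0 = 0 := by simp [freq]

lemma sum_mul_leray (k : Z2) (i : Fin 2) : ∑ j, (k j : ℝ) * leray k i j = 0 := by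
  simp only [leray, perp]
  fin_cases i <;> simp <;> ring

lemma abs_leray_le (k : Z2) (i j : Fin 2) : |leray k i j| ≤ 1 := by
  by_cases hk : k = 0
  · subst hk; simp [leray, ksq]
  have h := ksq_pos hk
  rw [leray, abs_div, abs_of_pos h, div_le_one h, ksq_eq, abs_le]
  fin_cases i <;> fin_cases j <;> simp [perp] <;> constructor <;>
    nlinarith [sq_nonneg ((k 0 : ℝ) + k 1)]

lemma sum_leray_mul (hk : k ≠ 0) {w : Fin 2 → ℂ} (hw : ∑ j, (k j : ℂ) * w j = 0)
    (i : Fin 2) : ∑ j, (leray k i j : ℂ) * w j = w i := by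
  have h := (ksq_pos hk).ne'
  have h' : ((k 0 : ℂ) ^ 2 + (k 1 : ℂ) ^ 2) ≠ 0 := by
    rw [ksq_eq] at h
    exact_mod_cast h
  simp only [sum_univ_two] at hw ⊢
  simp only [leray, perp, ksq_eq]
  fin_cases i <;> simp <;> field_simp
  · linear_combination (-(k 0 : ℂ)) * hw
  · linear_combination (-(k 1 : ℂ)) * hw

lemma sum_mul_coeff_of_isDivFree (hv : ∀ i, Integrable (v · i) vol)
    (h : IsDivFree v) (k : Z2) : ∑ j, (k j : ℂ) * coeff (v · j) k = 0 := by
  have hz : ∀ z : ℂ, (z * conj (∑ j, (k j : ℂ) * coeff (v · j) k)).re = 0 := by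
    intro z
    have h1 := h _ (isSmooth_fser (rapid_single k (z / (2 * π * I))))
    simp_rw [pd_fser_single] at h1
    rw [integral_finsetSum _ fun i _ => integrable_fser_mul (hv i) (rapid_single _ _).summable_norm]
      at h1
    simp_rw [fun i w => integral_mul_fser_single (hv i) k w] at h1
    rw [← re_sum] at h1
    rw [← h1]
    congr 1
    rw [map_sum, mul_sum]
    refine sum_congr rfl fun i _ => ?_
    have : (π : ℂ) ≠ 0 := by exact_mod_cast pi_ne_zero
    simp only [map_mul, map_intCast]
    field_simp
  exact eq_zero_of_forall_re_mul_conj hz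

/-- The forcing of the `k`-th mode of `v · u` in the momentum equation, where `v ⊥ k`. -/
def momForce (ε : ℝ) (u : VectorField) (θ : ScalarField) (k : Z2) (v : Fin 2 → ℝ) (t : ℝ) :
    ℂ :=
  v 1 * coeff (θ t) k - ε * ∑ i, ∑ j, 2 * π * I * (k j) * v i *
    coeff (fun x => u t x j * u t x i) k

lemma Adm.integrableOn_momForce (h : Adm u θ) (ε : ℝ)
    (k : Z2) (v : Fin 2 → ℝ) (T : ℝ) : IntegrableOn (momForce ε u θ k v) (Ioc 0 T) := by
  unfold momForce
  refine ((h.integrableOn_coeff_θ k T).const_mul _).sub (Integrable.const_mul ?_ _)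
  exact integrable_finsetSum _ fun i _ => integrable_finsetSum _ fun j _ =>
    (h.integrableOn_coeff_uu i j k T).const_mul _

lemma isSolenoidalTest_mode (hχ : ContDiff ℝ ∞ χ) (hχ' : ∃ T, ∀ t, T ≤ t → χ t = 0) {v : Fin 2 → ℝ}
    (hv : ∑ j, (k j : ℝ) * v j = 0) (z : ℂ) :
    IsSolenoidalTest fun t x i => χ t * fser (single k (z * v i)) x := by
  refine ⟨fun i => isTest_mul_fser hχ hχ' (rapid_single _ _), fun t x => ?_⟩
  simp_rw [pd_const_mul, pd_fser_single, fser_single]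
  rw [← mul_sum, ← re_sum, ← sum_mul]
  have : ∑ i, 2 * π * I * (k i) * (z * v i) = 0 := by
    have hv' : ∑ j, (k j : ℂ) * v j = 0 := by exact_mod_cast congrArg Complex.ofReal hv
    simp only [sum_univ_two] at hv' ⊢
    linear_combination (2 * π * I * z) * hv'
  rw [this]
  simp

lemma Adm.integrableOn_modeComb (h : Adm u θ) (k : Z2) (v : Fin 2 → ℝ) (T : ℝ) : IntegrableOn (fun t
    => ∑ i, (v i : ℂ) * coeff (u t · i) k) (Ioc 0 T) :=
  integrable_finsetSum _ fun i _ => (h.integrableOn_coeff_u i k T).const_mul _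

/-- The right-hand side of the equation for a solenoidal combination of modes. -/
def modeForce (α ε : ℝ) (u : VectorField) (θ : ScalarField) (k : Z2) (v : Fin 2 → ℝ) (t : ℝ) : ℂ :=
  -((freq k ^ (2 * α) : ℝ) : ℂ) * (∑ i, (v i : ℂ) * coeff (u t · i) k) + momForce ε u θ k v t

lemma Adm.integrableOn_modeForce (h : Adm u θ) (α ε : ℝ)
    (k : Z2) (v : Fin 2 → ℝ) (T : ℝ) : IntegrableOn (modeForce α ε u θ k v) (Ioc 0 T) :=
  ((h.integrableOn_modeComb k v T).const_mul _).add (h.integrableOn_momForce ε k v T)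

lemma momentum_weak (h : Adm u θ) (hu₀ : ∀ i, Integrable (u₀ · i) vol) (hm : SolvesMomentum α ε u θ
    u₀) {v : Fin 2 → ℝ} (hv : ∑ j, (k j : ℝ) * v j = 0) (hχ : ContDiff ℝ ∞ χ) (hχ' : ∃ T, ∀ t, T ≤ t
    → χ t = 0) : (∫ t in Ioi (0 : ℝ), (((deriv χ t : ℝ) : ℂ) * (ε * ∑ i, (v i : ℂ) * coeff (u t · i)
    k) + χ t * modeForce α ε u θ k v t)) + χ 0 * (ε * ∑ i, (v i : ℂ) * coeff (u₀ · i) k) = 0 := by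
  refine eq_zero_of_forall_re_mul_conj fun z => ?_
  have hw := hm _ (isSolenoidalTest_mode hχ hχ' hv z)
  have hsum := (integral_re_mul_conj ((integrableOn_cutoff_mul (fun T => (h.integrableOn_modeComb k
      v T).const_mul (ε : ℂ))
      ((contDiff_infty_iff_deriv.1 hχ).2.continuous) (deriv_eventually_zero hχ')).add
      (integrableOn_cutoff_mul (h.integrableOn_modeForce α ε k v) hχ.continuous hχ')) z).symm
  have e0 : ε * ∫ x, ∑ i, u₀ x i * (χ 0 * fser (single k (z * v i)) x) ∂vol =
      (z * conj ((χ 0 : ℂ) * (ε * ∑ i, (v i : ℂ) * coeff (u₀ · i) k))).re := by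
    simp_rw [mul_left_comm _ (χ 0)]
    rw [integral_finsetSum _ fun i _ => (integrable_fser_mul (hu₀ i)
      (rapid_single _ _).summable_norm).const_mul _]
    simp_rw [integral_const_mul, fun i w => integral_mul_fser_single (hu₀ i) k w, ← re_ofReal_mul]
    rw [← re_sum, ← re_ofReal_mul]
    congr 1
    simp only [sum_univ_two, map_add, map_mul, conj_ofReal]
    ring
  rw [e0] at hw
  rw [map_add, mul_add, add_re]
  simp only [Pi.add_apply] at hsum
  rw [hsum]
  refine Eq.trans ?_ hw
  congr 1
  refine integral_congr_ae ?_
  filter_upwards [h.slice] with t hs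
  obtain ⟨hu, C, hC⟩ := hs
  have hθi := (memLp_bdd (meas_slice h.meas_θ t) hC).l1
  have hui : ∀ i, Integrable (u t · i) vol := fun i => (hu i).l1
  have huu : ∀ i j, Integrable (fun x => u t x j * u t x i) vol := fun i j =>
    (hu j).integrable_mul (hu i)
  have hd : ∀ w x, deriv (fun s => χ s * fser (single k w) x) t =
      deriv χ t * fser (single k w) x := fun w x =>
    deriv_mul_const ((contDiff_infty_iff_deriv.1 hχ).1 t) _
  simp_rw [hd, pd_const_mul, pd_fser_single, fracLaplacian_fser_single]
  have e1 : ∀ x, ε * (∑ i, u t x i * (deriv χ t * fser (single k (z * v i)) x) +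
      ∑ i, ∑ j, u t x j * u t x i * (χ t * fser (single k (2 * π * I * (k j) * (z * v i))) x)) -
      ∑ i, u t x i * (freq k ^ (2 * α) * (χ t * fser (single k (z * v i)) x)) +
      θ t x * (χ t * fser (single k (z * v 1)) x) =
      ((∑ i, (ε * deriv χ t - freq k ^ (2 * α) * χ t) * (u t x i * fser (single k (z * v i)) x)) +
      ∑ i, ∑ j, (ε * χ t) * ((u t x j * u t x i) *
        fser (single k (2 * π * I * (k j) * (z * v i))) x)) +
      χ t * (θ t x * fser (single k (z * v 1)) x) := fun x => by
    simp only [sum_univ_two]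
    ring
  simp_rw [e1]
  have hI := fun (w : ℂ) i => integrable_fser_mul (hui i) (rapid_single k w).summable_norm
  have hII := fun (w : ℂ) i j => integrable_fser_mul (huu i j) (rapid_single k w).summable_norm
  have i1 : Integrable (fun x => ∑ i, (ε * deriv χ t - freq k ^ (2 * α) * χ t) *
      (u t x i * fser (single k (z * v i)) x)) vol :=
    integrable_finsetSum _ fun i _ => (hI _ i).const_mul _
  have i2 : Integrable (fun x => ∑ i, ∑ j, (ε * χ t) * ((u t x j * u t x i) *
        fser (single k (2 * π * I * (k j) * (z * v i))) x)) vol :=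
    integrable_finsetSum _ fun i _ => integrable_finsetSum _ fun j _ => (hII _ i j).const_mul _
  have i12 : Integrable (fun x => (∑ i, (ε * deriv χ t - freq k ^ (2 * α) * χ t) *
      (u t x i * fser (single k (z * v i)) x)) + ∑ i, ∑ j, (ε * χ t) * ((u t x j * u t x i) *
        fser (single k (2 * π * I * (k j) * (z * v i))) x)) vol := i1.add i2
  rw [integral_add i12 ((integrable_fser_mul hθi (rapid_single k _).summable_norm).const_mul _),
    integral_add i1 i2,
    integral_finsetSum _ fun i _ => (hI _ i).const_mul _,
    integral_finsetSum _ fun i _ => integrable_finsetSum _ fun j _ => (hII _ i j).const_mul _]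
  simp_rw [fun i => integral_finsetSum (μ := vol) Finset.univ fun j (_ : j ∈ Finset.univ) =>
    (hII (2 * π * I * (k j) * (z * v i)) i j).const_mul (ε * χ t)]
  simp_rw [integral_const_mul]
  rw [integral_mul_fser_single hθi]
  simp_rw [fun i w => integral_mul_fser_single (hui i) k w,
    fun i j w => integral_mul_fser_single (huu i j) k w]
  rw [modeForce, momForce]
  simp only [sum_univ_two, map_add, map_sub, map_mul, map_neg, conj_ofReal,
    conj_I, map_ofNat, map_intCast, ← re_ofReal_mul]
  simp only [← add_re]
  congr 1
  push_cast
  ring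

lemma coeff_momentum_comb (h : Adm u θ) (hu₀ : ∀ i, Integrable (u₀ · i) vol) (hm : SolvesMomentum α
    ε u θ u₀) {v : Fin 2 → ℝ} (hv : ∑ j, (k j : ℝ) * v j = 0) : ∀ᵐ t ∂ℓ, ε * ∑ i, (v i : ℂ) * coeff
    (u t · i) k = ε * (∑ i, (v i : ℂ) * coeff (u₀ · i) k) + ∫ s in 0..t, modeForce α ε u θ k v s :=
  ae_eq_primitive_of_weak (fun T => (h.integrableOn_modeComb k v T).const_mul _)
    (h.integrableOn_modeForce α ε k v) fun _ => momentum_weak h hu₀ hm hv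

lemma coeff_stokes_comb (h : Adm u θ) (hm : SolvesStokes α u θ) {v : Fin 2 → ℝ} (hv : ∑ j, (k j : ℝ)
    * v j = 0) : ∀ᵐ t ∂ℓ, ((freq k ^ (2 * α) : ℝ) : ℂ) * (∑ i, (v i : ℂ) * coeff (u t · i) k) = v 1
    * coeff (θ t) k := by
  have hm' : SolvesMomentum α 0 u θ 0 := fun φ hφ => by
    simpa [sub_eq_add_neg, add_comm] using hm φ hφ
  refine (ae_eq_zero_of_cutoff (h.integrableOn_modeForce α 0 k v) fun g hg B _ hB => by
    simpa using momentum_weak h (by simp) hm' hv hg ⟨B, hB⟩).mono fun t ht => ?_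
  rw [modeForce, momForce, ofReal_zero, zero_mul, sub_zero] at ht
  linear_combination -ht

/-! ### Hermite-Gauss kernels -/

/-- The polynomial factor of the `n`-th Hermite-Gauss function. -/
def hermPoly : ℕ → Polynomial ℝ
  | 0 => 1
  | n + 1 => Polynomial.X * hermPoly n - Polynomial.C (1 / (2 * π)) *
      Polynomial.derivative (hermPoly n)

/-- The function `(-1/2π)ⁿ ∂ⁿ exp(-π x²)`. -/
def hg (n : ℕ) (x : ℝ) : ℝ := (hermPoly n).eval x * exp (-π * x ^ 2)

lemma hasDerivAt_hg (n : ℕ) (x : ℝ) : HasDerivAt (hg n) (-(2 * π) * hg (n + 1) x) x := by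
  have h1 : HasDerivAt (fun x : ℝ => exp (-π * x ^ 2)) (exp (-π * x ^ 2) * (-π * (2 * x))) x := by
    have := ((hasDerivAt_pow 2 x).const_mul (-π)).exp
    simpa using this
  refine (((hermPoly n).hasDerivAt x).mul h1).congr_deriv ?_
  have := pi_ne_zero
  simp only [hg, hermPoly, Polynomial.eval_sub, Polynomial.eval_mul, Polynomial.eval_X,
    Polynomial.eval_C]
  field_simp
  ring

lemma continuous_hg (n : ℕ) : Continuous (hg n) :=
  continuous_iff_continuousAt.2 fun x => (hasDerivAt_hg n x).continuousAt

lemma integrable_pow_mul_gaussian (n : ℕ) : Integrable fun x : ℝ => x ^ n * exp (-π * x ^ 2) := by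
  have := integrable_rpow_mul_exp_neg_mul_sq pi_pos (s := n)
    (by have : (0 : ℝ) ≤ n := by positivity
        linarith)
  simpa using this

lemma integrable_poly_mul_gaussian (p : Polynomial ℝ) :
    Integrable fun x : ℝ => p.eval x * exp (-π * x ^ 2) := by
  simp_rw [Polynomial.eval_eq_sum_range, sum_mul]
  refine integrable_finsetSum _ fun i _ => ?_
  simp_rw [mul_assoc]
  exact (integrable_pow_mul_gaussian i).const_mul _

lemma integrable_hg (n : ℕ) : Integrable (hg n) := integrable_poly_mul_gaussian _

lemma integrable_id_mul_hg (n : ℕ) : Integrable fun x => x * hg n x := by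
  refine (integrable_poly_mul_gaussian (Polynomial.X * hermPoly n)).congr (ae_of_all _ fun x => ?_)
  simp only [hg, Polynomial.eval_mul, Polynomial.eval_X]
  ring

lemma integral_exp_mul_hg (n : ℕ) (ξ : ℝ) : ∫ x : ℝ, Complex.exp (-(2 * π * I * (ξ * x))) * (hg n x
    : ℂ) = (-I * ξ) ^ n * (exp (-π * ξ ^ 2) : ℂ) := by
  have key : ∀ n, FourierTransform.fourier (fun x : ℝ => (hg n x : ℂ)) ξ =
      (-I * ξ) ^ n * (exp (-π * ξ ^ 2) : ℂ) := by
    intro n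
    induction n with
    | zero =>
      have h := congrFun (fourier_gaussian_pi (b := 1) (by simp)) ξ
      simp only [div_one, mul_one] at h
      rw [show (fun x : ℝ => (hg 0 x : ℂ)) = fun x : ℝ => Complex.exp (-π * x ^ 2) by
        ext x; simp [hg, hermPoly]]
      rw [h]
      simp
    | succ n ih =>
      have hd : ∀ x, HasDerivAt (fun x : ℝ => (hg n x : ℂ))
          (((-(2 * π) * hg (n + 1) x : ℝ)) : ℂ) x := fun x => (hasDerivAt_hg n x).ofReal_comp
      have hd' : deriv (fun x : ℝ => (hg n x : ℂ)) = fun x : ℝ => (-(2 * π) : ℂ) • (hg (n + 1) x :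
          ℂ) := by
        ext x
        rw [(hd x).deriv]
        push_cast
        simp
      have h := congrFun (Real.fourier_deriv (f := fun x : ℝ => (hg n x : ℂ)) (integrable_hg
          n).ofReal
        (fun x => (hd x).differentiableAt) (by
          rw [hd']
          exact (integrable_hg (n + 1)).ofReal.const_mul _)) ξ
      rw [hd'] at h
      rw [show (fun x : ℝ => (-(2 * π) : ℂ) • (hg (n + 1) x : ℂ)) =
        (-(2 * π) : ℂ) • (fun x : ℝ => (hg (n + 1) x : ℂ)) from rfl] at h
      have h2 : FourierTransform.fourier ((-(2 * π) : ℂ) • (fun x : ℝ => (hg (n + 1) x : ℂ))) ξ =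
          (-(2 * π) : ℂ) * FourierTransform.fourier (fun x : ℝ => (hg (n + 1) x : ℂ)) ξ := by
        simp_rw [Real.fourier_real_eq_integral_exp_smul, Pi.smul_apply, smul_eq_mul]
        rw [← integral_const_mul]
        congr 1
        ext x
        ring
      rw [h2, ih, smul_eq_mul] at h
      have h3 : (2 * π : ℂ) ≠ 0 := by simp [(by exact_mod_cast pi_ne_zero)]
      refine mul_left_cancel₀ (neg_ne_zero.2 h3) (h.trans ?_)
      ring
  rw [← key n, Real.fourier_real_eq_integral_exp_smul]
  congr 1
  ext x
  rw [smul_eq_mul]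
  congr 2
  push_cast
  ring

lemma integral_hg_succ (n : ℕ) : ∫ x, hg (n + 1) x = 0 := by
  have h := integral_exp_mul_hg (n + 1) 0
  simp only [ofReal_zero, zero_mul, mul_zero, neg_zero, exp_zero, one_mul,
    ne_eq, Nat.add_eq_zero_iff, one_ne_zero, and_false, not_false_eq_true, zero_pow] at h
  rw [integral_complex_ofReal] at h
  exact_mod_cast h

lemma integral_hg_zero : ∫ x, hg 0 x = 1 := by
  have h := integral_exp_mul_hg 0 0
  simp only [ofReal_zero, zero_mul, mul_zero, neg_zero, exp_zero, one_mul, pow_zero] at h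
  rw [integral_complex_ofReal] at h
  simpa using h

lemma hg_zero_nonneg (x : ℝ) : 0 ≤ hg 0 x := by simp [hg, hermPoly, Real.exp_nonneg]

lemma integral_abs_hg_translate_sub (n : ℕ) (a : ℝ) :
    ∫ x, |hg n (x + a) - hg n x| ≤ |a| * (2 * π * ∫ x, |hg (n + 1) x|) := by
  have hc : Continuous fun x => -(2 * π) * hg (n + 1) x := continuous_const.mul (continuous_hg _)
  have e : ∀ x, hg n (x + a) - hg n x =
      ∫ s in (0 : ℝ)..1, a * (-(2 * π) * hg (n + 1) (x + s * a)) := by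
    intro x
    have hd : ∀ s : ℝ, HasDerivAt (fun s : ℝ => hg n (x + s * a))
        (a * (-(2 * π) * hg (n + 1) (x + s * a))) s := by
      intro s
      have h1 : HasDerivAt (fun s : ℝ => x + s * a) a s := by
        simpa using ((hasDerivAt_id s).mul_const a).const_add x
      have h3 := (hasDerivAt_hg n _).comp s h1
      rw [mul_comm a]
      exact h3
    rw [integral_eq_sub_of_hasDerivAt (fun s _ => hd s) (Continuous.intervalIntegrable (by
        exact continuous_const.mul (hc.comp (by fun_prop))) _ _)]
    simp
  have hI : Integrable (fun p : ℝ × ℝ => a * (-(2 * π) * hg (n + 1) (p.1 + p.2 * a)))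
      ((volume : Measure ℝ).prod (volume.restrict (Ioc (0 : ℝ) 1))) := by
    have hcc : Continuous fun p : ℝ × ℝ => a * (-(2 * π) * hg (n + 1) (p.1 + p.2 * a)) :=
      continuous_const.mul (hc.comp (by fun_prop : Continuous fun p : ℝ × ℝ => p.1 + p.2 * a))
    rw [integrable_prod_iff' hcc.aestronglyMeasurable]
    constructor
    · exact ae_of_all _ fun s => (((integrable_hg (n + 1)).comp_add_right (s * a)).const_mul
          _).const_mul _
    · have : ∀ s : ℝ, ∫ x, ‖a * (-(2 * π) * hg (n + 1) (x + s * a))‖ =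
          ∫ x, ‖a * (-(2 * π) * hg (n + 1) x)‖ := fun s =>
        integral_add_right_eq_self (fun x => ‖a * (-(2 * π) * hg (n + 1) x)‖) (s * a)
      simp_rw [this]
      exact integrable_const _
  have h1 : ∫ x, |hg n (x + a) - hg n x| ≤
      ∫ x, ∫ s in Ioc (0 : ℝ) 1, |a * (-(2 * π) * hg (n + 1) (x + s * a))| := by
    refine integral_mono (((integrable_hg n).comp_add_right a).sub (integrable_hg n)).abs
      hI.norm.integral_prod_left fun x => ?_
    simp only
    rw [e x, integral_of_le zero_le_one]
    exact abs_integral_le_integral_abs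
  refine h1.trans (le_of_eq ?_)
  rw [integral_integral_swap hI.norm]
  have : ∀ s : ℝ, ∫ x, |a * (-(2 * π) * hg (n + 1) (x + s * a))| =
      |a| * (2 * π * ∫ x, |hg (n + 1) x|) := fun s => by
    rw [integral_add_right_eq_self (fun x => |a * (-(2 * π) * hg (n + 1) x)|) (s * a)]
    simp_rw [abs_mul, abs_neg]
    rw [integral_const_mul, integral_const_mul, abs_of_pos Real.two_pi_pos]
  simp_rw [this]
  simp

/-! ### Convolution of functions on the torus with kernels on the plane -/

/-- The point `s z` of the torus. -/
def sc (s : ℝ) (z : ℝ × ℝ) : T2 := ![((s * z.1 : ℝ) : 𝕊), ((s * z.2 : ℝ) : 𝕊)]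

lemma continuous_sc (s : ℝ) : Continuous (sc s) := by
  refine continuous_pi fun i => ?_
  fin_cases i
  · exact (AddCircle.continuous_mk' 1).comp (by fun_prop : Continuous fun z : ℝ × ℝ => s * z.1)
  · exact (AddCircle.continuous_mk' 1).comp (by fun_prop : Continuous fun z : ℝ × ℝ => s * z.2)

lemma continuous_sc_uncurry : Continuous fun p : ℝ × (ℝ × ℝ) => sc p.1 p.2 := by
  refine continuous_pi fun i => ?_
  fin_cases i
  · exact (AddCircle.continuous_mk' 1).comp
      (by fun_prop : Continuous fun p : ℝ × (ℝ × ℝ) => p.1 * p.2.1)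
  · exact (AddCircle.continuous_mk' 1).comp
      (by fun_prop : Continuous fun p : ℝ × (ℝ × ℝ) => p.1 * p.2.2)

lemma mFourier_sc (k : Z2) (s : ℝ) (z : ℝ × ℝ) : mFourier k (sc s z) = Complex.exp (2 * π * I * ((s
    * k 0 : ℝ) * z.1)) * Complex.exp (2 * π * I * ((s * k 1 : ℝ) * z.2)) := by
  have : sc s z = fun i => (((![s * z.1, s * z.2] : Fin 2 → ℝ) i : ℝ) : 𝕊) := by
    ext i; fin_cases i <;> rfl
  rw [this, mFourier_coe, ← Complex.exp_add]
  congr 1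
  simp
  ring

lemma dist_sub_sc_le (x : T2) (hs : 0 ≤ s) (z : ℝ × ℝ) :
    dist (x - sc s z) x ≤ s * (|z.1| + |z.2|) := by
  have hc : ∀ a : ℝ, ‖(a : 𝕊)‖ ≤ |a| := fun a => by
    rw [UnitAddCircle.norm_eq]
    exact round_le a 0 |>.trans (by simp)
  refine (dist_pi_le_iff (by positivity)).2 fun i => ?_
  rw [dist_eq_norm, Pi.sub_apply, sub_sub_cancel_left, norm_neg]
  fin_cases i
  · refine (hc _).trans ?_
    rw [abs_mul, abs_of_nonneg hs]
    gcongr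
    simp
  · refine (hc _).trans ?_
    rw [abs_mul, abs_of_nonneg hs]
    gcongr
    simp

/-- The convolution of `f` with the kernel `h` at scale `s`. -/
def conv (h : ℝ × ℝ → ℝ) (s : ℝ) (f : T2 → ℝ) (x : T2) : ℝ := ∫ z, h z * f (x - sc s z)

/-- Product kernels. -/
def hk (m n : ℕ) (z : ℝ × ℝ) : ℝ := hg m z.1 * hg n z.2

lemma integrable_hk (m n : ℕ) : Integrable (hk m n) := (integrable_hg m).mul_prod (integrable_hg n)

lemma continuous_hk (m n : ℕ) : Continuous (hk m n) :=
  ((continuous_hg m).comp continuous_fst).mul ((continuous_hg n).comp continuous_snd)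

lemma integral_hk (m n : ℕ) : ∫ z, hk m n z = (∫ x, hg m x) * ∫ x, hg n x :=
  integral_prod_mul (hg m) (hg n)

lemma integrable_conv_prod {h : ℝ × ℝ → ℝ} (hh : Integrable h) (s : ℝ)
    (hf : Measurable f) (hfi : Integrable f vol) :
    Integrable (fun p : T2 × (ℝ × ℝ) => h p.2 * f (p.1 - sc s p.2)) (vol.prod volume) := by
  have hm : AEStronglyMeasurable (fun p : T2 × (ℝ × ℝ) => h p.2 * f (p.1 - sc s p.2))
      (vol.prod volume) := by
    refine hh.aestronglyMeasurable.comp_snd.mul ?_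
    exact (hf.comp (measurable_fst.sub
      ((continuous_sc s).measurable.comp measurable_snd))).aestronglyMeasurable
  rw [integrable_prod_iff' hm]
  constructor
  · exact ae_of_all _ fun z => (hfi.comp_sub_right (sc s z)).const_mul (h z)
  · have : ∀ z, ∫ x, ‖h z * f (x - sc s z)‖ ∂vol = ‖h z‖ * ∫ x, ‖f x‖ ∂vol := fun z => by
      simp_rw [norm_mul]
      rw [integral_const_mul, integral_sub_right_eq_self (fun x => ‖f x‖) (sc s z)]
    simp_rw [this]
    exact hh.norm.mul_const _

lemma integrable_conv {h : ℝ × ℝ → ℝ} (hh : Integrable h) (s : ℝ)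
    (hf : Measurable f) (hfi : Integrable f vol) : Integrable (conv h s f) vol :=
  (integrable_conv_prod hh s hf hfi).integral_prod_left

lemma coeff_conv {h : ℝ × ℝ → ℝ} (hh : Integrable h) (s : ℝ) (hf : Measurable f)
    (hfi : Integrable f vol) (k : Z2) :
    coeff (conv h s f) k = (∫ z, mFourier (-k) (sc s z) * (h z : ℂ)) * coeff f k := by
  have hI' : Integrable (fun p : T2 × (ℝ × ℝ) => mFourier (-k) p.1 *
      ((h p.2 * f (p.1 - sc s p.2) : ℝ) : ℂ)) (vol.prod volume) := by
    refine
        (integrable_conv_prod hh s hf hfi).ofReal.bdd_mul (c := 1) ?_ (ae_of_all _ fun p =>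
            (norm_mFourier_apply _ _).le)
    exact ((mFourier (-k)).continuous.comp continuous_fst).aestronglyMeasurable
  rw [coeff_eq]
  have e1 : ∀ x, mFourier (-k) x * ((conv h s f x : ℝ) : ℂ) =
      ∫ z, mFourier (-k) x * ((h z * f (x - sc s z) : ℝ) : ℂ) := fun x => by
    rw [integral_const_mul, integral_complex_ofReal, conv]
  simp_rw [e1]
  rw [integral_integral_swap hI', ← integral_mul_const]
  congr 1
  ext z
  have e2 : ∀ x, mFourier (-k) x * ((h z * f (x - sc s z) : ℝ) : ℂ) =
      (h z : ℂ) * (mFourier (-k) x * ((f (x + -sc s z) : ℝ) : ℂ)) := fun x => by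
    push_cast
    rw [sub_eq_add_neg]
    ring
  simp_rw [e2]
  rw [integral_const_mul, ← coeff_eq (fun x => f (x + -sc s z)), coeff_translate]
  have : mFourier k (-sc s z) = mFourier (-k) (sc s z) := by simp [mFourier, fourier_apply]
  rw [this]
  ring

/-- The Gaussian multiplier. -/
def gmul (s : ℝ) (k : Z2) : ℝ := exp (-π * s ^ 2 * ksq k)

lemma coeff_conv_hk (m n : ℕ) (s : ℝ) (hf : Measurable f) (hfi : Integrable f vol) (k : Z2) : coeff
    (conv (hk m n) s f) k = (-I * (s * k 0)) ^ m * (-I * (s * k 1)) ^ n * gmul s k * coeff f k := by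
  rw [coeff_conv (integrable_hk m n) s hf hfi]
  congr 1
  have e : ∀ z : ℝ × ℝ, mFourier (-k) (sc s z) * (hk m n z : ℂ) =
      (Complex.exp (-(2 * π * I * ((s * k 0 : ℝ) * z.1))) * (hg m z.1 : ℂ)) *
      (Complex.exp (-(2 * π * I * ((s * k 1 : ℝ) * z.2))) * (hg n z.2 : ℂ)) := by
    intro z
    rw [mFourier_sc, hk]
    simp only [Pi.neg_apply, Int.cast_neg]
    push_cast
    rw [show 2 * (π : ℂ) * I * (s * -(k 0 : ℂ) * z.1) = -(2 * π * I * (s * k 0 * z.1)) by ring,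
      show 2 * (π : ℂ) * I * (s * -(k 1 : ℂ) * z.2) = -(2 * π * I * (s * k 1 * z.2)) by ring]
    ring
  simp_rw [e]
  have := integral_prod_mul (μ := (volume : Measure ℝ)) (ν := (volume : Measure ℝ))
    (fun x : ℝ => Complex.exp (-(2 * π * I * ((s * k 0 : ℝ) * x))) * (hg m x : ℂ))
    (fun x : ℝ => Complex.exp (-(2 * π * I * ((s * k 1 : ℝ) * x))) * (hg n x : ℂ))
  rw [Measure.volume_eq_prod, this, integral_exp_mul_hg, integral_exp_mul_hg, gmul, ksq_eq,
    show -π * s ^ 2 * ((k 0 : ℝ) ^ 2 + (k 1 : ℝ) ^ 2) =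
      -π * (s * k 0) ^ 2 + -π * (s * k 1) ^ 2 by ring, exp_add]
  push_cast
  ring

lemma abs_conv_le {h : ℝ × ℝ → ℝ} (hh : Integrable h) (s : ℝ)
    (hC : ∀ x, |f x| ≤ C) (x : T2) : |conv h s f x| ≤ (∫ z, |h z|) * C := by
  unfold conv
  rw [← integral_mul_const]
  refine (abs_integral_le_integral_abs).trans ?_
  refine integral_mono_of_nonneg (ae_of_all _ fun z => abs_nonneg _) (hh.abs.mul_const C)
    (ae_of_all _ fun z => ?_)
  simp only [abs_mul]
  gcongr
  exact hC _

/-! ### Continuity of translations -/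

lemma integral_abs_le_sqrt (hf : MemLp f 2 vol) : ∫ x, |f x| ∂vol ≤ √(∫ x, f x ^ 2 ∂vol) := by
  have hm : MemLp (fun x => |f x|) 2 vol := hf.abs
  have hv := ProbabilityTheory.variance_nonneg (fun x => |f x|) vol
  rw [ProbabilityTheory.variance_eq_sub hm] at hv
  refine Real.le_sqrt_of_sq_le ?_
  simp only [Pi.pow_apply, sq_abs] at hv
  linarith

lemma tendsto_integral_abs_translate_sub (hf : MemLp f 2 vol) :
    Tendsto (fun h : T2 => ∫ x, |f (x - h) - f x| ∂vol) (𝓝 0) (𝓝 0) := by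
  have hm : ∀ h : T2, MemLp (fun x => f (x - h) - f x) 2 vol := fun h =>
    (hf.comp_measurePreserving (measurePreserving_sub_right vol h)).sub hf
  have hsq : Tendsto (fun h : T2 => ∑' k, ‖(mFourier k (-h) - 1) * coeff f k‖ ^ 2) (𝓝 0)
      (𝓝 (∑' _ : Z2, 0)) := by
    refine tendsto_tsum_of_dominated_convergence (bound := fun k => 4 * ‖coeff f k‖ ^ 2)
      ((hasSum_sq_coeff hf).summable.mul_left 4) (fun k => ?_) (Eventually.of_forall fun h k => ?_)
    · have : Continuous fun h : T2 => ‖(mFourier k (-h) - 1) * coeff f k‖ ^ 2 :=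
        ((((mFourier k).continuous.comp continuous_neg).sub continuous_const).mul
          continuous_const).norm.pow 2
      simpa [mFourier] using (this.tendsto 0)
    · rw [norm_of_nonneg (by positivity), norm_mul, mul_pow]
      gcongr
      have : ‖mFourier k (-h) - 1‖ ≤ 2 := by
        refine (norm_sub_le _ _).trans ?_
        rw [norm_mFourier_apply, norm_one]
        norm_num
      nlinarith [norm_nonneg (mFourier k (-h) - 1)]
  rw [tsum_zero] at hsq
  have e : ∀ h, ∑' k, ‖(mFourier k (-h) - 1) * coeff f k‖ ^ 2 = ∫ x, (f (x - h) - f x) ^ 2 ∂vol :=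
      by
    intro h
    rw [← (hasSum_sq_coeff (hm h)).tsum_eq]
    congr 1
    ext k
    have hi := hf.l1
    rw [coeff_sub (hi.comp_sub_right h) hi]
    simp_rw [sub_eq_add_neg _ h]
    rw [coeff_translate, sub_mul, one_mul]
  simp_rw [e] at hsq
  have hsqrt := (continuous_sqrt.tendsto 0).comp hsq
  rw [Real.sqrt_zero] at hsqrt
  refine squeeze_zero (fun h => integral_nonneg fun x => abs_nonneg _) (fun h => ?_) hsqrt
  exact integral_abs_le_sqrt (hm h)

/-! ### Smooth functions on the torus along lines -/

lemma exists_lift (x : T2) : ∃ y : Fin 2 → ℝ, (fun i => (y i : 𝕊)) = x := by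
  choose y hy using fun i => QuotientAddGroup.mk_surjective (x i)
  exact ⟨y, funext hy⟩

lemma lift_add_single (y : Fin 2 → ℝ) (i : Fin 2) (s : ℝ) : (fun j => (y j : 𝕊)) + single i (s : 𝕊)
    = fun j => (((y + s • (single i (1 : ℝ) : Fin 2 → ℝ)) j : ℝ) : 𝕊) := by
  ext j
  by_cases h : j = i
  · subst h; simp
  · simp [h]

lemma IsSmooth.contDiff_line (hf : IsSmooth f) (x : T2) (i : Fin 2) :
    ContDiff ℝ ∞ fun s : ℝ => f (x + single i (s : 𝕊)) := by
  obtain ⟨y, rfl⟩ := exists_lift x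
  simp_rw [lift_add_single]
  exact hf.comp (contDiff_const.add (contDiff_id.smul contDiff_const))

lemma IsSmooth.hasDerivAt (hf : IsSmooth f) (x : T2) (i : Fin 2) (s : ℝ) : HasDerivAt (fun s : ℝ =>
    f (x + single i (s : 𝕊))) (pd i f (x + single i (s : 𝕊))) s := by
  refine ((((hf.contDiff_line x i).differentiable (by simp)) s).hasDerivAt).congr_deriv ?_
  unfold pd
  have : (fun r : ℝ => f (x + single i (s : 𝕊) + single i (r : 𝕊))) =
      fun r : ℝ => (fun s : ℝ => f (x + single i (s : 𝕊))) (s + r) := by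
    ext r
    simp only
    rw [add_assoc, ← Pi.single_add, AddCircle.coe_add]
  have h0 := deriv_comp_const_add (fun s : ℝ => f (x + single i (s : 𝕊))) s (0 : ℝ)
  rw [add_zero] at h0
  rw [this]
  exact h0.symm

lemma IsSmooth.hasDerivAt_zero (hf : IsSmooth f) (x : T2) (i : Fin 2) :
    HasDerivAt (fun s : ℝ => f (x + single i (s : 𝕊))) (pd i f x) 0 := by
  simpa using hf.hasDerivAt x i 0

lemma IsSmooth.pow (hf : IsSmooth f) (p : ℕ) : IsSmooth fun x => f x ^ p := ContDiff.pow hf p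

lemma pd_pow (hf : IsSmooth f) (p : ℕ) (i : Fin 2) (x : T2) :
    pd i (fun y => f y ^ p) x = p * f x ^ (p - 1) * pd i f x := by
  have := (hf.hasDerivAt_zero x i).fun_pow p
  simpa [pd] using this.deriv

/-! ### Identification with trigonometric series -/

lemma memLp_cont (hf : Continuous f) : MemLp f 2 vol := by
  obtain ⟨C, hC⟩ := isCompact_univ.exists_bound_of_continuousOn hf.continuousOn
  exact MemLp.of_bound hf.aestronglyMeasurable C (ae_of_all _ fun x => hC x (mem_univ x))

lemma ae_eq_fser (hf : MemLp f 2 vol) (hs : Summable fun k => ‖coeff f k‖) :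
    f =ᵐ[vol] fser (coeff f) := by
  have hF := memLp_cont (continuous_fser hs)
  have key : ∀ g : T2 → ℝ, MemLp g 2 vol → ∫ x, g x * fser (coeff f) x ∂vol = ∫ x, g x * f x ∂vol :=
      by
    intro g hg
    have h2 := hasSum_re (hasSum_coeff_mul_conj hf hg)
    rw [ofReal_re] at h2
    rw [(hasSum_integral_mul_fser (hg.l1) hs).unique h2]
    simp_rw [mul_comm]
  have hd := hf.sub hF
  have h3 : ∫ x, (f x - fser (coeff f) x) ^ 2 ∂vol = 0 := by
    have := key _ hd
    simp only [Pi.sub_apply] at this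
    have e : ∀ x, (f x - fser (coeff f) x) ^ 2 = (f x - fser (coeff f) x) * f x -
        (f x - fser (coeff f) x) * fser (coeff f) x := fun x => by ring
    simp_rw [e]
    have i1 : Integrable (fun x => (f x - fser (coeff f) x) * f x) vol := hd.integrable_mul hf
    have i2 : Integrable (fun x => (f x - fser (coeff f) x) * fser (coeff f) x) vol :=
      hd.integrable_mul hF
    rw [integral_sub i1 i2, this, sub_self]
  have h4 := (integral_eq_zero_iff_of_nonneg (fun x => sq_nonneg _) hd.integrable_sq).1 h3
  filter_upwards [h4] with x hx
  have : f x - fser (coeff f) x = 0 := by simpa using hx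
  linarith

lemma gmul_pos (s : ℝ) (k : Z2) : 0 < gmul s k := exp_pos _

lemma norm_sq_le_ksq (k : Z2) : ‖k‖ ^ 2 ≤ ksq k := by
  have h : ‖k‖ ≤ √(ksq k) := by
    refine (pi_norm_le_iff_of_nonneg (sqrt_nonneg _)).2 fun i => ?_
    refine Real.le_sqrt_of_sq_le ?_
    rw [Int.norm_eq_abs, sq_abs, ksq_eq]
    fin_cases i <;> simp <;> positivity
  calc ‖k‖ ^ 2 ≤ √(ksq k) ^ 2 := by gcongr
    _ = ksq k := sq_sqrt (sum_nonneg fun i _ => sq_nonneg _)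

lemma summable_norm_rpow_neg {p : ℝ} (hp : 2 < p) : Summable fun k : Z2 => ‖k‖ ^ (-p) :=
  EisensteinSeries.summable_one_div_norm_rpow hp

lemma summable_pow_mul_gmul (hs : 0 < s) (n : ℕ) : Summable fun k : Z2 => ‖k‖ ^ n * gmul s k := by
  have hb : 0 < π * s ^ 2 := by positivity
  obtain ⟨N, hN⟩ : ∃ N : ℝ, ∀ r : ℝ, 0 ≤ r → r ^ (n + 3) * exp (-(π * s ^ 2) * r ^ 2) ≤ N := by
    have ht : (fun r : ℝ => r ^ (n + 3) * exp (-(π * s ^ 2) * r ^ 2)) ⇝ 0 := by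
      have := Real.tendsto_pow_mul_exp_neg_atTop_nhds_zero (n + 3)
      have h2 := exp_neg_mul_sq_isLittleO_exp_neg hb
      exact ((Asymptotics.isBigO_refl _ _).mul_isLittleO h2).trans_tendsto this
    have hcont : Continuous fun r : ℝ => r ^ (n + 3) * exp (-(π * s ^ 2) * r ^ 2) := by fun_prop
    have hev := ht.eventually (gt_mem_nhds (zero_lt_one))
    obtain ⟨R, hR⟩ := eventually_atTop.1 hev
    obtain ⟨M, hM⟩ := isCompact_Icc.exists_bound_of_continuousOn (s := Icc 0 R) hcont.continuousOn
    refine ⟨max M 1, fun r hr => ?_⟩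
    rcases le_or_gt r R with h | h
    · exact (le_abs_self _).trans ((hM r ⟨hr, h⟩).trans (le_max_left _ _))
    · exact (hR r h.le).le.trans (le_max_right _ _)
  refine Summable.of_norm_bounded_eventually (g := fun k : Z2 => N * ‖k‖ ^ (-(3 : ℝ)))
    ((summable_norm_rpow_neg (by norm_num)).mul_left N) ?_
  filter_upwards [(Set.finite_singleton (0 : Z2)).compl_mem_cofinite] with k hk
  have hk' : k ≠ 0 := hk
  have hkn : 0 < ‖k‖ := norm_pos_iff.2 hk'
  rw [norm_of_nonneg (mul_nonneg (by positivity) (gmul_pos s k).le),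
    rpow_neg hkn.le, show (3 : ℝ) = ((3 : ℕ) : ℝ) by norm_num, Real.rpow_natCast,
    ← div_eq_mul_inv, le_div_iff₀ (by positivity)]
  calc ‖k‖ ^ n * gmul s k * ‖k‖ ^ 3 = ‖k‖ ^ (n + 3) * gmul s k := by ring
    _ ≤ ‖k‖ ^ (n + 3) * exp (-(π * s ^ 2) * ‖k‖ ^ 2) := by
      gcongr
      unfold gmul
      refine Real.exp_le_exp.2 ?_
      have := norm_sq_le_ksq k
      nlinarith
    _ ≤ N := hN _ hkn.le

lemma rapid_gmul_mul (hs : 0 < s) (hc : ∀ k, ‖c k‖ ≤ B) : Rapid fun k => (gmul s k : ℂ) * c k := by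
  intro n
  refine Summable.of_nonneg_of_le (fun k => by positivity) (fun k => ?_)
    ((summable_pow_mul_gmul hs n).mul_right B)
  rw [norm_mul, norm_real, norm_of_nonneg (gmul_pos s k).le, ← mul_assoc]
  have := (gmul_pos s k).le
  gcongr
  exact hc k

/-! ### The commutator estimate -/

/-- The kernel of `-(s/2π) ∂ₐ` applied to the Gaussian. -/
def gradK (a : Fin 2) : ℝ × ℝ → ℝ := if a = 0 then hk 1 0 else hk 0 1

lemma integrable_gradK (a : Fin 2) : Integrable (gradK a) := by
  fin_cases a
  · exact integrable_hk 1 0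
  · exact integrable_hk 0 1

lemma continuous_gradK (a : Fin 2) : Continuous (gradK a) := by
  fin_cases a
  · exact continuous_hk 1 0
  · exact continuous_hk 0 1

lemma integral_gradK (a : Fin 2) : ∫ z, gradK a z = 0 := by
  fin_cases a
  · exact (integral_hk 1 0).trans (by rw [integral_hg_succ, zero_mul])
  · exact (integral_hk 0 1).trans (by rw [integral_hg_succ, mul_zero])

lemma coeff_conv_gradK (a : Fin 2) (s : ℝ) (hf : Measurable f) (hfi : Integrable f vol) (k : Z2) :
    coeff (conv (gradK a) s f) k = -I * (s * k a) * gmul s k * coeff f k := by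
  fin_cases a
  · exact (coeff_conv_hk 1 0 s hf hfi k).trans (by simp)
  · exact (coeff_conv_hk 0 1 s hf hfi k).trans (by simp)

lemma integrable_abs_hk_mul (m n : ℕ) : Integrable fun z => |hk m n z| * (|z.1| + |z.2|) := by
  refine (((integrable_id_mul_hg m).abs.mul_prod (integrable_hg n).abs).add
      ((integrable_hg m).abs.mul_prod (integrable_id_mul_hg n).abs)).congr (ae_of_all _ fun z => ?_)
  simp only [Pi.add_apply, hk, abs_mul]
  ring

lemma integrable_abs_gradK_mul (a : Fin 2) : Integrable fun z => |gradK a z| * (|z.1| + |z.2|) := by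
  fin_cases a
  · exact integrable_abs_hk_mul 1 0
  · exact integrable_abs_hk_mul 0 1

/-- The modulus of continuity that controls the commutator at scale `s`. -/
def commMod (s : ℝ) (f : T2 → ℝ) : ℝ :=
  ∑ a, ∫ z, |gradK a z| * (|z.1| + |z.2|) * ∫ x, |f (x - sc s z) - f x| ∂vol

lemma conv_congr_ae (h : ℝ × ℝ → ℝ) (s : ℝ) (hf : Measurable f) (hg : Measurable g)
    (hfg : f =ᵐ[vol] g) : conv h s f =ᵐ[vol] conv h s g := by
  have h1 : ∀ᵐ x ∂vol, ∀ᵐ z : ℝ × ℝ, f (x - sc s z) = g (x - sc s z) := by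
    have hm : MeasurableSet {p : T2 × (ℝ × ℝ) | f (p.1 - sc s p.2) = g (p.1 - sc s p.2)} := by
      have hp : Measurable fun p : T2 × (ℝ × ℝ) => p.1 - sc s p.2 :=
        measurable_fst.sub ((continuous_sc s).measurable.comp measurable_snd)
      exact measurableSet_eq_fun (hf.comp hp) (hg.comp hp)
    rw [ae_ae_comm hm]
    exact ae_of_all _ fun z => (measurePreserving_sub_right vol (sc s z)).quasiMeasurePreserving.ae
        hfg
  filter_upwards [h1] with x hx
  unfold conv
  exact integral_congr_ae (hx.mono fun z hz => by simp only [hz])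

lemma bddMeas_integrable (hf : Measurable f) (hC : ∀ x, |f x| ≤ C) : Integrable f vol :=
  Integrable.of_bound hf.aestronglyMeasurable C (ae_of_all _ hC)

lemma integrable_translate_abs (hf : Measurable f) (hC : ∀ x, |f x| ≤ C)
    (s : ℝ) {κ : ℝ × ℝ → ℝ} (hκ : Integrable κ) :
    Integrable (fun p : T2 × (ℝ × ℝ) => κ p.2 * |f (p.1 - sc s p.2) - f p.1|) (vol.prod volume) :=
        by
  refine (hκ.comp_snd (μ := vol)).mul_bdd (c := 2 * C) ?_ (ae_of_all _ fun p => ?_)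
  · have hp : Measurable fun p : T2 × (ℝ × ℝ) => p.1 - sc s p.2 :=
      measurable_fst.sub ((continuous_sc s).measurable.comp measurable_snd)
    exact (((hf.comp hp).sub (hf.comp measurable_fst)).abs).aestronglyMeasurable
  · rw [norm_eq_abs, abs_abs]
    have h1 := abs_sub (f (p.1 - sc s p.2)) (f p.1)
    linarith [hC (p.1 - sc s p.2), hC p.1]

lemma abs_integral_pow_mul_comm_le (hf : Measurable f) (hC : ∀ x, |f x| ≤ C) (hw : ∀ x y i, |w x i -
    w y i| ≤ L * dist x y) (hdiv : IsDivFree w) (hs : 0 < s) (p : ℕ) : |∫ x, p * conv (hk 0 0) s f x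
    ^ (p - 1) * ∑ a, (2 * π / s) * conv (gradK a) s (fun y => f y * w y a) x ∂vol| ≤ p * C ^ (p - 1)
    * (2 * π) * (|L| * commMod s f) := by
  have hC0 : 0 ≤ C := (abs_nonneg _).trans (hC 0)
  have hwL : ∀ x y i, |w x i - w y i| ≤ |L| * dist x y := fun x y i =>
    (hw x y i).trans (by gcongr; exact le_abs_self L)
  have hwc : ∀ i, Continuous fun x => w x i := fun i =>
    (LipschitzWith.of_dist_le_mul (K := ⟨|L|, abs_nonneg L⟩) fun x y => hwL x y i).continuous
  obtain ⟨B, hB⟩ : ∃ B : ℝ, ∀ x i, |w x i| ≤ B := by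
    choose B hB using fun i => isCompact_univ.exists_bound_of_continuousOn (hwc i).continuousOn
    exact ⟨max (B 0) (B 1), fun x i => (hB i x (mem_univ x)).trans (by fin_cases i <;> simp)⟩
  have hwi : ∀ i, Integrable (w · i) vol := fun i =>
    bddMeas_integrable (hwc i).measurable fun x => hB x i
  have hfi := bddMeas_integrable hf hC
  have hfwm : ∀ a, Measurable fun y => f y * w y a := fun a => hf.mul (hwc a).measurable
  have hfwb : ∀ a y, |f y * w y a| ≤ C * B := fun a y => by
    rw [abs_mul]
    gcongr
    exacts [hC y, hB y a]
  set c : Z2 → ℂ := coeff (conv (hk 0 0) s f) with hc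
  have hce : c = fun k => (gmul s k : ℂ) * coeff f k := by
    ext k
    rw [hc, coeff_conv_hk 0 0 s hf hfi]
    simp
  have hcR : Rapid c := by
    rw [hce]
    exact rapid_gmul_mul hs fun k => norm_coeff_le f k
  have hcm : ∀ (h : ℝ × ℝ → ℝ) (hh : Integrable h) (g : T2 → ℝ) (hg : Measurable g) (D : ℝ)
      (hD : ∀ x, |g x| ≤ D), MemLp (conv h s g) 2 vol := fun h hh g hg D hD =>
    MemLp.of_bound (integrable_conv hh s hg (bddMeas_integrable hg hD)).1 _
      (ae_of_all _ (abs_conv_le hh s hD))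
  have hS : conv (hk 0 0) s f =ᵐ[vol] fser c :=
    ae_eq_fser (hcm _ (integrable_hk 0 0) f hf C hC) hcR.summable_norm
  have hSsm := isSmooth_fser hcR
  have hSd : ∀ a, ∀ᵐ x ∂vol, pd a (fser c) x = -(2 * π / s) * conv (gradK a) s f x := by
    intro a
    have e : coeff (fun x => -(2 * π / s) * conv (gradK a) s f x) =
        fun k => 2 * π * I * (k a) * c k := by
      ext k
      rw [coeff_const_mul, coeff_conv_gradK a s hf hfi, hce]
      have : (s : ℂ) ≠ 0 := by exact_mod_cast hs.ne'
      push_cast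
      field_simp
    have := ae_eq_fser (((hcm _ (integrable_gradK a) f hf C hC)).const_mul (-(2 * π / s)))
      (by rw [e]; exact (hcR.deriv a).summable_norm)
    rw [e] at this
    filter_upwards [this] with x hx
    rw [pd_fser hcR, hx]
  have hSb : ∀ᵐ x ∂vol, |fser c x| ≤ C := by
    filter_upwards [hS] with x hx
    rw [← hx]
    refine (abs_conv_le (integrable_hk 0 0) s hC x).trans (le_of_eq ?_)
    have : ∀ z, |hk 0 0 z| = hk 0 0 z := fun z =>
      abs_of_nonneg (mul_nonneg (hg_zero_nonneg _) (hg_zero_nonneg _))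
    simp_rw [this]
    rw [integral_hk, integral_hg_zero]
    ring
  have hdivS := hdiv _ (hSsm.pow p)
  simp_rw [pd_pow hSsm] at hdivS
  have hdw : ∀ᵐ x ∂vol, ∑ a, conv (gradK a) s (w · a) x = 0 := by
    have hm : ∀ a, MemLp (conv (gradK a) s (w · a)) 2 vol := fun a =>
      hcm _ (integrable_gradK a) _ (hwc a).measurable B fun x => hB x a
    have hi := fun a => (hm a).l1
    refine ae_eq_of_coeff_eq (memLp_finsetSum _ fun a _ => hm a) (MemLp.zero') fun k => ?_
    simp only [sum_univ_two]
    rw [coeff_add (hi 0) (hi 1), coeff_conv_gradK 0 s (hwc 0).measurable (hwi 0),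
      coeff_conv_gradK 1 s (hwc 1).measurable (hwi 1), coeff_const]
    have := sum_mul_coeff_of_isDivFree hwi hdiv k
    rw [sum_univ_two] at this
    simp only [ofReal_zero, ite_self]
    linear_combination (-I * s * gmul s k) * this
  set κ : Fin 2 → ℝ × ℝ → ℝ := fun a z => |gradK a z| * (|z.1| + |z.2|) with hκ
  set R : T2 → ℝ := fun x => ∑ a, (conv (gradK a) s (fun y => f y * w y a) x -
    w x a * conv (gradK a) s f x) with hR
  have hRb : ∀ᵐ x ∂vol, |R x| ≤ ∑ a, s * |L| * ∫ z, κ a z * |f (x - sc s z) - f x| := by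
    filter_upwards [hdw] with x hx
    have hmz : Measurable fun z : ℝ × ℝ => x - sc s z :=
      measurable_const.sub (continuous_sc s).measurable
    have hi : ∀ a (g : T2 → ℝ) b, Measurable g → (∀ y, |g y| ≤ b) →
        Integrable fun z => gradK a z * g (x - sc s z) := fun a g b hg hb =>
      (integrable_gradK a).mul_bdd (c := b) (hg.comp hmz).aestronglyMeasurable
        (ae_of_all _ fun z => hb _)
    have i1 := fun a => hi a _ _ (hfwm a) (hfwb a)
    have i2 := fun a => hi a _ _ hf hC
    have i3 := fun a => hi a _ _ (hwc a).measurable (hB · a)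
    have i4 : ∀ a, Integrable fun z => gradK a z *
        ((f (x - sc s z) - f x) * (w (x - sc s z) a - w x a)) := fun a => by
      refine ((((i1 a).sub ((i2 a).mul_const (w x a))).sub ((i3 a).mul_const (f x))).add
        ((integrable_gradK a).mul_const (f x * w x a))).congr (ae_of_all _ fun z => ?_)
      simp only [Pi.add_apply, Pi.sub_apply]
      ring
    have e : ∀ a, ∫ z, gradK a z * ((f (x - sc s z) - f x) * (w (x - sc s z) a - w x a)) =
        (conv (gradK a) s (fun y => f y * w y a) x - w x a * conv (gradK a) s f x) -
          f x * conv (gradK a) s (w · a) x := fun a => by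
      have e1 : ∀ z, gradK a z * ((f (x - sc s z) - f x) * (w (x - sc s z) a - w x a)) =
          ((gradK a z * (f (x - sc s z) * w (x - sc s z) a) - w x a * (gradK a z * f (x - sc s z)))
              -
          f x * (gradK a z * w (x - sc s z) a)) + (f x * w x a) * gradK a z := fun z => by ring
      have j := (i1 a).sub ((i2 a).const_mul (w x a))
      have i5 := (i3 a).const_mul (f x)
      simp_rw [e1]
      rw [integral_add, integral_sub, integral_sub, integral_const_mul, integral_const_mul,
        integral_const_mul, integral_gradK, mul_zero, add_zero]
      · rfl
      exacts [i1 a, (i2 a).const_mul _, j, i5, j.sub i5, (integrable_gradK a).const_mul _]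
    have e2 : R x = ∑ a, ∫ z, gradK a z * ((f (x - sc s z) - f x) * (w (x - sc s z) a - w x a)) :=
        by
      simp_rw [e]
      rw [Finset.sum_sub_distrib, ← mul_sum, hx, mul_zero, sub_zero]
    rw [e2]
    refine (Finset.abs_sum_le_sum_abs _ _).trans (sum_le_sum fun a _ => ?_)
    rw [← integral_const_mul]
    refine abs_integral_le_integral_abs.trans (integral_mono (i4 a).abs ?_ fun z => ?_)
    · refine Integrable.const_mul ?_ _
      refine (integrable_abs_gradK_mul a).mul_bdd (c := 2 * C)
        (((hf.comp hmz).sub measurable_const).abs).aestronglyMeasurable (ae_of_all _ fun z => ?_)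
      rw [norm_eq_abs, abs_abs]
      have h1 := abs_sub (f (x - sc s z)) (f x)
      linarith [hC (x - sc s z), hC x]
    · simp only [abs_mul, hκ]
      have h1 := (hwL (x - sc s z) x a).trans
        (mul_le_mul_of_nonneg_left (dist_sub_sc_le x hs.le z) (abs_nonneg L))
      calc |gradK a z| * (|f (x - sc s z) - f x| * |w (x - sc s z) a - w x a|)
          ≤ |gradK a z| * (|f (x - sc s z) - f x| * (|L| * (s * (|z.1| + |z.2|)))) := by gcongr
        _ = s * |L| * (|gradK a z| * (|z.1| + |z.2|) * |f (x - sc s z) - f x|) := by ring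
  have hcomm : ∀ a, ∫ x, (∫ z, κ a z * |f (x - sc s z) - f x|) ∂vol =
      ∫ z, κ a z * ∫ x, |f (x - sc s z) - f x| ∂vol := fun a => by
    rw [integral_integral_swap (integrable_translate_abs hf hC s (integrable_abs_gradK_mul a))]
    simp_rw [integral_const_mul]
  have hki : ∀ a, Integrable (fun x => ∫ z, κ a z * |f (x - sc s z) - f x|) vol := fun a =>
    (integrable_translate_abs hf hC s (integrable_abs_gradK_mul a)).integral_prod_left
  have hcv : ∀ a, Integrable (conv (gradK a) s (fun y => f y * w y a)) vol := fun a =>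
    integrable_conv (integrable_gradK a) s (hfwm a) (bddMeas_integrable (hfwm a) (hfwb a))
  have hcv2 : ∀ a, Integrable (fun x => w x a * conv (gradK a) s f x) vol := fun a =>
    (integrable_conv (integrable_gradK a) s hf hfi).bdd_mul (c := B)
      (hwc a).aestronglyMeasurable (ae_of_all _ fun x => hB x a)
  have hRi : Integrable R vol := integrable_finsetSum _ fun a _ => (hcv a).sub (hcv2 a)
  have hpb : ∀ᵐ x ∂vol, |(p : ℝ) * fser c x ^ (p - 1)| ≤ p * C ^ (p - 1) := by
    filter_upwards [hSb] with x hx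
    rw [abs_mul, abs_pow, abs_of_nonneg (Nat.cast_nonneg p)]
    gcongr
  have hpm : Continuous fun x => (p : ℝ) * fser c x ^ (p - 1) :=
    continuous_const.mul ((continuous_fser hcR.summable_norm).pow _)
  have key : ∫ x, p * conv (hk 0 0) s f x ^ (p - 1) *
        ∑ a, (2 * π / s) * conv (gradK a) s (fun y => f y * w y a) x ∂vol =
      (2 * π / s) * ∫ x, (p * fser c x ^ (p - 1)) * R x ∂vol := by
    have e : ∀ᵐ x ∂vol, p * conv (hk 0 0) s f x ^ (p - 1) *
        ∑ a, (2 * π / s) * conv (gradK a) s (fun y => f y * w y a) x =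
        2 * π / s * ((p * fser c x ^ (p - 1)) * R x) -
          ∑ a, w x a * (p * fser c x ^ (p - 1) * pd a (fser c) x) := by
      filter_upwards [hS, hSd 0, hSd 1] with x h1 h2 h3
      rw [h1]
      simp only [hR, sum_univ_two, h2, h3]
      ring
    have hpdc : ∀ a, Continuous (pd a (fser c)) := fun a => by
      rw [show pd a (fser c) = fser (fun k => 2 * π * I * (k a) * c k) from
        funext fun x => pd_fser hcR a x]
      exact continuous_fser (hcR.deriv a).summable_norm
    have i5 : Integrable (fun x => 2 * π / s * ((p * fser c x ^ (p - 1)) * R x)) vol :=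
      (hRi.bdd_mul hpm.aestronglyMeasurable hpb).const_mul _
    have i6 : Integrable (fun x => ∑ a, w x a * (p * fser c x ^ (p - 1) * pd a (fser c) x)) vol :=
      (memLp_cont (continuous_finsetSum _ fun a _ => (hwc a).mul (hpm.mul (hpdc a)))).l1
    rw [integral_congr_ae e, integral_sub i5 i6, hdivS, sub_zero, integral_const_mul]
  have hp0 : (0 : ℝ) ≤ p * C ^ (p - 1) := by positivity
  rw [key, abs_mul, abs_of_pos (by positivity)]
  have hfin : |∫ x, (p * fser c x ^ (p - 1)) * R x ∂vol| ≤
      (p * C ^ (p - 1)) * (s * |L| * commMod s f) := by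
    calc |∫ x, (p * fser c x ^ (p - 1)) * R x ∂vol|
        ≤ ∫ x, (p * C ^ (p - 1)) * (∑ a, s * |L| * ∫ z, κ a z * |f (x - sc s z) - f x|) ∂vol := by
          refine abs_integral_le_integral_abs.trans (integral_mono_ae
            (hRi.bdd_mul hpm.aestronglyMeasurable hpb).abs
            ((integrable_finsetSum _ fun a _ => (hki a).const_mul _).const_mul _) ?_)
          filter_upwards [hpb, hRb] with x h1 h2
          rw [abs_mul]
          exact mul_le_mul h1 h2 (abs_nonneg _) hp0
      _ = (p * C ^ (p - 1)) * (s * |L| * commMod s f) := by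
          rw [integral_const_mul, integral_finsetSum _ fun a _ => (hki a).const_mul _]
          simp_rw [integral_const_mul, hcomm]
          rw [← mul_sum, commMod]
  calc 2 * π / s * |∫ x, (p * fser c x ^ (p - 1)) * R x ∂vol|
      ≤ 2 * π / s * ((p * C ^ (p - 1)) * (s * |L| * commMod s f)) := by gcongr
    _ = p * C ^ (p - 1) * (2 * π) * (|L| * commMod s f) := by field_simp

/-! ### Renormalization of the transport equation -/

lemma pow_primitive {g : ℝ → ℝ} {y₀ : ℝ} (ht : 0 ≤ t) (hg : IntegrableOn g (Ioc 0 t)) (p : ℕ) : (y₀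
    + ∫ s in 0..t, g s) ^ p = y₀ ^ p + ∫ s in 0..t, p * (y₀ + ∫ r in 0..s, g r) ^ (p - 1) * g s :=
    by
  induction p generalizing t with
  | zero => simp
  | succ p ih =>
    have hp : IntegrableOn (fun s => p * (y₀ + ∫ r in 0..s, g r) ^ (p - 1) * g s) (Ioc 0 t) := by
      refine (intervalIntegrable_iff_integrableOn_Ioc_of_le ht).1
        ((interval_of_Ioc ht hg).continuousOn_mul ?_)
      rw [uIcc_of_le ht]
      exact continuousOn_const.mul ((continuousOn_const.add (continuousOn_primitive' ht hg)).pow _)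
    rw [pow_succ, ih ht hg, mul_primitive ht hp hg, pow_succ]
    congr 1
    refine integral_congr fun s hs => ?_
    rw [uIcc_of_le ht] at hs
    rw [← ih hs.1 (hg.mono_set (Ioc_subset_Ioc_right hs.2))]
    rcases Nat.eq_zero_or_pos p with h0 | h0
    · subst h0; simp
    · obtain ⟨q, rfl⟩ : ∃ q, p = q + 1 := ⟨p - 1, by omega⟩
      simp only [Nat.add_sub_cancel]
      push_cast
      ring

lemma commMod_nonneg (s : ℝ) (f : T2 → ℝ) : 0 ≤ commMod s f :=
  sum_nonneg fun a _ => integral_nonneg fun z =>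
    mul_nonneg (by positivity) (integral_nonneg fun x => abs_nonneg _)

/-- The total mass of the commutator kernels. -/
def commMass : ℝ := ∑ a, ∫ z, |gradK a z| * (|z.1| + |z.2|)

lemma integral_abs_translate_sub_le (hC : ∀ x, |f x| ≤ C) (h : T2) :
    ∫ x, |f (x - h) - f x| ∂vol ≤ 2 * C := by
  refine (integral_mono_of_nonneg (ae_of_all _ fun x => abs_nonneg _) (integrable_const (2 * C))
    (ae_of_all _ fun x => ?_)).trans (by simp)
  have h1 := abs_sub (f (x - h)) (f x)
  simp only
  linarith [hC (x - h), hC x]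

lemma commMod_le (hC : ∀ x, |f x| ≤ C) (s : ℝ) : commMod s f ≤ commMass * (2 * C) := by
  rw [commMass, sum_mul]
  refine sum_le_sum fun a _ => ?_
  rw [← integral_mul_const]
  refine integral_mono_of_nonneg (ae_of_all _ fun z =>
    mul_nonneg (by positivity) (integral_nonneg fun x => abs_nonneg _))
    ((integrable_abs_gradK_mul a).mul_const _) (ae_of_all _ fun z => ?_)
  simp only
  gcongr
  exact integral_abs_translate_sub_le hC _

lemma measurable_translate_abs (hθ : Measurable (uncurry θ)) (s : ℝ) :
    Measurable fun q : ℝ × (ℝ × ℝ) => ∫ x, |θ q.1 (x - sc s q.2) - θ q.1 x| ∂vol := by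
  have h : StronglyMeasurable fun q : (ℝ × (ℝ × ℝ)) × T2 =>
      |θ q.1.1 (q.2 - sc s q.1.2) - θ q.1.1 q.2| := by
    refine Measurable.stronglyMeasurable ?_
    refine Measurable.abs (Measurable.sub ?_ ?_)
    · exact hθ.comp ((measurable_fst.comp measurable_fst).prodMk (measurable_snd.sub
        ((continuous_sc s).measurable.comp (measurable_snd.comp measurable_fst))))
    · exact hθ.comp ((measurable_fst.comp measurable_fst).prodMk measurable_snd)
  exact (h.integral_prod_right (ν := vol)).measurable

lemma measurable_commMod (hθ : Measurable (uncurry θ)) (s : ℝ) :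
    Measurable fun t => commMod s (θ t) := by
  refine Finset.measurable_sum _ fun a _ => ?_
  have h : StronglyMeasurable fun q : ℝ × (ℝ × ℝ) => |gradK a q.2| * (|q.2.1| + |q.2.2|) *
      ∫ x, |θ q.1 (x - sc s q.2) - θ q.1 x| ∂vol := by
    refine Measurable.stronglyMeasurable (Measurable.mul ?_ (measurable_translate_abs hθ s))
    have hc : Continuous fun z : ℝ × ℝ => |gradK a z| * (|z.1| + |z.2|) :=
      (continuous_gradK a).abs.mul (by fun_prop)
    exact hc.measurable.comp measurable_snd
  exact (h.integral_prod_right (ν := (volume : Measure (ℝ × ℝ)))).measurable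

/-- A sequence of mollification scales. -/
def scale (n : ℕ) : ℝ := 1 / (n + 1)

lemma scale_pos (n : ℕ) : 0 < scale n := by unfold scale; positivity

lemma tendsto_scale : scale ⇝ 0 := tendsto_one_div_add_atTop_nhds_zero_nat

lemma tendsto_sc_scale (z : ℝ × ℝ) : (fun n => sc (scale n) z) ⇝ 0 := by
  have h : Continuous fun s : ℝ => sc s z :=
    continuous_sc_uncurry.comp (continuous_id.prodMk continuous_const)
  have := (h.tendsto 0).comp tendsto_scale
  have h0 : sc 0 z = 0 := by ext i; fin_cases i <;> simp [sc]
  rwa [h0] at this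

lemma tendsto_integral_translate_mul (hf : Measurable f) (hC : ∀ x, |f x| ≤ C) {κ : ℝ × ℝ → ℝ} (hκ :
    Integrable κ) : (fun n => ∫ z, κ z * ∫ x, |f (x - sc (scale n) z) - f x| ∂vol) ⇝ 0 := by
  have : (0 : ℝ) = ∫ z : ℝ × ℝ, (0 : ℝ) := by simp
  rw [this]
  refine tendsto_integral_of_dominated_convergence (fun z => |κ z| * (2 * C)) (fun n => ?_)
    (hκ.abs.mul_const _) (fun n => ae_of_all _ fun z => ?_) (ae_of_all _ fun z => ?_)
  · have h := measurable_translate_abs (θ := fun _ => f) (hf.comp measurable_snd) (scale n)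
    exact hκ.1.mul (h.comp (measurable_const (a := (0 : ℝ)).prodMk
        measurable_id)).aestronglyMeasurable
  · rw [norm_mul, norm_eq_abs, norm_of_nonneg (integral_nonneg fun x => abs_nonneg _)]
    gcongr
    exact integral_abs_translate_sub_le hC _
  · have := ((tendsto_integral_abs_translate_sub
      (memLp_bdd hf (ae_of_all _ hC))).comp (tendsto_sc_scale z)).const_mul (κ z)
    simpa using this

lemma tendsto_commMod (hf : Measurable f) (hC : ∀ x, |f x| ≤ C) :
    (fun n => commMod (scale n) f) ⇝ 0 := by
  have := tendsto_finsetSum Finset.univ fun a (_ : a ∈ (Finset.univ : Finset (Fin 2))) =>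
    tendsto_integral_translate_mul hf hC (integrable_abs_gradK_mul a)
  simpa [commMod] using this

lemma abs_conv_hk_le (hC : ∀ x, |f x| ≤ C) (s : ℝ) (x : T2) : |conv (hk 0 0) s f x| ≤ C := by
  refine (abs_conv_le (integrable_hk 0 0) s hC x).trans (le_of_eq ?_)
  have : ∀ z, |hk 0 0 z| = hk 0 0 z := fun z =>
    abs_of_nonneg (mul_nonneg (hg_zero_nonneg _) (hg_zero_nonneg _))
  simp_rw [this]
  rw [integral_hk, integral_hg_zero]
  ring

lemma abs_pow_sub_pow_le_of_abs_le (ha : |a| ≤ C) (hb : |b| ≤ C) (p : ℕ) :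
    |a ^ p - b ^ p| ≤ p * C ^ (p - 1) * |a - b| := by
  refine (_root_.abs_pow_sub_pow_le a b p).trans ?_
  have : max |a| |b| ≤ C := max_le ha hb
  have h0 : 0 ≤ max |a| |b| := (abs_nonneg a).trans (le_max_left _ _)
  calc |a - b| * p * max |a| |b| ^ (p - 1) ≤ |a - b| * p * C ^ (p - 1) := by gcongr
    _ = _ := by ring

lemma tendsto_integral_conv_pow (hf : Measurable f) (hC : ∀ x, |f x| ≤ C)
    (p : ℕ) : (fun n => ∫ x, conv (hk 0 0) (scale n) f x ^ p ∂vol) ⇝ (∫ x, f x ^ p ∂vol) := by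
  have hC0 : 0 ≤ C := (abs_nonneg _).trans (hC 0)
  have hlim := (tendsto_integral_translate_mul hf hC (integrable_hk 0 0)).const_mul
    (p * C ^ (p - 1))
  rw [mul_zero] at hlim
  rw [tendsto_iff_dist_tendsto_zero]
  refine squeeze_zero (fun n => dist_nonneg) (fun n => ?_) hlim
  set s := scale n
  have hcm := (integrable_conv (integrable_hk 0 0) s hf (bddMeas_integrable hf hC)).1
  have i1 : Integrable (fun x => conv (hk 0 0) s f x ^ p) vol :=
    Integrable.of_bound (hcm.pow p) (C ^ p) (ae_of_all _ fun x => by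
      rw [norm_pow, norm_eq_abs]
      gcongr
      exact abs_conv_hk_le hC s x)
  have i2 : Integrable (fun x => f x ^ p) vol :=
    Integrable.of_bound (hf.pow_const p).aestronglyMeasurable (C ^ p) (ae_of_all _ fun x => by
      rw [norm_pow, norm_eq_abs]
      gcongr
      exact hC x)
  rw [Real.dist_eq, ← integral_sub i1 i2]
  have hswap : ∫ z, hk 0 0 z * ∫ x, |f (x - sc s z) - f x| ∂vol =
      ∫ x, (∫ z, hk 0 0 z * |f (x - sc s z) - f x|) ∂vol := by
    rw [integral_integral_swap (integrable_translate_abs hf hC s (integrable_hk 0 0))]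
    simp_rw [integral_const_mul]
  rw [hswap, ← integral_const_mul]
  refine abs_integral_le_integral_abs.trans (integral_mono (i1.sub i2).abs
    ((integrable_translate_abs hf hC s (integrable_hk 0 0)).integral_prod_left.const_mul _)
    fun x => ?_)
  simp only
  refine (abs_pow_sub_pow_le_of_abs_le (abs_conv_hk_le hC s x) (hC x) p).trans ?_
  gcongr
  have j1 : Integrable fun z => hk 0 0 z * f (x - sc s z) :=
    (integrable_hk 0 0).mul_bdd (c := C) (hf.comp
        (measurable_const.sub (continuous_sc s).measurable)).aestronglyMeasurable
      (ae_of_all _ fun z => hC _)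
  have e : conv (hk 0 0) s f x - f x = ∫ z, hk 0 0 z * (f (x - sc s z) - f x) := by
    simp_rw [mul_sub]
    rw [integral_sub j1 ((integrable_hk 0 0).mul_const _), integral_mul_const, integral_hk,
      integral_hg_zero]
    simp [conv]
  rw [e]
  refine abs_integral_le_integral_abs.trans (le_of_eq ?_)
  congr 1
  ext z
  rw [abs_mul, abs_of_nonneg (show 0 ≤ hk 0 0 z from
    mul_nonneg (hg_zero_nonneg _) (hg_zero_nonneg _))]

lemma dist_T2_le_one (x y : T2) : dist x y ≤ 1 := by
  refine (dist_pi_le_iff zero_le_one).2 fun i => ?_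
  rw [dist_eq_norm]
  have := AddCircle.norm_le_half_period (1 : ℝ) (x := x i - y i) one_ne_zero
  simp only [abs_one] at this
  linarith

lemma abs_le_of_lip (hg : MemLp g 2 vol) (h : ∀ x y, |g x - g y| ≤ L * dist x y) (x : T2) : |g x| ≤
    √(∫ y, g y ^ 2 ∂vol) + |L| := by
  have h2 : ∫ _, |g x| ∂vol ≤ ∫ y, (|g y| + |L|) ∂vol := integral_mono (integrable_const |g x|)
    (((hg.l1).abs).add (integrable_const |L|)) (fun y => by
        have h2 := (h x y).trans (mul_le_mul (le_abs_self L) (dist_T2_le_one x y) dist_nonneg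
          (abs_nonneg L))
        have h3 := abs_sub_abs_le_abs_sub (g x) (g y)
        linarith)
  rw [integral_add ((hg.l1).abs) (integrable_const _)] at h2
  simp only [integral_const, probReal_univ, smul_eq_mul, one_mul] at h2
  linarith [integral_abs_le_sqrt hg]

lemma measurable_conv {f : ScalarField} (hf : Measurable (uncurry f)) {h : ℝ × ℝ → ℝ}
    (hh : Continuous h) (s : ℝ) : Measurable (uncurry fun t x => conv h s (f t) x) := by
  have hm : StronglyMeasurable fun q : (ℝ × T2) × (ℝ × ℝ) => h q.2 * f q.1.1 (q.1.2 - sc s q.2) :=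
      by
    refine Measurable.stronglyMeasurable ((hh.measurable.comp measurable_snd).mul ?_)
    exact hf.comp ((measurable_fst.comp measurable_fst).prodMk ((measurable_snd.comp
      measurable_fst).sub ((continuous_sc s).measurable.comp measurable_snd)))
  exact (hm.integral_prod_right (ν := (volume : Measure (ℝ × ℝ)))).measurable

lemma abs_conv_le_ae {h : ℝ × ℝ → ℝ} (hh : Integrable h) (s : ℝ) (hf : Measurable f) (hC0 : 0 ≤ C)
    (hC : ∀ᵐ x ∂vol, |f x| ≤ C) :
    ∀ᵐ x ∂vol, |conv h s f x| ≤ (∫ z, |h z|) * C := by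
  set g : T2 → ℝ := fun x => max (-C) (min C (f x)) with hg
  have hfg : f =ᵐ[vol] g := by
    filter_upwards [hC] with x hx
    rw [abs_le] at hx
    simp [hg, hx.1, hx.2]
  filter_upwards [conv_congr_ae h s hf
      (measurable_const.max (measurable_const.min hf)) hfg] with x hx
  rw [hx]
  refine abs_conv_le hh s (fun y => ?_) x
  rw [abs_le]
  exact ⟨le_max_left _ _, max_le (by linarith) (min_le_left _ _)⟩

/-- Data for the renormalization argument on `(0, T]`. -/
structure TransportData (u : VectorField) (θ : ScalarField) (θ₀ : T2 → ℝ) (T C B : ℝ)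
    (L : ℝ → ℝ) : Prop where
  pos : 0 < T
  meas_u : Measurable (uncurry u)
  meas_θ : Measurable (uncurry θ)
  meas_θ₀ : Measurable θ₀
  meas_L : Measurable L
  bound_θ : ∀ t x, |θ t x| ≤ C
  bound_θ₀ : ∀ x, |θ₀ x| ≤ C
  int_L : IntegrableOn L (Ioc 0 T)
  memLp : ∀ᵐ t ∂ℓ(T), ∀ i, MemLp (u t · i) 2 vol ∧
    ∫ x, u t x i ^ 2 ∂vol ≤ B
  lip : ∀ᵐ t ∂ℓ(T), ∃ w : T2 → Fin 2 → ℝ, w =ᵐ[vol] u t ∧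
    ∀ x y i, |w x i - w y i| ≤ L t * dist x y
  div : ∀ᵐ t ∂ℓ(T), IsDivFree (u t)
  ode : ∀ k, ∀ᵐ t ∂ℓ(T),
    coeff (θ t) k = coeff θ₀ k + ∫ s in 0..t, transForce u θ k s

/-- The right-hand side of the mollified transport equation. -/
def mollRHS (u : VectorField) (θ : ScalarField) (s : ℝ) (t : ℝ) (x : T2) : ℝ :=
  ∑ a, (2 * π / s) * conv (gradK a) s (fun y => θ t y * u t y a) x

section Renormalization

variable {L : ℝ → ℝ}

lemma measurable_mollRHS (hu : Measurable (uncurry u)) (hθ : Measurable (uncurry θ))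
    (s : ℝ) : Measurable (uncurry (mollRHS u θ s)) := by
  exact Finset.measurable_sum Finset.univ fun a _ => (fun a =>
      (measurable_conv (f := fun t y => θ t y * u t y a) (hθ.mul (measurable_coord hu a))
        (continuous_gradK a) s).const_mul _) a

/-- An integrable bound for the velocity. -/
def velBound (B : ℝ) (L : ℝ → ℝ) (t : ℝ) : ℝ := √B + |L t|

lemma TransportData.velocity_le (h : TransportData u θ θ₀ T C B L) :
    ∀ᵐ t ∂ℓ(T), ∀ i, ∀ᵐ x ∂vol, |u t x i| ≤ velBound B L t := by
  filter_upwards [h.memLp, h.lip] with t h1 h2 i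
  obtain ⟨w, hw, hL⟩ := h2
  have e : (w · i) =ᵐ[vol] fun x => u t x i := hw.mono fun x hx => by simp only [hx]
  filter_upwards [e] with x hx
  rw [← hx]
  refine (abs_le_of_lip ((memLp_congr_ae e).2 (h1 i).1) (fun x y => hL x y i) x).trans ?_
  unfold velBound
  gcongr
  refine (le_of_eq ?_).trans (h1 i).2
  exact integral_congr_ae (e.mono fun x hx => by simp only [hx])

/-- The constant in the pointwise bound of `mollRHS`. -/
def mollConst (s C : ℝ) : ℝ := ∑ a, (2 * π / s) * ((∫ z, |gradK a z|) * C)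

lemma TransportData.mollRHS_le (h : TransportData u θ θ₀ T C B L) (hs : 0 < s) : ∀ᵐ t ∂ℓ(T), ∀ᵐ x
    ∂vol, |mollRHS u θ s t x| ≤ mollConst s C * velBound B L t := by
  filter_upwards [h.velocity_le] with t ht
  have hC0 : 0 ≤ C := (abs_nonneg _).trans (h.bound_θ₀ 0)
  have hv0 : 0 ≤ velBound B L t := by unfold velBound; positivity
  have h1 : ∀ a, ∀ᵐ x ∂vol, |conv (gradK a) s (fun y => θ t y * u t y a) x| ≤
      (∫ z, |gradK a z|) * (C * velBound B L t) := fun a => by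
    refine abs_conv_le_ae (integrable_gradK a) s ((meas_slice h.meas_θ t).mul
        (meas_slice (measurable_coord h.meas_u a) t)) (by positivity) ?_
    filter_upwards [ht a] with x hx
    rw [abs_mul]
    exact mul_le_mul (h.bound_θ t x) hx (abs_nonneg _) hC0
  filter_upwards [h1 0, h1 1] with x h2 h3
  unfold mollRHS mollConst
  rw [sum_mul]
  refine (Finset.abs_sum_le_sum_abs _ _).trans (sum_le_sum fun a _ => ?_)
  rw [abs_mul, abs_of_pos (by positivity), mul_assoc, mul_assoc]
  gcongr
  fin_cases a
  · exact h2
  · exact h3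

lemma TransportData.integrable_velBound (h : TransportData u θ θ₀ T C B L) :
    IntegrableOn (velBound B L) (Ioc 0 T) :=
  (integrable_const _).add h.int_L.abs

lemma TransportData.integrable_mollRHS (h : TransportData u θ θ₀ T C B L) (hs : 0 < s) :
    Integrable (uncurry (mollRHS u θ s)) (ℓ(T).prod vol) := by
  have hm := measurable_mollRHS h.meas_u h.meas_θ s
  refine Integrable.mono' (g := fun p => mollConst s C * velBound B L p.1)
    ((h.integrable_velBound.const_mul _).comp_fst vol) hm.aestronglyMeasurable ?_
  have hset : MeasurableSet {p : ℝ × T2 | ‖uncurry (mollRHS u θ s) p‖ ≤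
      mollConst s C * velBound B L p.1} :=
    measurableSet_le hm.norm (measurable_const.mul ((measurable_const.add h.meas_L.abs).comp
        measurable_fst))
  exact (ae_prod_iff_ae_ae hset).2 (h.mollRHS_le hs)

end Renormalization

lemma coeff_integral_time {G : ScalarField} (ht : 0 ≤ t) (hG : Integrable (uncurry G) (ℓ(t).prod
    vol)) (k : Z2) : coeff (fun x => ∫ τ in 0..t, G τ x) k = ∫ τ in 0..t, coeff (G τ) k := by
  have h1 : Integrable (fun q : T2 × ℝ => mFourier (-k) q.1 * (G q.2 q.1 : ℂ)) (vol.prod ℓ(t)) := by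
    refine (hG.swap.ofReal (𝕜 := ℂ)).bdd_mul (c := 1) ?_ (ae_of_all _ fun q => ?_)
    · exact ((mFourier (-k)).continuous.comp continuous_fst).aestronglyMeasurable
    · rw [norm_mFourier_apply]
  rw [coeff_eq]
  simp_rw [integral_of_le ht, coeff_eq]
  rw [← integral_integral_swap (f := fun (x : T2) (τ : ℝ) => mFourier (-k) x * (G τ x : ℂ)) h1]
  refine integral_congr_ae (ae_of_all _ fun x => ?_)
  simp only
  rw [integral_const_mul, integral_complex_ofReal]

lemma measurable_time_primitive {G : ScalarField} (hG : Measurable (uncurry G)) :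
    Measurable fun p : ℝ × T2 => ∫ τ in Ioc 0 p.1, G τ p.2 := by
  have h : StronglyMeasurable fun q : (ℝ × T2) × ℝ =>
      {q : (ℝ × T2) × ℝ | 0 < q.2 ∧ q.2 ≤ q.1.1}.indicator (fun q => G q.2 q.1.2) q := by
    refine Measurable.stronglyMeasurable (Measurable.indicator ?_ ?_)
    · exact hG.comp (measurable_snd.prodMk (measurable_snd.comp measurable_fst))
    · exact (measurableSet_lt measurable_const measurable_snd).inter
        (measurableSet_le measurable_snd (measurable_fst.comp measurable_fst))
  convert ((h.integral_prod_right' (ν := (volume : Measure ℝ))).measurable) using 2 with p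
  rw [← integral_indicator measurableSet_Ioc]
  rfl

lemma continuous_of_lip (h : ∀ x y, |g x - g y| ≤ L * dist x y) : Continuous g := by
  refine (LipschitzWith.of_dist_le_mul (K := ⟨|L|, abs_nonneg L⟩) fun x y => ?_).continuous
  rw [Real.dist_eq]
  exact (h x y).trans (mul_le_mul_of_nonneg_right (le_abs_self L) dist_nonneg)

section Renormalization

variable {L : ℝ → ℝ}

lemma TransportData.coeff_mollRHS (h : TransportData u θ θ₀ T C B L) (hs : 0 < s) (k : Z2) : ∀ᵐ t
    ∂ℓ(T), coeff (mollRHS u θ s t) k = gmul s k * transForce u θ k t := by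
  filter_upwards [h.memLp] with t ht
  have hm : ∀ a, Measurable fun y => θ t y * u t y a := fun a => (meas_slice h.meas_θ t).mul
      (meas_slice (measurable_coord h.meas_u a) t)
  have hi : ∀ a, Integrable (fun y => θ t y * u t y a) vol := fun a =>
    (memLp_two_bdd_mul (meas_slice h.meas_θ t) (ae_of_all _ (h.bound_θ t)) (ht a).1).l1
  have hc : ∀ a, Integrable (fun x => (2 * π / s) *
      conv (gradK a) s (fun y => θ t y * u t y a) x) vol := fun a =>
    (integrable_conv (integrable_gradK a) s (hm a) (hi a)).const_mul _
  have e : mollRHS u θ s t = fun x => (2 * π / s) *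
      conv (gradK 0) s (fun y => θ t y * u t y 0) x + (2 * π / s) *
      conv (gradK 1) s (fun y => θ t y * u t y 1) x := by
    ext x; simp [mollRHS]
  rw [e, coeff_add (hc 0) (hc 1), coeff_const_mul, coeff_const_mul,
    coeff_conv_gradK 0 s (hm 0) (hi 0), coeff_conv_gradK 1 s (hm 1) (hi 1), transForce,
    sum_univ_two]
  have : (s : ℂ) ≠ 0 := by exact_mod_cast hs.ne'
  push_cast
  field_simp
  ring

/-- The mollified solution, reconstructed from its equation. -/
def mollSol (u : VectorField) (θ : ScalarField) (θ₀ : T2 → ℝ) (s t : ℝ) (x : T2) : ℝ :=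
  conv (hk 0 0) s θ₀ x + ∫ τ in 0..t, mollRHS u θ s τ x

lemma TransportData.mollRHS_section (h : TransportData u θ θ₀ T C B L) (hs : 0 < s) : ∀ᵐ x ∂vol,
    IntegrableOn (mollRHS u θ s · x) (Ioc 0 T) ∧ ∀ᵐ τ ∂ℓ(T), |mollRHS u θ s τ x| ≤ mollConst s C *
    velBound B L τ := by
  have hset : MeasurableSet {p : ℝ × T2 | |mollRHS u θ s p.1 p.2| ≤
      mollConst s C * velBound B L p.1} :=
    measurableSet_le
        (measurable_mollRHS h.meas_u h.meas_θ s).norm (measurable_const.mul ((measurable_const.add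
            h.meas_L.abs).comp measurable_fst))
  filter_upwards [(ae_ae_comm hset).1 (h.mollRHS_le hs),
    (h.integrable_mollRHS hs).swap.prod_right_ae] with x h1 h2
  exact ⟨h2, h1⟩

lemma TransportData.mollSol_ae_eq (h : TransportData u θ θ₀ T C B L) (hs : 0 < s) :
    ∀ᵐ t ∂ℓ(T), mollSol u θ θ₀ s t =ᵐ[vol] conv (hk 0 0) s (θ t) := by
  have hm := measurable_mollRHS h.meas_u h.meas_θ s
  have hθ₀i := bddMeas_integrable h.meas_θ₀ h.bound_θ₀
  filter_upwards [ae_all_iff.2 h.ode, ae_mem_Ioc] with t ht htT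
  have hsub : ℓ(t) ≤ ℓ(T) := Measure.restrict_mono (Ioc_subset_Ioc_right htT.2) le_rfl
  have hG : Integrable (uncurry (mollRHS u θ s)) (ℓ(t).prod vol) :=
    (h.integrable_mollRHS hs).mono_measure (Measure.prod_mono hsub le_rfl)
  have hint : Integrable (fun x => ∫ τ in 0..t, mollRHS u θ s τ x) vol := by
    simp_rw [integral_of_le htT.1.le]
    exact hG.swap.integral_prod_left
  have hc0 := integrable_conv (integrable_hk 0 0) s h.meas_θ₀ hθ₀i
  refine ae_eq_of_coeff_eq ?_ ?_ fun k => ?_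
  · refine MemLp.of_bound (hc0.add hint).1 (C + ∫ τ in Ioc 0 T, mollConst s C * velBound B L τ) ?_
    filter_upwards [h.mollRHS_section hs] with x hx
    rw [mollSol, norm_eq_abs]
    refine (abs_add_le _ _).trans (add_le_add (abs_conv_hk_le h.bound_θ₀ s x) ?_)
    rw [integral_of_le htT.1.le]
    refine abs_integral_le_integral_abs.trans ?_
    refine (setIntegral_mono_set hx.1.abs (ae_of_all _ fun τ => abs_nonneg _)
      (Ioc_subset_Ioc_right htT.2).eventuallyLE).trans ?_
    exact integral_mono_ae hx.1.abs (h.integrable_velBound.const_mul _) hx.2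
  · exact memLp_bdd (meas_slice (measurable_conv h.meas_θ (continuous_hk 0 0) s) t)
      (ae_of_all _ (abs_conv_hk_le (h.bound_θ t) s))
  · have e : mollSol u θ θ₀ s t = fun x => conv (hk 0 0) s θ₀ x +
        ∫ τ in 0..t, mollRHS u θ s τ x := rfl
    rw [e, coeff_add hc0 hint, coeff_integral_time htT.1.le hG,
      coeff_conv_hk 0 0 s h.meas_θ₀ hθ₀i, coeff_conv_hk 0 0 s (meas_slice h.meas_θ t)
          (bddMeas_integrable (meas_slice h.meas_θ t) (h.bound_θ t)),
      ht k]
    have e2 : ∫ τ in 0..t, coeff (mollRHS u θ s τ) k =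
        ∫ τ in 0..t, (gmul s k : ℂ) * transForce u θ k τ := by
      rw [integral_of_le htT.1.le, integral_of_le htT.1.le]
      exact integral_congr_ae (ae_mono hsub (h.coeff_mollRHS hs k))
    rw [e2, intervalIntegral.integral_const_mul]
    simp
    ring

lemma TransportData.abs_integral_pow_sub_le (h : TransportData u θ θ₀ T C B L) (hs : 0 < s) (p : ℕ)
    : ∀ᵐ t ∂ℓ(T), |∫ x, conv (hk 0 0) s (θ t) x ^ p ∂vol - ∫ x, conv (hk 0 0) s θ₀ x ^ p ∂vol| ≤ ∫ τ
    in Ioc 0 T, p * C ^ (p - 1) * (2 * π) * (|L τ| * commMod s (θ τ)) := by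
  have hC0 : 0 ≤ C := (abs_nonneg _).trans (h.bound_θ₀ 0)
  have hcm := measurable_conv h.meas_θ (continuous_hk 0 0) s
  have hbig : IntegrableOn (fun τ => p * C ^ (p - 1) * (2 * π) * (|L τ| * commMod s (θ τ)))
      (Ioc 0 T) := by
    refine Integrable.const_mul (h.int_L.abs.mul_bdd (c := commMass * (2 * C))
      (measurable_commMod h.meas_θ s).aestronglyMeasurable (ae_of_all _ fun τ => ?_)) _
    rw [norm_of_nonneg (commMod_nonneg _ _)]
    exact commMod_le (h.bound_θ τ) s
  have hswap : ∀ᵐ x ∂vol, ∀ᵐ τ ∂ℓ(T), mollSol u θ θ₀ s τ x = conv (hk 0 0) s (θ τ) x := by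
    have hset : MeasurableSet {q : ℝ × T2 | conv (hk 0 0) s θ₀ q.2 +
        (∫ r in Ioc 0 q.1, mollRHS u θ s r q.2) = conv (hk 0 0) s (θ q.1) q.2} :=
      measurableSet_eq_fun ((meas_slice (measurable_conv (f := fun _ => θ₀)
        (h.meas_θ₀.comp measurable_snd) (continuous_hk 0 0) s) 0 |>.comp measurable_snd).add
        (measurable_time_primitive (measurable_mollRHS h.meas_u h.meas_θ s))) hcm
    have h1 : ∀ᵐ τ ∂ℓ(T), ∀ᵐ x ∂vol, conv (hk 0 0) s θ₀ x +
        (∫ r in Ioc 0 τ, mollRHS u θ s r x) = conv (hk 0 0) s (θ τ) x := by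
      filter_upwards [h.mollSol_ae_eq hs, ae_mem_Ioc] with τ h1 h2
      filter_upwards [h1] with x h3
      rw [← h3, mollSol, integral_of_le h2.1.le]
    filter_upwards [(ae_ae_comm hset).1 h1] with x h2
    filter_upwards [h2, ae_mem_Ioc] with τ h3 h4
    rw [← h3, mollSol, integral_of_le h4.1.le]
  filter_upwards [h.mollSol_ae_eq hs, ae_mem_Ioc] with t ht htT
  have hsub : ℓ(t) ≤ ℓ(T) := Measure.restrict_mono (Ioc_subset_Ioc_right htT.2) le_rfl
  have hF : Integrable (fun q : ℝ × T2 => p * conv (hk 0 0) s (θ q.1) q.2 ^ (p - 1) *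
      mollRHS u θ s q.1 q.2) (ℓ(t).prod vol) := by
    refine
        ((h.integrable_mollRHS hs).mono_measure (Measure.prod_mono hsub le_rfl)).bdd_mul (c := p * C
            ^ (p - 1)) (((hcm.pow_const _).const_mul _).aestronglyMeasurable)
      (ae_of_all _ fun q => ?_)
    rw [norm_mul, norm_pow, norm_eq_abs, norm_eq_abs, Nat.abs_cast]
    gcongr
    exact abs_conv_hk_le (h.bound_θ q.1) s q.2
  have e1 : ∫ x, conv (hk 0 0) s (θ t) x ^ p ∂vol = ∫ x, (conv (hk 0 0) s θ₀ x ^ p +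
      ∫ τ in Ioc 0 t, p * conv (hk 0 0) s (θ τ) x ^ (p - 1) * mollRHS u θ s τ x) ∂vol := by
    refine integral_congr_ae ?_
    filter_upwards [ht, hswap, h.mollRHS_section hs] with x h1 h2 h3
    rw [← h1, mollSol, pow_primitive htT.1.le (h3.1.mono_set (Ioc_subset_Ioc_right htT.2)) p,
      integral_of_le htT.1.le]
    congr 1
    refine integral_congr_ae ?_
    filter_upwards [ae_mono hsub h2] with τ h4
    rw [← h4, mollSol]
  have i0 : Integrable (fun x => conv (hk 0 0) s θ₀ x ^ p) vol :=
    Integrable.of_bound ((integrable_conv (integrable_hk 0 0) s h.meas_θ₀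
        (bddMeas_integrable h.meas_θ₀ h.bound_θ₀)).1.pow p) (C ^ p)
      (ae_of_all _ fun x => by
        rw [norm_pow, norm_eq_abs]
        gcongr
        exact abs_conv_hk_le h.bound_θ₀ s x)
  have i1 : Integrable (fun x => ∫ τ in Ioc 0 t, p * conv (hk 0 0) s (θ τ) x ^ (p - 1) *
      mollRHS u θ s τ x) vol := hF.swap.integral_prod_left
  rw [e1, integral_add i0 i1, add_sub_cancel_left,
    integral_integral_swap (f := fun (x : T2) (τ : ℝ) => p * conv (hk 0 0) s (θ τ) x ^ (p - 1) *
      mollRHS u θ s τ x) hF.swap]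
  refine abs_integral_le_integral_abs.trans ?_
  refine (integral_mono_ae hF.integral_prod_left.abs (IntegrableOn.mono_set hbig
    (Ioc_subset_Ioc_right htT.2)) ?_).trans (setIntegral_mono_set hbig (ae_of_all _ fun τ => ?_)
      (Ioc_subset_Ioc_right htT.2).eventuallyLE)
  · filter_upwards [ae_mono hsub h.lip, ae_mono hsub h.div] with τ h1 h2
    obtain ⟨w, hw, hL⟩ := h1
    refine (le_of_eq ?_).trans (abs_integral_pow_mul_comm_le (meas_slice h.meas_θ τ)
      (h.bound_θ τ) hL (isDivFree_congr hw.symm h2) hs p)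
    congr 1
    refine integral_congr_ae ?_
    have hc : ∀ a, conv (gradK a) s (fun y => θ τ y * u τ y a) =ᵐ[vol]
        conv (gradK a) s (fun y => θ τ y * w y a) := fun a =>
      conv_congr_ae _ s ((meas_slice h.meas_θ τ).mul (meas_slice (measurable_coord h.meas_u a) τ))
        ((meas_slice h.meas_θ τ).mul ((fun a =>
            (continuous_of_lip fun x y => hL x y
                a).measurable) a)) (hw.mono fun x hx => by simp only [hx])
    filter_upwards [hc 0, hc 1] with x h3 h4
    simp only [mollRHS, sum_univ_two, h3, h4]
  · have := commMod_nonneg s (θ τ)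
    simp only [Pi.zero_apply]
    positivity

lemma TransportData.integral_pow_eq (h : TransportData u θ θ₀ T C B L) (p : ℕ) :
    ∀ᵐ t ∂ℓ(T), ∫ x, θ t x ^ p ∂vol = ∫ x, θ₀ x ^ p ∂vol := by
  have hlim : (fun n => ∫ τ in Ioc 0 T, p * C ^ (p - 1) * (2 * π) *
      (|L τ| * commMod (scale n) (θ τ))) ⇝ 0 := by
    have e : 𝓝 (0 : ℝ) = 𝓝 (∫ τ in Ioc (0 : ℝ) T, (0 : ℝ)) := by simp
    rw [e]
    refine tendsto_integral_of_dominated_convergence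
      (fun τ => |p * C ^ (p - 1) * (2 * π)| * (|L τ| * (commMass * (2 * C)))) (fun n => ?_)
      ((h.int_L.abs.mul_const _).const_mul _) (fun n => ae_of_all _ fun τ => ?_)
      (ae_of_all _ fun τ => ?_)
    · exact ((h.meas_L.abs.mul (measurable_commMod h.meas_θ _)).const_mul _).aestronglyMeasurable
    · rw [norm_mul, norm_eq_abs (_ * _ * _), norm_mul |L τ|, norm_eq_abs |L τ|, abs_abs,
        norm_of_nonneg (commMod_nonneg _ _)]
      gcongr
      exact commMod_le (h.bound_θ τ) _
    · have := ((tendsto_commMod (meas_slice h.meas_θ τ) (h.bound_θ τ)).const_mul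
        |L τ|).const_mul (p * C ^ (p - 1) * (2 * π))
      simpa using this
  filter_upwards [(ae_all_iff.2 fun n => h.abs_integral_pow_sub_le (scale_pos n) p)] with t ht
  have h2 := le_of_tendsto_of_tendsto'
      (((tendsto_integral_conv_pow (meas_slice h.meas_θ t) (h.bound_θ t) p).sub
      (tendsto_integral_conv_pow h.meas_θ₀ h.bound_θ₀ p)).abs) hlim ht
  have h3 := abs_nonpos_iff.1 h2
  linarith

end Renormalization

lemma ae_abs_le_of_integral_pow_le (hf : Measurable f) (hC : ∀ᵐ x ∂vol, |f x| ≤ C) (hM : 0 ≤ M) (h :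
    ∀ q : ℕ, ∫ x, f x ^ (2 * q) ∂vol ≤ M ^ (2 * q)) : ∀ᵐ x ∂vol, |f x| ≤ M := by
  have key : ∀ n : ℕ, ∀ᵐ x ∂vol, |f x| ≤ M + 1 / (n + 1) := fun n => by
    set M' : ℝ := M + 1 / (n + 1) with hM'
    have hpos : (0 : ℝ) < 1 / (n + 1) := by positivity
    have hM'0 : 0 < M' := by positivity
    have hle : ∀ q : ℕ, vol.real {x | M' ≤ |f x|} ≤ ((M / M') ^ 2) ^ q := fun q => by
      have hi : Integrable (fun x => f x ^ (2 * q)) vol :=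
        Integrable.of_bound (hf.pow_const _).aestronglyMeasurable (C ^ (2 * q)) (by
          filter_upwards [hC] with x hx
          rw [norm_pow, norm_eq_abs]
          gcongr)
      have h1 := mul_meas_ge_le_integral_of_nonneg (ae_of_all _ fun x =>
        (even_two_mul q).pow_nonneg (f x)) hi (M' ^ (2 * q))
      have h2 : vol.real {x | M' ≤ |f x|} ≤ vol.real {x | M' ^ (2 * q) ≤ f x ^ (2 * q)} := by
        refine measureReal_mono fun x hx => ?_
        simp only [mem_ofPred_eq] at hx ⊢
        rw [← (even_two_mul q).pow_abs (f x)]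
        gcongr
      have h3 : M' ^ (2 * q) * vol.real {x | M' ≤ |f x|} ≤ M ^ (2 * q) :=
        (mul_le_mul_of_nonneg_left h2 (by positivity)).trans (h1.trans (h q))
      rw [← pow_mul, div_pow, le_div_iff₀ (by positivity)]
      linarith
    have hlt : (M / M') ^ 2 < 1 := by
      have : M / M' < 1 := (div_lt_one hM'0).2 (by linarith)
      have h0 : 0 ≤ M / M' := by positivity
      nlinarith
    have hz : vol.real {x | M' ≤ |f x|} ≤ 0 :=
      ge_of_tendsto' (tendsto_pow_atTop_nhds_zero_of_lt_one (by positivity) hlt) hle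
    have hz' : vol {x | M' ≤ |f x|} = 0 :=
      (measureReal_eq_zero_iff).1 (le_antisymm hz measureReal_nonneg)
    rw [ae_iff]
    refine measure_mono_null (fun x hx => ?_) hz'
    simp only [mem_ofPred_eq, not_le] at hx ⊢
    exact hx.le
  filter_upwards [ae_all_iff.2 key] with x hx
  have : (fun n : ℕ => M + 1 / ((n : ℝ) + 1)) ⇝ (M + 0) :=
    tendsto_const_nhds.add tendsto_one_div_add_atTop_nhds_zero_nat
  rw [add_zero] at this
  exact ge_of_tendsto' this hx

/-- Truncation to `[-C, C]`. -/
def clamp (C y : ℝ) : ℝ := max (-C) (min C y)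

lemma abs_clamp_le (hC : 0 ≤ C) (y : ℝ) : |clamp C y| ≤ C :=
  abs_le.2 ⟨le_max_left _ _, max_le (by linarith) (min_le_left _ _)⟩

lemma clamp_eq {y : ℝ} (h : |y| ≤ C) : clamp C y = y := by
  rw [abs_le] at h
  simp [clamp, h.1, h.2]

lemma measurable_clamp (C : ℝ) : Measurable (clamp C) :=
  measurable_const.max (measurable_const.min measurable_id)

/-- Powers of the temperature are conserved by a divergence-free Lipschitz flow. -/
theorem integral_pow_eq_of_transport
    (h : Adm u θ) (hθ₀m : AEMeasurable θ₀ vol) (hθ₀ : ∀ᵐ x ∂vol, |θ₀ x| ≤ M)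
    (ht : SolvesTransport u θ θ₀) (hL : ∀ T > 0, MemL1Lip T u)
    (hd : ∀ᵐ t ∂ℓ, IsDivFree (u t)) (p : ℕ) :
    ∀ᵐ t ∂ℓ, ∫ x, θ t x ^ p ∂vol = ∫ x, θ₀ x ^ p ∂vol := by
  refine ae_Ioi_of_forall_Ioc fun T hT => ?_
  obtain ⟨C, hC⟩ := h.bound T hT
  obtain ⟨L, hLi, hLip⟩ := hL T hT
  rw [restrict_Icc] at hLip
  replace hLi : IntegrableOn L (Ioc 0 T) := hLi.mono_set Ioc_subset_Icc_self
  set D : ℝ := max C (max M 0)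
  have hD0 : 0 ≤ D := (le_max_right _ _).trans (le_max_right _ _)
  set θ' : ScalarField := fun t x => clamp D (θ t x)
  set θ₀' : T2 → ℝ := fun x => clamp D (hθ₀m.mk θ₀ x)
  have e0 : θ₀ =ᵐ[vol] θ₀' := by
    filter_upwards [hθ₀, hθ₀m.ae_eq_mk] with x h1 h2
    simp only [θ₀', ← h2]
    rw [clamp_eq (h1.trans ((le_max_left _ _).trans (le_max_right _ _)))]
  have e1 : ∀ᵐ t ∂ℓ(T), θ t =ᵐ[vol] θ' t := by
    filter_upwards [hC] with t h1
    filter_upwards [h1.2] with x h2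
    simp only [θ']
    rw [clamp_eq (h2.trans (le_max_left _ _))]
  have data : TransportData u θ' θ₀' T D C (hLi.1.mk L) := by
    constructor
    · exact hT
    · exact h.meas_u
    · exact (measurable_clamp D).comp h.meas_θ
    · exact (measurable_clamp D).comp hθ₀m.measurable_mk
    · exact hLi.1.stronglyMeasurable_mk.measurable
    · exact fun t x => abs_clamp_le hD0 _
    · exact fun x => abs_clamp_le hD0 _
    · exact (integrable_congr hLi.1.ae_eq_mk).1 hLi
    · filter_upwards [hC] with t h1 i
      exact ⟨(h1.1 i).1, integral_sq_le_of_h1NormSq (h1.1 i).1 (h1.1 i).2⟩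
    · filter_upwards [hLip, hLi.1.ae_eq_mk] with t h1 h2
      rwa [← h2]
    · exact ae_Ioc hd T
    · intro k
      have hf : ∀ᵐ s ∂ℓ(T), transForce u θ k s = transForce u θ' k s := by
        filter_upwards [e1] with s hs
        unfold transForce
        congr 1
        refine sum_congr rfl fun i _ => ?_
        rw [coeff_congr (f := fun x => θ s x * u s x i) (g := fun x => θ' s x * u s x i)
          (hs.mono fun x hx => by simp only [hx])]
      filter_upwards [ae_Ioc (coeff_transport h
          (Integrable.of_bound hθ₀m.aestronglyMeasurable M hθ₀) ht
              k) T, e1, ae_mem_Ioc] with t h1 h2 h3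
      rw [← coeff_congr h2, ← coeff_congr e0, h1]
      congr 1
      rw [integral_of_le h3.1.le, integral_of_le h3.1.le]
      exact integral_congr_ae (ae_restrict_of_ae_restrict_of_subset (Ioc_subset_Ioc_right h3.2) hf)
  filter_upwards [data.integral_pow_eq p, e1] with t h1 h2
  have e2 : ∫ x, θ t x ^ p ∂vol = ∫ x, θ' t x ^ p ∂vol :=
    integral_congr_ae (h2.mono fun x hx => by simp only [hx])
  rw [e2, h1]
  exact integral_congr_ae (e0.mono fun x hx => by simp only [hx])

/-- The maximum principle. -/
theorem ae_abs_le_of_transport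
    (h : Adm u θ) (hθ₀m : AEMeasurable θ₀ vol) (hθ₀ : ∀ᵐ x ∂vol, |θ₀ x| ≤ M)
    (hM : 0 ≤ M) (ht : SolvesTransport u θ θ₀) (hL : ∀ T > 0, MemL1Lip T u)
    (hd : ∀ᵐ t ∂ℓ, IsDivFree (u t)) :
    ∀ᵐ t ∂ℓ, ∀ᵐ x ∂vol, |θ t x| ≤ M := by
  filter_upwards [ae_all_iff.2 fun q : ℕ => integral_pow_eq_of_transport h hθ₀m hθ₀ ht hL hd (2 *
      q),
    h.slice] with t h1 h2
  obtain ⟨C, hC⟩ := h2.2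
  refine ae_abs_le_of_integral_pow_le (meas_slice h.meas_θ t) hC hM fun q => ?_
  rw [h1 q]
  have := integral_mono_of_nonneg (ae_of_all vol fun x => (even_two_mul q).pow_nonneg (θ₀ x))
    (integrable_const (M ^ (2 * q))) (hθ₀.mono fun x hx => by
      simp only
      rw [← (even_two_mul q).pow_abs]
      gcongr)
  simpa using this

/-! ### Lipschitz regularity of the Stokes flow -/

lemma exists_sc_eq (h : T2) : ∃ a : ℝ × ℝ, sc 1 a = h ∧ |a.1| ≤ ‖h‖ ∧ |a.2| ≤ ‖h‖ := by
  have key : ∀ i, ∃ a : ℝ, (a : 𝕊) = h i ∧ |a| ≤ ‖h‖ := fun i => by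
    obtain ⟨y, hy⟩ := QuotientAddGroup.mk_surjective (h i)
    refine ⟨y - round y, ?_, ?_⟩
    · rw [AddCircle.coe_sub, ← hy]
      have : ((round y : ℝ) : 𝕊) = 0 := by
        rw [AddCircle.coe_eq_zero_iff]
        exact ⟨round y, by simp⟩
      rw [this, sub_zero]
    · rw [← UnitAddCircle.norm_eq]
      have : ((y : ℝ) : 𝕊) = h i := hy
      rw [this]
      exact norm_le_pi_norm h i
  obtain ⟨a, ha, ha'⟩ := key 0
  obtain ⟨b, hb, hb'⟩ := key 1
  refine ⟨(a, b), ?_, ha', hb'⟩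
  ext i
  fin_cases i
  · simpa [sc] using ha
  · simpa [sc] using hb

/-- A Lipschitz bound along translations by representatives. -/
lemma lip_of_translate {K : ℝ} (hK : 0 ≤ K) (h : ∀ x a, |g (x + sc 1 a) - g x| ≤ K * (|a.1| +
    |a.2|)) (x y : T2) : |g x - g y| ≤ 2 * K * dist x y := by
  obtain ⟨a, ha, h1, h2⟩ := exists_sc_eq (x - y)
  have h3 := h y a
  rw [ha, add_sub_cancel] at h3
  rw [dist_eq_norm]
  nlinarith

lemma mFourier_sc_one (k : Z2) (a : ℝ × ℝ) : mFourier k (sc 1 a) =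
    Complex.exp (I * (2 * π * (k 0 * a.1 + k 1 * a.2) : ℝ)) := by
  rw [mFourier_sc, ← Complex.exp_add]
  congr 1
  push_cast
  ring

lemma fser_translate_sub_le (hc : Rapid c) (x : T2) (a : ℝ × ℝ) : |fser c (x + sc 1 a) - fser c x| ≤
    (2 * π * ∑' k, ‖k‖ * ‖c k‖) * (|a.1| + |a.2|) := by
  have hs : Summable fun k => ‖k‖ * ‖c k‖ := by simpa using hc 1
  have h1 : ∀ y, Summable fun k => c k * mFourier k y := summable_mul_mFourier hc.summable_norm
  rw [fser, fser, ← sub_re, ← (h1 _).tsum_sub (h1 _)]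
  refine (Complex.abs_re_le_norm _).trans ?_
  have hb : ∀ k, ‖c k * mFourier k (x + sc 1 a) - c k * mFourier k x‖ ≤
      (‖k‖ * ‖c k‖) * (2 * π * (|a.1| + |a.2|)) := fun k => by
    have e : c k * mFourier k (x + sc 1 a) - c k * mFourier k x =
        c k * mFourier k x * (mFourier k (sc 1 a) - 1) := by
      rw [mFourier_add_apply]; ring
    rw [e, norm_mul, norm_mul, norm_mFourier_apply, mul_one, mFourier_sc_one]
    have h3 : |2 * π * (k 0 * a.1 + k 1 * a.2)| ≤ 2 * π * (‖k‖ * (|a.1| + |a.2|)) := by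
      rw [abs_mul, abs_of_pos (by positivity : (0 : ℝ) < 2 * π)]
      gcongr
      refine (abs_add_le _ _).trans ?_
      rw [abs_mul, abs_mul, mul_add]
      gcongr
      · exact norm_int_le k 0
      · exact norm_int_le k 1
    calc _ ≤ ‖c k‖ * (2 * π * (‖k‖ * (|a.1| + |a.2|))) := by
          gcongr
          exact Real.norm_exp_I_mul_ofReal_sub_one_le.trans h3
      _ = _ := by ring
  refine (tsum_of_norm_bounded (hs.mul_right _).hasSum hb).trans (le_of_eq ?_)
  rw [tsum_mul_right]
  ring

lemma coeff_fser (hc : Summable fun k => ‖c k‖) (hh : ∀ k, c (-k) = conj (c k))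
    (j : Z2) : coeff (fser c) j = c j := by
  rw [← sub_eq_zero]
  refine eq_zero_of_forall_re_mul_conj fun z => ?_
  have hi' : Integrable (fser (single j z)) vol := (memLp_cont (continuous_fser
      ((rapid_single j z).summable_norm))).l1
  have h1 := hasSum_integral_mul_fser hi' hc
  have h2 := integral_mul_fser_single ((memLp_cont (continuous_fser hc)).l1) j z
  have e : ∫ x, fser (single j z) x * fser c x ∂vol =
      ∫ x, fser c x * fser (single j z) x ∂vol := by simp_rw [mul_comm]
  rw [e, h2] at h1
  have h3 : HasSum (fun k => (c k * conj (coeff (fser (single j z)) k)).re)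
      ((c j * conj (z / 2)).re + (c (-j) * conj (conj z / 2)).re) := by
    have h4 : ∀ l w, HasSum (fun k => (c k * conj ((single l w : Z2 → ℂ) k)).re)
        (c l * conj w).re := fun l w => by
      convert hasSum_single l (fun k hk => ?_) using 1
      · simp
      · simp [hk]
    refine ((h4 j _).add (h4 (-j) _)).congr_fun fun k => ?_
    rw [coeff_fser_single, map_add, mul_add, add_re]
  have h4 := h1.unique h3
  rw [map_sub, mul_sub, sub_re, h4, hh]
  have c2 : conj (2 : ℂ) = 2 := by simp [Complex.ext_iff]
  simp only [map_div₀, c2, conj_conj, Complex.mul_re, conj_re, Complex.conj_im,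
    Complex.div_ofNat_re, Complex.div_ofNat_im]
  ring

lemma coeff_neg (f : T2 → ℝ) (k : Z2) : coeff f (-k) = conj (coeff f k) := by
  rw [coeff_eq, coeff_eq, ← integral_conj]
  refine integral_congr_ae (ae_of_all _ fun x => ?_)
  simp only [map_mul, conj_mFourier, conj_ofReal]

/-- The `L¹`-modulus of continuity of the product kernels. -/
def hkLip (m n : ℕ) : ℝ := (2 * π * ∫ x, |hg (m + 1) x|) * (∫ x, |hg n x|) +
  (∫ x, |hg m x|) * (2 * π * ∫ x, |hg (n + 1) x|)

lemma hkLip_nonneg (m n : ℕ) : 0 ≤ hkLip m n := by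
  unfold hkLip
  positivity

lemma integral_abs_hk_translate_sub (m n : ℕ) (a : ℝ × ℝ) :
    ∫ z, |hk m n (z + a) - hk m n z| ≤ hkLip m n * (|a.1| + |a.2|) := by
  have d : ∀ m (a : ℝ), Integrable fun x => |hg m (x + a) - hg m x| := fun m a =>
    (((integrable_hg m).comp_add_right a).sub (integrable_hg m)).abs
  have i1 : Integrable fun z : ℝ × ℝ => |hg m (z.1 + a.1) - hg m z.1| * |hg n (z.2 + a.2)| :=
    (d m a.1).mul_prod ((integrable_hg n).comp_add_right a.2).abs
  have i2 : Integrable fun z : ℝ × ℝ => |hg m z.1| * |hg n (z.2 + a.2) - hg n z.2| :=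
    (integrable_hg m).abs.mul_prod (d n a.2)
  have hle : ∫ z, |hk m n (z + a) - hk m n z| ≤ ∫ z : ℝ × ℝ,
      (|hg m (z.1 + a.1) - hg m z.1| * |hg n (z.2 + a.2)| +
        |hg m z.1| * |hg n (z.2 + a.2) - hg n z.2|) := by
    refine integral_mono_of_nonneg (ae_of_all _ fun z => abs_nonneg _) (i1.add i2)
      (ae_of_all _ fun z => ?_)
    simp only [hk, Prod.fst_add, Prod.snd_add]
    rw [← abs_mul, ← abs_mul]
    refine (le_of_eq ?_).trans (abs_add_le _ _)
    congr 1
    ring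
  refine hle.trans ?_
  rw [integral_add i1 i2]
  have e1 : ∫ z : ℝ × ℝ, |hg m (z.1 + a.1) - hg m z.1| * |hg n (z.2 + a.2)| =
      (∫ x, |hg m (x + a.1) - hg m x|) * ∫ x, |hg n (x + a.2)| :=
    integral_prod_mul (fun x => |hg m (x + a.1) - hg m x|) (fun x => |hg n (x + a.2)|)
  have e2 : ∫ z : ℝ × ℝ, |hg m z.1| * |hg n (z.2 + a.2) - hg n z.2| =
      (∫ x, |hg m x|) * ∫ x, |hg n (x + a.2) - hg n x| :=
    integral_prod_mul (fun x => |hg m x|) (fun x => |hg n (x + a.2) - hg n x|)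
  rw [e1, e2, integral_add_right_eq_self (fun x => |hg n x|) a.2]
  refine (add_le_add (mul_le_mul_of_nonneg_right (integral_abs_hg_translate_sub m a.1)
    (by positivity)) (mul_le_mul_of_nonneg_left (integral_abs_hg_translate_sub n a.2)
    (by positivity))).trans ?_
  unfold hkLip
  have q1 : 0 ≤ (2 * π * ∫ x, |hg (m + 1) x|) * (∫ x, |hg n x|) := by positivity
  have q2 : 0 ≤ (∫ x, |hg m x|) * (2 * π * ∫ x, |hg (n + 1) x|) := by positivity
  nlinarith [mul_nonneg q1 (abs_nonneg a.2), mul_nonneg q2 (abs_nonneg a.1)]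

lemma sc_sub (s : ℝ) (z w : ℝ × ℝ) : sc s (z - w) = sc s z - sc s w := by
  ext i
  fin_cases i <;> simp [sc, mul_sub]

lemma sc_inv_smul (hs : s ≠ 0) (a : ℝ × ℝ) : sc s (s⁻¹ • a) = sc 1 a := by
  ext i
  fin_cases i <;> simp [sc, hs]

lemma conv_hk_translate_sub_le (m n : ℕ) (hs : 0 < s) (hf : Measurable f) (hM : ∀ x, |f x| ≤ M) (x :
    T2) (a : ℝ × ℝ) : |conv (hk m n) s f (x + sc 1 a) - conv (hk m n) s f x| ≤ M * hkLip m n *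
    (|a.1| + |a.2|) * s⁻¹ := by
  have e : conv (hk m n) s f (x + sc 1 a) = ∫ z, hk m n (z + s⁻¹ • a) * f (x - sc s z) := by
    rw [conv, ← integral_add_right_eq_self _ (s⁻¹ • a)]
    refine integral_congr_ae (ae_of_all _ fun z => ?_)
    simp only
    congr 2
    have h1 := sc_sub s (z + s⁻¹ • a) (s⁻¹ • a)
    rw [add_sub_cancel_right, sc_inv_smul hs.ne'] at h1
    rw [h1]
    abel
  have j : ∀ b, Integrable fun z => hk m n (z + b) * f (x - sc s z) := fun b =>
    ((integrable_hk m n).comp_add_right b).mul_bdd (c := M) (hf.comp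
        (measurable_const.sub (continuous_sc s).measurable)).aestronglyMeasurable
      (ae_of_all _ fun z => hM _)
  have j0 : Integrable fun z => hk m n z * f (x - sc s z) := by simpa using j 0
  rw [e, conv, ← integral_sub (j _) j0]
  refine abs_integral_le_integral_abs.trans ?_
  have h1 : ∫ z, |hk m n (z + s⁻¹ • a) * f (x - sc s z) - hk m n z * f (x - sc s z)| ≤
      ∫ z, |hk m n (z + s⁻¹ • a) - hk m n z| * M := by
    refine integral_mono ((j _).sub j0).abs
      ((((integrable_hk m n).comp_add_right _).sub (integrable_hk m n)).abs.mul_const M) fun z => ?_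
    simp only
    rw [← sub_mul, abs_mul]
    exact mul_le_mul_of_nonneg_left (hM _) (abs_nonneg _)
  refine h1.trans ?_
  rw [integral_mul_const]
  have h2 := integral_abs_hk_translate_sub m n (s⁻¹ • a)
  simp only [Prod.smul_fst, Prod.smul_snd, smul_eq_mul, abs_mul, abs_of_pos (inv_pos.2 hs)] at h2
  refine (mul_le_mul_of_nonneg_right h2 ((abs_nonneg _).trans (hM 0))).trans (le_of_eq (by ring))

/-- The multiplier of the map `θ ↦ u_i` defined by the Stokes equation, without the mean. -/
def stokesMul (α : ℝ) (k : Z2) (i : Fin 2) : ℝ := leray k i 1 * freq k ^ (-(2 * α))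

lemma perp_zero (i : Fin 2) : perp 0 i = 0 := by fin_cases i <;> simp [perp]

/-- The small-time part of the heat representation of the Stokes multiplier. -/
def heatNear (α : ℝ) (k : Z2) : ℝ :=
  ∫ τ in (0 : ℝ)..1, τ ^ α * exp (-(π * ksq k * τ))

/-- The large-time part of the heat representation of the Stokes multiplier. -/
def heatFar (α : ℝ) (k : Z2) : ℝ :=
  ∫ τ in Ioi (1 : ℝ), τ ^ α * exp (-(π * ksq k * τ))

/-- The normalization of the heat representation. -/
def heatConst (α : ℝ) : ℝ :=
  (2 * π) ^ (-(2 * α)) * π ^ (α + 1) / Gamma (α + 1)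

lemma integrableOn_heat (hα : 0 < α) {r : ℝ} (hr : 0 < r) :
    IntegrableOn (fun τ : ℝ => τ ^ α * exp (-(r * τ))) (Ioi 0) := by
  have := integrableOn_rpow_mul_exp_neg_mul_rpow (s := α) (b := r) (p := 1) (by linarith) one_pos hr
  simpa using this

lemma stokesMul_eq (hα : 0 < α) (k : Z2) (i : Fin 2) :
    stokesMul α k i = heatConst α * (perp k i * perp k 1) * (heatNear α k + heatFar α k) := by
  by_cases hk : k = 0
  · subst hk
    simp [stokesMul, leray, perp_zero]
  have hq := ksq_pos hk
  have hr : 0 < π * ksq k := by positivity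
  have hi := integrableOn_heat hα hr
  have h1 : heatNear α k + heatFar α k = (1 / (π * ksq k)) ^ (α + 1) * Gamma (α + 1) := by
    rw [← Real.integral_rpow_mul_exp_neg_mul_Ioi (by linarith : (0 : ℝ) < α + 1) hr, heatNear,
      heatFar, integral_of_le zero_le_one, ← setIntegral_union
        (Ioc_disjoint_Ioi le_rfl) measurableSet_Ioi (hi.mono_set Ioc_subset_Ioi_self)
        (hi.mono_set (Ioi_subset_Ioi zero_le_one)), Ioc_union_Ioi_eq_Ioi zero_le_one]
    simp
  have hG : Gamma (α + 1) ≠ 0 := (Real.Gamma_pos_of_pos (by linarith)).ne'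
  have hfr : freq k = 2 * π * √(ksq k) := rfl
  have h2 : freq k ^ (-(2 * α)) = (2 * π) ^ (-(2 * α)) * ksq k ^ (-α) := by
    rw [hfr, mul_rpow (by positivity) (sqrt_nonneg _), Real.sqrt_eq_rpow, ← Real.rpow_mul hq.le]
    congr 2
    ring
  have h3 : (1 / (π * ksq k)) ^ (α + 1) = (π ^ (α + 1))⁻¹ * (ksq k ^ (-α) / ksq k) := by
    rw [one_div, Real.inv_rpow hr.le, mul_rpow pi_pos.le hq.le, mul_inv,
      rpow_add_one hq.ne', rpow_neg hq.le]
    field_simp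
  have hp : (π : ℝ) ^ (α + 1) ≠ 0 := (rpow_pos_of_pos pi_pos _).ne'
  rw [h1, h3, stokesMul, h2, leray, heatConst]
  field_simp

lemma heatFar_nonneg (α : ℝ) (k : Z2) : 0 ≤ heatFar α k :=
  setIntegral_nonneg measurableSet_Ioi fun _ hτ =>
    mul_nonneg (rpow_nonneg (zero_le_one.trans (le_of_lt (mem_Ioi.1 hτ))) _) (exp_pos _).le

/-- The constant in the decay of `heatFar`. -/
def heatFarConst (α : ℝ) : ℝ := ∫ τ in Ioi (1 : ℝ), τ ^ α * exp (-(π / 2 * τ))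

lemma heatFarConst_nonneg (α : ℝ) : 0 ≤ heatFarConst α :=
  setIntegral_nonneg measurableSet_Ioi fun _ hτ =>
    mul_nonneg (rpow_nonneg (zero_le_one.trans (le_of_lt (mem_Ioi.1 hτ))) _) (exp_pos _).le

lemma heatFar_le (hα : 0 < α) (hk : k ≠ 0) : heatFar α k ≤ heatFarConst α * gmul (1 / √2) k := by
  have hq := one_le_ksq hk
  rw [heatFar, heatFarConst, ← integral_mul_const]
  refine setIntegral_mono_on ((integrableOn_heat hα (by positivity)).mono_set
    (Ioi_subset_Ioi zero_le_one)) (((integrableOn_heat hα (by positivity)).mono_set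
    (Ioi_subset_Ioi zero_le_one)).mul_const _) measurableSet_Ioi fun τ hτ => ?_
  have hτ : (1 : ℝ) < τ := hτ
  rw [mul_assoc (τ ^ α), gmul, ← exp_add]
  have h0 : 0 ≤ τ ^ α := by positivity
  gcongr
  rw [div_pow, sq_sqrt zero_le_two]
  have : 0 ≤ π * ((τ - 1) * (ksq k - 1)) := by
    have := sub_nonneg.2 hq
    have := sub_nonneg.2 hτ.le
    positivity
  have h2 : 0 ≤ π * (τ * ksq k - τ / 2 - ksq k / 2) := by
    refine mul_nonneg pi_pos.le ?_
    nlinarith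
  linarith

/-- The singular part of the Stokes flow. -/
def nearPart (m n : ℕ) (α : ℝ) (f : T2 → ℝ) (x : T2) : ℝ :=
  ∫ τ in (0 : ℝ)..1, τ ^ (α - 1) * conv (hk m n) (√τ) f x

lemma integrableOn_rpow_sub_one (hα : 0 < α) : IntegrableOn (fun τ : ℝ => τ ^ (α - 1)) (Ioc 0 1) :=
  (intervalIntegrable_iff_integrableOn_Ioc_of_le zero_le_one).1
    (intervalIntegrable_rpow' (by linarith))

section NearPart

variable (hf : Measurable f) (hM : ∀ x, |f x| ≤ M)
include hf hM

omit hM in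
lemma measurable_conv_scale (m n : ℕ) : Measurable fun p : ℝ × T2 =>
    conv (hk m n) (√p.1) f p.2 := by
  have hm : StronglyMeasurable fun q : (ℝ × T2) × (ℝ × ℝ) =>
      hk m n q.2 * f (q.1.2 - sc (√q.1.1) q.2) := by
    refine Measurable.stronglyMeasurable (((continuous_hk m n).measurable.comp measurable_snd).mul
        ?_)
    refine hf.comp ((measurable_snd.comp measurable_fst).sub ?_)
    exact continuous_sc_uncurry.measurable.comp (((continuous_sqrt.measurable.comp
      (measurable_fst.comp measurable_fst))).prodMk measurable_snd)
  exact (hm.integral_prod_right' (ν := (volume : Measure (ℝ × ℝ)))).measurable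

lemma integrable_nearPart (m n : ℕ) (hα : 0 < α) : Integrable (uncurry fun (τ : ℝ) x => τ ^ (α - 1)
    * conv (hk m n) (√τ) f x) ((volume.restrict (Ioc 0 1)).prod vol) := by
  exact ((integrableOn_rpow_sub_one hα).comp_fst vol).mul_bdd (c := (∫ z, |hk m n z|) * M)
    (measurable_conv_scale hf m n).aestronglyMeasurable
    (ae_of_all _ fun p => abs_conv_le (integrable_hk m n) _ hM _)

lemma integrableOn_nearPart (m n : ℕ) (hα : 0 < α) (x : T2) :
    IntegrableOn (fun τ : ℝ => τ ^ (α - 1) * conv (hk m n) (√τ) f x) (Ioc 0 1) := by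
  exact (integrableOn_rpow_sub_one hα).mul_bdd (c := (∫ z, |hk m n z|) * M)
    ((measurable_conv_scale hf m n).comp (measurable_id.prodMk
        measurable_const)).aestronglyMeasurable
    (ae_of_all _ fun p => abs_conv_le (integrable_hk m n) _ hM _)

lemma coeff_nearPart {m n : ℕ} (hmn : m + n = 2) (hα : 0 < α) (k : Z2) : coeff (nearPart m n α f) k
    = (-I * k 0) ^ m * (-I * k 1) ^ n * heatNear α k * coeff f k := by
  refine (coeff_integral_time zero_le_one (integrable_nearPart hf hM m n hα) k).trans ?_
  rw [heatNear, ← intervalIntegral.integral_ofReal, ← intervalIntegral.integral_const_mul,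
    ← intervalIntegral.integral_mul_const, integral_of_le zero_le_one, integral_of_le zero_le_one]
  refine setIntegral_congr_fun measurableSet_Ioc fun τ hτ => ?_
  rw [coeff_const_mul, coeff_conv_hk m n _ hf (bddMeas_integrable hf hM), gmul, sq_sqrt hτ.1.le]
  have e1 : (τ : ℝ) ^ α = τ ^ (α - 1) * (√τ) ^ m * (√τ) ^ n := by
    rw [mul_assoc, ← pow_add, hmn, sq_sqrt hτ.1.le, ← rpow_add_one hτ.1.ne']
    congr 1
    ring
  rw [e1, show -(π * ksq k * τ) = -π * τ * ksq k by ring]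
  push_cast
  ring

lemma nearPart_lip (m n : ℕ) (hα : 1 / 2 < α) (x : T2) (a : ℝ × ℝ) : |nearPart m n α f (x + sc 1 a)
    - nearPart m n α f x| ≤ (M * hkLip m n / (α - 1 / 2)) * (|a.1| + |a.2|) := by
  have hα0 : 0 < α := by linarith
  have i1 := integrableOn_nearPart hf hM m n hα0 (x + sc 1 a)
  have i2 := integrableOn_nearPart hf hM m n hα0 x
  rw [nearPart, nearPart, ← intervalIntegral.integral_sub (interval_of_Ioc zero_le_one i1)
    (interval_of_Ioc zero_le_one i2), integral_of_le zero_le_one]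
  have h2 : ∫ τ in Ioc (0 : ℝ) 1, τ ^ (α - 3 / 2) = 1 / (α - 1 / 2) := by
    rw [← integral_of_le zero_le_one, integral_rpow (Or.inl (by linarith)),
      Real.one_rpow, zero_rpow (by linarith)]
    congr 1 <;> ring
  have h3 : |∫ τ in Ioc (0 : ℝ) 1, (τ ^ (α - 1) * conv (hk m n) (√τ) f (x + sc 1 a) -
      τ ^ (α - 1) * conv (hk m n) (√τ) f x)| ≤
      ∫ τ in Ioc (0 : ℝ) 1, τ ^ (α - 3 / 2) * (M * hkLip m n * (|a.1| + |a.2|)) := by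
    refine abs_integral_le_integral_abs.trans (setIntegral_mono_on (i1.sub i2).abs
      (((intervalIntegrable_iff_integrableOn_Ioc_of_le zero_le_one).1
          (intervalIntegrable_rpow' (by linarith))).mul_const _)
      measurableSet_Ioc fun τ hτ => ?_)
    have hp : 0 ≤ τ ^ (α - 1) := rpow_nonneg hτ.1.le _
    rw [← mul_sub, abs_mul, abs_of_nonneg hp]
    have := conv_hk_translate_sub_le m n (Real.sqrt_pos.2 hτ.1) hf hM x a
    refine (mul_le_mul_of_nonneg_left this hp).trans (le_of_eq ?_)
    rw [show α - 3 / 2 = α - 1 + -(1 / 2) by ring, rpow_add hτ.1, rpow_neg hτ.1.le,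
      ← Real.sqrt_eq_rpow]
    ring
  refine h3.trans (le_of_eq ?_)
  rw [integral_mul_const, h2]
  ring

end NearPart

/-- The smooth part of the Stokes flow. -/
def farCoeff (α : ℝ) (i : Fin 2) (f : T2 → ℝ) (k : Z2) : ℂ :=
  (heatConst α * (perp k i * perp k 1) * heatFar α k : ℝ) * coeff f k

/-- The size of the multiplier of the smooth part. -/
def farBound (α : ℝ) (k : Z2) : ℝ :=
  |heatConst α| * heatFarConst α * (‖k‖ ^ 2 * gmul (1 / √2) k)

lemma farBound_nonneg (α : ℝ) (k : Z2) : 0 ≤ farBound α k := by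
  have := heatFarConst_nonneg α
  have := gmul_pos (1 / √2) k
  unfold farBound
  positivity

lemma abs_perp_le (k : Z2) (i : Fin 2) : |perp k i| ≤ ‖k‖ := by
  fin_cases i <;> simpa [perp] using norm_int_le k _

lemma norm_farCoeff_le (hα : 0 < α) (i : Fin 2)
    (hf : ∀ k, ‖coeff f k‖ ≤ M) (k : Z2) : ‖farCoeff α i f k‖ ≤ farBound α k * M := by
  rw [farCoeff, norm_mul, norm_real, norm_eq_abs]
  refine mul_le_mul ?_ (hf k) (norm_nonneg _) ?_
  · by_cases hk : k = 0
    · subst hk; simp [perp_zero, farBound]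
    rw [abs_mul, abs_mul, abs_mul, abs_of_nonneg (heatFar_nonneg α k), farBound]
    have h1 := heatFar_le hα hk
    have h2 : |perp k i| * |perp k 1| ≤ ‖k‖ ^ 2 := by
      rw [sq]
      exact mul_le_mul (abs_perp_le k i) (abs_perp_le k 1) (abs_nonneg _) (norm_nonneg _)
    have h3 := heatFar_nonneg α k
    calc |heatConst α| * (|perp k i| * |perp k 1|) * heatFar α k
        ≤ |heatConst α| * ‖k‖ ^ 2 * (heatFarConst α * gmul (1 / √2) k) := by gcongr
      _ = _ := by ring
  · exact farBound_nonneg α k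

lemma summable_farBound (α : ℝ) (n : ℕ) : Summable fun k => ‖k‖ ^ n * farBound α k := by
  have := (summable_pow_mul_gmul (s := 1 / √2) (by positivity) (n + 2)).mul_left
    (|heatConst α| * heatFarConst α)
  refine this.congr fun k => ?_
  simp only [farBound]
  ring

lemma rapid_farCoeff (hα : 0 < α) (i : Fin 2)
    (hf : ∀ k, ‖coeff f k‖ ≤ M) : Rapid (farCoeff α i f) := fun n => by
  refine Summable.of_nonneg_of_le (fun k => by positivity) (fun k => ?_)
    ((summable_farBound α n).mul_right M)
  rw [mul_assoc]
  exact mul_le_mul_of_nonneg_left (norm_farCoeff_le hα i hf k) (by positivity)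

lemma ksq_neg (k : Z2) : ksq (-k) = ksq k := by simp [ksq]

lemma perp_neg (k : Z2) (i : Fin 2) : perp (-k) i = -perp k i := by fin_cases i <;> simp [perp]

lemma farCoeff_neg (α : ℝ) (i : Fin 2) (f : T2 → ℝ) (k : Z2) :
    farCoeff α i f (-k) = conj (farCoeff α i f k) := by
  simp only [farCoeff, map_mul, conj_ofReal, coeff_neg, perp_neg, heatFar, ksq_neg, neg_mul_neg]

/-- The Lipschitz constant of the Stokes flow of a temperature bounded by one. -/
def stokesLip (α : ℝ) : ℝ := 2 * (|heatConst α| * ((hkLip 1 1 + hkLip 2 0) / (α - 1 / 2)) +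
  2 * π * ∑' k, ‖k‖ * farBound α k)

lemma stokesLip_nonneg (hα : 1 / 2 < α) : 0 ≤ stokesLip α := by
  have h3 : 0 < α - 1 / 2 := by linarith
  rw [stokesLip]
  exact mul_nonneg zero_le_two (add_nonneg (mul_nonneg (abs_nonneg _)
    (div_nonneg (add_nonneg (hkLip_nonneg 1 1) (hkLip_nonneg 2 0)) h3.le)) (mul_nonneg
        Real.two_pi_pos.le
        (tsum_nonneg fun k => mul_nonneg (norm_nonneg _) (farBound_nonneg α k))))

lemma exists_stokes_kernel (i : Fin 2) : ∃ (m n : ℕ) (σ : ℝ), m + n = 2 ∧ |σ| ≤ 1 ∧ hkLip m n ≤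
    hkLip 1 1 + hkLip 2 0 ∧ ∀ k : Z2, (σ : ℂ) * ((-I * k 0) ^ m * (-I * k 1) ^ n) = ((perp k i *
    perp k 1 : ℝ) : ℂ) := by
  have h1 := hkLip_nonneg 1 1
  have h2 := hkLip_nonneg 2 0
  fin_cases i
  · refine ⟨1, 1, 1, rfl, by simp, by linarith, fun k => ?_⟩
    have : perp k ((fun i => i) ⟨0, by norm_num⟩) = -(k 1 : ℝ) := rfl
    have h3 : perp k 1 = (k 0 : ℝ) := rfl
    rw [this, h3]
    push_cast
    linear_combination (k 0 * k 1 : ℂ) * Complex.I_sq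
  · refine ⟨2, 0, -1, rfl, by simp, by linarith, fun k => ?_⟩
    have : perp k ((fun i => i) ⟨1, by norm_num⟩) = (k 0 : ℝ) := rfl
    have h3 : perp k 1 = (k 0 : ℝ) := rfl
    rw [this, h3]
    push_cast
    linear_combination (-(k 0 : ℂ) * k 0) * Complex.I_sq

/-- The Stokes flow of a bounded temperature is Lipschitz, since `α > 1/2`. -/
theorem exists_stokes_flow (hα : 1 / 2 < α) (hf : Measurable f)
    (hM : ∀ x, |f x| ≤ M) (i : Fin 2) : ∃ W : T2 → ℝ,
      (∀ x y, |W x - W y| ≤ stokesLip α * M * dist x y) ∧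
      ∀ k, coeff W k = stokesMul α k i * coeff f k := by
  have hα0 : 0 < α := by linarith
  have hM0 : 0 ≤ M := (abs_nonneg _).trans (hM 0)
  have hfk : ∀ k, ‖coeff f k‖ ≤ M := fun k => (norm_coeff_le f k).trans (by
    have := integral_mono_of_nonneg (ae_of_all vol fun x => abs_nonneg (f x))
      (integrable_const M) (ae_of_all _ hM)
    simpa using this)
  have hr := rapid_farCoeff hα0 i hfk
  obtain ⟨m, n, σ, hmn, hσ, hlip, hsym⟩ := exists_stokes_kernel i
  refine ⟨fun x => heatConst α * σ * nearPart m n α f x + fser (farCoeff α i f) x,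
    fun x y => ?_, fun k => ?_⟩
  · have hK : 0 ≤ stokesLip α * M / 2 := by have := stokesLip_nonneg hα; positivity
    have := lip_of_translate (g := fun x => heatConst α * σ * nearPart m n α f x +
      fser (farCoeff α i f) x) hK (fun x a => by
          have h1 := nearPart_lip hf hM m n hα x a
          have h2 := fser_translate_sub_le hr x a
          have h3 : ∑' k, ‖k‖ * ‖farCoeff α i f k‖ ≤ (∑' k, ‖k‖ * farBound α k) * M := by
            rw [← tsum_mul_right]
            refine Summable.tsum_le_tsum (fun k => ?_) (by simpa using hr 1)
              ((by simpa using summable_farBound α 1 : Summable fun k => ‖k‖ * farBound α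
                  k).mul_right M)
            rw [mul_assoc]
            exact mul_le_mul_of_nonneg_left (norm_farCoeff_le hα0 i hfk k) (norm_nonneg _)
          have h4 : 0 < α - 1 / 2 := by linarith
          have hs : 0 ≤ |a.1| + |a.2| := by positivity
          have h5 : |heatConst α * σ * (nearPart m n α f (x + sc 1 a) - nearPart m n α f x)| ≤
              |heatConst α| * ((M * (hkLip 1 1 + hkLip 2 0) / (α - 1 / 2)) * (|a.1| + |a.2|)) := by
            rw [abs_mul, abs_mul]
            have : |heatConst α| * |σ| ≤ |heatConst α| := mul_le_of_le_one_right (abs_nonneg _) hσ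
            refine mul_le_mul this (h1.trans ?_) (abs_nonneg _) (abs_nonneg _)
            gcongr
          calc _ = |heatConst α * σ * (nearPart m n α f (x + sc 1 a) - nearPart m n α f x) +
                (fser (farCoeff α i f) (x + sc 1 a) - fser (farCoeff α i f) x)| := by congr 1; ring
            _ ≤ _ := abs_add_le _ _
            _ ≤ |heatConst α| * ((M * (hkLip 1 1 + hkLip 2 0) / (α - 1 / 2)) * (|a.1| + |a.2|)) +
                (2 * π * ((∑' k, ‖k‖ * farBound α k) * M)) * (|a.1| + |a.2|) := by
                  refine add_le_add h5 (h2.trans ?_)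
                  gcongr
            _ = _ := by
              unfold stokesLip
              ring) x y
    refine this.trans (le_of_eq (by ring))
  · have hni : Integrable (nearPart m n α f) vol := by
      have := (integrable_nearPart hf hM m n hα0).swap.integral_prod_left
      refine this.congr (ae_of_all _ fun x => ?_)
      simp only [nearPart]
      rw [integral_of_le zero_le_one]
      rfl
    rw [coeff_add (hni.const_mul _)
        ((memLp_cont (continuous_fser hr.summable_norm)).l1), coeff_const_mul, coeff_nearPart hf hM
            hmn hα0,
      coeff_fser hr.summable_norm (farCoeff_neg α i f), farCoeff, stokesMul_eq hα0]
    have := hsym k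
    push_cast at this ⊢
    linear_combination (heatConst α * heatNear α k * coeff f k : ℂ) * this

/-! ### A product estimate -/

lemma tsum_mul_sq_le {ι : Type*} (f g : ι → ℝ≥0∞) :
    (∑' j, f j * g j) ^ 2 ≤ (∑' j, f j ^ 2) * ∑' j, g j ^ 2 := by
  let _ : MeasurableSpace ι := ⊤
  have h := ENNReal.lintegral_mul_le_Lp_mul_Lq (Measure.count : Measure ι)
    Real.HolderConjugate.two_two (f := f) (g := g) measurable_from_top.aemeasurable
    measurable_from_top.aemeasurable
  simp only [lintegral_count] at h
  refine (pow_le_pow_left' h 2).trans (le_of_eq ?_)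
  rw [mul_pow, ← rpow_natCast, ← rpow_natCast, ← rpow_mul, ← rpow_mul]
  norm_num

lemma mFourierCoeff_mFourier_mul (g : T2 → ℝ) (k j : Z2) :
    mFourierCoeff (fun x => mFourier k x * (g x : ℂ)) j = coeff g (j - k) := by
  rw [coeff_eq, mFourierCoeff]
  refine integral_congr_ae (ae_of_all _ fun x => ?_)
  simp only
  rw [neg_sub, sub_eq_add_neg, mFourier_add]
  ring

lemma hasSum_coeff_mul (hf : MemLp f 2 vol) (hg : MemLp g 2 vol) (k : Z2) :
    HasSum (fun j => coeff f j * conj (coeff g (j - k))) (coeff (fun x => f x * g x) k) := by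
  have hf' : MemLp (fun x => (f x : ℂ)) 2 vol := hf.ofReal
  have hg' : MemLp (fun x => mFourier k x * (g x : ℂ)) 2 vol := by
    have hg1 : MemLp (fun x => (g x : ℂ)) 2 vol := hg.ofReal
    refine MemLp.of_le_mul (c := 1) hg1
      ((mFourier k).continuous.aestronglyMeasurable.mul hg1.1) (ae_of_all _ fun x => ?_)
    rw [norm_mul, norm_mFourier_apply]
  have hc : ∀ {h : T2 → ℂ} (hh : MemLp h 2 vol) (k : Z2),
      mFourierCoeff (hh.toLp : T2 → ℂ) k = mFourierCoeff h k := fun hh k =>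
    integral_congr_ae (hh.coeFn_toLp.mono fun x hx => by simp only [hx])
  have := UnitAddTorus.hasSum_prod_mFourierCoeff (d := Fin 2) hg'.toLp hf'.toLp
  simp_rw [hc hf', hc hg', mFourierCoeff_mFourier_mul] at this
  convert this using 1
  · ext j
    rw [mul_comm]; rfl
  · rw [coeff_eq]
    refine integral_congr_ae ?_
    filter_upwards [hf'.coeFn_toLp, hg'.coeFn_toLp] with x hx hy
    rw [hx, hy]
    simp only [map_mul, conj_mFourier, conj_ofReal]
    push_cast
    ring

/-- The weight `1 + |k|`. -/
def jw (k : Z2) : ℝ := 1 + ‖k‖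

lemma one_le_jw (k : Z2) : 1 ≤ jw k := by unfold jw; linarith [norm_nonneg k]

lemma jw_pos (k : Z2) : 0 < jw k := one_pos.trans_le (one_le_jw k)

lemma jw_le_add (j k : Z2) : jw k ≤ jw j + jw (j - k) := by
  unfold jw
  have : ‖k‖ ≤ ‖j‖ + ‖j - k‖ := by
    have := norm_sub_le j (j - k)
    simpa using this
  linarith

lemma summable_jw {p : ℝ} (hp : 2 < p) : Summable fun k => jw k ^ (-p) := by
  refine Summable.of_nonneg_of_le (fun k => (rpow_pos_of_pos (jw_pos k) _).le) (fun k => ?_)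
      ((summable_norm_rpow_neg hp).add
      (summable_of_ne_finset_zero (s := ({0} : Finset Z2)) (f := fun k : Z2 =>
        if k = 0 then (1 : ℝ) else 0) fun k hk => by simpa using hk))
  by_cases hk : k = 0
  · subst hk
    have : (0 : ℝ) ≤ ‖(0 : Z2)‖ ^ (-p) := rpow_nonneg (norm_nonneg _) _
    simp only [jw, norm_zero, add_zero, Real.one_rpow, if_true] at this ⊢
    linarith
  · simp only [hk, if_false, add_zero]
    have : 0 < ‖k‖ := norm_pos_iff.2 hk
    exact Real.rpow_le_rpow_of_nonpos this (by unfold jw; linarith) (by linarith)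

lemma jw_sq_le (k : Z2) : jw k ^ 2 ≤ 2 * (1 + freq k ^ 2) := by
  have h1 := norm_sq_le_ksq k
  have h2 := freq_sq k
  have h3 : 1 ≤ 4 * π ^ 2 := by nlinarith [Real.pi_gt_three]
  have h4 : 0 ≤ ksq k := (sq_nonneg _).trans h1
  unfold jw
  nlinarith [sq_nonneg (‖k‖ - 1)]

lemma prod_weight_le (h0 : 0 < δ) (h1 : δ ≤ 1) {x y z : ℝ} (hx : 1 ≤ x) (hy : 1 ≤ y) (hz : 1 ≤ z) (h
    : z ≤ x + y) : (z ^ (1 - δ) / (x * y)) ^ 2 ≤ 4 * (x ^ (-(2 + 2 * δ)) + y ^ (-(2 + 2 * δ))) := by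
  wlog hxy : y ≤ x generalizing x y
  · have := this hy hx (by linarith) (le_of_not_ge hxy)
    rw [mul_comm x y, add_comm (x ^ _)]
    exact this
  have hx0 : 0 < x := by linarith
  have hy0 : 0 < y := by linarith
  have e1 : z ^ (1 - δ) ≤ 2 * x ^ (1 - δ) := by
    calc z ^ (1 - δ) ≤ (2 * x) ^ (1 - δ) :=
          Real.rpow_le_rpow (by linarith) (by linarith) (by linarith)
      _ = 2 ^ (1 - δ) * x ^ (1 - δ) := mul_rpow zero_le_two hx0.le
      _ ≤ 2 ^ (1 : ℝ) * x ^ (1 - δ) := by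
        gcongr
        · norm_num
        · linarith
      _ = _ := by rw [rpow_one]
  have e2 : z ^ (1 - δ) / (x * y) ≤ 2 * y ^ (-(1 + δ)) := by
    rw [div_le_iff₀ (by positivity)]
    refine e1.trans ?_
    have e3 : x ^ (1 - δ) = x * x ^ (-δ) := by rw [sub_eq_add_neg, rpow_add hx0, rpow_one]
    have e4 : y ^ (-(1 + δ)) * y = y ^ (-δ) := by
      rw [← rpow_add_one hy0.ne']
      congr 1
      ring
    have e5 : x ^ (-δ) ≤ y ^ (-δ) := Real.rpow_le_rpow_of_nonpos hy0 hxy (by linarith)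
    calc 2 * x ^ (1 - δ) = 2 * x * x ^ (-δ) := by rw [e3]; ring
      _ ≤ 2 * x * y ^ (-δ) := by gcongr
      _ = _ := by rw [← e4]; ring
  have h2 : 0 ≤ z ^ (1 - δ) / (x * y) := by positivity
  calc _ ≤ (2 * y ^ (-(1 + δ))) ^ 2 := by gcongr
    _ = 4 * y ^ (-(2 + 2 * δ)) := by
      rw [mul_pow, ← Real.rpow_natCast (y ^ _), ← Real.rpow_mul hy0.le]
      norm_num
      congr 1
      ring
    _ ≤ _ := by
      have : 0 ≤ x ^ (-(2 + 2 * δ)) := by positivity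
      linarith

/-- The constant of the product estimate. -/
def prodConst (δ : ℝ) : ℝ≥0∞ := 32 * ∑' k, ofReal (jw k ^ (-(2 + 2 * δ)))

lemma prodConst_ne_top (h0 : 0 < δ) : prodConst δ ≠ ⊤ := by
  refine mul_ne_top (by norm_num) ?_
  exact (summable_jw (by linarith : 2 < 2 + 2 * δ)).tsum_ofReal_ne_top

lemma tsum_jw_sq_le (f : T2 → ℝ) : ∑' k, (ofReal (jw k) * ‖coeff f k‖ₑ) ^ 2 ≤ 2 * h1NormSq f := by
  rw [h1NormSq, ← ENNReal.tsum_mul_left]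
  refine tsum_le_tsum fun k => ?_
  rw [← ofReal_norm, ← ofReal_mul (jw_pos k).le, ← ofReal_pow (by
    have := jw_pos k; positivity), ← ofReal_ofNat, ← ofReal_mul zero_le_two]
  refine ofReal_le_ofReal ?_
  rw [mul_pow, ← mul_assoc]
  exact mul_le_mul_of_nonneg_right (jw_sq_le k) (by positivity)

/-- `‖f g‖_{H^{1-δ}} ≤ C ‖f‖_{H¹} ‖g‖_{H¹}` in dimension two. -/
theorem tsum_weight_coeff_mul_le (h0 : 0 < δ) (h1 : δ ≤ 1)
    (hf : MemLp f 2 vol) (hg : MemLp g 2 vol) :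
    ∑' k, ofReal (jw k ^ (2 - 2 * δ)) * ‖coeff (fun x => f x * g x) k‖ₑ ^ 2 ≤
      prodConst δ * (h1NormSq f * h1NormSq g) := by
  set S : ℝ≥0∞ := ∑' k, ofReal (jw k ^ (-(2 + 2 * δ))) with hS
  set a : Z2 → ℝ≥0∞ := fun k => ofReal (jw k) * ‖coeff f k‖ₑ with ha
  set b : Z2 → ℝ≥0∞ := fun k => ofReal (jw k) * ‖coeff g k‖ₑ with hb
  set h : Z2 → Z2 → ℝ := fun k j => jw k ^ (1 - δ) / (jw j * jw (j - k)) with hh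
  have hh0 : ∀ k j, 0 ≤ h k j := fun k j => by
    have := jw_pos k
    have := jw_pos j
    have := jw_pos (j - k)
    simp only [hh]
    positivity
  have step : ∀ k, ofReal (jw k ^ (2 - 2 * δ)) * ‖coeff (fun x => f x * g x) k‖ₑ ^ 2 ≤
      (∑' j, (a j * b (j - k)) ^ 2) * (8 * S) := fun k => by
    have e1 : ofReal (jw k ^ (2 - 2 * δ)) = ofReal (jw k ^ (1 - δ)) ^ 2 := by
      rw [← ofReal_pow (rpow_nonneg (jw_pos k).le _), ← Real.rpow_natCast,
        ← Real.rpow_mul (jw_pos k).le]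
      congr 2
      push_cast
      ring
    have e2 : ofReal (jw k ^ (1 - δ)) * ‖coeff (fun x => f x * g x) k‖ₑ ≤
        ∑' j, (a j * b (j - k)) * ofReal (h k j) := by
      rw [← (hasSum_coeff_mul hf hg k).tsum_eq]
      refine (mul_le_mul_right (enorm_tsum_le_tsum_enorm) _).trans ?_
      rw [← ENNReal.tsum_mul_left]
      refine tsum_le_tsum fun j => le_of_eq ?_
      rw [enorm_mul, RCLike.enorm_conj]
      have e3 : ofReal (jw k ^ (1 - δ)) = ofReal (jw j) * ofReal (jw (j - k)) * ofReal (h k j) := by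
        rw [← ofReal_mul (jw_pos j).le, ← ofReal_mul (by
          have := jw_pos j
          have := jw_pos (j - k)
          positivity)]
        congr 1
        have := (jw_pos j).ne'
        have := (jw_pos (j - k)).ne'
        simp only [hh]
        field_simp
      rw [e3]
      simp only [ha, hb]
      ring
    rw [e1, ← mul_pow]
    refine (pow_le_pow_left' e2 2).trans ((tsum_mul_sq_le _ _).trans (mul_le_mul_right ?_ _))
    have e4 : ∀ j, ofReal (h k j) ^ 2 ≤ 4 * (ofReal (jw j ^ (-(2 + 2 * δ))) +
        ofReal (jw (j - k) ^ (-(2 + 2 * δ)))) := fun j => by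
      rw [← ofReal_pow (hh0 k j), ← ofReal_add
          (rpow_nonneg (jw_pos j).le (-(2 + 2 * δ)))
          (rpow_nonneg (jw_pos (j - k)).le (-(2 + 2 * δ))), ← ofReal_ofNat, ← ofReal_mul (by
              norm_num)]
      exact ofReal_le_ofReal (prod_weight_le h0 h1 (one_le_jw j) (one_le_jw _)
        (one_le_jw k) (jw_le_add j k))
    refine (tsum_le_tsum e4).trans (le_of_eq ?_)
    rw [ENNReal.tsum_mul_left, tsum_add]
    have e5 : ∑' j, ofReal (jw (j - k) ^ (-(2 + 2 * δ))) = S :=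
      (Equiv.subRight k).tsum_eq fun j => ofReal (jw j ^ (-(2 + 2 * δ)))
    rw [e5, ← hS]
    ring
  refine (tsum_le_tsum step).trans ?_
  rw [ENNReal.tsum_mul_right, ENNReal.tsum_comm]
  have e6 : ∀ j, ∑' k, (a j * b (j - k)) ^ 2 = a j ^ 2 * ∑' k, b k ^ 2 := fun j => by
    simp_rw [mul_pow]
    rw [ENNReal.tsum_mul_left]
    congr 1
    exact (Equiv.subLeft j).tsum_eq fun k => b k ^ 2
  simp_rw [e6]
  rw [ENNReal.tsum_mul_right]
  have h2 := mul_le_mul' (mul_le_mul' (tsum_jw_sq_le f) (tsum_jw_sq_le g)) (le_refl (8 * S))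
  refine h2.trans (le_of_eq ?_)
  rw [prodConst]
  ring

/-! ### Uniform bounds for the velocity -/

lemma rpow_mul_exp_le {y : ℝ} (hb0 : 0 ≤ b) (hb : b ≤ 1) (hy : 0 ≤ y) :
    y ^ b ≤ 2 * exp (y / 2) := by
  have h1 : y ^ b ≤ 1 + y := by
    rcases le_or_gt y 1 with h | h
    · exact (Real.rpow_le_one hy h hb0).trans (by linarith)
    · have := Real.rpow_le_rpow_of_exponent_le h.le hb
      rw [rpow_one] at this
      linarith
  have := Real.add_one_le_exp (y / 2)
  linarith

/-- The smoothing rate of the fractional heat semigroup. -/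
def smoothRate (b τ : ℝ) : ℝ := 2 * τ ^ (-b) * exp (-(1 / 2 * τ))

lemma rpow_mul_exp_neg_le {τ : ℝ} (hb0 : 0 ≤ b) (hb : b ≤ 1) (hL : 1 ≤ L) (hτ : 0 < τ) :
    L ^ b * exp (-L * τ) ≤ smoothRate b τ := by
  have hL0 : 0 < L := by linarith
  have h1 := rpow_mul_exp_le hb0 hb (by positivity : 0 ≤ L * τ)
  rw [mul_rpow hL0.le hτ.le] at h1
  have h2 : L ^ b ≤ 2 * exp (L * τ / 2) * τ ^ (-b) := by
    rw [rpow_neg hτ.le, ← div_eq_mul_inv, le_div_iff₀ (rpow_pos_of_pos hτ _)]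
    exact h1
  have h3 : exp (L * τ / 2) * exp (-L * τ) ≤ exp (-(1 / 2 * τ)) := by
    rw [← exp_add]
    gcongr
    nlinarith
  have h4 : 0 ≤ τ ^ (-b) := rpow_nonneg hτ.le _
  calc L ^ b * exp (-L * τ) ≤ 2 * exp (L * τ / 2) * τ ^ (-b) * exp (-L * τ) := by
        gcongr
    _ = 2 * τ ^ (-b) * (exp (L * τ / 2) * exp (-L * τ)) := by ring
    _ ≤ _ := by unfold smoothRate; gcongr

lemma smoothRate_nonneg {τ : ℝ} (hτ : 0 ≤ τ) : 0 ≤ smoothRate b τ := by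
  unfold smoothRate
  positivity

lemma integrableOn_smoothRate (hb : b < 1) : IntegrableOn (smoothRate b) (Ioi 0) := by
  have := (integrableOn_rpow_mul_exp_neg_mul_rpow (s := -b) (b := 1 / 2) (p := 1) (by linarith)
    one_pos (by norm_num)).const_mul 2
  refine this.congr (ae_of_all _ fun τ => ?_)
  simp only [smoothRate, rpow_one]
  ring_nf

lemma measurable_smoothRate (b : ℝ) : Measurable (smoothRate b) := by
  unfold smoothRate
  fun_prop

/-- The kernel `ε⁻¹ κ(σ/ε)`. -/
def smoothKer (b ε σ : ℝ) : ℝ≥0∞ := ofReal (ε⁻¹ * smoothRate b (ε⁻¹ * σ))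

lemma measurable_smoothKer (b ε : ℝ) : Measurable (smoothKer b ε) :=
  measurable_ofReal.comp (((measurable_smoothRate b).comp
    (measurable_const.mul measurable_id)).const_mul _)

/-- The mass of the smoothing kernel. -/
def smoothMass (b : ℝ) : ℝ := ∫ τ in Ioi (0 : ℝ), smoothRate b τ

lemma lintegral_smoothKer (hb : b < 1) (hε : 0 < ε) :
    ∫⁻ σ in Ioi (0 : ℝ), smoothKer b ε σ = ofReal (smoothMass b) := by
  have hi : IntegrableOn (fun σ => ε⁻¹ * smoothRate b (ε⁻¹ * σ)) (Ioi 0) := by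
    refine Integrable.const_mul ?_ _
    have := (integrableOn_Ioi_comp_mul_left_iff (smoothRate b) 0 (inv_pos.2 hε)).2
    rw [mul_zero] at this
    exact this (integrableOn_smoothRate hb)
  unfold smoothKer
  rw [← ofReal_integral_eq_lintegral_ofReal hi]
  · congr 1
    rw [integral_const_mul, integral_comp_mul_left_Ioi (smoothRate b) 0 (inv_pos.2 hε), mul_zero,
      inv_inv, smul_eq_mul, ← mul_assoc, inv_mul_cancel₀ hε.ne', one_mul, smoothMass]
  · filter_upwards [ae_mem_Ioi] with σ hσ
    have hσ : 0 < σ := hσ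
    exact mul_nonneg (inv_pos.2 hε).le (smoothRate_nonneg (by positivity))

/-- A solution of the momentum equation with the bounds used below. -/
structure MomentumData (α ε M : ℝ) (u : VectorField) (θ : ScalarField)
    (u₀ : T2 → Fin 2 → ℝ) : Prop where
  alpha_gt : 1 / 2 < α
  alpha_le : α ≤ 1
  eps_pos : 0 < ε
  adm : Adm u θ
  M_nonneg : 0 ≤ M
  bound : ∀ᵐ t ∂ℓ, ∀ᵐ x ∂vol, |θ t x| ≤ M
  mean : ∀ᵐ t ∂ℓ, coeff (θ t) 0 = 0
  memLp : ∀ i, MemLp (u₀ · i) 2 vol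
  div₀ : IsDivFree u₀
  div : ∀ᵐ t ∂ℓ, IsDivFree (u t)
  momentum : SolvesMomentum α ε u θ u₀

section Momentum

lemma MomentumData.sum_leray (h : MomentumData α ε M u θ u₀) (hk : k ≠ 0) (i : Fin 2) : ∀ᵐ t ∂ℓ, ∑
    l, (leray k i l : ℂ) * coeff (u t · l) k = coeff (u t · i) k := by
  filter_upwards [h.div, h.adm.slice] with t h1 h2
  exact sum_leray_mul hk (sum_mul_coeff_of_isDivFree (fun i => (h2.1 i).l1) h1 k) i

lemma MomentumData.ode (h : MomentumData α ε M u θ u₀) (hk : k ≠ 0) (i : Fin 2) : ∀ᵐ t ∂ℓ, coeff (u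
    t · i) k = coeff (u₀ · i) k + ∫ s in 0..t, (-((freq k ^ (2 * α) / ε : ℝ) : ℂ) * coeff (u s · i)
    k + (ε⁻¹ : ℝ) * momForce ε u θ k (leray k i) s) := by
  have hεc : (ε : ℂ) ≠ 0 := by exact_mod_cast h.eps_pos.ne'
  have hl := h.sum_leray hk i
  filter_upwards [hl, coeff_momentum_comb h.adm (fun i => (h.memLp i).l1)
    h.momentum (sum_mul_leray k i), ae_mem_Ioi] with t h1 h2 h3
  have h3 : 0 < t := h3
  rw [h1,
      (sum_leray_mul hk (sum_mul_coeff_of_isDivFree (fun i => (h.memLp i).l1) h.div₀ k) i)] at h2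
  have e : ∫ s in 0..t, (-((freq k ^ (2 * α) / ε : ℝ) : ℂ) *
        coeff (u s · i) k + (ε⁻¹ : ℝ) * momForce ε u θ k (leray k i) s) =
      (ε : ℂ)⁻¹ * ∫ s in 0..t, modeForce α ε u θ k (leray k i) s := by
    rw [← intervalIntegral.integral_const_mul, integral_of_le h3.le, integral_of_le h3.le]
    refine integral_congr_ae ?_
    filter_upwards [ae_Ioc hl t] with s hs
    rw [modeForce, hs]
    push_cast
    field_simp
  rw [e]
  have h4 : coeff (u t · i) k = (ε : ℂ)⁻¹ * (ε * coeff (u t · i) k) := by field_simp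
  rw [h4, h2]
  field_simp

lemma MomentumData.duhamel (h : MomentumData α ε M u θ u₀) (hk : k ≠ 0) (i : Fin 2) : ∀ᵐ t ∂ℓ, coeff
    (u t · i) k = exp (-(freq k ^ (2 * α) / ε) * t) * coeff (u₀ · i) k + ∫ s in 0..t, (exp (-(freq k
    ^ (2 * α) / ε) * (t - s)) : ℂ) * ((ε⁻¹ : ℝ) * momForce ε u θ k (leray k i) s) :=
  ae_eq_duhamel (freq k ^ (2 * α) / ε) (fun T => h.adm.integrableOn_coeff_u i k T)
    (fun T => (h.adm.integrableOn_momForce ε k (leray k i) T).const_mul _) (h.ode hk i)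

lemma MomentumData.mean_eq (h : MomentumData α ε M u θ u₀) (i : Fin 2) : ∀ᵐ t ∂ℓ, coeff (u t · i) 0
    = coeff (u₀ · i) 0 := by
  have hα := h.alpha_gt
  filter_upwards [coeff_momentum_comb h.adm (fun i => (h.memLp i).l1)
    h.momentum (k := 0) (v := single i 1) (by simp), ae_mem_Ioi]
    with t h2 h3
  have e : ∫ s in 0..t, modeForce α ε u θ 0 (single i 1) s = 0 := by
    rw [integral_of_le h3.le]
    refine integral_eq_zero_of_ae ?_
    filter_upwards [ae_Ioc h.mean t] with s hs
    rw [modeForce, freq_zero, zero_rpow (by linarith)]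
    simp [momForce, hs]
  rw [e, add_zero] at h2
  have h4 : ∀ w : Fin 2 → ℂ, ∑ l, ((single i 1 : Fin 2 → ℝ) l : ℂ) * w l = w i := fun w => by
    fin_cases i <;> simp
  rw [h4 (fun l => coeff (u t · l) 0), h4 (fun l => coeff (u₀ · l) 0)] at h2
  exact mul_left_cancel₀ (by exact_mod_cast h.eps_pos.ne') h2

/-- The sum of the squared products of velocity components. -/
def quadSq (u : VectorField) (k : Z2) (t : ℝ) : ℝ :=
  ∑ l, ∑ j, ‖coeff (fun x => u t x j * u t x l) k‖ ^ 2

lemma two_pi_abs_le_freq (k : Z2) (j : Fin 2) : 2 * π * |(k j : ℝ)| ≤ freq k := by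
  unfold freq
  gcongr
  refine Real.abs_le_sqrt ?_
  exact single_le_sum (f := fun i => (k i : ℝ) ^ 2) (fun i _ => sq_nonneg _) (Finset.mem_univ j)

lemma norm_advection_le (k : Z2) (i : Fin 2) (t : ℝ) : ‖∑ l, ∑ j, 2 * π * I * (k j) * leray k i l *
    coeff (fun x => u t x j * u t x l) k‖ ^ 2 ≤ 4 * (freq k ^ 2 * quadSq u k t) := by
  have h1 : ∀ l j, ‖2 * π * I * (k j) * leray k i l *
      coeff (fun x => u t x j * u t x l) k‖ ≤ freq k * ‖coeff (fun x => u t x j * u t x l) k‖ := by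
    intro l j
    have e : ‖(2 * π * I * (k j) * leray k i l : ℂ)‖ = 2 * π * |(k j : ℝ)| * |leray k i l| := by
      simp [abs_of_pos pi_pos]
    rw [norm_mul, e]
    gcongr
    exact (mul_le_of_le_one_right (by positivity) (abs_leray_le k i l)).trans
      (two_pi_abs_le_freq k j)
  have h2 : ‖∑ l, ∑ j, 2 * π * I * (k j) * leray k i l * coeff (fun x => u t x j * u t x l) k‖ ≤
      freq k * ∑ l, ∑ j, ‖coeff (fun x => u t x j * u t x l) k‖ := by
    rw [mul_sum]
    refine norm_sum_le_of_le _ fun l _ => ?_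
    rw [mul_sum]
    exact norm_sum_le_of_le _ fun j _ => h1 l j
  refine (pow_le_pow_left₀ (norm_nonneg _) h2 2).trans ?_
  rw [mul_pow, mul_left_comm]
  refine mul_le_mul_of_nonneg_left ?_ (sq_nonneg _)
  rw [quadSq]
  simp only [sum_univ_two]
  set a := ‖coeff (fun x => u t x 0 * u t x 0) k‖
  set b := ‖coeff (fun x => u t x 1 * u t x 0) k‖
  set c := ‖coeff (fun x => u t x 0 * u t x 1) k‖
  set d := ‖coeff (fun x => u t x 1 * u t x 1) k‖
  nlinarith [sq_nonneg (a - c), sq_nonneg (a - d), sq_nonneg (b - c),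
    sq_nonneg (b - d), sq_nonneg (c - d)]

lemma norm_momForce_sq_le (k : Z2) (i : Fin 2) (t : ℝ) : ‖momForce ε u θ k (leray k i) t‖ ^ 2 ≤ 2 *
    ‖coeff (θ t) k‖ ^ 2 + 8 * ε ^ 2 * (freq k ^ 2 * quadSq u k t) := by
  rw [momForce]
  have h2 : ‖(leray k i 1 : ℂ) * coeff (θ t) k‖ ≤ ‖coeff (θ t) k‖ := by
    rw [norm_mul, norm_real, norm_eq_abs]
    exact mul_le_of_le_one_left (norm_nonneg _) (abs_leray_le k i 1)
  set X := (leray k i 1 : ℂ) * coeff (θ t) k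
  set Y := ∑ l, ∑ j, 2 * π * I * (k j) * leray k i l * coeff (fun x => u t x j * u t x l) k
  have h3 : ‖X - ε * Y‖ ≤ ‖X‖ + |ε| * ‖Y‖ := by
    refine (norm_sub_le _ _).trans ?_
    rw [norm_mul (ε : ℂ), norm_real, norm_eq_abs]
  have h4 : ‖X - ε * Y‖ ^ 2 ≤ 2 * ‖X‖ ^ 2 + 2 * (ε ^ 2 * ‖Y‖ ^ 2) := by
    have := pow_le_pow_left₀ (norm_nonneg _) h3 2
    nlinarith [sq_nonneg (‖X‖ - |ε| * ‖Y‖), sq_abs ε]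
  have h5 : ‖X‖ ^ 2 ≤ ‖coeff (θ t) k‖ ^ 2 := pow_le_pow_left₀ (norm_nonneg _) h2 2
  have h6 := mul_le_mul_of_nonneg_left (norm_advection_le (u := u) k i t) (sq_nonneg ε)
  linarith

/-- The forcing in the energy inequality at frequency `k`. -/
def energyForce (α ε : ℝ) (u : VectorField) (θ : ScalarField) (k : Z2) (s : ℝ) : ℝ≥0∞ :=
  8 * ofReal (‖coeff (θ s) k‖ ^ 2) + 2592 * ofReal (ε ^ 2) *
    ∑ l, ∑ j, ofReal (jw k ^ (2 - 2 * (α - 1 / 2))) *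
      ‖coeff (fun x => u s x j * u s x l) k‖ₑ ^ 2

lemma measurable_energyForce (h : Adm u θ) (α ε : ℝ) (k : Z2) :
    Measurable (energyForce α ε u θ k) := by
  refine Measurable.add (Measurable.const_mul (measurable_ofReal.comp
    ((meas_coeff h.meas_θ k).norm.pow_const 2)) _) (Measurable.const_mul ?_ _)
  refine Finset.measurable_fun_sum _ fun l _ => Finset.measurable_fun_sum _ fun j _ => ?_
  exact ((meas_coeff (h.meas_uu l j) k).enorm.pow_const 2).const_mul _

lemma freq_le_jw (k : Z2) : freq k ≤ 9 * jw k := by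
  refine le_of_sq_le_sq ?_ (by have := jw_pos k; positivity)
  have h1 : ksq k ≤ 2 * jw k ^ 2 := by
    rw [ksq_eq]
    have h : ∀ i, (k i : ℝ) ^ 2 ≤ jw k ^ 2 := fun i => by
      rw [← sq_abs]
      have := norm_int_le k i
      exact pow_le_pow_left₀ (abs_nonneg _) (by unfold jw; linarith) 2
    linarith [h 0, h 1]
  have h2 : π ^ 2 ≤ 10 := by nlinarith [Real.pi_lt_d2, pi_pos]
  rw [freq_sq]
  have h3 : 0 ≤ jw k ^ 2 := sq_nonneg _
  nlinarith [sq_nonneg π]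

lemma freq_rpow_eq (hα : 0 < α) (k : Z2) : (freq k ^ (2 * α)) ^ (1 / (2 * α)) = freq k := by
  rw [← Real.rpow_mul (freq_nonneg k)]
  have : 2 * α * (1 / (2 * α)) = 1 := by field_simp
  rw [this, rpow_one]

lemma kernel_le (hα : 1 / 2 < α) (hk : k ≠ 0) {τ : ℝ} (hτ : 0 < τ) : freq k ^ 2 / freq k ^ (2 * α) *
    exp (-(freq k ^ (2 * α)) * τ) ≤ freq k ^ (-(2 * (α - 1 / 2))) * smoothRate (1 / (2 * α)) τ := by
  have hf := one_le_freq hk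
  have hf0 : 0 < freq k := by linarith
  have h1 : (1 : ℝ) ≤ freq k ^ (2 * α) := Real.one_le_rpow hf (by linarith)
  have hb : 1 / (2 * α) ≤ 1 := by
    rw [div_le_one (by linarith)]
    linarith
  have h2 := rpow_mul_exp_neg_le (by positivity) hb h1 hτ
  rw [freq_rpow_eq (by linarith)] at h2
  have h3 : freq k ^ 2 / freq k ^ (2 * α) = freq k ^ (-(2 * (α - 1 / 2))) * freq k := by
    rw [← Real.rpow_natCast, ← Real.rpow_sub hf0, ← rpow_add_one hf0.ne']
    congr 1
    push_cast
    ring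
  rw [h3, mul_assoc]
  exact mul_le_mul_of_nonneg_left h2 (rpow_nonneg hf0.le _)

lemma weighted_forcing_le (hα : 1 / 2 < α) (hα1 : α ≤ 1) (hk : k ≠ 0) (i : Fin 2) (s : ℝ) : ofReal
    (4 * freq k ^ (-(2 * (α - 1 / 2))) * ‖momForce ε u θ k (leray k i) s‖ ^ 2) ≤ energyForce α ε u θ
    k s := by
  have hf := one_le_freq hk
  have hf0 : 0 < freq k := by linarith
  have hJ := jw_pos k
  have h1 := norm_momForce_sq_le (ε := ε) (u := u) (θ := θ) k i s
  have hp : 0 ≤ freq k ^ (-(2 * (α - 1 / 2))) := rpow_nonneg hf0.le _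
  have hp1 : freq k ^ (-(2 * (α - 1 / 2))) ≤ 1 :=
    Real.rpow_le_one_of_one_le_of_nonpos hf (by linarith)
  have hq : freq k ^ (-(2 * (α - 1 / 2))) * freq k ^ 2 ≤ 81 * jw k ^ (2 - 2 * (α - 1 / 2)) := by
    rw [← Real.rpow_natCast (freq k), ← rpow_add hf0]
    have e : -(2 * (α - 1 / 2)) + ((2 : ℕ) : ℝ) = 2 - 2 * (α - 1 / 2) := by push_cast; ring
    rw [e]
    calc freq k ^ (2 - 2 * (α - 1 / 2)) ≤ (9 * jw k) ^ (2 - 2 * (α - 1 / 2)) :=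
          Real.rpow_le_rpow hf0.le (freq_le_jw k) (by linarith)
      _ = 9 ^ (2 - 2 * (α - 1 / 2)) * jw k ^ (2 - 2 * (α - 1 / 2)) := mul_rpow (by norm_num) hJ.le
      _ ≤ 9 ^ (2 : ℝ) * jw k ^ (2 - 2 * (α - 1 / 2)) := by
        gcongr
        · norm_num
        · linarith
      _ = _ := by norm_num
  have hQ : 0 ≤ quadSq u k s := sum_nonneg fun l _ => sum_nonneg fun j _ => sq_nonneg _
  have hmain : 4 * freq k ^ (-(2 * (α - 1 / 2))) * ‖momForce ε u θ k (leray k i) s‖ ^ 2 ≤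
      8 * ‖coeff (θ s) k‖ ^ 2 + 2592 * ε ^ 2 * (jw k ^ (2 - 2 * (α - 1 / 2)) * quadSq u k s) := by
    calc _ ≤ 4 * freq k ^ (-(2 * (α - 1 / 2))) *
          (2 * ‖coeff (θ s) k‖ ^ 2 + 8 * ε ^ 2 * (freq k ^ 2 * quadSq u k s)) := by gcongr
      _ = 8 * (freq k ^ (-(2 * (α - 1 / 2))) * ‖coeff (θ s) k‖ ^ 2) + 32 * ε ^ 2 *
          ((freq k ^ (-(2 * (α - 1 / 2))) * freq k ^ 2) * quadSq u k s) := by ring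
      _ ≤ 8 * (1 * ‖coeff (θ s) k‖ ^ 2) + 32 * ε ^ 2 *
          ((81 * jw k ^ (2 - 2 * (α - 1 / 2))) * quadSq u k s) := by gcongr
      _ = _ := by ring
  refine (ofReal_le_ofReal hmain).trans (le_of_eq ?_)
  rw [energyForce, ofReal_add (by positivity) (by positivity),
    ofReal_mul (by norm_num), ofReal_mul (by positivity),
    ofReal_mul (by norm_num), ofReal_mul (rpow_nonneg hJ.le _)]
  congr 2
  · norm_num
  · norm_num
  · rw [quadSq, ofReal_sum_of_nonneg fun l _ => sum_nonneg fun j _ => sq_nonneg _, mul_sum]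
    refine sum_congr rfl fun l _ => ?_
    rw [ofReal_sum_of_nonneg fun j _ => sq_nonneg _, mul_sum]
    refine sum_congr rfl fun j _ => ?_
    rw [ofReal_pow (norm_nonneg _), ofReal_norm]

end Momentum

/-- `‖v‖²` in `H¹`, for vector fields. -/
def h1Sum (v : T2 → Fin 2 → ℝ) : ℝ≥0∞ := ∑ i, h1NormSq fun x => v x i

section Momentum

lemma add_sq_le_two (a b : ℝ≥0∞) : (a + b) ^ 2 ≤ 2 * a ^ 2 + 2 * b ^ 2 := by
  rcases eq_or_ne a ⊤ with rfl | ha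
  · simp
  rcases eq_or_ne b ⊤ with rfl | hb
  · simp
  lift a to ℝ≥0 using ha
  lift b to ℝ≥0 using hb
  norm_cast
  rw [← NNReal.coe_le_coe]
  push_cast
  nlinarith [sq_nonneg ((a : ℝ) - b)]

lemma MomentumData.mode_le (h : MomentumData α ε M u θ u₀) (k : Z2) (i : Fin 2) : ∀ᵐ t ∂ℓ, ofReal
    ((1 + freq k ^ 2) * ‖coeff (u t · i) k‖ ^ 2) ≤ 2 * ofReal ((1 + freq k ^ 2) * ‖coeff (u₀ · i) k‖
    ^ 2) + ∫⁻ s in Ioc 0 t, smoothKer (1 / (2 * α)) ε (t - s) * energyForce α ε u θ k s := by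
  by_cases hk : k = 0
  · subst hk
    filter_upwards [h.mean_eq i] with t ht
    rw [ht, two_mul, add_assoc]
    exact le_self_add
  have hε := h.eps_pos
  have hf := one_le_freq hk
  have hfα : 0 < freq k ^ (2 * α) := rpow_pos_of_pos (by linarith) _
  have ha : 0 < freq k ^ (2 * α) / ε := by positivity
  filter_upwards [h.duhamel hk i, ae_mem_Ioi] with t ht ht0
  have ht0 : 0 < t := ht0
  set F : ℝ → ℂ := fun s => (ε⁻¹ : ℝ) * momForce ε u θ k (leray k i) s with hF
  have hFm : AEStronglyMeasurable F ℓ(t) :=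
    ((h.adm.integrableOn_momForce ε k (leray k i) t).const_mul _).1
  have h1 := enorm_duhamel_sq_le ha ht0.le hFm
  have h2 : ‖coeff (u t · i) k‖ₑ ^ 2 ≤ 2 * ‖coeff (u₀ · i) k‖ₑ ^ 2 +
      2 * (ofReal (1 / (freq k ^ (2 * α) / ε)) * ∫⁻ s in Ioc 0 t,
        ofReal (exp (-(freq k ^ (2 * α) / ε) * (t - s))) * ‖F s‖ₑ ^ 2) := by
    rw [ht]
    refine (pow_le_pow_left' (enorm_add_le _ _) 2).trans ((add_sq_le_two _ _).trans ?_)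
    gcongr
    rw [enorm_mul]
    refine mul_le_of_le_one_left zero_le ?_
    rw [← ofReal_norm, norm_real, norm_of_nonneg (exp_pos _).le]
    refine ofReal_le_one.2 (Real.exp_le_one_iff.2 ?_)
    have := mul_pos ha ht0
    linarith
  have e : ∀ z : ℂ, ofReal ((1 + freq k ^ 2) * ‖z‖ ^ 2) =
      ofReal (1 + freq k ^ 2) * ‖z‖ₑ ^ 2 := fun z => by
    rw [ofReal_mul (by positivity), ofReal_pow (norm_nonneg _), ofReal_norm]
  rw [e, e]
  refine (mul_le_mul_right h2 _).trans ?_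
  rw [mul_add]
  refine add_le_add (le_of_eq (by ring)) ?_
  rw [mul_left_comm, ← mul_assoc, ← mul_assoc, ← lintegral_const_mul'' _ (by
    exact (measurable_ofReal.comp (Continuous.measurable (by fun_prop))).aemeasurable.mul
      (hFm.enorm.pow_const 2))]
  refine lintegral_mono_ae ?_
  filter_upwards [ae_mem_Ioc, ae_restrict_of_ae (Measure.ae_ne volume t)] with s hs hne
  have hσ : 0 < ε⁻¹ * (t - s) := by
    have := sub_pos.2 (lt_of_le_of_ne hs.2 hne)
    positivity
  refine le_trans ?_ (mul_le_mul_right (weighted_forcing_le h.alpha_gt h.alpha_le hk i s) _)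
  rw [smoothKer, ← ofReal_mul (mul_nonneg (by positivity) (smoothRate_nonneg hσ.le)),
    ← ofReal_norm, ← ofReal_pow (norm_nonneg _), ← ofReal_mul (by positivity),
    ← ofReal_ofNat, ← ofReal_mul (by norm_num), ← ofReal_mul (by positivity),
    ← ofReal_mul (by positivity)]
  refine ofReal_le_ofReal ?_
  have hker := kernel_le h.alpha_gt hk hσ
  have hn : ‖F s‖ ^ 2 = ε⁻¹ ^ 2 * ‖momForce ε u θ k (leray k i) s‖ ^ 2 := by
    rw [hF, norm_mul, mul_pow, norm_real, norm_eq_abs, sq_abs]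
  rw [hn]
  set m := ‖momForce ε u θ k (leray k i) s‖ ^ 2 with hm
  have hm0 : 0 ≤ m := sq_nonneg _
  have e2 : exp (-(freq k ^ (2 * α) / ε) * (t - s)) =
      exp (-(freq k ^ (2 * α)) * (ε⁻¹ * (t - s))) := by
    congr 1
    field_simp
  rw [e2]
  set E := exp (-(freq k ^ (2 * α)) * (ε⁻¹ * (t - s)))
  have hE : 0 ≤ E := (exp_pos _).le
  calc 2 * (1 + freq k ^ 2) * (1 / (freq k ^ (2 * α) / ε)) * (E * (ε⁻¹ ^ 2 * m))
      ≤ 2 * (2 * freq k ^ 2) * (1 / (freq k ^ (2 * α) / ε)) * (E * (ε⁻¹ ^ 2 * m)) := by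
        gcongr
        nlinarith
    _ = 4 * ε⁻¹ * m * (freq k ^ 2 / freq k ^ (2 * α) * E) := by
        field_simp
        ring
    _ ≤ 4 * ε⁻¹ * m * (freq k ^ (-(2 * (α - 1 / 2))) * smoothRate (1 / (2 * α)) (ε⁻¹ * (t - s))) :=
        by
        gcongr
    _ = _ := by ring

lemma tsum_coeff_sq_le (hf : Measurable f) (hM : ∀ᵐ x ∂vol, |f x| ≤ M) : ∑' k, ofReal (‖coeff f k‖ ^
    2) ≤ ofReal (M ^ 2) := by
  rw [← ofReal_integral_sq_eq (memLp_bdd hf hM)]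
  refine ofReal_le_ofReal ?_
  have := integral_mono_of_nonneg (ae_of_all vol fun x => sq_nonneg (f x))
    (integrable_const (M ^ 2)) (hM.mono fun x hx => by
      simp only
      rw [← sq_abs]
      gcongr)
  simpa using this

lemma MomentumData.tsum_energyForce_le (h : MomentumData α ε M u θ u₀) : ∀ᵐ s ∂ℓ, ∑' k, energyForce
    α ε u θ k s ≤ 8 * ofReal (M ^ 2) + 2592 * ofReal (ε ^ 2) * (prodConst (α - 1 / 2) * h1Sum (u s)
    ^ 2) := by
  filter_upwards [h.bound, h.adm.slice] with s h1 h2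
  unfold energyForce
  rw [tsum_add, ENNReal.tsum_mul_left, ENNReal.tsum_mul_left]
  gcongr
  · exact tsum_coeff_sq_le (meas_slice h.adm.meas_θ s) h1
  · have hα := h.alpha_gt
    have hα1 := h.alpha_le
    have hp : ∀ l j, _ := fun l j => tsum_weight_coeff_mul_le (δ := α - 1 / 2) (by linarith)
      (by linarith) (h2.1 j) (h2.1 l)
    simp only [sum_univ_two, h1Sum]
    rw [tsum_add, tsum_add, tsum_add]
    refine (add_le_add (add_le_add (hp 0 0) (hp 0 1)) (add_le_add (hp 1 0) (hp 1 1))).trans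
      (le_of_eq ?_)
    ring

/-- The energy inequality with the smoothing kernel. -/
lemma MomentumData.energy_le (h : MomentumData α ε M u θ u₀) : ∀ᵐ t ∂ℓ, h1Sum (u t) ≤ 2 * h1Sum u₀ +
    ∫⁻ s in Ioc 0 t, smoothKer (1 / (2 * α)) ε (t - s) * (16 * ofReal (M ^ 2) + 5184 * ofReal (ε ^
    2) * (prodConst (α - 1 / 2) * h1Sum (u s) ^ 2)) := by
  filter_upwards [(ae_all_iff.2 fun k => ae_all_iff.2 fun i => h.mode_le k i)] with t ht
  have h1 : ∀ i, h1NormSq (u t · i) ≤ 2 * h1NormSq (u₀ · i) +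
      ∫⁻ s in Ioc 0 t, smoothKer (1 / (2 * α)) ε (t - s) * (8 * ofReal (M ^ 2) +
        2592 * ofReal (ε ^ 2) * (prodConst (α - 1 / 2) * h1Sum (u s) ^ 2)) := fun i => by
    rw [h1NormSq]
    refine (tsum_le_tsum fun k => ht k i).trans ?_
    rw [tsum_add, ENNReal.tsum_mul_left, h1NormSq]
    gcongr
    have hm : ∀ k, AEMeasurable (fun s => smoothKer (1 / (2 * α)) ε (t - s) *
        energyForce α ε u θ k s) ℓ(t) := fun k =>
      (((measurable_smoothKer _ _).comp (measurable_const.sub measurable_id)).mul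
          (measurable_energyForce h.adm α ε k)).aemeasurable
    rw [← lintegral_tsum hm]
    refine lintegral_mono_ae ?_
    filter_upwards [ae_Ioc h.tsum_energyForce_le t] with s hs
    rw [ENNReal.tsum_mul_left]
    gcongr
  rw [h1Sum, h1Sum, sum_univ_two, sum_univ_two]
  refine (add_le_add (h1 0) (h1 1)).trans (le_of_eq ?_)
  set J := ∫⁻ s in Ioc 0 t, smoothKer (1 / (2 * α)) ε (t - s) * (8 * ofReal (M ^ 2) +
        2592 * ofReal (ε ^ 2) * (prodConst (α - 1 / 2) * h1Sum (u s) ^ 2)) with hI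
  have e : ∫⁻ s in Ioc 0 t, smoothKer (1 / (2 * α)) ε (t - s) * (16 * ofReal (M ^ 2) +
        5184 * ofReal (ε ^ 2) * (prodConst (α - 1 / 2) * h1Sum (u s) ^ 2)) = 2 * J := by
    rw [hI, ← lintegral_const_mul' _ _ (by norm_num)]
    refine lintegral_congr fun s => ?_
    ring
  rw [e]
  ring

end Momentum

lemma lintegral_sub_le {g : ℝ → ℝ≥0∞} (hg : Measurable g) (t : ℝ) (c : ℝ≥0∞) :
    ∫⁻ s in Ioc 0 t, g (t - s) * c ≤ (∫⁻ σ in Ioi (0 : ℝ), g σ) * c := by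
  rw [lintegral_mul_const _ (by exact hg.comp (measurable_const.sub measurable_id))]
  refine mul_le_mul_left ?_ _
  rw [← lintegral_indicator measurableSet_Ioc]
  calc ∫⁻ s, (Ioc 0 t).indicator (fun s => g (t - s)) s
      ≤ ∫⁻ s, (Ici (0 : ℝ)).indicator g (t - s) := by
        refine lintegral_mono fun s => ?_
        by_cases hs : s ∈ Ioc 0 t
        · have : t - s ∈ Ici (0 : ℝ) := sub_nonneg.2 hs.2
          rw [indicator_of_mem hs, indicator_of_mem this]
        · rw [indicator_of_notMem hs]
          exact zero_le
    _ = ∫⁻ σ in Ici (0 : ℝ), g σ := by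
        rw [lintegral_sub_left_eq_self (fun σ => (Ici (0 : ℝ)).indicator g σ) t,
          lintegral_indicator measurableSet_Ici]
    _ = _ := by rw [setLIntegral_congr Ioi_ae_eq_Ici]

/-- A continuation argument for a quadratic integral inequality. -/
lemma le_of_quadratic_inequality {N κ : ℝ → ℝ≥0∞} (hκ : Measurable κ) {a B η : ℝ≥0∞} (ha0 : a ≠ 0)
    (hη : η ≠ ⊤) (hκB : ∫⁻ σ in Ioi (0 : ℝ), κ σ ≤ B) (hB : B ≠ ⊤) (hsmall : B * (η * (2 * a) ^ 2) ≤
    a / 2) {C : ℝ≥0} (hC : ∀ᵐ t ∂ℓ(T), N t ≤ C) (hN : ∀ᵐ t ∂ℓ(T), N t ≤ a + ∫⁻ s in Ioc 0 t, κ (t -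
    s) * (η * N s ^ 2)) : ∀ᵐ t ∂ℓ(T), N t ≤ 2 * a := by
  obtain ⟨h, hh, hstep⟩ : ∃ h : ℝ, 0 < h ∧
      (∫⁻ σ in Ioc 0 h, κ σ) * (η * (C : ℝ≥0∞) ^ 2) ≤ a / 2 := by
    have hpos : a / 2 / (η * (C : ℝ≥0∞) ^ 2 + 1) ≠ 0 :=
      ENNReal.div_ne_zero.2 ⟨ENNReal.div_ne_zero.2 ⟨ha0, by norm_num⟩,
        ENNReal.add_ne_top.2 ⟨(mul_ne_top hη (by simp)), by norm_num⟩⟩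
    obtain ⟨d, hd, hd'⟩ := exists_pos_setLIntegral_lt_of_measure_lt
      (μ := ℓ) (f := κ) (ne_top_of_le_ne_top hB hκB) hpos
    obtain ⟨h, hh0, hhd⟩ : ∃ h : ℝ, 0 < h ∧ ofReal h < d := by
      obtain ⟨r, hr0, hrd⟩ := ENNReal.lt_iff_exists_nnreal_btwn.1 hd
      refine ⟨r, by exact_mod_cast hr0, by simpa using hrd⟩
    refine ⟨h, hh0, ?_⟩
    have h1 := hd' (Ioc 0 h) (by
      rw [Measure.restrict_apply measurableSet_Ioc, inter_eq_left.2 Ioc_subset_Ioi_self,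
        volume_Ioc, sub_zero]
      exact hhd)
    rw [restrict_restrict measurableSet_Ioc, inter_eq_left.2 Ioc_subset_Ioi_self] at h1
    exact (mul_le_mul_right le_self_add _).trans (ENNReal.mul_le_of_le_div h1.le)
  have key : ∀ n : ℕ, ∀ᵐ t ∂ℓ(T), t ≤ n * h → N t ≤ 2 * a := by
    intro n
    induction n with
    | zero =>
      filter_upwards [ae_mem_Ioc] with t ht h0
      simp only [Nat.cast_zero, zero_mul] at h0
      exact absurd ht.1 (not_lt.2 h0)
    | succ n ih =>
      filter_upwards [hN, ae_mem_Ioc] with t ht htT htn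
      refine ht.trans ?_
      have h1 : ∫⁻ s in Ioc 0 t, κ (t - s) * (η * N s ^ 2) ≤
          (∫⁻ s in Ioc 0 t, κ (t - s) * (η * (2 * a) ^ 2)) +
            ∫⁻ s in Ioc 0 t, (Iic h).indicator κ (t - s) * (η * (C : ℝ≥0∞) ^ 2) := by
        rw [← lintegral_add_left (by
          exact (hκ.comp (measurable_const.sub measurable_id)).mul_const _)]
        refine lintegral_mono_ae ?_
        filter_upwards [ae_restrict_of_ae_restrict_of_subset (Ioc_subset_Ioc_right htT.2) ih,
          ae_restrict_of_ae_restrict_of_subset (Ioc_subset_Ioc_right htT.2) hC] with s h2 h3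
        rcases le_or_gt s (n * h) with h4 | h4
        · refine le_trans ?_ le_self_add
          gcongr
          exact h2 h4
        · refine le_trans ?_ le_add_self
          have : t - s ∈ Iic h := by
            simp only [mem_Iic]
            push_cast at htn
            linarith
          rw [indicator_of_mem this]
          gcongr
      refine (add_le_add_right h1 a).trans ?_
      have h5 : ∫⁻ s in Ioc 0 t, κ (t - s) * (η * (2 * a) ^ 2) ≤ a / 2 :=
        (lintegral_sub_le hκ t _).trans ((mul_le_mul_left hκB _).trans hsmall)
      have h6 : ∫⁻ s in Ioc 0 t, (Iic h).indicator κ (t - s) * (η * (C : ℝ≥0∞) ^ 2) ≤ a / 2 := by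
        refine (lintegral_sub_le (hκ.indicator measurableSet_Iic) t _).trans (le_trans ?_ hstep)
        refine mul_le_mul_left ?_ _
        rw [lintegral_indicator measurableSet_Iic, restrict_restrict measurableSet_Iic,
          inter_comm, Ioi_inter_Iic]
      calc _ ≤ a + (a / 2 + a / 2) := by gcongr
        _ = 2 * a := by rw [ENNReal.add_halves, two_mul]
  obtain ⟨n, hn⟩ := exists_nat_ge (T / h)
  filter_upwards [key n, ae_mem_Ioc] with t h1 h2
  refine h1 (h2.2.trans ?_)
  rwa [div_le_iff₀ hh] at hn

/-- The velocity is bounded in `H¹` uniformly for small `ε`. -/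
theorem exists_uniform_h1 (hα : 1 / 2 < α) (M : ℝ) (N₀ : ℝ≥0) :
    ∃ ε₀ > 0, ∃ K : ℝ≥0, ∀ ε ≤ ε₀, ∀ (u : VectorField) (θ : ScalarField) (u₀ : T2 → Fin 2 → ℝ),
      MomentumData α ε M u θ u₀ → h1Sum u₀ ≤ N₀ → ∀ᵐ t ∂ℓ, h1Sum (u t) ≤ K := by
  have hb : 1 / (2 * α) < 1 := by
    rw [div_lt_one (by linarith)]
    linarith
  set B : ℝ≥0∞ := ofReal (smoothMass (1 / (2 * α))) with hB
  set P : ℝ≥0∞ := prodConst (α - 1 / 2) with hP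
  have hPt : P ≠ ⊤ := prodConst_ne_top (by linarith)
  set a : ℝ≥0∞ := 2 * N₀ + B * (16 * ofReal (M ^ 2)) + 1 with ha
  have hat : a ≠ ⊤ := by
    simp only [ha, hB]
    finiteness
  have ha1 : 1 ≤ a := le_add_self
  set X : ℝ≥0∞ := B * (5184 * P * (2 * a) ^ 2) with hX
  have hXt : X ≠ ⊤ := by
    simp only [hX, hB]
    finiteness
  refine ⟨min 1 (1 / (2 * (X.toReal + 1))), by positivity, (2 * a).toNNReal,
    fun ε hε u θ u₀ h hu₀ => ?_⟩
  have hε0 := h.eps_pos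
  have hε1 : ε ≤ 1 := hε.trans (min_le_left _ _)
  have hε2 : ε ≤ 1 / (2 * (X.toReal + 1)) := hε.trans (min_le_right _ _)
  have hεX : X * ofReal (ε ^ 2) ≤ 1 / 2 := by
    rw [← ENNReal.ofReal_toReal hXt, ← ofReal_mul ENNReal.toReal_nonneg]
    have e : (1 / 2 : ℝ≥0∞) = ofReal (1 / 2) := by
      rw [ENNReal.ofReal_div_of_pos (by norm_num)]; simp
    rw [e]
    refine ofReal_le_ofReal ?_
    have hX0 : 0 ≤ X.toReal := ENNReal.toReal_nonneg
    rw [le_div_iff₀ (by positivity)] at hε2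
    nlinarith
  rw [coe_toNNReal (by finiteness)]
  refine ae_Ioi_of_forall_Ioc fun T hT => ?_
  obtain ⟨C, hC⟩ := h.adm.bound T hT
  refine le_of_quadratic_inequality (N := fun t => h1Sum (u t))
    (measurable_smoothKer (1 / (2 * α)) ε) (a := a) (B := B)
    (η := 5184 * ofReal (ε ^ 2) * P) (C := 2 * C) (by positivity) (by finiteness)
    (lintegral_smoothKer hb hε0).le ofReal_ne_top ?_ ?_ ?_
  · calc B * (5184 * ofReal (ε ^ 2) * P * (2 * a) ^ 2) = X * ofReal (ε ^ 2) := by rw [hX]; ring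
      _ ≤ 1 / 2 := hεX
      _ ≤ a / 2 := by gcongr
  · filter_upwards [hC] with t ht
    rw [h1Sum, sum_univ_two]
    refine (add_le_add (ht.1 0).2 (ht.1 1).2).trans (le_of_eq ?_)
    push_cast
    ring
  · filter_upwards [ae_Ioc h.energy_le T] with t ht
    have hker : Measurable fun s => smoothKer (1 / (2 * α)) ε (t - s) :=
      (measurable_smoothKer _ _).comp (measurable_const.sub measurable_id)
    refine ht.trans ?_
    simp_rw [mul_add]
    rw [lintegral_add_left (hker.mul_const _), ← add_assoc]
    refine add_le_add ?_ (le_of_eq ?_)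
    · refine le_trans ?_ le_self_add
      refine add_le_add (mul_le_mul_right hu₀ _) ?_
      have h1 := lintegral_sub_le (measurable_smoothKer (1 / (2 * α)) ε) t (16 * ofReal (M ^ 2))
      rwa [lintegral_smoothKer hb hε0] at h1
    · refine lintegral_congr fun s => ?_
      ring

/-- A solution of the Boussinesq system with the bounds used below. -/
structure FlowData (α ε M : ℝ) (u : VectorField) (θ : ScalarField)
    (u₀ : T2 → Fin 2 → ℝ) (θ₀ : T2 → ℝ) : Prop extends MomentumData α ε M u θ u₀ where
  transport : SolvesTransport u θ θ₀
  meas_θ₀ : AEMeasurable θ₀ vol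
  bound_θ₀ : ∀ᵐ x ∂vol, |θ₀ x| ≤ M

/-- The distance of the velocity to the Stokes flow, at frequency `k`. -/
def resid (α : ℝ) (u : VectorField) (θ : ScalarField) (k : Z2) (i : Fin 2) (t : ℝ) : ℂ :=
  coeff (u t · i) k - stokesMul α k i * coeff (θ t) k

/-- The forcing in the equation of the residual. -/
def residForce (α : ℝ) (u : VectorField) (θ : ScalarField) (k : Z2) (i : Fin 2) (t : ℝ) : ℂ :=
  -(∑ l, ∑ j, 2 * π * I * (k j) * leray k i l *
    coeff (fun x => u t x j * u t x l) k) - stokesMul α k i * transForce u θ k t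

section Residual

lemma FlowData.integrable_θ₀ (h : FlowData α ε M u θ u₀ θ₀) : Integrable θ₀ vol :=
  Integrable.of_bound h.meas_θ₀.aestronglyMeasurable M h.bound_θ₀

lemma Adm.integrableOn_residForce (h : Adm u θ) (α : ℝ) (k : Z2) (i : Fin 2) (T : ℝ) :
    IntegrableOn (residForce α u θ k i) (Ioc 0 T) := by
  exact (integrable_finsetSum _ fun l _ => integrable_finsetSum _ fun j _ =>
      (h.integrableOn_coeff_uu l j k T).const_mul _).neg.sub ((h.integrableOn_transForce k
          T).const_mul _)

lemma freq_rpow_mul_stokesMul (hk : k ≠ 0) (i : Fin 2) :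
    freq k ^ (2 * α) * stokesMul α k i = leray k i 1 := by
  have hf0 : 0 < freq k := one_pos.trans_le (one_le_freq hk)
  rw [stokesMul, rpow_neg hf0.le]
  field_simp

lemma FlowData.resid_ode (h : FlowData α ε M u θ u₀ θ₀) (hk : k ≠ 0) (i : Fin 2) : ∀ᵐ t ∂ℓ, resid α
    u θ k i t = (coeff (u₀ · i) k - stokesMul α k i * coeff θ₀ k) + ∫ s in 0..t, (-((freq k ^ (2 *
    α) / ε : ℝ) : ℂ) * resid α u θ k i s + residForce α u θ k i s) := by
  have hεc : (ε : ℂ) ≠ 0 := by exact_mod_cast h.eps_pos.ne'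
  filter_upwards [h.ode hk i, coeff_transport h.adm h.integrable_θ₀ h.transport k,
    ae_mem_Ioi] with t h1 h2 h3
  have h3 : 0 < t := h3
  rw [resid, h1, h2]
  have i1 : IntervalIntegrable (fun s => -((freq k ^ (2 * α) / ε : ℝ) : ℂ) *
      coeff (u s · i) k + (ε⁻¹ : ℝ) * momForce ε u θ k (leray k i) s) volume 0 t :=
    interval_of_Ioc h3.le (((h.adm.integrableOn_coeff_u i k t).const_mul _).add
      ((h.adm.integrableOn_momForce ε k (leray k i) t).const_mul _))
  rw [mul_add, ← intervalIntegral.integral_const_mul, add_sub_add_comm,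
    ← intervalIntegral.integral_sub i1
        (interval_of_Ioc h3.le ((h.adm.integrableOn_transForce k t).const_mul _))]
  congr 1
  refine integral_congr fun s _ => ?_
  have e : ((freq k ^ (2 * α) : ℝ) : ℂ) * stokesMul α k i = leray k i 1 := by
    rw [← freq_rpow_mul_stokesMul (α := α) hk i]
    push_cast
    rfl
  simp only [resid, residForce, momForce]
  rw [← e]
  push_cast
  field_simp
  ring

/-- The sum of the squared coefficients of the temperature flux. -/
def fluxSq (u : VectorField) (θ : ScalarField) (k : Z2) (t : ℝ) : ℝ :=
  ∑ i, ‖coeff (fun x => θ t x * u t x i) k‖ ^ 2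

lemma norm_transForce_sq_le (k : Z2) (t : ℝ) :
    ‖transForce u θ k t‖ ^ 2 ≤ 2 * (freq k ^ 2 * fluxSq u θ k t) := by
  have h1 : ‖transForce u θ k t‖ ≤ freq k * ∑ i, ‖coeff (fun x => θ t x * u t x i) k‖ := by
    rw [transForce, norm_neg, mul_sum]
    refine norm_sum_le_of_le _ fun j _ => ?_
    have e : ‖(2 * π * I * (k j) : ℂ)‖ = 2 * π * |(k j : ℝ)| := by simp [abs_of_pos pi_pos]
    rw [norm_mul, e]
    exact mul_le_mul_of_nonneg_right (two_pi_abs_le_freq k j) (norm_nonneg _)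
  refine (pow_le_pow_left₀ (norm_nonneg _) h1 2).trans ?_
  rw [mul_pow, mul_left_comm]
  refine mul_le_mul_of_nonneg_left ?_ (sq_nonneg _)
  rw [fluxSq]
  simp only [sum_univ_two]
  nlinarith [sq_nonneg (‖coeff (fun x => θ t x * u t x 0) k‖ - ‖coeff (fun x => θ t x * u t x 1)
      k‖)]

lemma abs_stokesMul_le (hα : 1 / 2 < α) (hk : k ≠ 0) (i : Fin 2) :
    |stokesMul α k i| ≤ (freq k)⁻¹ := by
  have hf := one_le_freq hk
  have hf0 : 0 < freq k := one_pos.trans_le hf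
  rw [stokesMul, abs_mul, abs_of_nonneg (rpow_nonneg hf0.le _), ← Real.rpow_neg_one]
  calc _ ≤ 1 * freq k ^ (-(2 * α)) :=
        mul_le_mul_of_nonneg_right (abs_leray_le k i 1) (rpow_nonneg hf0.le _)
    _ ≤ _ := by
      rw [one_mul]
      exact Real.rpow_le_rpow_of_exponent_le hf (by linarith)

lemma norm_residForce_sq_le (hα : 1 / 2 < α) (hk : k ≠ 0) (i : Fin 2) (t : ℝ) :
    ‖residForce α u θ k i t‖ ^ 2 ≤ freq k ^ 2 * (8 * quadSq u k t + 4 * fluxSq u θ k t) := by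
  have hf := one_le_freq hk
  have hf0 : 0 < freq k := one_pos.trans_le hf
  have h1 := norm_advection_le (u := u) k i t
  have h2 := norm_transForce_sq_le (u := u) (θ := θ) k t
  have hfl : 0 ≤ fluxSq u θ k t := sum_nonneg fun i _ => sq_nonneg _
  rw [residForce]
  set Y := ∑ l, ∑ j, 2 * π * I * (k j) * leray k i l * coeff (fun x => u t x j * u t x l) k
  have h3 : ‖-Y - stokesMul α k i * transForce u θ k t‖ ≤
      ‖Y‖ + |stokesMul α k i| * ‖transForce u θ k t‖ := by
    refine (norm_sub_le _ _).trans ?_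
    rw [norm_neg, norm_mul, norm_real, norm_eq_abs]
  have h5 : |stokesMul α k i| * ‖transForce u θ k t‖ ≤ ‖transForce u θ k t‖ :=
    mul_le_of_le_one_left (norm_nonneg _)
        ((abs_stokesMul_le hα hk i).trans (inv_le_one_of_one_le₀ hf))
  have h6 := pow_le_pow_left₀ (norm_nonneg _) (h3.trans (add_le_add_right h5 _)) 2
  nlinarith [sq_nonneg (‖Y‖ - ‖transForce u θ k t‖)]

end Residual

lemma lintegral_exp_neg_le (ha : 0 < a) :
    ∫⁻ σ in Ioi (0 : ℝ), ofReal (exp (-a * σ)) ≤ ofReal (1 / a) := by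
  rw [← ofReal_integral_eq_lintegral_ofReal
      (integrableOn_exp_mul_Ioi (neg_lt_zero.2 ha) 0) (ae_of_all _ fun σ => (exp_pos _).le),
    integral_exp_mul_Ioi (neg_lt_zero.2 ha)]
  simp

section Residual

lemma Adm.integrableOn_resid (h : Adm u θ) (α : ℝ) (k : Z2) (i : Fin 2) (T : ℝ) :
    IntegrableOn (resid α u θ k i) (Ioc 0 T) :=
  (h.integrableOn_coeff_u i k T).sub ((h.integrableOn_coeff_θ k T).const_mul _)

lemma Adm.measurable_resid (h : Adm u θ) (α : ℝ) (k : Z2) (i : Fin 2) :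
    Measurable (resid α u θ k i) :=
  (meas_coeff (measurable_coord h.meas_u i) k).sub ((meas_coeff h.meas_θ k).const_mul _)

lemma Adm.measurable_quadSq (h : Adm u θ) (k : Z2) : Measurable (quadSq u k) :=
  Finset.measurable_fun_sum _ fun l _ => Finset.measurable_fun_sum _ fun j _ =>
    (meas_coeff (h.meas_uu l j) k).norm.pow_const 2

lemma Adm.measurable_fluxSq (h : Adm u θ) (k : Z2) : Measurable (fluxSq u θ k) :=
  Finset.measurable_fun_sum _ fun i _ => (meas_coeff (h.meas_θu i) k).norm.pow_const 2

lemma FlowData.lintegral_resid_le (h : FlowData α ε M u θ u₀ θ₀) (hk : k ≠ 0) (i : Fin 2) (T : ℝ) :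
    ∫⁻ t in Ioc 0 T, ‖resid α u θ k i t‖ₑ ^ 2 ≤ 2 * ofReal ε * ‖coeff (u₀ · i) k - stokesMul α k i *
    coeff θ₀ k‖ₑ ^ 2 + 2 * ofReal (ε ^ 2) * ∫⁻ t in Ioc 0 T, ofReal (8 * quadSq u k t + 4 * fluxSq u
    θ k t) := by
  have hε := h.eps_pos
  have hα := h.alpha_gt
  have hf := one_le_freq hk
  have hf0 : 0 < freq k := by linarith
  have hfα : freq k ≤ freq k ^ (2 * α) := by
    have := Real.rpow_le_rpow_of_exponent_le hf (by linarith : 1 ≤ 2 * α)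
    rwa [rpow_one] at this
  have hfα0 : 0 < freq k ^ (2 * α) := by linarith
  set a := freq k ^ (2 * α) / ε with ha_def
  have ha : 0 < a := by positivity
  have hainv : 1 / a = ε / freq k ^ (2 * α) := by rw [ha_def, one_div_div]
  have hainv1 : 1 / a ≤ ε := by
    rw [hainv]
    exact div_le_self hε.le (by linarith)
  set r₀ := coeff (u₀ · i) k - stokesMul α k i * coeff θ₀ k
  set g := residForce α u θ k i with hg
  set E : ℝ → ℝ≥0∞ := fun σ => ofReal (exp (-a * σ)) with hE
  have hEm : Measurable E := measurable_ofReal.comp (Continuous.measurable (by fun_prop))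
  have hgm : AEStronglyMeasurable g ℓ(T) := (h.adm.integrableOn_residForce α k i T).1
  have hd := ae_eq_duhamel a (fun T => h.adm.integrableOn_resid α k i T)
    (fun T => h.adm.integrableOn_residForce α k i T) (h.resid_ode hk i)
  have hpt : ∀ᵐ t ∂ℓ(T), ‖resid α u θ k i t‖ₑ ^ 2 ≤ 2 * (E t * ‖r₀‖ₑ ^ 2) + 2 * (ofReal (1 / a) *
        ∫⁻ s in Ioc 0 t, E (t - s) * ‖g s‖ₑ ^ 2) := by
    filter_upwards [ae_Ioc hd T, ae_mem_Ioc] with t h1 h2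
    rw [h1]
    refine (pow_le_pow_left' (enorm_add_le _ _) 2).trans ((add_sq_le_two _ _).trans ?_)
    gcongr
    · rw [enorm_mul, mul_pow]
      gcongr
      rw [← ofReal_norm, norm_real, norm_of_nonneg (exp_pos _).le, sq]
      refine mul_le_of_le_one_left zero_le (ofReal_le_one.2 (Real.exp_le_one_iff.2 ?_))
      have := mul_pos ha h2.1
      linarith
    · exact enorm_duhamel_sq_le ha h2.1.le (h.adm.integrableOn_residForce α k i t).1
  refine (lintegral_mono_ae hpt).trans ?_
  rw [lintegral_add_left' ((hEm.mul_const _).const_mul _).aemeasurable]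
  refine add_le_add ?_ ?_
  · rw [lintegral_const_mul _ (hEm.mul_const _), lintegral_mul_const _ hEm, ← mul_assoc]
    gcongr
    calc ∫⁻ t in Ioc 0 T, E t ≤ ∫⁻ t in Ioi 0, E t := lintegral_mono_set Ioc_subset_Ioi_self
      _ ≤ ofReal (1 / a) := lintegral_exp_neg_le ha
      _ ≤ ofReal ε := ofReal_le_ofReal hainv1
  · rw [lintegral_const_mul' _ _ (by norm_num), lintegral_const_mul' _ _ ofReal_ne_top]
    have h1 := lintegral_conv_le hEm T (hgm.enorm.pow_const 2)
    have h2 : (∫⁻ σ in Ioi (0 : ℝ), E σ) * ∫⁻ s in Ioc 0 T, ‖g s‖ₑ ^ 2 ≤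
        ofReal (1 / a) * (ofReal (freq k ^ 2) *
          ∫⁻ t in Ioc 0 T, ofReal (8 * quadSq u k t + 4 * fluxSq u θ k t)) := by
      refine mul_le_mul' (lintegral_exp_neg_le ha) ?_
      rw [← lintegral_const_mul' _ _ ofReal_ne_top]
      refine lintegral_mono fun s => ?_
      rw [← ofReal_mul (sq_nonneg _), ← ofReal_norm, ← ofReal_pow (norm_nonneg _)]
      exact ofReal_le_ofReal (norm_residForce_sq_le hα hk i s)
    rw [mul_assoc]
    refine mul_le_mul_right ?_ _
    refine (mul_le_mul_right (h1.trans h2) _).trans ?_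
    rw [← mul_assoc, ← mul_assoc, ← ofReal_mul (by positivity), ← ofReal_mul (by positivity)]
    gcongr
    rw [hainv]
    calc ε / freq k ^ (2 * α) * (ε / freq k ^ (2 * α)) * freq k ^ 2 =
        ε ^ 2 * (freq k / freq k ^ (2 * α)) ^ 2 := by ring
      _ ≤ ε ^ 2 * 1 ^ 2 := by
        gcongr
        rw [div_le_one hfα0]
        exact hfα
      _ = ε ^ 2 := by ring

/-- The squared distance to the Stokes flow, without the mean. -/
def residSq (α : ℝ) (u : VectorField) (θ : ScalarField) (t : ℝ) : ℝ≥0∞ :=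
  ∑' k : Z2, if k = 0 then 0 else ∑ i, ‖resid α u θ k i t‖ₑ ^ 2

lemma one_le_jw_rpow (hα1 : α ≤ 1) (k : Z2) : 1 ≤ ofReal (jw k ^ (2 - 2 * (α - 1 / 2))) := by
  rw [← ofReal_one]
  exact ofReal_le_ofReal (Real.one_le_rpow (one_le_jw k) (by linarith))

lemma ofReal_norm_sq (z : ℂ) : ofReal (‖z‖ ^ 2) = ‖z‖ₑ ^ 2 := by
  rw [ofReal_pow (norm_nonneg _), ofReal_norm]

lemma tsum_quadSq_le (hα : 1 / 2 < α) (hα1 : α ≤ 1) (h : ∀ i, MemLp (u t · i) 2 vol) : ∑' k, ofReal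
    (quadSq u k t) ≤ prodConst (α - 1 / 2) * h1Sum (u t) ^ 2 := by
  have hp : ∀ l j, ∑' k, ‖coeff (fun x => u t x j * u t x l) k‖ₑ ^ 2 ≤
      prodConst (α - 1 / 2) * (h1NormSq (u t · j) * h1NormSq (u t · l)) :=
    fun l j => (tsum_le_tsum fun k => le_mul_of_one_le_left zero_le
      (one_le_jw_rpow hα1 k)).trans (tsum_weight_coeff_mul_le (δ := α - 1 / 2) (by linarith)
        (by linarith) (h j) (h l))
  have e : ∀ k, ofReal (quadSq u k t) =
      ∑ l, ∑ j, ‖coeff (fun x => u t x j * u t x l) k‖ₑ ^ 2 := fun k => by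
    rw [quadSq, ofReal_sum_of_nonneg fun l _ => sum_nonneg fun j _ => sq_nonneg _]
    refine sum_congr rfl fun l _ => ?_
    rw [ofReal_sum_of_nonneg fun j _ => sq_nonneg _]
    exact sum_congr rfl fun j _ => ofReal_norm_sq _
  simp_rw [e]
  simp only [sum_univ_two, h1Sum]
  rw [tsum_add, tsum_add, tsum_add]
  refine (add_le_add (add_le_add (hp 0 0) (hp 0 1)) (add_le_add (hp 1 0) (hp 1 1))).trans
    (le_of_eq ?_)
  ring

lemma tsum_fluxSq_le (hθ : Measurable (θ t)) (hM : ∀ᵐ x ∂vol, |θ t x| ≤ M) (h : ∀ i, MemLp (u t · i)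
    2 vol) : ∑' k, ofReal (fluxSq u θ k t) ≤ ofReal (M ^ 2) * h1Sum (u t) := by
  have hp : ∀ i, ∑' k, ofReal (‖coeff (fun x => θ t x * u t x i) k‖ ^ 2) ≤
      ofReal (M ^ 2) * h1NormSq (u t · i) := fun i => by
    rw [← ofReal_integral_sq_eq (memLp_two_bdd_mul hθ hM (h i))]
    refine le_trans ?_ (mul_le_mul_right (tsum_sq_coeff_le_h1NormSq _) _)
    rw [← ofReal_integral_sq_eq (h i), ← ofReal_mul (sq_nonneg _), ← integral_const_mul]
    refine ofReal_le_ofReal (integral_mono_of_nonneg (ae_of_all _ fun x => sq_nonneg _)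
      ((h i).integrable_sq.const_mul _) ?_)
    filter_upwards [hM] with x hx
    rw [mul_pow, ← sq_abs (θ t x)]
    gcongr
  have e : ∀ k, ofReal (fluxSq u θ k t) =
      ∑ i, ofReal (‖coeff (fun x => θ t x * u t x i) k‖ ^ 2) := fun k =>
    ofReal_sum_of_nonneg fun i _ => sq_nonneg _
  simp_rw [e]
  simp only [sum_univ_two, h1Sum]
  rw [tsum_add]
  refine (add_le_add (hp 0) (hp 1)).trans (le_of_eq ?_)
  ring

/-- The constant in the convergence rate of the velocity to the Stokes flow. -/
def residConst (α M : ℝ) (N₀ K : ℝ≥0∞) (T : ℝ) : ℝ≥0∞ :=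
  2 * (2 * N₀ + 4 * ofReal (M ^ 2)) +
    4 * (ofReal T * (8 * (prodConst (α - 1 / 2) * K ^ 2) + 4 * (ofReal (M ^ 2) * K)))

/-- The velocity is close to the Stokes flow in `L²`. -/
theorem FlowData.lintegral_residSq_le (h : FlowData α ε M u θ u₀ θ₀) (hε1 : ε ≤ 1) {N₀ K : ℝ≥0∞}
    (hN₀ : h1Sum u₀ ≤ N₀) (hK : ∀ᵐ t ∂ℓ, h1Sum (u t) ≤ K) (T : ℝ) :
    ∫⁻ t in Ioc 0 T, residSq α u θ t ≤ ofReal ε * residConst α M N₀ K T := by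
  have hε := h.eps_pos
  have hm : ∀ k i, Measurable fun t => ‖resid α u θ k i t‖ₑ ^ 2 := fun k i =>
    (h.adm.measurable_resid α k i).enorm.pow_const 2
  set Q : Z2 → ℝ → ℝ≥0∞ := fun k t => ofReal (8 * quadSq u k t + 4 * fluxSq u θ k t)
  have hQm : ∀ k, Measurable (Q k) := fun k => measurable_ofReal.comp
    (((h.adm.measurable_quadSq k).const_mul _).add ((h.adm.measurable_fluxSq k).const_mul _))
  have hQ : ∫⁻ t in Ioc 0 T, ∑' k, Q k t ≤ ofReal T *
      (8 * (prodConst (α - 1 / 2) * K ^ 2) + 4 * (ofReal (M ^ 2) * K)) := by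
    have : ∀ᵐ t ∂ℓ(T), ∑' k, Q k t ≤
        8 * (prodConst (α - 1 / 2) * K ^ 2) + 4 * (ofReal (M ^ 2) * K) := by
      filter_upwards [ae_Ioc h.adm.slice T, ae_Ioc h.bound T, ae_Ioc hK T] with t h1 h2 h3
      have e : ∀ k, Q k t = 8 * ofReal (quadSq u k t) + 4 * ofReal (fluxSq u θ k t) := fun k => by
        have q1 : 0 ≤ quadSq u k t := sum_nonneg fun l _ => sum_nonneg fun j _ => sq_nonneg _
        have q2 : 0 ≤ fluxSq u θ k t := sum_nonneg fun i _ => sq_nonneg _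
        simp only [Q]
        rw [ofReal_add (by positivity) (by positivity), ofReal_mul (by norm_num),
          ofReal_mul (by norm_num)]
        norm_num
      simp_rw [e]
      rw [tsum_add, ENNReal.tsum_mul_left, ENNReal.tsum_mul_left]
      gcongr
      · exact (tsum_quadSq_le h.alpha_gt h.alpha_le h1.1).trans (by gcongr)
      · exact (tsum_fluxSq_le (meas_slice h.adm.meas_θ t) h2 h1.1).trans (by gcongr)
    refine (lintegral_mono_ae this).trans ?_
    rw [lintegral_const, Measure.restrict_apply_univ, volume_Ioc, sub_zero, mul_comm]
  set R₀ : Z2 → Fin 2 → ℝ≥0∞ := fun k i => ‖coeff (u₀ · i) k - stokesMul α k i * coeff θ₀ k‖ₑ ^ 2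
  have hmode : ∀ k : Z2, ∫⁻ t in Ioc 0 T, (if k = 0 then 0 else ∑ i, ‖resid α u θ k i t‖ₑ ^ 2) ≤
      ofReal ε * (if k = 0 then 0 else 2 * ∑ i, R₀ k i) +
        4 * ofReal ε * ∫⁻ t in Ioc 0 T, Q k t := fun k => by
    by_cases hk : k = 0
    · simp [hk]
    simp only [hk, if_false, sum_univ_two]
    rw [lintegral_add_left (hm k 0)]
    refine (add_le_add (h.lintegral_resid_le hk 0 T) (h.lintegral_resid_le hk 1 T)).trans ?_
    have hsq : ofReal (ε ^ 2) ≤ ofReal ε := ofReal_le_ofReal (by nlinarith)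
    calc _ = ofReal ε * (2 * (R₀ k 0 + R₀ k 1)) + 4 * ofReal (ε ^ 2) *
          ∫⁻ t in Ioc 0 T, Q k t := by
            simp only [R₀, Q]
            ring
      _ ≤ _ := by gcongr
  have hR₀ : ∑' k : Z2, (if k = 0 then 0 else 2 * ∑ i, R₀ k i) ≤
      2 * (2 * N₀ + 4 * ofReal (M ^ 2)) := by
    have h1 : ∀ k : Z2, (if k = 0 then 0 else 2 * ∑ i, R₀ k i) ≤
        2 * (2 * (∑ i, ofReal (‖coeff (u₀ · i) k‖ ^ 2)) +
          4 * ofReal (‖coeff θ₀ k‖ ^ 2)) := fun k => by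
      by_cases hk : k = 0
      · simp [hk]
      simp only [hk, if_false]
      gcongr
      have h2 : ∀ i, R₀ k i ≤ 2 * ofReal (‖coeff (u₀ · i) k‖ ^ 2) +
          2 * ofReal (‖coeff θ₀ k‖ ^ 2) := fun i => by
        rw [ofReal_norm_sq, ofReal_norm_sq]
        refine (pow_le_pow_left' (enorm_sub_le) 2).trans ((add_sq_le_two _ _).trans ?_)
        gcongr
        rw [enorm_mul]
        refine mul_le_of_le_one_left zero_le ?_
        rw [← ofReal_norm, norm_real, norm_eq_abs]
        exact ofReal_le_one.2 ((abs_stokesMul_le h.alpha_gt hk i).trans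
          (inv_le_one_of_one_le₀ (one_le_freq hk)))
      rw [sum_univ_two, sum_univ_two]
      refine (add_le_add (h2 0) (h2 1)).trans (le_of_eq (by ring))
    refine (tsum_le_tsum h1).trans ?_
    rw [ENNReal.tsum_mul_left, tsum_add, ENNReal.tsum_mul_left, ENNReal.tsum_mul_left]
    gcongr
    · refine le_trans ?_ hN₀
      simp only [sum_univ_two, h1Sum]
      rw [tsum_add]
      exact add_le_add (tsum_sq_coeff_le_h1NormSq _) (tsum_sq_coeff_le_h1NormSq _)
    · have e : ∀ k, coeff θ₀ k = coeff (h.meas_θ₀.mk θ₀) k := coeff_congr h.meas_θ₀.ae_eq_mk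
      simp_rw [e]
      refine tsum_coeff_sq_le h.meas_θ₀.measurable_mk ?_
      filter_upwards [h.bound_θ₀, h.meas_θ₀.ae_eq_mk] with x h1 h2
      rwa [← h2]
  unfold residSq
  rw [lintegral_tsum fun k => by
    by_cases hk : k = 0
    · simp [hk]
    · simp only [hk, if_false]
      exact (Finset.measurable_fun_sum _ fun i _ => hm k i).aemeasurable]
  refine (tsum_le_tsum hmode).trans ?_
  rw [tsum_add, ENNReal.tsum_mul_left, ENNReal.tsum_mul_left,
    ← lintegral_tsum fun k => (hQm k).aemeasurable]
  calc _ ≤ ofReal ε * (2 * (2 * N₀ + 4 * ofReal (M ^ 2))) +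
      4 * ofReal ε * (ofReal T *
      (8 * (prodConst (α - 1 / 2) * K ^ 2) + 4 * (ofReal (M ^ 2) * K))) := by gcongr
    _ = _ := by
      unfold residConst
      ring

end Residual

/-! ### Fourier series of smooth functions -/

lemma isOpenQuotientMap_coe : IsOpenQuotientMap fun (y : Fin 2 → ℝ) (i : Fin 2) => (y i : 𝕊) :=
  IsOpenQuotientMap.piMap fun _ => QuotientAddGroup.isOpenQuotientMap_mk

lemma IsSmooth.continuous (hf : IsSmooth f) : Continuous f :=
  isOpenQuotientMap_coe.isQuotientMap.continuous_iff.2 (ContDiff.continuous hf)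

lemma IsSmooth.pd_coe (hf : IsSmooth f) (i : Fin 2) (y : Fin 2 → ℝ) : pd i f (fun j => (y j : 𝕊)) =
    fderiv ℝ (fun y : Fin 2 → ℝ => f fun i => (y i : 𝕊)) y (single i 1) := by
  have h1 : HasDerivAt (fun s : ℝ => y + s • (single i (1 : ℝ) : Fin 2 → ℝ)) (single i 1) 0 := by
    simpa using ((hasDerivAt_id (0 : ℝ)).smul_const (single i (1 : ℝ) : Fin 2 → ℝ)).const_add y
  have h2 :=
      ((ContDiff.differentiable hf (by simp) y).hasFDerivAt).comp_hasDerivAt_of_eq (0 : ℝ) h1 (by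
          simp)
  unfold pd
  simp_rw [lift_add_single]
  exact h2.deriv

lemma IsSmooth.pd (hf : IsSmooth f) (i : Fin 2) : IsSmooth (pd i f) := by
  unfold IsSmooth
  simp_rw [hf.pd_coe]
  exact (ContDiff.fderiv_right hf (by simp)).clm_apply contDiff_const

lemma IsSmooth.mul (hf : IsSmooth f) (hg : IsSmooth g) :
    IsSmooth fun x => f x * g x := ContDiff.mul hf hg

lemma pd_mul (hf : IsSmooth f) (hg : IsSmooth g) (i : Fin 2) (x : T2) :
    pd i (fun y => f y * g y) x = pd i f x * g x + f x * pd i g x := by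
  have := (hf.hasDerivAt_zero x i).fun_mul (hg.hasDerivAt_zero x i)
  simpa [PrandtlLimit.pd] using this.deriv

lemma integrable_cont (hf : Continuous f) : Integrable f vol := (memLp_cont hf).l1

lemma exists_abs_le_of_continuous (hf : Continuous f) : ∃ C, ∀ x, |f x| ≤ C := by
  obtain ⟨C, hC⟩ := isCompact_univ.exists_bound_of_continuousOn hf.continuousOn
  exact ⟨C, fun x => hC x (mem_univ x)⟩

lemma coeff_pd (hf : IsSmooth f) (i : Fin 2) (k : Z2) :
    coeff (pd i f) k = 2 * π * I * (k i) * coeff f k := by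
  have hc := (hf.pd i).continuous
  obtain ⟨C, hC⟩ := exists_abs_le_of_continuous hc
  have hcs : Continuous fun s : ℝ => (single i (s : 𝕊) : T2) :=
    (continuous_single i).comp (AddCircle.continuous_mk' 1)
  have h1 : HasDerivAt (fun s : ℝ => ∫ x, mFourier (-k) x * (f (x + single i (s : 𝕊)) : ℂ) ∂vol)
      (∫ x, mFourier (-k) x * (pd i f (x + single i ((0 : ℝ) : 𝕊)) : ℂ) ∂vol) 0 := by
    refine (hasDerivAt_integral_of_dominated_loc_of_deriv_le (𝕜 := ℝ) (bound := fun _ => C)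
      (F := fun (s : ℝ) x => mFourier (-k) x * (f (x + single i (s : 𝕊)) : ℂ))
      (F' := fun (s : ℝ) x => mFourier (-k) x * (pd i f (x + single i (s : 𝕊)) : ℂ))
      univ_mem (Eventually.of_forall fun s => ?_) ?_ ?_ (ae_of_all _ fun x s _ => ?_)
      (integrable_const (μ := vol) C) (ae_of_all _ fun x s _ => ?_)).2
    · exact (Continuous.mul (mFourier (-k)).continuous (continuous_ofReal.comp
        (hf.continuous.comp (continuous_id.add continuous_const)))).aestronglyMeasurable
    · exact integrable_mFourier_mul (integrable_cont
        (hf.continuous.comp (continuous_id.add continuous_const))) _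
    · exact (Continuous.mul (mFourier (-k)).continuous (continuous_ofReal.comp
        (hc.comp (continuous_id.add continuous_const)))).aestronglyMeasurable
    · rw [norm_mul, norm_mFourier_apply, one_mul, norm_real]
      exact hC _
    · exact (hf.hasDerivAt x i s).ofReal_comp.const_mul _
  have h2 : (fun s : ℝ => ∫ x, mFourier (-k) x * (f (x + single i (s : 𝕊)) : ℂ) ∂vol) =
      fun s : ℝ => Complex.exp (2 * π * I * (k i) * s) * coeff f k := by
    ext s
    rw [← mFourier_pi_single, ← coeff_translate, coeff_eq]
  rw [h2] at h1
  have h3 : HasDerivAt (fun s : ℝ => Complex.exp (2 * π * I * (k i) * s) * coeff f k)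
      (2 * π * I * (k i) * coeff f k) 0 := by
    have h4 : HasDerivAt (fun s : ℝ => 2 * π * I * (k i) * (s : ℂ)) (2 * π * I * (k i) * 1) 0 :=
      (ofRealCLM.hasDerivAt (x := (0 : ℝ))).const_mul _
    have := h4.cexp.mul_const (coeff f k)
    simpa using this
  rw [← (h1.unique h3), coeff_eq]
  simp

lemma IsSmooth.exists_coeff_le (hf : IsSmooth f) (n : ℕ) (i : Fin 2) :
    ∃ C, ∀ k, |(k i : ℝ)| ^ n * ‖coeff f k‖ ≤ C := by
  induction n generalizing f with
  | zero => exact ⟨_, fun k => by simpa using norm_coeff_le f k⟩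
  | succ n ih =>
    obtain ⟨C, hC⟩ := ih (hf.pd i)
    refine ⟨C, fun k => le_trans ?_ (hC k)⟩
    rw [coeff_pd hf, norm_mul, pow_succ, mul_assoc]
    have e : ‖(2 * π * I * (k i) : ℂ)‖ = 2 * π * |(k i : ℝ)| := by
      simp [abs_of_pos pi_pos]
    rw [e]
    gcongr
    nlinarith [Real.pi_gt_three, abs_nonneg (k i : ℝ)]

lemma IsSmooth.rapid (hf : IsSmooth f) : Rapid (coeff f) := fun n => by
  obtain ⟨C0, h0⟩ := hf.exists_coeff_le (n + 3) 0
  obtain ⟨C1, h1⟩ := hf.exists_coeff_le (n + 3) 1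
  refine summable_of_ne_finset_zero (s := ({0} : Finset Z2))
    (f := fun k : Z2 => if k = 0 then ‖k‖ ^ n * ‖coeff f k‖ else 0) (fun k hk => by
      simp only [Finset.mem_singleton] at hk
      simp [hk]) |>.add (Summable.of_nonneg_of_le (f := fun k : Z2 =>
      (C0 + C1) * ‖k‖ ^ (-(3 : ℝ))) (g := fun k : Z2 => if k = 0 then 0 else ‖k‖ ^ n * ‖coeff f k‖)
      (fun k => by split_ifs <;> positivity) (fun k => ?_)
          ((summable_norm_rpow_neg (p := 3) (by norm_num)).mul_left (C0 + C1))) |>.congr fun k => ?_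
  · have hC : 0 ≤ C0 + C1 := by
      have := h0 0
      have := h1 0
      simp at *
      linarith
    split_ifs with hk
    · positivity
    have hk0 : 0 < ‖k‖ := norm_pos_iff.2 hk
    have e : ‖k‖ ^ (-(3 : ℝ)) = (‖k‖ ^ 3)⁻¹ := by
      rw [rpow_neg hk0.le]
      norm_cast
    rw [e, ← div_eq_mul_inv, le_div_iff₀ (by positivity), mul_right_comm, ← pow_add]
    obtain ⟨i, hi⟩ : ∃ i, ‖k‖ = |(k i : ℝ)| := by
      by_contra! hne
      refine lt_irrefl ‖k‖ ((pi_norm_lt_iff hk0).2 fun i => ?_)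
      have := norm_le_pi_norm k i
      exact lt_of_le_of_ne this (by rw [Int.norm_eq_abs]; exact (hne i).symm)
    have p0 := (mul_nonneg (pow_nonneg (abs_nonneg (k 0 : ℝ)) (n + 3)) (norm_nonneg _)).trans (h0 k)
    have p1 := (mul_nonneg (pow_nonneg (abs_nonneg (k 1 : ℝ)) (n + 3)) (norm_nonneg _)).trans (h1 k)
    rw [hi]
    fin_cases i
    · exact (h0 k).trans (by linarith)
    · exact (h1 k).trans (by linarith)
  · split_ifs <;> simp

lemma IsSmooth.eq_fser (hf : IsSmooth f) : f = fser (coeff f) :=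
  Continuous.ae_eq_iff_eq vol hf.continuous (continuous_fser hf.rapid.summable_norm) |>.1
    (ae_eq_fser (memLp_cont hf.continuous) hf.rapid.summable_norm)

lemma isDivFree_of_coeff (hv : ∀ i, Integrable (v · i) vol)
    (h : ∀ k, ∑ i, (k i : ℂ) * coeff (v · i) k = 0) : IsDivFree v := by
  intro ψ hψ
  have h1 : ∀ i, HasSum (fun k => (2 * π * I * (k i) * coeff ψ k *
      conj (coeff (v · i) k)).re) (∫ x, v x i * pd i ψ x ∂vol) := fun i => by
    have := hasSum_integral_mul_fser (hv i) (hψ.rapid.deriv i).summable_norm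
    have e : ∀ x, pd i ψ x = fser (fun k => 2 * π * I * (k i) * coeff ψ k) x := fun x => by
        conv_lhs => rw [hψ.eq_fser]
        exact pd_fser hψ.rapid i x
    simp_rw [e]
    exact this
  have hi : ∀ i, Integrable (fun x => v x i * pd i ψ x) vol := fun i => by
    obtain ⟨C, hC⟩ := exists_abs_le_of_continuous (hψ.pd i).continuous
    exact (hv i).mul_bdd (c := C) (hψ.pd i).continuous.aestronglyMeasurable (ae_of_all _ hC)
  rw [integral_finsetSum _ fun i _ => hi i, sum_univ_two]
  refine ((h1 0).add (h1 1)).unique ?_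
  refine hasSum_zero.congr_fun fun k => ?_
  rw [← add_re]
  have h2 := congrArg conj (h k)
  rw [sum_univ_two, map_add, map_mul, map_mul, map_zero, map_intCast, map_intCast] at h2
  have e : 2 * π * I * (k 0) * coeff ψ k * conj (coeff (v · 0) k) +
      2 * π * I * (k 1) * coeff ψ k * conj (coeff (v · 1) k) = 0 := by
    linear_combination (2 * π * I * coeff ψ k) * h2
  rw [e, Complex.zero_re]

lemma dist_add_single_le (x : T2) (i : Fin 2) (s : ℝ) : dist (x + single i (s : 𝕊)) x ≤ |s| := by
  rw [dist_eq_norm, add_sub_cancel_left]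
  refine (pi_norm_le_iff_of_nonneg (abs_nonneg s)).2 fun j => ?_
  by_cases h : j = i
  · subst h
    rw [Pi.single_eq_same]
    exact QuotientAddGroup.norm_mk_le_norm
  · rw [Pi.single_eq_of_ne h, norm_zero]
    exact abs_nonneg s

/-- Integration by parts against a Lipschitz function. -/
lemma abs_integral_mul_pd_le {U : T2 → ℝ} (hL : 0 ≤ L) (hU : ∀ x y, |U x - U y| ≤ L * dist x y) (hg
    : IsSmooth g) (j : Fin 2) : |∫ x, U x * pd j g x ∂vol| ≤ L * ∫ x, |g x| ∂vol := by
  have hUc := continuous_of_lip hU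
  obtain ⟨C, hC⟩ := exists_abs_le_of_continuous (hg.pd j).continuous
  have htr : ∀ s : ℝ, Continuous fun x : T2 => x + single j (s : 𝕊) := fun s =>
    continuous_id.add continuous_const
  have h1 : HasDerivAt (fun s : ℝ => ∫ x, U x * g (x + single j (s : 𝕊)) ∂vol)
      (∫ x, U x * pd j g (x + single j ((0 : ℝ) : 𝕊)) ∂vol) 0 := by
    refine (hasDerivAt_integral_of_dominated_loc_of_deriv_le (𝕜 := ℝ) (bound := fun x => |U x| * C)
      (F := fun (s : ℝ) x => U x * g (x + single j (s : 𝕊)))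
      (F' := fun (s : ℝ) x => U x * pd j g (x + single j (s : 𝕊)))
      univ_mem (Eventually.of_forall fun s => ?_) ?_ ?_ (ae_of_all _ fun x s _ => ?_)
      ((integrable_cont hUc).abs.mul_const C) (ae_of_all _ fun x s _ => ?_)).2
    · exact (hUc.mul (hg.continuous.comp (htr s))).aestronglyMeasurable
    · exact integrable_cont (hUc.mul (hg.continuous.comp (htr 0)))
    · exact (hUc.mul ((hg.pd j).continuous.comp (htr 0))).aestronglyMeasurable
    · rw [norm_mul, norm_eq_abs, norm_eq_abs]
      exact mul_le_mul_of_nonneg_left (hC _) (abs_nonneg _)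
    · exact (hg.hasDerivAt x j s).const_mul _
  have e0 : (fun x : T2 => x + single j ((0 : ℝ) : 𝕊)) = id := by ext x; simp
  have h2 := h1.le_of_lip' (C := L * ∫ x, |g x| ∂vol)
    (mul_nonneg hL (integral_nonneg fun x => abs_nonneg _)) (Eventually.of_forall fun s => ?_)
  · simpa using h2
  obtain ⟨v, hv⟩ : ∃ v : T2, v = single j (s : 𝕊) := ⟨_, rfl⟩
  rw [← hv]
  have hsh : ∫ x, U x * g (x + v) ∂vol = ∫ x, U (x - v) * g x ∂vol := by
    rw [← integral_add_right_eq_self (fun x => U (x - v) * g x) v]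
    simp
  have hc2 : Continuous fun x => U (x - v) * g x :=
    (hUc.comp (continuous_id.sub continuous_const)).mul hg.continuous
  have hz : ∫ x, U x * g (x + single j ((0 : ℝ) : 𝕊)) ∂vol = ∫ x, U x * g x ∂vol := by simp
  have i2 : Integrable (fun x => U x * g x) vol := integrable_cont (hUc.mul hg.continuous)
  rw [hsh, hz, ← integral_sub (integrable_cont hc2) i2, sub_zero, mul_right_comm,
    ← integral_const_mul]
  refine (norm_integral_le_integral_norm _).trans (integral_mono
    (integrable_cont (hc2.sub (hUc.mul hg.continuous))).norm ((integrable_cont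
        hg.continuous).abs.const_mul _)
    fun x => ?_)
  simp only [norm_eq_abs]
  rw [← sub_mul, abs_mul]
  refine mul_le_mul_of_nonneg_right ((hU _ _).trans (mul_le_mul_of_nonneg_left ?_ hL)) (abs_nonneg
      _)
  have := dist_add_single_le (x - v) j s
  rwa [← hv, sub_add_cancel, dist_comm] at this

section

/-! ### The flux of the `H⁻¹` energy at a fixed time -/

/-- Fourier coefficients of the frequency truncation of `η`. -/
def trunc (S : Finset Z2) (η : T2 → ℝ) (k : Z2) : ℂ := if k ∈ S then coeff η k else 0

/-- Fourier coefficients of the truncated `∂ᵢ (-Δ)⁻¹ η`. -/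
def potCoeff (S : Finset Z2) (η : T2 → ℝ) (i : Fin 2) (k : Z2) : ℂ :=
  2 * π * I * (k i) * ((freq k ^ 2)⁻¹ : ℝ) * trunc S η k

/-- The truncated `∂ᵢ (-Δ)⁻¹ η`. -/
def potGrad (S : Finset Z2) (η : T2 → ℝ) (i : Fin 2) : T2 → ℝ := fser (potCoeff S η i)

variable {S : Finset Z2} {η : T2 → ℝ}

lemma rapid_trunc (S : Finset Z2) (η : T2 → ℝ) : Rapid (trunc S η) :=
  Rapid.of_finite S fun k hk => by simp [trunc, hk]

lemma rapid_potCoeff (S : Finset Z2) (η : T2 → ℝ) (i : Fin 2) : Rapid (potCoeff S η i) :=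
  Rapid.of_finite S fun k hk => by simp [potCoeff, trunc, hk]

lemma trunc_neg (hS : ∀ k, -k ∈ S ↔ k ∈ S) (k : Z2) : trunc S η (-k) = conj (trunc S η k) := by
  unfold trunc
  rw [apply_ite conj, ← coeff_neg, map_zero]
  exact if_congr (hS k) rfl rfl

lemma potCoeff_neg (hS : ∀ k, -k ∈ S ↔ k ∈ S) (i : Fin 2) (k : Z2) :
    potCoeff S η i (-k) = conj (potCoeff S η i k) := by
  unfold potCoeff
  rw [trunc_neg hS, freq_neg]
  simp only [map_mul, conj_I, conj_ofReal, map_intCast, Pi.neg_apply, Int.cast_neg, map_ofNat]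
  ring

lemma isSmooth_potGrad (S : Finset Z2) (η : T2 → ℝ) (i : Fin 2) : IsSmooth (potGrad S η i) :=
  isSmooth_fser (rapid_potCoeff S η i)

lemma integral_mul_potGrad {F : T2 → ℝ} (hF : Integrable F vol) (i : Fin 2) : ∫ x, F x * potGrad S η
    i x ∂vol = ∑ k ∈ S, (freq k ^ 2)⁻¹ * (2 * π * I * (k i) * coeff η k * conj (coeff F k)).re := by
  rw [potGrad,
      (hasSum_integral_mul_fser hF (rapid_potCoeff S η i).summable_norm).unique
          (hasSum_sum_of_ne_finset_zero (s := S) fun k hk => by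
    simp [potCoeff, trunc, hk])]
  refine sum_congr rfl fun k hk => ?_
  rw [← re_ofReal_mul]
  simp only [potCoeff, trunc, hk, if_true]
  ring_nf

lemma sum_integral_potGrad_sq (hS : ∀ k, -k ∈ S ↔ k ∈ S) :
    ∑ i, ∫ x, potGrad S η i x ^ 2 ∂vol = ∑ k ∈ S, (freq k ^ 2)⁻¹ * ‖coeff η k‖ ^ 2 := by
  have h : ∀ i, ∫ x, potGrad S η i x ^ 2 ∂vol = ∑ k ∈ S, ‖potCoeff S η i k‖ ^ 2 := fun i => by
    refine (hasSum_sq_coeff (memLp_cont (isSmooth_potGrad S η i).continuous)).unique ?_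
    have e : ∀ k, coeff (potGrad S η i) k = potCoeff S η i k :=
      coeff_fser (rapid_potCoeff S η i).summable_norm (potCoeff_neg hS i)
    simp_rw [e]
    exact hasSum_sum_of_ne_finset_zero fun k hk => by simp [potCoeff, trunc, hk]
  rw [sum_univ_two, h, h, ← sum_add_distrib]
  refine sum_congr rfl fun k hk => ?_
  have e : ∀ i, ‖potCoeff S η i k‖ ^ 2 =
      4 * π ^ 2 * (k i : ℝ) ^ 2 * ((freq k ^ 2)⁻¹) ^ 2 * ‖coeff η k‖ ^ 2 := fun i => by
    simp only [potCoeff, trunc, hk, if_true, norm_mul, norm_real, norm_I,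
      norm_eq_abs, mul_pow, sq_abs, Complex.norm_intCast]
    norm_num
  rw [e, e]
  by_cases hk0 : k = 0
  · simp [hk0, freq_zero]
  · have hf : freq k ^ 2 ≠ 0 := (pow_pos (zero_lt_one.trans_le (one_le_freq hk0)) 2).ne'
    have h1 := mul_inv_cancel₀ hf
    rw [freq_sq, ksq_eq] at h1 ⊢
    linear_combination (4 * π ^ 2 * ((k 0 : ℝ) ^ 2 + (k 1 : ℝ) ^ 2))⁻¹ * ‖coeff η k‖ ^ 2 * h1

lemma fser_add {d : Z2 → ℂ} (hc : Summable fun k => ‖c k‖) (hd : Summable fun k => ‖d k‖)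
    (x : T2) : fser c x + fser d x = fser (fun k => c k + d k) x := by
  unfold fser
  rw [← add_re, ← (summable_mul_mFourier hc x).tsum_add (summable_mul_mFourier hd x)]
  simp_rw [add_mul]

lemma pd_potGrad_comm (S : Finset Z2) (η : T2 → ℝ) (i j : Fin 2) (x : T2) :
    pd j (potGrad S η i) x = pd i (potGrad S η j) x := by
  unfold potGrad
  rw [pd_fser (rapid_potCoeff S η i), pd_fser (rapid_potCoeff S η j)]
  congr 1
  ext k
  simp only [potCoeff]
  ring

lemma sum_pd_potGrad (h0 : coeff η 0 = 0) (x : T2) :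
    pd 0 (potGrad S η 0) x + pd 1 (potGrad S η 1) x = -fser (trunc S η) x := by
  unfold potGrad
  rw [pd_fser (rapid_potCoeff S η 0), pd_fser (rapid_potCoeff S η 1),
    fser_add ((rapid_potCoeff S η 0).deriv 0).summable_norm
      ((rapid_potCoeff S η 1).deriv 1).summable_norm]
  have e : ∀ k, 2 * π * I * (k 0) * potCoeff S η 0 k +
      2 * π * I * (k 1) * potCoeff S η 1 k = -trunc S η k := fun k => by
    by_cases hk0 : k = 0
    · subst hk0
      simp [potCoeff, trunc, h0]
    · have hf : freq k ^ 2 ≠ 0 := (pow_pos (zero_lt_one.trans_le (one_le_freq hk0)) 2).ne'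
      have h1 : (4 * π ^ 2 * ((k 0 : ℂ) ^ 2 + (k 1 : ℂ) ^ 2)) * ((freq k ^ 2)⁻¹ : ℝ) = 1 := by
        have := mul_inv_cancel₀ hf
        rw [freq_sq, ksq_eq] at this ⊢
        exact_mod_cast this
      simp only [potCoeff]
      linear_combination (4 * π ^ 2 * ((k 0 : ℂ) ^ 2 + (k 1 : ℂ) ^ 2) * ((freq k ^ 2)⁻¹ : ℝ) *
        trunc S η k) * Complex.I_sq - trunc S η k * h1
  simp_rw [e]
  simp [fser, tsum_neg]

/-- Commutator form of the transport term in `H⁻¹`. -/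
lemma sum_integral_mul_potGrad_le (h0 : coeff η 0 = 0) {U : T2 → Fin 2 → ℝ} (hL : 0 ≤ L) (hU : ∀ x y
    i, |U x i - U y i| ≤ L * dist x y) (hdiv : IsDivFree U) : ∑ i, ∫ x, U x i * fser (trunc S η) x *
    potGrad S η i x ∂vol ≤ 2 * L * ∑ i, ∫ x, potGrad S η i x ^ 2 ∂vol := by
  have hUc : ∀ i, Continuous fun x => U x i := fun i => continuous_of_lip fun x y => hU x y i
  set g := potGrad S η with hg
  have hgs : ∀ i, IsSmooth (g i) := isSmooth_potGrad S η
  have hgi := fun i => (hgs i).continuous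
  have hterm : ∀ i j l, Integrable (fun x => U x i * pd j (fun y => g l y * g i y) x) vol :=
    fun i j l => integrable_cont ((hUc i).mul (((hgs l).mul (hgs i)).pd j).continuous)
  have hterm2 : ∀ i j, Integrable (fun x => U x i * pd i (fun y => g j y * g j y) x) vol :=
    fun i j => integrable_cont ((hUc i).mul (((hgs j).mul (hgs j)).pd i).continuous)
  have e : ∀ x, ∑ i, U x i * fser (trunc S η) x * g i x =
      (∑ j, (1 / 2) * ∑ i, U x i * pd i (fun y => g j y * g j y) x) -
        ∑ i, ∑ j, U x i * pd j (fun y => g j y * g i y) x := fun x => by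
    have h1 := sum_pd_potGrad (S := S) h0 x
    have h2 := pd_potGrad_comm S η 0 1 x
    rw [← hg] at h1 h2
    simp only [sum_univ_two, pd_mul (hgs _) (hgs _)]
    linear_combination (U x 0 * g 0 x + U x 1 * g 1 x) * h1 + (U x 0 * g 1 x - U x 1 * g 0 x) * h2
  have hi2 : Integrable (fun x => ∑ i, ∑ j, U x i * pd j (fun y => g j y * g i y) x) vol :=
    integrable_finsetSum _ fun i _ => integrable_finsetSum _ fun j _ => hterm i j j
  have hz : ∫ x, ∑ j, (1 / 2) * ∑ i, U x i * pd i (fun y => g j y * g j y) x ∂vol = 0 := by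
    rw [integral_finsetSum _ fun j _ => (integrable_finsetSum _ fun i _ => hterm2 i j).const_mul _]
    refine Finset.sum_eq_zero fun j _ => ?_
    rw [integral_const_mul, hdiv _ ((hgs j).mul (hgs j)), mul_zero]
  have hi3 : ∀ i, Integrable (fun x => U x i * fser (trunc S η) x * g i x) vol := fun i =>
    integrable_cont (((hUc i).mul (continuous_fser (rapid_trunc S η).summable_norm)).mul (hgi i))
  rw [← integral_finsetSum _ fun i _ => hi3 i, integral_congr_ae (ae_of_all _ e),
    integral_sub
        (integrable_finsetSum _ fun j _ => (integrable_finsetSum _ fun i _ => hterm2 i j).const_mul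
            _) hi2, hz, zero_sub,
    integral_finsetSum _ fun i _ => integrable_finsetSum _ fun j _ => hterm i j j]
  simp_rw [fun i => integral_finsetSum Finset.univ fun j _ => hterm i j j]
  have hb : ∀ i j, -(∫ x, U x i * pd j (fun y => g j y * g i y) x ∂vol) ≤
      L * ((∫ x, g j x ^ 2 ∂vol) / 2 + (∫ x, g i x ^ 2 ∂vol) / 2) := fun i j => by
    refine (neg_le_abs _).trans ((abs_integral_mul_pd_le hL (fun x y => hU x y i)
      ((hgs j).mul (hgs i)) j).trans (mul_le_mul_of_nonneg_left ?_ hL))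
    have h1 : ∀ l, Integrable (fun x => g l x ^ 2) vol := fun l => integrable_cont ((hgi l).pow 2)
    rw [← integral_div, ← integral_div, ← integral_add ((h1 j).div_const 2) ((h1 i).div_const 2)]
    refine integral_mono (integrable_cont ((hgi j).mul (hgi i))).abs
      (((h1 j).div_const 2).add ((h1 i).div_const 2)) fun x => ?_
    simp only
    rw [abs_mul, ← sq_abs (g j x), ← sq_abs (g i x)]
    nlinarith [sq_nonneg (|g j x| - |g i x|)]
  have := hb 0 0
  have := hb 0 1
  have := hb 1 0
  have := hb 1 1
  simp only [sum_univ_two]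
  linarith

lemma two_mul_integral_mul_le {a b : T2 → ℝ} (ha : MemLp a 2 vol) (hb : MemLp b 2 vol) :
    2 * ∫ x, a x * b x ∂vol ≤ (∫ x, a x ^ 2 ∂vol) + ∫ x, b x ^ 2 ∂vol := by
  rw [← integral_const_mul, ← integral_add ha.integrable_sq hb.integrable_sq]
  exact integral_mono ((integrable_mul_L2 ha hb).const_mul 2)
    (ha.integrable_sq.add hb.integrable_sq) fun x => by
      simp only
      nlinarith [sq_nonneg (a x - b x)]

lemma flux_le (hη : MemLp η 2 vol) (h0 : coeff η 0 = 0) {U G : T2 → Fin 2 → ℝ} (hL : 0 ≤ L) (hU : ∀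
    x y i, |U x i - U y i| ≤ L * dist x y) (hB : ∀ x i, |U x i| ≤ B) (hdiv : IsDivFree U) (hG : ∀ i,
    MemLp (G · i) 2 vol) : 2 * ∑ i, ∫ x, (U x i * η x + G x i) * potGrad S η i x ∂vol ≤ (4 * L + 2)
    * (∑ i, ∫ x, potGrad S η i x ^ 2 ∂vol) + (∑ i, ∫ x, G x i ^ 2 ∂vol) + 2 * B ^ 2 * ∫ x, (η x -
    fser (trunc S η) x) ^ 2 ∂vol := by
  have hUc : ∀ i, Continuous fun x => U x i := fun i => continuous_of_lip fun x y => hU x y i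
  have hPc := continuous_fser (rapid_trunc S η).summable_norm
  have hgc := fun i => (isSmooth_potGrad S η i).continuous
  have hg2 := fun i => memLp_cont (hgc i)
  have hr : MemLp (fun x => η x - fser (trunc S η) x) 2 vol := hη.sub (memLp_cont hPc)
  have hUr : ∀ i, MemLp (fun x => U x i * (η x - fser (trunc S η) x)) 2 vol := fun i =>
    memLp_two_bdd_mul (hUc i).measurable (ae_of_all _ fun x => hB x i) hr
  have h1 := sum_integral_mul_potGrad_le (S := S) h0 hL hU hdiv
  have hsplit : ∀ i, ∫ x, (U x i * η x + G x i) * potGrad S η i x ∂vol =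
      (∫ x, U x i * fser (trunc S η) x * potGrad S η i x ∂vol) +
      (∫ x, U x i * (η x - fser (trunc S η) x) * potGrad S η i x ∂vol) +
      ∫ x, G x i * potGrad S η i x ∂vol := fun i => by
    have i1 : Integrable (fun x => U x i * fser (trunc S η) x * potGrad S η i x) vol :=
      integrable_cont (((hUc i).mul hPc).mul (hgc i))
    have i2 : Integrable (fun x => U x i * (η x - fser (trunc S η) x) * potGrad S η i x) vol :=
      integrable_mul_L2 (hUr i) (hg2 i)
    have i12 : Integrable (fun x => U x i * fser (trunc S η) x * potGrad S η i x +
      U x i * (η x - fser (trunc S η) x) * potGrad S η i x) vol := i1.add i2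
    rw [← integral_add i1 i2, ← integral_add i12 (integrable_mul_L2 (hG i) (hg2 i))]
    exact integral_congr_ae (ae_of_all _ fun x => by ring)
  have h2 : ∀ i, 2 * ∫ x, U x i * (η x - fser (trunc S η) x) * potGrad S η i x ∂vol ≤
      B ^ 2 * (∫ x, (η x - fser (trunc S η) x) ^ 2 ∂vol) +
        ∫ x, potGrad S η i x ^ 2 ∂vol := fun i => by
    refine (two_mul_integral_mul_le (hUr i) (hg2 i)).trans (add_le_add_left ?_ _)
    rw [← integral_const_mul]
    refine integral_mono (hUr i).integrable_sq (hr.integrable_sq.const_mul _) fun x => ?_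
    simp only
    rw [mul_pow]
    exact mul_le_mul_of_nonneg_right (by rw [← sq_abs]; gcongr; exact hB x i) (sq_nonneg _)
  have h3 := fun i => two_mul_integral_mul_le (hG i) (hg2 i)
  simp only [sum_univ_two] at h1 ⊢
  rw [hsplit, hsplit]
  linarith [h2 0, h2 1, h3 0, h3 1]

lemma ofReal_integral_sub_trunc_sq (hS : ∀ k, -k ∈ S ↔ k ∈ S) (hη : MemLp η 2 vol) : ofReal (∫ x, (η
    x - fser (trunc S η) x) ^ 2 ∂vol) = ∑' k, if k ∈ S then 0 else ofReal (‖coeff η k‖ ^ 2) := by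
  have hPc := continuous_fser (rapid_trunc S η).summable_norm
  have hm : MemLp (fun x => η x - fser (trunc S η) x) 2 vol := hη.sub (memLp_cont hPc)
  rw [ofReal_integral_sq_eq hm]
  refine tsum_congr fun k => ?_
  have e : coeff (fun x => η x - fser (trunc S η) x) k = coeff η k - trunc S η k := by
    rw [coeff_sub (hη.l1) (integrable_cont hPc),
      coeff_fser (rapid_trunc S η).summable_norm (trunc_neg hS)]
  rw [e]
  split_ifs with h <;> simp [trunc, h]

end

/-! ### Stability of the transport equation in `H⁻¹` -/

lemma stokesMul_zero (α : ℝ) (i : Fin 2) : stokesMul α 0 i = 0 := by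
  simp [stokesMul, leray, perp_zero]

lemma sum_mul_stokesMul (α : ℝ) (k : Z2) : ∑ i, (k i : ℝ) * stokesMul α k i = 0 := by
  have h := sum_mul_leray k 1
  simp only [sum_univ_two, stokesMul, leray] at h ⊢
  linear_combination (freq k ^ (-(2 * α))) * h

lemma stokesMul_sq_le (hα : 1 / 2 < α) (k : Z2) (i : Fin 2) :
    stokesMul α k i ^ 2 ≤ (freq k ^ 2)⁻¹ := by
  by_cases hk : k = 0
  · simp [hk, stokesMul_zero, freq_zero]
  · rw [← sq_abs, ← inv_pow]
    exact pow_le_pow_left₀ (abs_nonneg _) (abs_stokesMul_le hα hk i) 2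

lemma sum_mul_stokes_coeff (α : ℝ) (m : Fin 2 → ℝ) (z : ℂ) (k : Z2) :
    ∑ i, (k i : ℂ) * (stokesMul α k i * z + coeff (fun _ => m i) k) = 0 := by
  have h : ((∑ i, (k i : ℝ) * stokesMul α k i : ℝ) : ℂ) = 0 := by
    rw [sum_mul_stokesMul, ofReal_zero]
  have h2 : ∀ i, (k i : ℂ) * coeff (fun _ => m i) k = 0 := fun i => by
    rw [coeff_const]
    split_ifs with hk
    · simp [hk]
    · simp
  simp only [sum_univ_two] at h ⊢
  push_cast at h
  linear_combination z * h + h2 0 + h2 1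

/-- The velocity that a bounded temperature generates, with prescribed mean. -/
lemma exists_velocity (hα : 1 / 2 < α) (hf : Measurable f) (hM0 : 0 ≤ M) (hM : ∀ᵐ x ∂vol, |f x| ≤ M)
    (m : Fin 2 → ℝ) : ∃ U : T2 → Fin 2 → ℝ, (∀ x y i, |U x i - U y i| ≤ stokesLip α * M * dist x y)
    ∧ (∀ x i, |U x i| ≤ stokesLip α * M + |m i|) ∧ IsDivFree U ∧ ∀ i k, coeff (U · i) k = stokesMul
    α k i * coeff f k + coeff (fun _ => m i) k := by
  choose W hW hWc using exists_stokes_flow hα ((measurable_clamp M).comp hf)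
    (fun x => abs_clamp_le hM0 (f x))
  have hint := fun i => integrable_cont ((fun i => continuous_of_lip (hW i)) i)
  have hc : ∀ i k, coeff (fun x => W i x + m i) k =
      stokesMul α k i * coeff f k + coeff (fun _ => m i) k := fun i k => by
    rw [coeff_add (hint i) (integrable_const _), hWc, ← (coeff_congr
        (hM.mono fun x hx => clamp_eq hx))]
    rfl
  refine ⟨fun x i => W i x + m i, fun x y i => ?_, fun x i => ?_, ?_, hc⟩
  · rw [add_sub_add_right_eq_sub]
    exact hW i x y
  · refine (abs_add_le _ _).trans (add_le_add_left ?_ _)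
    have h0 : ∫ y, W i y ∂vol = 0 := by
      have := hWc i 0
      rw [coeff_zero_eq, stokesMul_zero, ofReal_zero, zero_mul] at this
      exact_mod_cast this
    have h1 : W i x = ∫ y, (W i x - W i y) ∂vol := by
      rw [integral_sub (integrable_const _) (hint i), h0]
      simp
    rw [h1]
    have := norm_integral_le_of_norm_le_const (μ := vol) (f := fun y => W i x - W i y)
      (C := stokesLip α * M) (ae_of_all _ fun y => ?_)
    · simpa using this
    · exact (hW i x y).trans (mul_le_of_le_one_right (mul_nonneg (stokesLip_nonneg hα) hM0)
        (dist_T2_le_one x y))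
  · refine isDivFree_of_coeff (fun i => (hint i).add (integrable_const _)) fun k => ?_
    simp_rw [hc]
    exact sum_mul_stokes_coeff α m _ k

/-- The squared `H⁻¹` distance, blind to the means. -/
def hDist (f g : T2 → ℝ) : ℝ≥0∞ :=
  ∑' k, ofReal ((freq k ^ 2)⁻¹ * ‖coeff f k - coeff g k‖ ^ 2)

/-- Squared `L²` distance between a velocity and the Stokes flow of mean `m` of a temperature. -/
def velErr (α : ℝ) (m : Fin 2 → ℝ) (v : T2 → Fin 2 → ℝ) (f : T2 → ℝ) : ℝ≥0∞ :=
  ∑ i, ∑' k, ‖coeff (v · i) k - stokesMul α k i * coeff f k - coeff (fun _ => m i) k‖ₑ ^ 2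

lemma le_velErr (α : ℝ) (m : Fin 2 → ℝ) (v : T2 → Fin 2 → ℝ) (f : T2 → ℝ) (i : Fin 2) : ∑' k, ‖coeff
    (v · i) k - stokesMul α k i * coeff f k - coeff (fun _ => m i) k‖ₑ ^ 2 ≤ velErr α m v f := by
  fin_cases i <;> simp [velErr]

/-- The squared `L²` norm outside the frequencies in `S`. -/
def tailSq (S : Finset Z2) (f g : T2 → ℝ) : ℝ≥0∞ :=
  ∑' k, if k ∈ S then 0 else ofReal (‖coeff f k - coeff g k‖ ^ 2)

lemma tsum_sub_stokes_le (hα : 1 / 2 < α) (m : Fin 2 → ℝ) (v f g : T2 → ℝ) (i : Fin 2) : ∑' k,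
    ‖coeff v k - (stokesMul α k i * coeff g k + coeff (fun _ => m i) k)‖ₑ ^ 2 ≤ 2 * (∑' k, ‖coeff v
    k - stokesMul α k i * coeff f k - coeff (fun _ => m i) k‖ₑ ^ 2) + 2 * hDist f g := by
  rw [hDist, ← ENNReal.tsum_mul_left, ← ENNReal.tsum_mul_left, ← tsum_add]
  refine tsum_le_tsum fun k => ?_
  have e : coeff v k - (stokesMul α k i * coeff g k + coeff (fun _ => m i) k) =
      (coeff v k - stokesMul α k i * coeff f k - coeff (fun _ => m i) k) +
      stokesMul α k i * (coeff f k - coeff g k) := by ring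
  rw [e]
  refine (pow_le_pow_left' (enorm_add_le _ _) 2).trans ((add_sq_le_two _ _).trans
    (add_le_add_right (mul_le_mul_right ?_ 2) _))
  rw [← ofReal_norm_sq, norm_mul, mul_pow, norm_real, norm_eq_abs, sq_abs]
  exact ofReal_le_ofReal (mul_le_mul_of_nonneg_right (stokesMul_sq_le hα k i) (sq_nonneg _))

lemma ofReal_integral_sq_eq_enorm (hf : MemLp f 2 vol) :
    ofReal (∫ x, f x ^ 2 ∂vol) = ∑' k, ‖coeff f k‖ₑ ^ 2 := by
  simp_rw [ofReal_integral_sq_eq hf, ofReal_norm_sq]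

/-- The rate of change of one mode of the `H⁻¹` energy. -/
def fluxMode (ua ub : VectorField) (θa θb : ScalarField) (k : Z2) (t : ℝ) : ℝ :=
  (freq k ^ 2)⁻¹ * (2 * (conj (coeff (θa t) k - coeff (θb t) k) *
    (transForce ua θa k t - transForce ub θb k t)).re)

def stabRate (α M : ℝ) : ℝ := 4 * (stokesLip α * M) + 2 + 8 * M ^ 2

def stabTail (α M : ℝ) (m : Fin 2 → ℝ) : ℝ := 2 * (stokesLip α * M + ∑ i, |m i|) ^ 2

lemma integral_sq_commutator_le {a b : T2 → ℝ} (hfm : Measurable f) (hgm : Measurable g) (hf : ∀ᵐ x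
    ∂vol, |f x| ≤ M) (hg : ∀ᵐ x ∂vol, |g x| ≤ M) (ha : MemLp a 2 vol) (hb : MemLp b 2 vol) : ofReal
    (∫ x, (f x * a x - g x * b x) ^ 2 ∂vol) ≤ ofReal (2 * M ^ 2) * (∑' k, ‖coeff a k‖ₑ ^ 2 + ∑' k,
    ‖coeff b k‖ₑ ^ 2) := by
  rw [← ofReal_integral_sq_eq_enorm ha, ← ofReal_integral_sq_eq_enorm hb,
    ← ofReal_add (integral_nonneg fun x => sq_nonneg _) (integral_nonneg fun x => sq_nonneg _),
    ← ofReal_mul (by positivity)]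
  refine ofReal_le_ofReal ?_
  rw [← integral_add ha.integrable_sq hb.integrable_sq, ← integral_const_mul]
  refine integral_mono_ae ((memLp_two_bdd_mul hfm hf ha).sub
    (memLp_two_bdd_mul hgm hg hb)).integrable_sq
    ((ha.integrable_sq.add hb.integrable_sq).const_mul _) ?_
  filter_upwards [hf, hg] with x h1 h2
  have e1 : (f x * a x) ^ 2 ≤ M ^ 2 * a x ^ 2 := by
    rw [mul_pow, ← sq_abs (f x)]
    gcongr
  have e2 : (g x * b x) ^ 2 ≤ M ^ 2 * b x ^ 2 := by
    rw [mul_pow, ← sq_abs (g x)]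
    gcongr
  nlinarith [sq_nonneg (f x * a x + g x * b x)]

theorem sum_fluxMode_le (hα : 1 / 2 < α) {ua ub : VectorField} {θa θb : ScalarField} (hM : 0 ≤ M)
    (m : Fin 2 → ℝ) (hma : Measurable (θa t)) (hmb : Measurable (θb t))
    (hba : ∀ᵐ x ∂vol, |θa t x| ≤ M) (hbb : ∀ᵐ x ∂vol, |θb t x| ≤ M)
    (hua : ∀ i, MemLp (ua t · i) 2 vol) (hub : ∀ i, MemLp (ub t · i) 2 vol)
    (h0 : coeff (θa t) 0 = coeff (θb t) 0) {S : Finset Z2} (hS : ∀ k, -k ∈ S ↔ k ∈ S) :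
    ofReal (∑ k ∈ S, fluxMode ua ub θa θb k t) ≤ ofReal (stabRate α M) * hDist (θa t) (θb t) +
      ofReal (8 * M ^ 2) * (velErr α m (ua t) (θa t) + velErr α m (ub t) (θb t)) +
      ofReal (stabTail α M m) * tailSq S (θa t) (θb t) := by
  obtain ⟨U, hUL, hUB, hUd, hUc⟩ := exists_velocity hα hmb hM hbb m
  have hL : 0 ≤ stokesLip α * M := mul_nonneg (stokesLip_nonneg hα) hM
  have hU2 := fun i => memLp_cont ((fun i => continuous_of_lip fun x y => hUL x y i) i)
  have hθa2 := memLp_bdd hma hba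
  have hθb2 := memLp_bdd hmb hbb
  have hη : MemLp (fun x => θa t x - θb t x) 2 vol := hθa2.sub hθb2
  have hηc : ∀ k, coeff (fun x => θa t x - θb t x) k = coeff (θa t) k - coeff (θb t) k :=
    coeff_sub (hθa2.l1) (hθb2.l1)
  have hda : ∀ i, MemLp (fun x => ua t x i - U x i) 2 vol := fun i => (hua i).sub (hU2 i)
  have hdb : ∀ i, MemLp (fun x => ub t x i - U x i) 2 vol := fun i => (hub i).sub (hU2 i)
  set G : T2 → Fin 2 → ℝ := fun x i => θa t x * (ua t x i - U x i) - θb t x * (ub t x i - U x i)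
    with hG
  have hfl := flux_le (S := S) hη (by rw [hηc, h0, sub_self]) hL hUL
    (B := stokesLip α * M + ∑ i, |m i|) (fun x i => (hUB x i).trans (add_le_add_right
      (single_le_sum (f := fun i => |m i|) (fun i _ => abs_nonneg _) (Finset.mem_univ i)) _))
    hUd (fun i =>
        (memLp_two_bdd_mul hma hba (hda i)).sub (memLp_two_bdd_mul hmb hbb (hdb i)))
  have hFa := fun i => memLp_two_bdd_mul hma hba (hua i)
  have hFb := fun i => memLp_two_bdd_mul hmb hbb (hub i)
  have hFi : ∀ i, Integrable (fun x => θa t x * ua t x i - θb t x * ub t x i) vol := fun i =>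
    ((hFa i).l1).sub ((hFb i).l1)
  have e1 : ∑ k ∈ S, fluxMode ua ub θa θb k t = 2 * ∑ i, ∫ x, (U x i * (θa t x - θb t x) + G x i) *
      potGrad S (fun x => θa t x - θb t x) i x ∂vol := by
    have e : ∀ i x, U x i * (θa t x - θb t x) + G x i =
        θa t x * ua t x i - θb t x * ub t x i := fun i x => by simp only [hG]; ring
    simp_rw [e, fun i => integral_mul_potGrad (S := S) (η := fun x => θa t x - θb t x) (hFi i) i,
        hηc]
    rw [sum_univ_two, ← sum_add_distrib, mul_sum]
    refine sum_congr rfl fun k _ => ?_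
    have hc : ∀ i, coeff (fun x => θa t x * ua t x i - θb t x * ub t x i) k =
        coeff (fun x => θa t x * ua t x i) k - coeff (fun x => θb t x * ub t x i) k := fun i =>
      coeff_sub ((hFa i).l1) ((hFb i).l1) k
    rw [hc, hc, fluxMode, ← mul_add, ← add_re, ← conj_re (conj (coeff (θa t) k - coeff (θb t) k) *
        (transForce ua θa k t - transForce ub θb k t))]
    rw [mul_left_comm 2]
    congr 3
    simp only [transForce, sum_univ_two, map_mul, map_sub, map_neg, map_add,
      conj_conj, conj_I, conj_ofReal, map_intCast, map_ofNat]
    ring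
  have hGle : ofReal (∑ i, ∫ x, G x i ^ 2 ∂vol) ≤ ofReal (8 * M ^ 2) *
      (velErr α m (ua t) (θa t) + velErr α m (ub t) (θb t) + hDist (θa t) (θb t)) := by
    rw [ofReal_sum_of_nonneg fun i _ => integral_nonneg fun x => sq_nonneg _]
    have h1 : ∀ i, ∑' k, ‖coeff (fun x => ub t x i - U x i) k‖ₑ ^ 2 = ∑' k, ‖coeff (ub t · i) k -
        stokesMul α k i * coeff (θb t) k - coeff (fun _ => m i) k‖ₑ ^ 2 := fun i => by
      refine tsum_congr fun k => ?_
      rw [coeff_sub ((hub i).l1) ((hU2 i).l1), hUc, sub_sub]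
    have h2 : ∀ i, ∑' k, ‖coeff (fun x => ua t x i - U x i) k‖ₑ ^ 2 ≤
        2 * (∑' k, ‖coeff (ua t · i) k - stokesMul α k i * coeff (θa t) k -
          coeff (fun _ => m i) k‖ₑ ^ 2) + 2 * hDist (θa t) (θb t) := fun i => by
      simp_rw [coeff_sub ((hua i).l1) ((hU2 i).l1), hUc]
      exact tsum_sub_stokes_le hα m (ua t · i) (θa t) (θb t) i
    have h3 : ∀ i, ofReal (∫ x, G x i ^ 2 ∂vol) ≤ ofReal (2 * M ^ 2) *
        ((2 * (∑' k, ‖coeff (ua t · i) k - stokesMul α k i * coeff (θa t) k -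
          coeff (fun _ => m i) k‖ₑ ^ 2) + 2 * hDist (θa t) (θb t)) +
          ∑' k, ‖coeff (ub t · i) k -
            stokesMul α k i * coeff (θb t) k - coeff (fun _ => m i) k‖ₑ ^ 2) := fun i => by
      refine (integral_sq_commutator_le hma hmb hba hbb (hda i) (hdb i)).trans
        (mul_le_mul_right ?_ _)
      rw [← h1]
      exact add_le_add_left (h2 i) _
    refine (sum_le_sum fun i _ => h3 i).trans ?_
    have e8 : ofReal (8 * M ^ 2) = ofReal (2 * M ^ 2) * 4 := by
      rw [show (4 : ℝ≥0∞) = ofReal 4 by norm_num, ← ofReal_mul (by positivity)]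
      ring_nf
    rw [← mul_sum, e8, mul_assoc]
    refine mul_le_mul_right ?_ _
    simp only [velErr, sum_univ_two]
    ring_nf
    gcongr <;> first | exact le_mul_of_one_le_right zero_le (by norm_num) | norm_num
  have hE : ∑ i, ∫ x, potGrad S (fun x => θa t x - θb t x) i x ^ 2 ∂vol =
      ∑ k ∈ S, (freq k ^ 2)⁻¹ * ‖coeff (θa t) k - coeff (θb t) k‖ ^ 2 := by
    rw [sum_integral_potGrad_sq hS]
    simp_rw [hηc]
  have hEle : ofReal (∑ i, ∫ x, potGrad S (fun x => θa t x - θb t x) i x ^ 2 ∂vol) ≤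
      hDist (θa t) (θb t) := by
    rw [hE, ofReal_sum_of_nonneg fun k _ => by positivity]
    exact sum_le_tsum S
  have hT := ofReal_integral_sub_trunc_sq hS hη
  simp_rw [hηc] at hT
  rw [e1]
  have hr1 : 0 ≤ 4 * (stokesLip α * M) + 2 := by positivity
  refine (ofReal_le_ofReal hfl).trans (ofReal_add_le.trans ?_)
  rw [ofReal_mul (p := 2 * _ ^ 2) (by positivity), hT]
  refine add_le_add_left (ofReal_add_le.trans ?_) _
  rw [ofReal_mul hr1]
  refine (add_le_add (mul_le_mul_right hEle _) hGle).trans (le_of_eq ?_)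
  rw [stabRate, ofReal_add hr1 (by positivity)]
  ring

lemma norm_sq_primitive {f : ℝ → ℂ} {y₀ : ℂ} (ht : 0 ≤ t) (hf : IntegrableOn f (Ioc 0 t)) : ‖y₀ + ∫
    s in 0..t, f s‖ ^ 2 = ‖y₀‖ ^ 2 + ∫ s in 0..t, 2 * (conj (y₀ + ∫ r in 0..s, f r) * f s).re := by
  have hfi := interval_of_Ioc ht hf
  have hconj : ∀ s, conj (∫ r in 0..s, f r) = ∫ r in 0..s, conj (f r) := fun s => by
    rw [intervalIntegral, intervalIntegral, map_sub, integral_conj, integral_conj]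
  have hgf : IntegrableOn (fun s => conj (f s)) (Ioc 0 t) :=
    (conjCLE.toContinuousLinearMap.integrable_comp hf :)
  have h := mul_primitive (y₀ := y₀) (z₀ := conj y₀) ht hf hgf
  simp_rw [← hconj, ← map_add] at h
  have h2 : ∀ z : ℂ, ((‖z‖ ^ 2 : ℝ) : ℂ) = z * conj z := fun z => by
    rw [mul_conj, Complex.normSq_eq_norm_sq]
  rw [← h2, ← h2] at h
  have h3 : ∀ s, f s * conj (y₀ + ∫ r in 0..s, f r) + (y₀ + ∫ r in 0..s, f r) * conj (f s) =
      ((2 * (conj (y₀ + ∫ r in 0..s, f r) * f s).re : ℝ) : ℂ) := fun s => by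
    have := Complex.add_conj (conj (y₀ + ∫ r in 0..s, f r) * f s)
    rw [map_mul, conj_conj] at this
    rw [← this]
    ring
  simp_rw [h3] at h
  rw [intervalIntegral.integral_ofReal] at h
  exact_mod_cast h

lemma ofReal_integral_le {α : Type*} [MeasurableSpace α] {μ : Measure α} (f : α → ℝ) :
    ofReal (∫ x, f x ∂μ) ≤ ∫⁻ x, ofReal (f x) ∂μ := by
  by_cases hf : Integrable f μ
  · have hp : Integrable (fun x => max (f x) 0) μ := hf.pos_part
    refine (ofReal_le_ofReal (integral_mono hf hp fun x => le_max_left _ _)).trans ?_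
    rw [ofReal_integral_eq_lintegral_ofReal hp (ae_of_all _ fun x => le_max_right _ _)]
    exact lintegral_mono fun x => by simp
  · simp [integral_undef hf]

/-- Grönwall's inequality, for bounded functions and almost everywhere. -/
lemma gronwall_ae {E : ℝ → ℝ≥0∞} (hC : 0 < C) {A : ℝ≥0∞} (hK : ∀ᵐ t ∂ℓ(T), E t ≤ K) (h : ∀ᵐ t ∂ℓ(T),
    E t ≤ A + ∫⁻ s in Ioc 0 t, ofReal C * E s) : ∀ᵐ t ∂ℓ(T), E t ≤ ofReal (exp (2 * C * T)) * (2 *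
    A) := by
  have key : ∀ n : ℕ, ∀ᵐ t ∂ℓ(T),
      E t ≤ ofReal (exp (2 * C * t)) * (2 * A + K * 2⁻¹ ^ n) := fun n => by
    induction n with
    | zero =>
      filter_upwards [hK, ae_mem_Ioc] with t ht htm
      refine ht.trans ?_
      rw [pow_zero, mul_one]
      refine le_trans ?_ (mul_le_mul_left (ofReal_le_ofReal
        (Real.one_le_exp (by have := htm.1; positivity))) _)
      simp
    | succ n ih =>
      filter_upwards [h, ae_mem_Ioc] with t ht htm
      refine ht.trans ?_
      set X := 2 * A + K * 2⁻¹ ^ n with hX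
      set X' := 2 * A + K * 2⁻¹ ^ (n + 1) with hX'
      have hXX : X ≤ 2 * X' := by
        rw [hX, hX', mul_add, pow_succ, ← mul_assoc (K : ℝ≥0∞), mul_comm (2 : ℝ≥0∞) (_ * 2⁻¹),
          mul_assoc _ (2⁻¹ : ℝ≥0∞), ENNReal.inv_mul_cancel (by norm_num) (by norm_num), mul_one]
        gcongr
        exact le_mul_of_one_le_left zero_le (by norm_num)
      have hAX : A ≤ X' := (le_mul_of_one_le_left zero_le (by norm_num)).trans le_self_add
      have h1 : ∫⁻ s in Ioc 0 t, ofReal C * E s ≤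
          ∫⁻ s in Ioc 0 t, ofReal (2 * C * exp (2 * C * s)) * X' := by
        refine lintegral_mono_ae ?_
        filter_upwards [ae_restrict_of_ae_restrict_of_subset (Ioc_subset_Ioc_right htm.2) ih]
          with s hs
        calc ofReal C * E s
            ≤ ofReal C * (ofReal (exp (2 * C * s)) * (2 * X')) :=
              mul_le_mul_right (hs.trans (mul_le_mul_right hXX _)) _
          _ = ofReal (2 * C * exp (2 * C * s)) * X' := by
              rw [ofReal_mul (p := 2 * C) (by positivity), ofReal_mul (p := 2) (by norm_num)]
              simp only [ofReal_ofNat]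
              ring
      have h2 : ∫⁻ s in Ioc 0 t, ofReal (2 * C * exp (2 * C * s)) =
          ofReal (exp (2 * C * t) - 1) := by
        have hc : Continuous fun s : ℝ => 2 * C * exp (2 * C * s) := by fun_prop
        rw [← ofReal_integral_eq_lintegral_ofReal (hc.integrableOn_Ioc)
          (ae_of_all _ fun s => by positivity), ← integral_of_le htm.1.le,
          integral_eq_sub_of_hasDerivAt (f := fun s => exp (2 * C * s))
            (fun s _ => ?_) (hc.intervalIntegrable _ _)]
        · simp
        · have := ((hasDerivAt_id s).const_mul (2 * C)).exp
          simpa [mul_comm] using this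
      rw [lintegral_mul_const _ (by fun_prop), h2] at h1
      have he : 1 ≤ exp (2 * C * t) := Real.one_le_exp (by have := htm.1; positivity)
      refine (add_le_add hAX h1).trans (le_of_eq ?_)
      have : ofReal (exp (2 * C * t)) =
          1 + ofReal (exp (2 * C * t) - 1) := by
        rw [← ofReal_one, ← ofReal_add zero_le_one (by linarith)]
        ring_nf
      rw [this, add_mul, one_mul]
  filter_upwards [ae_all_iff.2 key, ae_mem_Ioc] with t ht htm
  have hlim : (fun n : ℕ => ofReal (exp (2 * C * t)) * (2 * A + K * 2⁻¹ ^ n)) ⇝ (ofReal (exp (2 * C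
      * t)) * (2 * A + K * 0)) := by
    refine ENNReal.Tendsto.const_mul (Tendsto.add tendsto_const_nhds (ENNReal.Tendsto.const_mul
      (ENNReal.tendsto_pow_atTop_nhds_zero_of_lt_one (by norm_num)) (Or.inr coe_ne_top)))
      (Or.inr ofReal_ne_top)
  refine (ge_of_tendsto' hlim ht).trans ?_
  rw [mul_zero, add_zero]
  exact mul_le_mul_left (ofReal_le_ofReal (Real.exp_le_exp.2
    (mul_le_mul_of_nonneg_left htm.2 (by positivity)))) _

/-- Symmetric boxes exhausting the frequencies. -/
def box (n : ℕ) : Finset Z2 := Fintype.piFinset fun _ => Finset.Icc (-(n : ℤ)) n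

lemma neg_mem_box (n : ℕ) (k : Z2) : -k ∈ box n ↔ k ∈ box n := by
  simp only [box, Fintype.mem_piFinset, Finset.mem_Icc, Pi.neg_apply]
  exact forall_congr' fun i => by omega

lemma tendsto_box : Tendsto box atTop atTop := by
  refine tendsto_atTop_finset_of_monotone (fun a b hab k hk => ?_) fun k => ?_
  · simp only [box, Fintype.mem_piFinset, Finset.mem_Icc] at hk ⊢
    exact fun i => ⟨by have := hk i; omega, by have := hk i; omega⟩
  · refine ⟨(k 0).natAbs + (k 1).natAbs, ?_⟩
    simp only [box, Fintype.mem_piFinset, Finset.mem_Icc, Fin.forall_fin_two]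
    omega

lemma tailSq_le (S : Finset Z2) (f g : T2 → ℝ) :
    tailSq S f g ≤ ∑' k, ofReal (‖coeff f k - coeff g k‖ ^ 2) :=
  tsum_le_tsum fun k => by split_ifs <;> simp

lemma tsum_coeff_sub_sq_le (hf : Measurable f) (hg : Measurable g)
    (hfM : ∀ᵐ x ∂vol, |f x| ≤ M) (hgM : ∀ᵐ x ∂vol, |g x| ≤ M) :
    ∑' k, ofReal (‖coeff f k - coeff g k‖ ^ 2) ≤ ofReal ((2 * M) ^ 2) := by
  have h := tsum_coeff_sq_le (f := fun x => f x - g x) (M := 2 * M) (hf.sub hg) (by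
    filter_upwards [hfM, hgM] with x h1 h2
    calc _ ≤ |f x| + |g x| := abs_sub _ _
      _ ≤ _ := by linarith)
  simp_rw [(coeff_sub ((memLp_bdd hf hfM).l1) ((memLp_bdd hg hgM).l1))] at h
  exact h

lemma hDist_le_tsum (f g : T2 → ℝ) : hDist f g ≤ ∑' k, ofReal (‖coeff f k - coeff g k‖ ^ 2) :=
  tsum_le_tsum fun k => ofReal_le_ofReal (mul_le_of_le_one_left (by positivity) (by
    by_cases hk : k = 0
    · simp [hk, freq_zero]
    · exact inv_le_one_of_one_le₀ (one_le_pow₀ (one_le_freq hk))))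

lemma tendsto_tsum_notMem_box {f : Z2 → ℝ≥0∞} (h : ∑' k, f k ≠ ⊤) :
    (fun n => ∑' k, if k ∈ box n then 0 else f k) ⇝ 0 := by
  exact ((ENNReal.tendsto_tsum_compl_atTop_zero h).comp tendsto_box).congr fun n =>
    (tsum_subtype {k | k ∉ box n} f).trans <|
    tsum_congr fun k => by by_cases hk : k ∈ box n <;> simp [hk]

lemma measurable_hDist {θa θb : ScalarField} (ha : Measurable (uncurry θa))
    (hb : Measurable (uncurry θb)) : Measurable fun t => hDist (θa t) (θb t) :=
  Measurable.tsum fun k => measurable_ofReal.comp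
    ((((meas_coeff ha k).sub (meas_coeff hb k)).norm.pow_const 2).const_mul _)

lemma measurable_tailSq {θa θb : ScalarField} (ha : Measurable (uncurry θa)) (hb : Measurable
    (uncurry θb)) (S : Finset Z2) : Measurable fun t => tailSq S (θa t) (θb t) :=
  Measurable.tsum fun k => by
    split_ifs
    · exact measurable_const
    · exact measurable_ofReal.comp (((meas_coeff ha k).sub (meas_coeff hb k)).norm.pow_const 2)

lemma Adm.measurable_velErr (h : Adm u θ) (α : ℝ)
    (m : Fin 2 → ℝ) : Measurable fun t => velErr α m (u t) (θ t) :=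
  Finset.measurable_fun_sum _ fun i _ => Measurable.tsum fun k =>
    ((((meas_coeff (measurable_coord h.meas_u i) k).sub
      ((meas_coeff h.meas_θ k).const_mul _)).sub measurable_const).enorm).pow_const 2

/-- A bounded weak solution of the transport equation on `[0, T]`. -/
structure BddTransport (u : VectorField) (θ : ScalarField) (θ₀ : T2 → ℝ) (T M : ℝ) : Prop where
  adm : Adm u θ
  transport : SolvesTransport u θ θ₀
  integrable : Integrable θ₀ vol
  bound : ∀ᵐ t ∂ℓ(T), ∀ᵐ x ∂vol, |θ t x| ≤ M

section Stability

variable {ua ub : VectorField} {θa θb : ScalarField} {θ₀a θ₀b : T2 → ℝ}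

lemma sum_energy_le (ha : BddTransport ua θa θ₀a T M) (hb : BddTransport ub θb θ₀b T M) (S : Finset
    Z2) : ∀ᵐ t ∂ℓ(T), ∑ k ∈ S, ofReal ((freq k ^ 2)⁻¹ * ‖coeff (θa t) k - coeff (θb t) k‖ ^ 2) ≤
    hDist θ₀a θ₀b + ∫⁻ s in Ioc 0 t, ofReal (∑ k ∈ S, fluxMode ua ub θa θb k s) := by
  have hY : ∀ᵐ t ∂ℓ, ∀ k, coeff (θa t) k - coeff (θb t) k = (coeff θ₀a k - coeff θ₀b k) +
        ∫ s in 0..t, (transForce ua θa k s - transForce ub θb k s) := by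
    refine ae_all_iff.2 fun k => ?_
    filter_upwards [coeff_transport ha.adm ha.integrable ha.transport k,
      coeff_transport hb.adm hb.integrable hb.transport k, ae_mem_Ioi]
      with t h1 h2 ht
    rw [h1, h2, intervalIntegral.integral_sub
      (interval_of_Ioc (le_of_lt ht) (ha.adm.integrableOn_transForce k t))
      (interval_of_Ioc (le_of_lt ht) (hb.adm.integrableOn_transForce k t))]
    ring
  filter_upwards [ae_Ioc hY T, ae_mem_Ioc] with t ht htm
  have hfi : ∀ k, IntegrableOn (fun s => transForce ua θa k s - transForce ub θb k s)
      (Ioc 0 t) := fun k =>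
    (ha.adm.integrableOn_transForce k t).sub (hb.adm.integrableOn_transForce k t)
  have hgi : ∀ k, IntegrableOn (fun s => 2 * (conj ((coeff θ₀a k - coeff θ₀b k) +
      ∫ r in 0..s, (transForce ua θa k r - transForce ub θb k r)) *
        (transForce ua θa k s - transForce ub θb k s)).re) (Ioc 0 t) := fun k => by
    have hc : ContinuousOn (fun s => conj ((coeff θ₀a k - coeff θ₀b k) +
        ∫ r in 0..s, (transForce ua θa k r - transForce ub θb k r))) (Icc 0 t) :=
      Complex.continuous_conj.comp_continuousOn
        (continuousOn_const.add (continuousOn_primitive' htm.1.le (hfi k)))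
    have h1 := ((integrableOn_Icc_iff_integrableOn_Ioc' (by simp)).2 (hfi k)).continuousOn_mul hc
      isCompact_Icc
    exact (h1.mono_set Ioc_subset_Icc_self).re.const_mul 2
  have hmode : ∀ k, (freq k ^ 2)⁻¹ * ‖coeff (θa t) k - coeff (θb t) k‖ ^ 2 =
      (freq k ^ 2)⁻¹ * ‖coeff θ₀a k - coeff θ₀b k‖ ^ 2 +
        ∫ s in Ioc 0 t, fluxMode ua ub θa θb k s := fun k => by
    rw [ht k, norm_sq_primitive htm.1.le (hfi k), mul_add, ← intervalIntegral.integral_const_mul,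
      integral_of_le htm.1.le]
    congr 1
    refine integral_congr_ae ((ae_Ioc hY t).mono fun s hs => ?_)
    simp only [fluxMode]
    rw [hs k]
  have hfl : ∀ k, IntegrableOn (fluxMode ua ub θa θb k) (Ioc 0 t) := fun k => by
    refine ((hgi k).const_mul (freq k ^ 2)⁻¹).congr ((ae_Ioc hY t).mono fun s hs => ?_)
    simp only [fluxMode]
    rw [hs k]
  rw [← ofReal_sum_of_nonneg fun k _ => by positivity, sum_congr rfl fun k _ =>
    hmode k, sum_add_distrib, ← integral_finsetSum _ fun k _ => hfl k]
  refine ofReal_add_le.trans (add_le_add ?_ (ofReal_integral_le _))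
  rw [ofReal_sum_of_nonneg fun k _ => by positivity]
  exact sum_le_tsum S

lemma BddTransport.coeff_zero (ha : BddTransport ua θa θ₀a T M) :
    ∀ᵐ t ∂ℓ, coeff (θa t) 0 = coeff θ₀a 0 := by
  filter_upwards [coeff_transport ha.adm ha.integrable ha.transport 0] with t h
  rw [h]
  simp [transForce]

lemma stabRate_pos (hα : 1 / 2 < α) (hM : 0 ≤ M) : 0 < stabRate α M := by
  have := mul_nonneg (stokesLip_nonneg hα) hM
  unfold stabRate
  positivity

theorem hDist_le_of_transport (hα : 1 / 2 < α) (hM : 0 ≤ M)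
    (ha : BddTransport ua θa θ₀a T M) (hb : BddTransport ub θb θ₀b T M)
    (h0 : coeff θ₀a 0 = coeff θ₀b 0) (m : Fin 2 → ℝ) :
    ∀ᵐ t ∂ℓ(T), hDist (θa t) (θb t) ≤ ofReal (exp (2 * stabRate α M * T)) * (2 * (hDist θ₀a θ₀b +
        ofReal (8 * M ^ 2) * ∫⁻ s in Ioc 0 T,
          (velErr α m (ua s) (θa s) + velErr α m (ub s) (θb s)))) := by
  have hma := ha.adm.meas_θ
  have hmb := hb.adm.meas_θ
  have hbd : ∀ᵐ t ∂ℓ(T), ∑' k, ofReal (‖coeff (θa t) k - coeff (θb t) k‖ ^ 2) ≤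
        ofReal ((2 * M) ^ 2) := by
    filter_upwards [ha.bound, hb.bound] with t h1 h2
    exact tsum_coeff_sub_sq_le (meas_slice hma t) (meas_slice hmb t) h1 h2
  set ρ : ℝ → ℝ≥0∞ := fun s => velErr α m (ua s) (θa s) + velErr α m (ub s) (θb s) with hρ
  have hρm : Measurable ρ := (ha.adm.measurable_velErr α m).add (hb.adm.measurable_velErr α m)
  refine gronwall_ae (stabRate_pos hα hM) (K := toNNReal ((2 * M) ^ 2))
    (hbd.mono fun t ht => (hDist_le_tsum _ _).trans ht) ?_
  have hn : ∀ n : ℕ, ∀ᵐ t ∂ℓ(T),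
      ∑ k ∈ box n, ofReal ((freq k ^ 2)⁻¹ * ‖coeff (θa t) k - coeff (θb t) k‖ ^ 2) ≤
        (hDist θ₀a θ₀b + ofReal (8 * M ^ 2) * ∫⁻ s in Ioc 0 T, ρ s) +
        (∫⁻ s in Ioc 0 t, ofReal (stabRate α M) * hDist (θa s) (θb s)) +
        ofReal (stabTail α M m) * ∫⁻ s in Ioc 0 T, tailSq (box n) (θa s) (θb s) :=
    fun n => by
    filter_upwards [sum_energy_le ha hb (box n), ae_mem_Ioc] with t ht htm
    refine ht.trans ?_
    have hsub : Ioc 0 t ⊆ Ioc 0 T := Ioc_subset_Ioc_right htm.2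
    have h1 : ∫⁻ s in Ioc 0 t, ofReal (∑ k ∈ box n, fluxMode ua ub θa θb k s) ≤
        ∫⁻ s in Ioc 0 t, (ofReal (stabRate α M) * hDist (θa s) (θb s) + ofReal (8 * M ^ 2) * ρ s +
          ofReal (stabTail α M m) * tailSq (box n) (θa s) (θb s)) := by
      refine lintegral_mono_ae ?_
      filter_upwards [ae_restrict_of_ae_restrict_of_subset hsub ha.bound,
        ae_restrict_of_ae_restrict_of_subset hsub hb.bound, ae_Ioc ha.adm.slice t,
        ae_Ioc hb.adm.slice t, ae_Ioc ha.coeff_zero t,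
        ae_Ioc hb.coeff_zero t] with s h1 h2 h3 h4 h5 h6
      exact sum_fluxMode_le hα hM m (meas_slice hma s) (meas_slice hmb s) h1 h2 h3.1 h4.1
        (by rw [h5, h6, h0]) (neg_mem_box n)
    have hdm := measurable_hDist hma hmb
    have hsm : Measurable fun s => ofReal (stabRate α M) * hDist (θa s) (θb s) +
        ofReal (8 * M ^ 2) * ρ s := (hdm.const_mul _).add (hρm.const_mul _)
    rw [lintegral_add_left hsm, lintegral_add_left (hdm.const_mul _), lintegral_const_mul _ hρm,
      lintegral_const_mul _ (measurable_tailSq hma hmb _)] at h1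
    refine (add_le_add_right h1 _).trans ?_
    have h2 := lintegral_mono_set (μ := volume) (f := ρ) hsub
    have h3 := lintegral_mono_set (μ := volume) (f := fun s => tailSq (box n) (θa s) (θb s)) hsub
    calc _ ≤ hDist θ₀a θ₀b + ((∫⁻ s in Ioc 0 t, ofReal (stabRate α M) *
          hDist (θa s) (θb s)) + ofReal (8 * M ^ 2) * (∫⁻ s in Ioc 0 T, ρ s) +
          ofReal (stabTail α M m) * ∫⁻ s in Ioc 0 T, tailSq (box n) (θa s) (θb s)) := by gcongr
      _ = _ := by ring
  have htail : (fun n => ∫⁻ s in Ioc 0 T, tailSq (box n) (θa s) (θb s)) ⇝ 0 := by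
    have := tendsto_lintegral_of_dominated_convergence (μ := ℓ(T))
      (F := fun n s => tailSq (box n) (θa s) (θb s)) (f := fun _ => 0)
      (fun _ => ofReal ((2 * M) ^ 2)) (fun n => measurable_tailSq hma hmb _)
      (fun n => hbd.mono fun s hs => (tailSq_le _ _ _).trans hs)
      (by rw [lintegral_const]; exact mul_ne_top ofReal_ne_top (by simp))
      (hbd.mono fun s hs => tendsto_tsum_notMem_box (ne_top_of_le_ne_top ofReal_ne_top hs))
    simpa using this
  filter_upwards [ae_all_iff.2 hn] with t ht
  refine le_of_tendsto_of_tendsto' (summable.hasSum.comp tendsto_box) ?_ ht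
  have := (ENNReal.Tendsto.const_mul htail (Or.inr (ofReal_ne_top (r := stabTail α M m)))).const_add
    ((hDist θ₀a θ₀b + ofReal (8 * M ^ 2) * ∫⁻ s in Ioc 0 T, ρ s) +
        (∫⁻ s in Ioc 0 t, ofReal (stabRate α M) * hDist (θa s) (θb s)))
  simpa using this

end Stability

/-! ### Limits of Fourier coefficients -/

lemma exists_subseq_tendsto_zero {X : Type*} [MeasurableSpace X] {μ : Measure X} {g : ℕ → X → ℝ≥0∞}
    (hg : ∀ n, Measurable (g n)) {A : ℕ → Set X} (hA : Monotone A) (h : ∀ j, (fun n => ∫⁻ x in A j,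
    g n x ∂μ) ⇝ 0) : ∃ φ : ℕ → ℕ, StrictMono φ ∧ ∀ j, ∀ᵐ x ∂μ.restrict (A j), (fun n => g (φ n) x) ⇝
    0 := by
  obtain ⟨φ, hφ, h1⟩ := extraction_forall_of_eventually (P := fun j n =>
    ∫⁻ x in A j, g n x ∂μ ≤ 2⁻¹ ^ j) fun j => (h j).eventually_le_const (ENNReal.pow_pos (by
        norm_num) j)
  refine ⟨φ, hφ, fun j => ?_⟩
  have h2 : ∫⁻ x in A j, ∑' n, g (φ (n + j)) x ∂μ ≠ ⊤ := by
    rw [lintegral_tsum fun n => (hg _).aemeasurable]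
    refine ne_top_of_le_ne_top ?_ (tsum_le_tsum (g := fun n => 2⁻¹ ^ n) fun n =>
      (lintegral_mono_set (hA (Nat.le_add_left j n))).trans ((h1 (n + j)).trans
        (pow_le_pow_right_of_le_one' (by norm_num) (Nat.le_add_right n j))))
    rw [ENNReal.tsum_geometric]
    norm_num
  filter_upwards [ae_lt_top (Measurable.tsum fun n => hg _) h2] with x hx
  exact (tendsto_add_atTop_iff_nat j).1 (ENNReal.tendsto_atTop_zero_of_tsum_ne_top hx.ne)

lemma enorm_tsum_mul_conj_le (g a : Z2 → ℂ) : ‖∑' k, g k * conj (a k)‖ₑ ≤ ∑' k, ‖g k‖ₑ * ‖a k‖ₑ :=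
  enorm_tsum_le_tsum_enorm.trans (le_of_eq (by simp only [enorm_mul, RCLike.enorm_conj]))

lemma sqrt_mul_enorm_sq {v : ℝ} (hv : 0 ≤ v) (z : ℂ) :
    (ofReal (√v) * ‖z‖ₑ) ^ 2 = ofReal (v * ‖z‖ ^ 2) := by
  rw [mul_pow, ← ofReal_pow (sqrt_nonneg v), sq_sqrt hv, ← ofReal_norm_sq, ← ofReal_mul hv]

lemma tsum_enorm_mul_sq_le {w : Z2 → ℝ} (hw : ∀ k, 0 < w k) (c d : Z2 → ℂ) : (∑' k, ‖c k‖ₑ * ‖d k‖ₑ)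
    ^ 2 ≤ (∑' k, ofReal ((w k)⁻¹ * ‖c k‖ ^ 2)) * ∑' k, ofReal (w k * ‖d k‖ ^ 2) := by
  have hprod : ∀ k, ‖c k‖ₑ * ‖d k‖ₑ = (ofReal (√(w k)⁻¹) * ‖c k‖ₑ) *
      (ofReal (√(w k)) * ‖d k‖ₑ) := fun k => by
    rw [mul_mul_mul_comm, ← ofReal_mul (sqrt_nonneg _),
      ← Real.sqrt_mul (inv_nonneg.2 (hw k).le), inv_mul_cancel₀ (hw k).ne', Real.sqrt_one,
      ofReal_one, one_mul]
  simp_rw [hprod]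
  refine (tsum_mul_sq_le _ _).trans (le_of_eq ?_)
  simp_rw [fun k => sqrt_mul_enorm_sq (inv_nonneg.2 (hw k).le) (c k),
    fun k => sqrt_mul_enorm_sq (hw k).le (d k)]

/-- Bounded sequences in a weighted `ℓ²` that converge in each coordinate converge weakly. -/
lemma tendsto_tsum_mul_conj {a : ℕ → Z2 → ℂ} {b g : Z2 → ℂ} {w : Z2 → ℝ} (hw : ∀ k, 0 < w k) (ha :
    ∀ᶠ n in atTop, ∑' k, ofReal (w k * ‖a n k‖ ^ 2) ≤ K)
    (hg : ∑' k, ofReal ((w k)⁻¹ * ‖g k‖ ^ 2) ≠ ⊤)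
    (h : ∀ k, (a · k) ⇝ (b k)) :
    (fun n => ∑' k, g k * conj (a n k)) ⇝ (∑' k, g k * conj (b k)) := by
  have hb : ∑' k, ofReal (w k * ‖b k‖ ^ 2) ≤ K := by
    refine summable.tsum_le_of_sum_le fun S => ?_
    refine le_of_tendsto (tendsto_finsetSum S fun k _ => tendsto_ofReal
      (((h k).norm.pow 2).const_mul (w k))) (ha.mono fun n hn => (sum_le_tsum S).trans hn)
  have hsum : ∀ d : Z2 → ℂ, ∑' k, ofReal (w k * ‖d k‖ ^ 2) ≠ ⊤ →
      Summable fun k => g k * conj (d k) := fun d hd => by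
    exact Summable.of_norm (tsum_enorm_ne_top_iff_summable_norm.1 (fun h1 => by
        have h2 := tsum_enorm_mul_sq_le hw g d
        simp only [enorm_mul, RCLike.enorm_conj] at h1
        rw [h1] at h2
        exact mul_ne_top hg hd (top_le_iff.1 (by simpa using h2))))
  rw [tendsto_iff_edist_tendsto_0]
  have hD : ∀ᶠ n in atTop, ∑' k, ofReal (w k * ‖a n k - b k‖ ^ 2) ≤ 4 * K := by
    filter_upwards [ha] with n hn
    calc _ ≤ ∑' k, (2 * ofReal (w k * ‖a n k‖ ^ 2) + 2 * ofReal (w k * ‖b k‖ ^ 2)) := by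
          refine tsum_le_tsum fun k => ?_
          rw [← sqrt_mul_enorm_sq (hw k).le, ← sqrt_mul_enorm_sq (hw k).le, ← sqrt_mul_enorm_sq (hw
              k).le]
          refine le_trans (pow_le_pow_left' ?_ 2) (add_sq_le_two _ _)
          rw [← mul_add]
          exact mul_le_mul_right (enorm_sub_le) _
      _ = 2 * _ + 2 * _ := by rw [tsum_add, ENNReal.tsum_mul_left, ENNReal.tsum_mul_left]
      _ ≤ 2 * K + 2 * K := by gcongr
      _ = 4 * K := by ring
  have hz : (fun N => ((∑' k, if k ∈ box N then 0 else
      ofReal ((w k)⁻¹ * ‖g k‖ ^ 2)) * (4 * K)) ^ (1 / 2 : ℝ)) ⇝ 0 := by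
    have h2 := ((ENNReal.Tendsto.mul_const (b := 4 * (K : ℝ≥0∞)) (tendsto_tsum_notMem_box hg)
        (Or.inr (mul_ne_top (by norm_num) coe_ne_top)))).ennrpow_const (1 / 2)
    simpa using h2
  exact tendsto_of_le_liminf_of_limsup_le zero_le (ge_of_tendsto' hz (fun N => by
      have hlim : (fun n => (∑ k ∈ box N, ‖g k‖ₑ * ‖a n k - b k‖ₑ) +
          ((∑' k, if k ∈ box N then 0 else ofReal ((w k)⁻¹ * ‖g k‖ ^ 2)) * (4 * K)) ^
            (1 / 2 : ℝ)) ⇝ ((∑ k ∈ box N, ‖g k‖ₑ * 0) +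
          ((∑' k, if k ∈ box N then 0 else ofReal ((w k)⁻¹ * ‖g k‖ ^ 2)) * (4 * K)) ^
            (1 / 2 : ℝ)) := by
        refine Tendsto.add (tendsto_finsetSum _ fun k _ => ENNReal.Tendsto.const_mul ?_
          (Or.inr enorm_ne_top)) tendsto_const_nhds
        have := (tendsto_iff_edist_tendsto_0.1 (h k))
        simpa [edist_eq_enorm_sub] using this
      refine (limsup_le_limsup ?_).trans (hlim.limsup_eq.le.trans (by simp))
      filter_upwards [hD, ha] with n hn hn'
      rw [edist_eq_enorm_sub, ← (hsum _ (ne_top_of_le_ne_top coe_ne_top hn')).tsum_sub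
        (hsum _ (ne_top_of_le_ne_top coe_ne_top hb))]
      simp_rw [← mul_sub, ← map_sub]
      refine (enorm_tsum_mul_conj_le g fun k => a n k - b k).trans ?_
      have e : ∀ k, ‖g k‖ₑ * ‖a n k - b k‖ₑ = (if k ∈ box N then ‖g k‖ₑ * ‖a n k - b k‖ₑ else 0) +
          ‖(if k ∈ box N then 0 else g k : ℂ)‖ₑ * ‖a n k - b k‖ₑ := fun k => by
        split_ifs <;> simp
      rw [tsum_congr e, tsum_add, tsum_eq_sum (s := box N) fun k hk => by simp [hk],
        sum_congr rfl fun k hk => if_pos hk]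
      refine add_le_add_right ?_ _
      rw [one_div, ENNReal.le_rpow_inv_iff two_pos, rpow_two]
      refine (tsum_enorm_mul_sq_le hw _ _).trans (mul_le_mul' (tsum_le_tsum fun k => ?_) hn)
      split_ifs <;> simp))

/-- Weak convergence in `L²` from convergence of the Fourier coefficients. -/
lemma tendsto_integral_mul_of_coeff {f : ℕ → T2 → ℝ} {h : T2 → ℝ} (hf : ∀ n, Measurable (f n)) (hM :
    ∀ n, ∀ᵐ x ∂vol, |f n x| ≤ M) (hh : MemLp h 2 vol) (hg : MemLp g 2 vol) (hc : ∀ k, (fun n =>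
    coeff (f n) k) ⇝ (coeff h k)) : (fun n => ∫ x, g x * f n x ∂vol) ⇝ (∫ x, g x * h x ∂vol) := by
  have h1 := tendsto_tsum_mul_conj (a := fun n k => coeff (f n) k) (b := coeff h) (g := coeff g)
    (w := fun _ => 1) (K := toNNReal (M ^ 2)) (fun _ => one_pos)
    (Eventually.of_forall fun n => by simp_rw [one_mul]; exact tsum_coeff_sq_le (hf n) (hM n))
    (by simp_rw [inv_one, one_mul, ← ofReal_integral_sq_eq hg]; exact ofReal_ne_top) hc
  rw [(hasSum_coeff_mul_conj hg hh).tsum_eq] at h1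
  simp_rw [fun n => (hasSum_coeff_mul_conj hg (memLp_bdd (hf n) (hM n))).tsum_eq] at h1
  exact (Complex.continuous_re.tendsto _).comp h1

lemma ae_abs_le_of_coeff_tendsto {f : ℕ → T2 → ℝ} {h : T2 → ℝ} (hf : ∀ n, Measurable (f n)) (hM : ∀
    n, ∀ᵐ x ∂vol, |f n x| ≤ M) (hh : MemLp h 2 vol) (hc : ∀ k, (fun n => coeff (f n) k) ⇝ (coeff h
    k)) : ∀ᵐ x ∂vol, |h x| ≤ M := by
  have hlim : ∀ s : Set T2, MeasurableSet s →
      (fun n => ∫ x in s, f n x ∂vol) ⇝ (∫ x in s, h x ∂vol) := fun s hs => by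
    have h1 := tendsto_integral_mul_of_coeff hf hM hh
      (g := s.indicator fun _ => 1) ((memLp_const 1).indicator hs) hc
    simp_rw [fun (f : T2 → ℝ) x => show s.indicator (fun _ => (1 : ℝ)) x * f x = s.indicator f x by
      by_cases hx : x ∈ s <;> simp [hx], integral_indicator hs] at h1
    exact h1
  have hi := hh.l1
  have hfi := fun n => (memLp_bdd (hf n) (hM n)).l1
  filter_upwards [(ae_le_of_forall_setIntegral_le hi (integrable_const M)
      fun s hs _ => le_of_tendsto' (hlim s hs) fun n => setIntegral_mono_ae (hfi n).integrableOn
        (integrable_const M).integrableOn ((hM n).mono fun x hx => (abs_le.1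
            hx).2)), (ae_le_of_forall_setIntegral_le (integrable_const (-M)) hi
      fun s hs _ => ge_of_tendsto' (hlim s hs) fun n => setIntegral_mono_ae
        (integrable_const (-M)).integrableOn (hfi n).integrableOn
          ((hM n).mono fun x hx => (abs_le.1 hx).1))] with x h1 h2 using abs_le.2 ⟨h2, h1⟩

/-- Partial sums of a Fourier series. -/
def partialSum (c : Z2 → ℂ) (n : ℕ) (x : T2) : ℝ := (∑ k ∈ box n, c k * mFourier k x).re

lemma partialSum_eq (c : Z2 → ℂ) (n : ℕ) :
    partialSum c n = fser fun k => if k ∈ box n then c k else 0 := by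
  ext x
  rw [partialSum, fser, tsum_eq_sum (s := box n) fun k hk => by simp [hk]]
  exact congrArg _ (sum_congr rfl fun k hk => by simp [hk])

lemma rapid_box (c : Z2 → ℂ) (n : ℕ) : Rapid fun k => if k ∈ box n then c k else 0 :=
  Rapid.of_finite (box n) fun k hk => by simp [hk]

lemma continuous_partialSum (c : Z2 → ℂ) (n : ℕ) : Continuous (partialSum c n) := by
  rw [partialSum_eq]
  exact continuous_fser (rapid_box c n).summable_norm

lemma coeff_partialSum (hc : ∀ k, c (-k) = conj (c k)) (n : ℕ) (k : Z2) :
    coeff (partialSum c n) k = if k ∈ box n then c k else 0 := by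
  rw [partialSum_eq]
  refine coeff_fser (rapid_box c n).summable_norm (fun k => ?_) k
  rw [apply_ite conj, hc, map_zero]
  exact if_congr (neg_mem_box n k) rfl rfl

lemma lintegral_enorm_sq_eq (hf : MemLp f 2 vol) :
    ∫⁻ x, ‖f x‖ₑ ^ 2 ∂vol = ∑' k, ‖coeff f k‖ₑ ^ 2 := by
  rw [← ofReal_integral_sq_eq_enorm hf, ofReal_integral_eq_lintegral_ofReal hf.integrable_sq
    (ae_of_all _ fun x => sq_nonneg _)]
  exact lintegral_congr fun x => by
    rw [← sq_abs, ofReal_pow (abs_nonneg _), Real.enorm_eq_ofReal_abs]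

lemma lintegral_partialSum_sub_le (hc : ∀ k, c (-k) = conj (c k)) {N n m : ℕ} (hn : N ≤ n) (hm : N ≤
    m) : ∫⁻ x, ‖partialSum c n x - partialSum c m x‖ₑ ^ 2 ∂vol ≤ ∑' k, if k ∈ box N then 0 else ‖c
    k‖ₑ ^ 2 := by
  have hc1 := fun n => memLp_cont (continuous_partialSum c n)
  have hs : MemLp (fun x => partialSum c n x - partialSum c m x) 2 vol := (hc1 n).sub (hc1 m)
  rw [lintegral_enorm_sq_eq hs]
  refine tsum_le_tsum fun k => ?_
  rw [coeff_sub ((hc1 n).l1) ((hc1 m).l1), coeff_partialSum hc, coeff_partialSum hc]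
  have hmono : ∀ {n}, N ≤ n → k ∈ box N → k ∈ box n := fun {n} h hk => by
    simp only [box, Fintype.mem_piFinset, Finset.mem_Icc] at hk ⊢
    exact fun i => ⟨by have := hk i; omega, by have := hk i; omega⟩
  by_cases hk : k ∈ box N
  · simp [hk, hmono hn hk, hmono hm hk]
  · rw [if_neg hk]
    split_ifs <;> simp

/-- A jointly measurable function of time and space with prescribed Fourier coefficients. -/
theorem exists_field (ν : Measure ℝ) [IsFiniteMeasure ν] {c : ℝ → Z2 → ℂ}
    (hcm : ∀ k, Measurable fun t => c t k) (hh : ∀ᵐ t ∂ν, ∀ k, c t (-k) = conj (c t k)) {B : ℝ≥0}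
    (hB : ∀ᵐ t ∂ν, ∑' k, ‖c t k‖ₑ ^ 2 ≤ B) :
    ∃ f : ScalarField, Measurable (uncurry f) ∧
      ∀ᵐ t ∂ν, MemLp (f t) 2 vol ∧ ∀ k, coeff (f t) k = c t k := by
  set F : ℕ → ℝ × T2 → ℝ := fun n p => partialSum (c p.1) n p.2 with hF
  have hFm : ∀ n, Measurable (F n) := fun n =>
    Complex.measurable_re.comp (Finset.measurable_fun_sum _ fun k _ =>
      ((hcm k).comp measurable_fst).mul ((mFourier k).continuous.measurable.comp measurable_snd))
  set tail : ℕ → ℝ → ℝ≥0∞ := fun N t => ∑' k, if k ∈ box N then 0 else ‖c t k‖ₑ ^ 2 with htail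
  have htail0 : (fun N => ∫⁻ t, tail N t ∂ν) ⇝ 0 := by
    have := tendsto_lintegral_of_dominated_convergence (μ := ν) (F := tail) (f := fun _ => 0)
      (fun _ => (B : ℝ≥0∞)) (fun N => Measurable.tsum fun k => by
          split_ifs
          · exact measurable_const
          · exact (hcm k).enorm.pow_const 2) (fun N => hB.mono fun t ht => (tsum_le_tsum fun k => by
        split_ifs <;> simp).trans ht)
      (by rw [lintegral_const]; exact mul_ne_top coe_ne_top (by simp))
      (hB.mono fun t ht => tendsto_tsum_notMem_box (ne_top_of_le_ne_top coe_ne_top ht))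
    simpa using this
  have hdiff : ∀ N n m, N ≤ n → N ≤ m →
      ∫⁻ p, ‖F n p - F m p‖ₑ ^ 2 ∂(ν.prod vol) ≤ ∫⁻ t, tail N t ∂ν := fun N n m hn hm => by
    have hm' : Measurable fun p => ‖F n p - F m p‖ₑ ^ 2 := ((hFm n).sub (hFm m)).enorm.pow_const 2
    rw [lintegral_prod _ hm'.aemeasurable]
    exact lintegral_mono_ae (hh.mono fun t ht => lintegral_partialSum_sub_le ht hn hm)
  have hnorm : ∀ g : ℝ × T2 → ℝ, eLpNorm g 2 (ν.prod vol) =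
      (∫⁻ p, ‖g p‖ₑ ^ 2 ∂(ν.prod vol)) ^ (1 / 2 : ℝ) := fun g => by
    rw [eLpNorm_eq_lintegral_rpow_enorm_toReal two_ne_zero ofNat_ne_top]
    simp
  have hFL : ∀ n, MemLp (F n) 2 (ν.prod vol) := fun n => by
    refine ⟨(hFm n).aestronglyMeasurable, ?_⟩
    rw [hnorm]
    refine ENNReal.rpow_lt_top_of_nonneg (by norm_num) (ne_top_of_le_ne_top
      (mul_ne_top (a := B) (b := ν univ) coe_ne_top (by simp)) ?_)
    rw [lintegral_prod _ ((hFm n).enorm.pow_const 2).aemeasurable, ← lintegral_const]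
    refine lintegral_mono_ae ?_
    filter_upwards [hh, hB] with t h1 h2
    refine le_trans ?_ h2
    refine (lintegral_enorm_sq_eq (memLp_cont (continuous_partialSum (c t) n))).trans_le
      (tsum_le_tsum fun k => ?_)
    rw [coeff_partialSum h1]
    split_ifs <;> simp
  have hcau : CauchySeq fun n => (hFL n).toLp (F n) := by
    rw [EMetric.cauchySeq_iff_le_tendsto_0]
    refine ⟨fun N => (∫⁻ t, tail N t ∂ν) ^ (1 / 2 : ℝ), fun n m N hn hm => ?_, ?_⟩
    · rw [Lp.edist_toLp_toLp, hnorm]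
      exact rpow_le_rpow (hdiff N n m hn hm) (by norm_num)
    · simpa using htail0.ennrpow_const (1 / 2)
  obtain ⟨L, hL⟩ := cauchySeq_tendsto_of_complete hcau
  obtain ⟨f, hfm, hfL⟩ : ∃ f : ℝ × T2 → ℝ, Measurable f ∧ L =ᵐ[ν.prod vol] f :=
    ⟨_, (Lp.stronglyMeasurable L).measurable, EventuallyEq.rfl⟩
  have hf2 : MemLp f 2 (ν.prod vol) := (memLp_congr_ae hfL).1 (Lp.memLp L)
  have hlim : (fun n => ∫⁻ t, (∫⁻ x, ‖F n (t, x) - f (t, x)‖ₑ ^ 2 ∂vol) ∂ν) ⇝ 0 := by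
    have h1 := ENNReal.Tendsto.pow (n := 2) (tendsto_iff_edist_tendsto_0.1 hL)
    simp only [ne_eq, OfNat.ofNat_ne_zero, not_false_eq_true, zero_pow] at h1
    refine h1.congr fun n => ?_
    rw [← Lp.toLp_coeFn L (Lp.memLp L), Lp.edist_toLp_toLp, hnorm, ← rpow_natCast, ← rpow_mul]
    norm_num
    have hm' : Measurable fun p => ‖F n p - f p‖ₑ ^ 2 := ((hFm n).sub hfm).enorm.pow_const 2
    rw [← lintegral_prod (fun p => ‖F n p - f p‖ₑ ^ 2) hm'.aemeasurable]
    exact lintegral_congr_ae (hfL.mono fun p hp => by simp [hp])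
  obtain ⟨φ, hmono, hφ⟩ := exists_subseq_tendsto_zero (μ := ν) (A := fun _ => univ)
    (g := fun n t => ∫⁻ x, ‖F n (t, x) - f (t, x)‖ₑ ^ 2 ∂vol)
    (fun n => (((hFm n).sub hfm).enorm.pow_const 2).lintegral_prod_right') (fun _ _ _ => le_rfl)
    (fun _ => by simpa using hlim)
  have hmem : ∀ᵐ t ∂ν, MemLp (fun x => f (t, x)) 2 vol := by
    have h1 : ∫⁻ t, (∫⁻ x, ‖f (t, x)‖ₑ ^ 2 ∂vol) ∂ν ≠ ⊤ := by
      rw [← lintegral_prod _ (hfm.enorm.pow_const 2).aemeasurable]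
      have := hf2.eLpNorm_ne_top
      rw [hnorm] at this
      exact fun h => this (by rw [h]; norm_num)
    filter_upwards [ae_lt_top ((hfm.enorm.pow_const 2).lintegral_prod_right') h1] with t ht
    refine ⟨(hfm.comp measurable_prodMk_left).aestronglyMeasurable, ?_⟩
    rw [eLpNorm_eq_lintegral_rpow_enorm_toReal two_ne_zero ofNat_ne_top]
    exact ENNReal.rpow_lt_top_of_nonneg (by norm_num) (by simpa using ht.ne)
  refine ⟨fun t x => f (t, x), hfm, ?_⟩
  have hφ' := hφ 0
  rw [restrict_univ] at hφ'
  filter_upwards [hmem, hφ', hh] with t h1 h2 h3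
  refine ⟨h1, fun k => ?_⟩
  have hev : ∀ᶠ n in atTop, ‖c t k - coeff (fun x => f (t, x)) k‖ₑ ^ 2 ≤
      ∫⁻ x, ‖F (φ n) (t, x) - f (t, x)‖ₑ ^ 2 ∂vol := by
    filter_upwards [hmono.tendsto_atTop.eventually
      (tendsto_box.eventually (eventually_ge_atTop {k}))] with n hn
    have hp := memLp_cont (continuous_partialSum (c t) (φ n))
    have hs : MemLp (fun x => F (φ n) (t, x) - f (t, x)) 2 vol := hp.sub h1
    rw [lintegral_enorm_sq_eq hs]
    refine le_trans (le_of_eq ?_) (le_tsum k)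
    rw [hF, coeff_sub (hp.l1) (h1.l1), coeff_partialSum h3,
      if_pos (Finset.singleton_subset_iff.1 hn)]
  have hle := ge_of_tendsto h2 hev
  have hz : ‖c t k - coeff (fun x => f (t, x)) k‖ₑ = 0 := by simpa using hle
  exact (sub_eq_zero.1 (enorm_eq_zero.1 hz)).symm

/-! ### Test functions -/

section TestFunctions

variable {φ : ScalarField}

lemma IsTest.slice (h : IsTest φ) (t : ℝ) : IsSmooth (φ t) :=
  h.1.comp (contDiff_const.prodMk contDiff_id)

lemma IsTest.deriv_coe (h : IsTest φ) (t : ℝ) (y : Fin 2 → ℝ) : deriv (fun s => φ s fun i => (y i :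
    𝕊)) t = fderiv ℝ (fun p : ℝ × (Fin 2 → ℝ) => φ p.1 fun i => (p.2 i : 𝕊)) (t, y) (1, 0) := by
  exact (((h.1.differentiable (by simp) (t, y)).hasFDerivAt).comp_hasDerivAt t ((hasDerivAt_id
      t).prodMk (hasDerivAt_const t y))).deriv

lemma IsTest.pd_coe (h : IsTest φ) (i : Fin 2) (t : ℝ) (y : Fin 2 → ℝ) : pd i (φ t) (fun j => (y j :
    𝕊)) = fderiv ℝ (fun p : ℝ × (Fin 2 → ℝ) => φ p.1 fun i => (p.2 i : 𝕊)) (t, y) (0, single i 1) :=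
    by
  rw [(h.slice t).pd_coe]
  have h1 :=
      ((h.1.differentiable (by simp) (t, y)).hasFDerivAt).comp y (hasFDerivAt_prodMk_right t y)
  have h2 : fderiv ℝ (fun y : Fin 2 → ℝ => φ t fun i => (y i : 𝕊)) y = _ := h1.fderiv
  rw [h2]
  simp

lemma continuous_of_lift {F : ℝ × T2 → ℝ} (h : Continuous fun p : ℝ × (Fin 2 → ℝ) => F (p.1, fun i
    => (p.2 i : 𝕊))) : Continuous F :=
  (IsOpenQuotientMap.id.prodMap isOpenQuotientMap_coe).isQuotientMap.continuous_iff.2 h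

lemma IsTest.continuous (h : IsTest φ) : Continuous fun p : ℝ × T2 => φ p.1 p.2 :=
  continuous_of_lift h.1.continuous

lemma IsTest.continuous_deriv (h : IsTest φ) :
    Continuous fun p : ℝ × T2 => deriv (fun s => φ s p.2) p.1 := by
  refine continuous_of_lift ?_
  simp_rw [h.deriv_coe]
  exact (h.1.continuous_fderiv (by simp)).clm_apply continuous_const

lemma IsTest.continuous_pd (h : IsTest φ) (i : Fin 2) :
    Continuous fun p : ℝ × T2 => pd i (φ p.1) p.2 := by
  refine continuous_of_lift ?_
  simp_rw [h.pd_coe]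
  exact (h.1.continuous_fderiv (by simp)).clm_apply continuous_const

/-- The derivatives of a test function are bounded, and vanish for large times. -/
lemma IsTest.exists_bound (h : IsTest φ) : ∃ T > 0, ∃ C : ℝ, 0 ≤ C ∧
    (∀ t ∈ Ioc 0 T, ∀ x, |deriv (φ · x) t| ≤ C ∧ ∀ i, |pd i (φ t) x| ≤ C) ∧
    ∀ t, T < t → ∀ x, deriv (φ · x) t = 0 ∧ ∀ i, pd i (φ t) x = 0 := by
  obtain ⟨T₀, hT₀⟩ := h.2
  refine ⟨max T₀ 1, lt_max_of_lt_right one_pos, ?_⟩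
  have hb : ∀ F : ℝ × T2 → ℝ, Continuous F → ∃ C : ℝ, 0 ≤ C ∧ ∀ t ∈ Ioc 0 (max T₀ 1), ∀ x,
      |F (t, x)| ≤ C := fun F hF => by
    obtain ⟨C, hC⟩ := ((isCompact_Icc (a := (0 : ℝ)) (b := max T₀ 1)).prod
      (isCompact_univ (X := T2))).exists_bound_of_continuousOn hF.continuousOn
    exact ⟨|C|, abs_nonneg C, fun t ht x =>
      (hC (t, x) ⟨Ioc_subset_Icc_self ht, mem_univ x⟩).trans (le_abs_self C)⟩
  obtain ⟨C1, h10, h1⟩ := hb _ h.continuous_deriv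
  obtain ⟨C2, h20, h2⟩ := hb _ (h.continuous_pd 0)
  obtain ⟨C3, h30, h3⟩ := hb _ (h.continuous_pd 1)
  refine ⟨C1 + C2 + C3, by positivity, fun t ht x => ⟨(h1 t ht x).trans (by linarith), fun i => ?_⟩,
    fun t ht x => ⟨?_, fun i => ?_⟩⟩
  · fin_cases i
    · exact (h2 t ht x).trans (by linarith)
    · exact (h3 t ht x).trans (by linarith)
  · have : (φ · x) =ᶠ[𝓝 t] fun _ => 0 :=
      (eventually_gt_nhds ht).mono fun s hs => hT₀ s ((le_max_left _ _).trans hs.le) x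
    rw [this.deriv_eq, deriv_const]
  · have : φ t = fun _ => 0 := funext fun y => hT₀ t ((le_max_left _ _).trans ht.le) y
    simp [this, pd]

end TestFunctions

/-! ### The Stokes equation on the Fourier side -/

lemma IsSmooth.summable_fracLaplacian (hα : 0 < α) (hα1 : α ≤ 1) {ψ : T2 → ℝ}
    (hψ : IsSmooth ψ) : Summable fun k => ‖((freq k ^ (2 * α) : ℝ) : ℂ) * coeff ψ k‖ := by
  refine Summable.of_nonneg_of_le (fun k => norm_nonneg _) (fun k => ?_) ((hψ.rapid 0).add
      ((hψ.rapid 2).mul_left (8 * π ^ 2)))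
  rw [norm_mul, norm_real, norm_eq_abs, abs_of_nonneg (rpow_nonneg (freq_nonneg k) _),
    ← mul_assoc, ← add_mul]
  refine mul_le_mul_of_nonneg_right ?_ (norm_nonneg _)
  have h1 : freq k ^ (2 * α) ≤ 1 + freq k ^ 2 := by
    rcases le_total (freq k) 1 with h | h
    · exact (Real.rpow_le_one (freq_nonneg k) h (by positivity)).trans (by nlinarith)
    · have := Real.rpow_le_rpow_of_exponent_le h (show 2 * α ≤ 2 by linarith)
      rw [Real.rpow_two] at this
      linarith
  have hk : ∀ i, (k i : ℝ) ^ 2 ≤ ‖k‖ ^ 2 := fun i => by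
    rw [← sq_abs]
    exact pow_le_pow_left₀ (abs_nonneg _) (norm_int_le k i) 2
  rw [freq_sq, ksq_eq] at h1
  have := hk 0
  have := hk 1
  nlinarith [sq_nonneg π]

/-- The Stokes balance at a fixed time. -/
lemma integral_stokes_eq_zero (hα : 0 < α) (hα1 : α ≤ 1) {ψ : T2 → Fin 2 → ℝ} (hf : Integrable f
    vol) (hv : ∀ i, Integrable (v · i) vol)
    (h0 : coeff f 0 = 0) {m : Fin 2 → ℝ}
    (hc : ∀ i k, coeff (v · i) k = stokesMul α k i * coeff f k + coeff (fun _ => m i) k)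
    (hψ : ∀ i, IsSmooth fun x => ψ x i) (hdiv : ∀ x, ∑ i, pd i (ψ · i) x = 0) :
    ∫ x, (f x * ψ x 1 - ∑ i, v x i * fracLaplacian α (ψ · i) x) ∂vol = 0 := by
  have hs := fun i => (hψ i).summable_fracLaplacian hα hα1
  have h1 : HasSum (fun k => (coeff (ψ · 1) k * conj (coeff f k)).re) (∫ x, f x * ψ x 1 ∂vol) := by
    have := hasSum_integral_mul_fser hf (hψ 1).rapid.summable_norm
    rwa [← (hψ 1).eq_fser] at this
  have h2 := fun i => hasSum_integral_mul_fser (hv i) (hs i)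
  have hi1 : Integrable (fun x => f x * ψ x 1) vol := by
    have := integrable_fser_mul hf (hψ 1).rapid.summable_norm
    rwa [← (hψ 1).eq_fser] at this
  have hi2 : ∀ i, Integrable (fun x => v x i * fracLaplacian α (ψ · i) x) vol := fun i =>
    integrable_fser_mul (hv i) (hs i)
  have hψc : ∀ k, ∑ i, (k i : ℂ) * coeff (ψ · i) k = 0 := fun k => by
    have hz : coeff (fun x => pd 0 (ψ · 0) x + pd 1 (ψ · 1) x) k = 0 := by
      have e : (fun x => pd 0 (ψ · 0) x + pd 1 (ψ · 1) x) = fun _ => 0 :=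
        funext fun x => by simpa [sum_univ_two] using hdiv x
      rw [e, coeff_const]
      simp
    rw [coeff_add (integrable_cont ((hψ 0).pd 0).continuous)
      (integrable_cont ((hψ 1).pd 1).continuous), coeff_pd (hψ 0), coeff_pd (hψ 1)] at hz
    have hpi : (2 * π * I : ℂ) ≠ 0 := by simp [pi_ne_zero]
    refine ((mul_eq_zero (a := (2 * π * I : ℂ))).1 ?_).resolve_left hpi
    rw [sum_univ_two, ← hz]
    ring
  rw [integral_sub hi1 (integrable_finsetSum _ fun i _ => hi2 i),
    integral_finsetSum _ fun i _ => hi2 i, sub_eq_zero, sum_univ_two]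
  refine h1.unique (((h2 0).add (h2 1)).congr_fun fun k => ?_)
  by_cases hk : k = 0
  · subst hk
    simp [h0, freq_zero, zero_rpow (by positivity : 2 * α ≠ 0)]
  · have hl := sum_leray_mul hk (hψc k) 1
    have hm : ∀ i, coeff (v · i) k = stokesMul α k i * coeff f k := fun i => by
      rw [hc, coeff_const, if_neg hk, add_zero]
    have hL : ∀ i, (leray k 1 i : ℂ) = ((freq k ^ (2 * α) : ℝ) : ℂ) * (stokesMul α k i : ℝ) :=
      fun i => by
        rw [← Complex.ofReal_mul, freq_rpow_mul_stokesMul hk]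
        simp only [leray, mul_comm]
    rw [← add_re, hm, hm]
    rw [sum_univ_two, hL, hL] at hl
    simp only [map_mul, conj_ofReal]
    congr 1
    linear_combination -conj (coeff f k) * hl

lemma solvesStokes_of_coeff (hα : 0 < α) (hα1 : α ≤ 1) {m : Fin 2 → ℝ} (hθ : ∀ᵐ t ∂ℓ, Integrable (θ
    t) vol) (hu : ∀ᵐ t ∂ℓ, ∀ i, Integrable (u t · i) vol) (h0 : ∀ᵐ t ∂ℓ, coeff (θ t) 0 = 0) (hc : ∀ᵐ
    t ∂ℓ, ∀ i k, coeff (u t · i) k = stokesMul α k i * coeff (θ t) k + coeff (fun _ => m i) k) :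
    SolvesStokes α u θ := by
  intro φ hφ
  rw [integral_congr_ae (g := fun _ => 0)]
  · simp
  filter_upwards [hθ, hu, h0, hc] with t h1 h2 h3 h4
  exact integral_stokes_eq_zero hα hα1 h1 h2 h3 h4 (fun i => (hφ.1 i).slice t) (hφ.2 t)

/-! ### Stability of the transport equation under weak convergence -/

lemma abs_integral_transport_le {D : T2 → ℝ} {P : T2 → Fin 2 → ℝ} (hM0 : 0 ≤ M)
    (hC0 : 0 ≤ C) (hM : ∀ᵐ x ∂vol, |f x| ≤ M) (hD : ∀ x, |D x| ≤ C) (hP : ∀ x i, |P x i| ≤ C)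
    (hv : ∀ i, MemLp (v · i) 2 vol) (hB : ∀ i, ∫ x, v x i ^ 2 ∂vol ≤ B) :
    |∫ x, f x * (D x + ∑ i, v x i * P x i) ∂vol| ≤ M * C * (1 + 2 * √B) := by
  have hvi := fun i => ((hv i).l1).abs
  have hsq : ∀ i, ∫ x, |v x i| ∂vol ≤ √B := fun i =>
    (integral_abs_le_sqrt (hv i)).trans (Real.sqrt_le_sqrt (hB i))
  have h1 : |∫ x, f x * (D x + ∑ i, v x i * P x i) ∂vol| ≤
      ∫ x, M * C * (1 + (|v x 0| + |v x 1|)) ∂vol := by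
    rw [← norm_eq_abs]
    refine norm_integral_le_of_norm_le
        ((((integrable_const 1).add ((hvi 0).add (hvi 1)))).const_mul _) ?_
    filter_upwards [hM] with x hx
    rw [norm_eq_abs, abs_mul, mul_assoc M]
    refine mul_le_mul hx ?_ (abs_nonneg _) hM0
    rw [sum_univ_two]
    have h2 : ∀ i, |v x i * P x i| ≤ C * |v x i| := fun i => by
      rw [abs_mul, mul_comm]
      exact mul_le_mul_of_nonneg_right (hP x i) (abs_nonneg _)
    have h3 := abs_add_le (D x) (v x 0 * P x 0 + v x 1 * P x 1)
    have h4 := abs_add_le (v x 0 * P x 0) (v x 1 * P x 1)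
    linarith [h2 0, h2 1, hD x]
  refine h1.trans ?_
  have hva : Integrable (fun x => |v x 0| + |v x 1|) vol := (hvi 0).add (hvi 1)
  rw [integral_const_mul, integral_add (integrable_const 1) hva, integral_add (hvi 0) (hvi 1)]
  refine mul_le_mul_of_nonneg_left ?_ (by positivity)
  simp only [integral_const, probReal_univ, smul_eq_mul, mul_one]
  linarith [hsq 0, hsq 1]

lemma tendsto_integral_transport {f : ℕ → T2 → ℝ} {h D : T2 → ℝ} {v : ℕ → T2 → Fin 2 → ℝ} {P : T2 →
    Fin 2 → ℝ} (hf : ∀ n, Measurable (f n)) (hM : ∀ n, ∀ᵐ x ∂vol, |f n x| ≤ M) (hh : MemLp h 2 vol)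
    (hc : ∀ k, (fun n => coeff (f n) k) ⇝ (coeff h k)) (hDc : Continuous D) (hPc : ∀ i, Continuous
    fun x => P x i) (hP : ∀ x i, |P x i| ≤ C) (hv : ∀ n i, MemLp (v n · i) 2 vol) (hw : ∀ i, MemLp
    (w · i) 2 vol) (hvw : ∀ i, (fun n => ∫ x, (v n x i - w x i) ^ 2 ∂vol) ⇝ 0) : (fun n => ∫ x, f n
    x * (D x + ∑ i, v n x i * P x i) ∂vol) ⇝ (∫ x, h x * (D x + ∑ i, w x i * P x i) ∂vol) := by
  have hwP : ∀ i, MemLp (fun x => w x i * P x i) 2 vol := fun i => by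
    have := memLp_two_bdd_mul (hPc i).measurable (ae_of_all _ fun x => hP x i) (hw i)
    simpa only [mul_comm] using this
  have hg : MemLp (fun x => D x + ∑ i, w x i * P x i) 2 vol := by
    simp only [sum_univ_two]
    exact (memLp_cont hDc).add ((hwP 0).add (hwP 1))
  have hd : ∀ n i, MemLp (fun x => v n x i - w x i) 2 vol := fun n i => (hv n i).sub (hw i)
  have hdP : ∀ n i, MemLp (fun x => (v n x i - w x i) * P x i) 2 vol := fun n i => by
    have := memLp_two_bdd_mul (hPc i).measurable (ae_of_all _ fun x => hP x i) (hd n i)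
    simpa only [mul_comm] using this
  have hfd : ∀ n i, Integrable (fun x => f n x * ((v n x i - w x i) * P x i)) vol := fun n i =>
    (memLp_two_bdd_mul (hf n) (hM n) (hdP n i)).l1
  have h2 : ∀ i, (fun n => ∫ x, f n x * ((v n x i - w x i) * P x i) ∂vol) ⇝ 0 := fun i => by
    have hs : (fun n => |M| * |C| * √(∫ x, (v n x i - w x i) ^ 2 ∂vol)) ⇝ 0 := by
      have := ((continuous_sqrt.tendsto 0).comp (hvw i)).const_mul (|M| * |C|)
      simpa using this
    refine squeeze_zero_norm (fun n => ?_) hs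
    refine (norm_integral_le_of_norm_le (((((hv n i).sub (hw i)).l1).abs).const_mul (|M| * |C|))
        ?_).trans ?_
    · filter_upwards [hM n] with x hx
      rw [norm_eq_abs, abs_mul, abs_mul, mul_assoc, mul_comm |v n x i - w x i|]
      exact mul_le_mul (hx.trans (le_abs_self M)) (mul_le_mul_of_nonneg_right
        ((hP x i).trans (le_abs_self C)) (abs_nonneg _)) (by positivity) (abs_nonneg _)
    · rw [integral_const_mul]
      exact mul_le_mul_of_nonneg_left (integral_abs_le_sqrt ((hv n i).sub (hw i))) (by positivity)
  have h3 := (tendsto_integral_mul_of_coeff hf hM hh hg hc).add ((h2 0).add (h2 1))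
  rw [add_zero, add_zero] at h3
  simp_rw [mul_comm (h _)]
  refine h3.congr fun n => ?_
  have i1 : Integrable (fun x => (D x + ∑ i, w x i * P x i) * f n x) vol :=
    integrable_mul_L2 hg (memLp_bdd (hf n) (hM n))
  have i2 : Integrable (fun x => f n x * ((v n x 0 - w x 0) * P x 0) +
    f n x * ((v n x 1 - w x 1) * P x 1)) vol := (hfd n 0).add (hfd n 1)
  rw [← integral_add (hfd n 0) (hfd n 1), ← integral_add i1 i2]
  refine integral_congr_ae (ae_of_all _ fun x => ?_)
  simp only [sum_univ_two]
  ring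

lemma integral_sq_le_of_h1Sum (hv : ∀ i, MemLp (v · i) 2 vol) (h : h1Sum v ≤ K) (i : Fin 2) : ∫ x, v
    x i ^ 2 ∂vol ≤ K :=
  integral_sq_le_of_h1NormSq (hv i) ((single_le_sum (f := fun i => h1NormSq fun x => v x i)
    (fun _ _ => zero_le) (Finset.mem_univ i)).trans h)

lemma measurable_integral_transport {φ : ScalarField} (h : Adm u θ) (hφ : IsTest φ) : Measurable fun
    t => ∫ x, θ t x * (deriv (φ · x) t + ∑ i, u t x i * pd i (φ t) x) ∂vol := by
  exact (h.meas_θ.mul (hφ.continuous_deriv.measurable.add (Finset.measurable_fun_sum _ fun i _ =>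
      (measurable_coord h.meas_u i).mul (hφ.continuous_pd
          i).measurable))).stronglyMeasurable.integral_prod_right'.measurable

theorem solvesTransport_of_tendsto {u : ℕ → VectorField} {θ : ℕ → ScalarField}
    {θ₀n : ℕ → T2 → ℝ} {U : VectorField} {Θ : ScalarField}
    (hM0 : 0 ≤ M) (hadm : ∀ n, Adm (u n) (θ n)) (hadmU : Adm U Θ)
    (ht : ∀ n, SolvesTransport (u n) (θ n) (θ₀n n))
    (hM : ∀ n, ∀ᵐ t ∂ℓ, ∀ᵐ x ∂vol, |θ n t x| ≤ M)
    (hK : ∀ n, ∀ᵐ t ∂ℓ, h1Sum (u n t) ≤ K)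
    (hc : ∀ᵐ t ∂ℓ, ∀ k, (fun n => coeff (θ n t) k) ⇝ (coeff (Θ t) k))
    (hu : ∀ᵐ t ∂ℓ, ∀ i, (fun n => ∫ x, (u n t x i - U t x i) ^ 2 ∂vol) ⇝ 0)
    (h₀ : ∀ ψ : T2 → ℝ, Continuous ψ →
      (fun n => ∫ x, θ₀n n x * ψ x ∂vol) ⇝ (∫ x, θ₀ x * ψ x ∂vol)) :
    SolvesTransport U Θ θ₀ := by
  intro φ hφ
  obtain ⟨T, hT, C, hC0, hC, hz⟩ := hφ.exists_bound
  have hlim : (fun n => ∫ t in Ioi (0 : ℝ), ∫ x, θ n t x * (deriv (φ · x) t +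
      ∑ i, u n t x i * pd i (φ t) x) ∂vol) ⇝ (∫ t in Ioi (0 : ℝ), ∫ x, Θ t x *
      (deriv (φ · x) t + ∑ i, U t x i * pd i (φ t) x) ∂vol) := by
    refine tendsto_integral_of_dominated_convergence
      ((Ioc 0 T).indicator fun _ => M * C * (1 + 2 * √K))
      (fun n => (measurable_integral_transport (hadm n) hφ).aestronglyMeasurable) ?_ (fun n => ?_)
          ?_
    · exact ((integrable_indicator_iff (μ := volume) measurableSet_Ioc).2
        (integrableOn_const (by simp))).restrict
    · filter_upwards [hM n, hK n, (hadm n).slice, ae_mem_Ioi] with t h1 h2 h3 h4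
      by_cases htT : t ≤ T
      · rw [indicator_of_mem (show t ∈ Ioc 0 T from ⟨h4, htT⟩)]
        exact abs_integral_transport_le hM0 hC0 h1 (fun x => (hC t ⟨h4, htT⟩ x).1)
          (fun x i => (hC t ⟨h4, htT⟩ x).2 i) h3.1 (integral_sq_le_of_h1Sum h3.1 h2)
      · rw [indicator_of_notMem fun h => htT h.2]
        simp [hz t (not_le.1 htT)]
    · filter_upwards [ae_all_iff.2 hM, ae_all_iff.2 fun n => (hadm n).slice, hc, hu, hadmU.slice,
        ae_mem_Ioi] with t h1 h2 h3 h4 h5 h6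
      obtain ⟨C', hC'⟩ := h5.2
      by_cases htT : t ≤ T
      · exact tendsto_integral_transport (fun n => meas_slice (hadm n).meas_θ t) h1
          (memLp_bdd (meas_slice hadmU.meas_θ t) hC') h3 ((fun t =>
              hφ.continuous_deriv.comp (Continuous.prodMk_right t)) t) ((fun t i =>
              (hφ.continuous_pd i).comp (Continuous.prodMk_right t)) t)
          (fun x i => (hC t ⟨h6, htT⟩ x).2 i) (fun n => (h2 n).1) h5.1 h4
      · simp [hz t (not_le.1 htT)]
  have h1 := hlim.add (h₀ _ (hφ.continuous.comp (Continuous.prodMk_right 0)))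
  refine tendsto_nhds_unique h1 ?_
  simp only [Function.comp]
  simp_rw [fun n => ht n φ hφ]
  exact tendsto_const_nhds

section

/-! ### Stokes-transport flows and their approximation -/

/-- A bounded solution of the Stokes-transport system with mean velocity `m`, the Stokes equation
being written on the Fourier side. -/
structure StokesFlow (α M : ℝ) (m : Fin 2 → ℝ) (U : VectorField) (Θ : ScalarField)
    (θ₀ : T2 → ℝ) : Prop where
  adm : Adm U Θ
  bound : ∀ᵐ t ∂ℓ, ∀ᵐ x ∂vol, |Θ t x| ≤ M
  coeff_eq : ∀ᵐ t ∂ℓ, ∀ i k, coeff (U t · i) k =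
    stokesMul α k i * coeff (Θ t) k + coeff (fun _ => m i) k
  transport : SolvesTransport U Θ θ₀

/-- Approximate solutions of the Stokes-transport system: the velocity error vanishes and the
initial temperatures converge. -/
structure StokesApprox (α M : ℝ) (m : Fin 2 → ℝ) (K : ℝ≥0) (u : ℕ → VectorField)
    (θ : ℕ → ScalarField) (θ₀n : ℕ → T2 → ℝ) (θ₀ : T2 → ℝ) : Prop where
  alpha_gt : 1 / 2 < α
  alpha_le : α ≤ 1
  M_nonneg : 0 ≤ M
  adm : ∀ n, Adm (u n) (θ n)
  transport : ∀ n, SolvesTransport (u n) (θ n) (θ₀n n)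
  bound : ∀ n, ∀ᵐ t ∂ℓ, ∀ᵐ x ∂vol, |θ n t x| ≤ M
  h1 : ∀ n, ∀ᵐ t ∂ℓ, h1Sum (u n t) ≤ K
  memLp : ∀ n, MemLp (θ₀n n) 2 vol
  memLp₀ : MemLp θ₀ 2 vol
  mean : ∀ n, coeff (θ₀n n) 0 = 0
  mean₀ : coeff θ₀ 0 = 0
  init : (fun n => ∫ x, (θ₀n n x - θ₀ x) ^ 2 ∂vol) ⇝ 0
  velErr : ∀ T, (fun n => ∫⁻ t in Ioc 0 T, velErr α m (u n t) (θ n t)) ⇝ 0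

variable {m : Fin 2 → ℝ} {u : ℕ → VectorField} {θ : ℕ → ScalarField}
  {θ₀n : ℕ → T2 → ℝ} {U : VectorField} {Θ : ScalarField}

lemma hDist_comm (f g : T2 → ℝ) : hDist f g = hDist g f := by simp only [hDist, norm_sub_rev]

lemma hDist_triangle (f g h : T2 → ℝ) : hDist f h ≤ 2 * hDist f g + 2 * hDist g h := by
  simp only [hDist]
  rw [← ENNReal.tsum_mul_left, ← ENNReal.tsum_mul_left, ← tsum_add]
  refine tsum_le_tsum fun k => ?_
  have h0 : 0 ≤ (freq k ^ 2)⁻¹ := by positivity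
  simp_rw [ofReal_mul h0, ofReal_norm_sq, mul_left_comm (2 : ℝ≥0∞), ← mul_add]
  refine mul_le_mul_right ?_ _
  rw [← sub_add_sub_cancel (coeff f k) (coeff g k)]
  exact (pow_le_pow_left' (enorm_add_le _ _) 2).trans
    ((add_sq_le_two _ _).trans_eq (mul_add _ _ _).symm)

lemma enorm_coeff_sub_sq_le (hk : k ≠ 0) :
    ‖coeff f k - coeff g k‖ₑ ^ 2 ≤ ofReal (freq k ^ 2) * hDist f g := by
  refine le_trans (le_of_eq ?_) (mul_le_mul_right (le_tsum k) _)
  rw [← ofReal_mul (sq_nonneg _), ← mul_assoc, mul_inv_cancel₀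
      ((pow_pos (zero_lt_one.trans_le (one_le_freq hk)) 2).ne'), one_mul, ofReal_norm_sq]

lemma StokesFlow.velErr_eq (h : StokesFlow α M m U Θ θ₀) : ∀ᵐ t ∂ℓ, velErr α m (U t) (Θ t) = 0 := by
  filter_upwards [h.coeff_eq] with t ht
  simp [PrandtlLimit.velErr, ht]

lemma StokesFlow.bddTransport (h : StokesFlow α M m U Θ θ₀) (h₀ : MemLp θ₀ 2 vol) (T : ℝ) :
    BddTransport U Θ θ₀ T M :=
  ⟨h.adm, h.transport, h₀.l1, ae_Ioc h.bound T⟩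

lemma StokesApprox.bddTransport (h : StokesApprox α M m K u θ θ₀n θ₀) (T : ℝ) (n : ℕ) :
    BddTransport (u n) (θ n) (θ₀n n) T M :=
  ⟨h.adm n, h.transport n, (h.memLp n).l1, ae_Ioc (h.bound n) T⟩

lemma StokesApprox.comp (h : StokesApprox α M m K u θ θ₀n θ₀) {φ : ℕ → ℕ} (hφ : StrictMono φ) :
    StokesApprox α M m K (fun n => u (φ n)) (fun n => θ (φ n)) (fun n => θ₀n (φ n)) θ₀ :=
  { alpha_gt := h.alpha_gt
    alpha_le := h.alpha_le
    M_nonneg := h.M_nonneg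
    adm := fun _ => h.adm _
    transport := fun _ => h.transport _
    bound := fun _ => h.bound _
    h1 := fun _ => h.h1 _
    memLp := fun _ => h.memLp _
    memLp₀ := h.memLp₀
    mean := fun _ => h.mean _
    mean₀ := h.mean₀
    init := h.init.comp hφ.tendsto_atTop
    velErr := fun T => (h.velErr T).comp hφ.tendsto_atTop }

/-- The error of an approximate solution in `H⁻¹` on `[0, T]`. -/
def approxErr (α M : ℝ) (m : Fin 2 → ℝ) (θ₀ : T2 → ℝ) (T : ℝ) (u : VectorField) (θ : ScalarField)
    (θ₀' : T2 → ℝ) : ℝ≥0∞ :=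
  ofReal (exp (2 * stabRate α M * T)) * (2 * (2 * hDist θ₀' θ₀ +
    ofReal (8 * M ^ 2) * ∫⁻ s in Ioc 0 T, velErr α m (u s) (θ s)))

lemma hDist_le_integral (hf : MemLp f 2 vol) (hg : MemLp g 2 vol) :
    hDist f g ≤ ofReal (∫ x, (f x - g x) ^ 2 ∂vol) := by
  have hs : MemLp (fun x => f x - g x) 2 vol := hf.sub hg
  rw [ofReal_integral_sq_eq hs]
  simp_rw [coeff_sub (hf.l1) (hg.l1)]
  exact hDist_le_tsum f g

lemma StokesApprox.tendsto_approxErr (h : StokesApprox α M m K u θ θ₀n θ₀) (T : ℝ) :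
    (fun n => approxErr α M m θ₀ T (u n) (θ n) (θ₀n n)) ⇝ 0 := by
  have h1 : (fun n => hDist (θ₀n n) θ₀) ⇝ 0 := by
    have := tendsto_ofReal h.init
    rw [ENNReal.ofReal_zero] at this
    exact tendsto_of_tendsto_of_tendsto_of_le_of_le tendsto_const_nhds this (fun _ => zero_le)
      fun n => hDist_le_integral (h.memLp n) h.memLp₀
  have h2 := ENNReal.Tendsto.const_mul (ENNReal.Tendsto.const_mul
    ((ENNReal.Tendsto.const_mul h1 (Or.inr (ofNat_ne_top (n := 2)))).add
      (ENNReal.Tendsto.const_mul (h.velErr T) (Or.inr (ofReal_ne_top (r := 8 * M ^ 2)))))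
      (Or.inr (ofNat_ne_top (n := 2))))
    (Or.inr (ofReal_ne_top (r := exp (2 * stabRate α M * T))))
  simpa [approxErr] using h2

lemma StokesApprox.hDist_le (h : StokesApprox α M m K u θ θ₀n θ₀) (T : ℝ) (n l : ℕ) : ∀ᵐ t ∂ℓ(T),
    hDist (θ n t) (θ l t) ≤ approxErr α M m θ₀ T (u n) (θ n) (θ₀n n) + approxErr α M m θ₀ T (u l) (θ
    l) (θ₀n l) := by
  filter_upwards [hDist_le_of_transport h.alpha_gt h.M_nonneg (h.bddTransport T n)
    (h.bddTransport T l) (by rw [h.mean, h.mean]) m] with t ht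
  refine ht.trans ?_
  rw [approxErr, approxErr, ← mul_add, ← mul_add,
    lintegral_add_left ((h.adm n).measurable_velErr α m)]
  refine mul_le_mul_right (mul_le_mul_right ((add_le_add_left
    (hDist_triangle (θ₀n n) θ₀ (θ₀n l)) _).trans (le_of_eq ?_)) _) _
  rw [hDist_comm θ₀]
  ring

lemma StokesApprox.hDist_flow_le (h : StokesApprox α M m K u θ θ₀n θ₀) (hU : StokesFlow α M m U Θ
    θ₀) (T : ℝ) (n : ℕ) : ∀ᵐ t ∂ℓ(T), hDist (θ n t) (Θ t) ≤ approxErr α M m θ₀ T (u n) (θ n) (θ₀n n)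
    := by
  filter_upwards [hDist_le_of_transport h.alpha_gt h.M_nonneg (h.bddTransport T n)
    (hU.bddTransport h.memLp₀ T) (by rw [h.mean, h.mean₀]) m] with t ht
  refine ht.trans ?_
  rw [approxErr, lintegral_add_left ((h.adm n).measurable_velErr α m),
    lintegral_congr_ae (ae_Ioc hU.velErr_eq T), lintegral_zero, add_zero]
  refine mul_le_mul_right (mul_le_mul_right (add_le_add_left ?_ _) _) _
  exact le_mul_of_one_le_left zero_le (by norm_num)

lemma StokesApprox.coeff_zero (h : StokesApprox α M m K u θ θ₀n θ₀) :
    ∀ᵐ t ∂ℓ, ∀ n, coeff (θ n t) 0 = 0 :=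
  ae_all_iff.2 fun n => (h.bddTransport 1 n).coeff_zero.mono fun t ht => by rw [ht, h.mean]

lemma StokesApprox.cauchySeq_coeff (h : StokesApprox α M m K u θ θ₀n θ₀) :
    ∀ᵐ t ∂ℓ, ∀ k, CauchySeq fun n => coeff (θ n t) k := by
  refine ae_Ioi_of_forall_Ioc fun T hT => ?_
  filter_upwards [ae_all_iff.2 fun n => ae_all_iff.2 fun l => h.hDist_le T n l,
    ae_Ioc h.coeff_zero T] with t h1 h2 k
  by_cases hk : k = 0
  · subst hk
    simp_rw [h2]
    exact cauchySeq_const 0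
  rw [cauchySeq_iff_tendsto_dist_atTop_0]
  have hβ := h.tendsto_approxErr T
  set β := fun n => approxErr α M m θ₀ T (u n) (θ n) (θ₀n n) with hβd
  have h3 : (fun p : ℕ × ℕ => ofReal (freq k ^ 2) * (β p.1 + β p.2)) ⇝ 0 := by
    rw [← prod_atTop_atTop_eq]
    have := ENNReal.Tendsto.const_mul ((hβ.comp tendsto_fst).add (hβ.comp tendsto_snd))
      (Or.inr (ofReal_ne_top (r := freq k ^ 2))) (f := (atTop : Filter ℕ) ×ˢ (atTop : Filter ℕ))
    simpa using this
  have h5 :=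
      (tendsto_of_tendsto_of_tendsto_of_le_of_le tendsto_const_nhds h3 (fun _ => zero_le) fun p =>
      (enorm_coeff_sub_sq_le hk).trans (mul_le_mul_right (h1 p.1 p.2) _)).ennrpow_const (1 / 2)
  have h6 := (tendsto_toReal (by simp)).comp h5
  simp only [Function.comp_def, ← rpow_natCast, ← rpow_mul] at h6
  simpa [dist_eq_norm] using h6

end

section

variable {m : Fin 2 → ℝ} {u : ℕ → VectorField} {θ : ℕ → ScalarField}
  {θ₀n : ℕ → T2 → ℝ} {U : VectorField} {Θ : ScalarField}

lemma stokesMul_neg (α : ℝ) (k : Z2) (i : Fin 2) : stokesMul α (-k) i = stokesMul α k i := by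
  simp [stokesMul, leray, perp_neg, ksq_neg, freq_neg]

lemma stokesMul_sq_le_one (hα : 1 / 2 < α) (k : Z2) (i : Fin 2) : stokesMul α k i ^ 2 ≤ 1 :=
  (stokesMul_sq_le hα k i).trans (by
    by_cases hk : k = 0
    · simp [hk, freq_zero]
    · exact inv_le_one_of_one_le₀ (one_le_pow₀ (one_le_freq hk)))

lemma h1NormSq_stokes_le (hα : 1 / 2 < α) {v : T2 → ℝ} {i : Fin 2} (hf : Measurable f) (hM : ∀ᵐ x
    ∂vol, |f x| ≤ M) (hc : ∀ k, coeff v k = stokesMul α k i * coeff f k + coeff (fun _ => m i) k) :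
    h1NormSq v ≤ 2 * ofReal (M ^ 2) + ofReal (m i ^ 2) := by
  have h1 : ∀ k, ofReal ((1 + freq k ^ 2) * ‖coeff v k‖ ^ 2) ≤
      2 * ofReal (‖coeff f k‖ ^ 2) + if k = 0 then ofReal (m i ^ 2) else 0 := fun k => by
    rw [hc, coeff_const]
    by_cases hk : k = 0
    · subst hk
      rw [if_pos rfl, if_pos rfl, stokesMul_zero, freq_zero]
      refine le_trans (le_of_eq ?_) le_add_self
      simp
    · rw [if_neg hk, if_neg hk, add_zero, add_zero, norm_mul, mul_pow, norm_real,
        norm_eq_abs, sq_abs, ← mul_assoc, ← ofReal_ofNat 2,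
        ← ofReal_mul zero_le_two]
      refine ofReal_le_ofReal (mul_le_mul_of_nonneg_right ?_ (sq_nonneg _))
      have hf2 : 1 ≤ freq k ^ 2 := one_le_pow₀ (one_le_freq hk)
      have := mul_le_mul_of_nonneg_left (stokesMul_sq_le hα k i) (by positivity : 0 ≤ 1 + freq k ^
          2)
      refine this.trans ?_
      rw [← div_eq_mul_inv, div_le_iff₀ (by positivity)]
      linarith
  refine (tsum_le_tsum h1).trans ?_
  rw [tsum_add, ENNReal.tsum_mul_left, tsum_ite_eq]
  exact add_le_add_left (mul_le_mul_right (tsum_coeff_sq_le hf hM) _) _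

/-- Admissibility of a temperature with its Stokes velocity. -/
lemma adm_of_coeff (hα : 1 / 2 < α) (hUm : Measurable (uncurry U)) (hΘm : Measurable (uncurry Θ))
    (hM : ∀ᵐ t ∂ℓ, ∀ᵐ x ∂vol, |Θ t x| ≤ M) (hU : ∀ᵐ t ∂ℓ, ∀ i, MemLp (U t · i) 2 vol) (hc : ∀ᵐ t ∂ℓ,
    ∀ i k, coeff (U t · i) k = stokesMul α k i * coeff (Θ t) k + coeff (fun _ => m i) k) : Adm U Θ
    := by
  refine ⟨hUm, hΘm, fun T _ => ⟨toNNReal (2 * M ^ 2 + m 0 ^ 2 + m 1 ^ 2 + |M|), ?_⟩⟩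
  refine ae_Ioc ?_ T
  filter_upwards [hM, hU, hc] with t h1 h2 h3
  refine ⟨fun i => ⟨h2 i, (h1NormSq_stokes_le hα (meas_slice hΘm t) h1 (h3 i)).trans ?_⟩, ?_⟩
  · rw [← ofReal_ofNat 2, ← ofReal_mul zero_le_two, ← ofReal_add (by positivity) (by positivity)]
    refine ofReal_le_ofReal ?_
    fin_cases i
    · simp only [Fin.zero_eta]
      nlinarith [abs_nonneg M]
    · simp only [Fin.mk_one]
      nlinarith [sq_nonneg (m 0), abs_nonneg M]
  · filter_upwards [h1] with x hx
    rw [Real.coe_toNNReal _ (by positivity)]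
    nlinarith [sq_nonneg M, sq_nonneg (m 0), sq_nonneg (m 1), le_abs_self M]

lemma tendsto_integral_velocity_sub (hα : 1 / 2 < α) {v : ℕ → T2 → Fin 2 → ℝ} {f : ℕ → T2 → ℝ} {h :
    T2 → ℝ} (hv : ∀ n i, MemLp (v n · i) 2 vol) (hw : ∀ i, MemLp (w · i) 2 vol) (hc : ∀ i k, coeff
    (w · i) k = stokesMul α k i * coeff h k + coeff (fun _ => m i) k) (h1 : (fun n => velErr α m (v
    n) (f n)) ⇝ 0) (h2 : (fun n => hDist (f n) h) ⇝ 0) (i : Fin 2) : (fun n => ∫ x, (v n x i - w x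
    i) ^ 2 ∂vol) ⇝ 0 := by
  have h3 : (fun n => 2 * velErr α m (v n) (f n) + 2 * hDist (f n) h) ⇝ 0 := by
    have := (ENNReal.Tendsto.const_mul h1 (Or.inr (ofNat_ne_top (n := 2)))).add
      (ENNReal.Tendsto.const_mul h2 (Or.inr (ofNat_ne_top (n := 2))))
    simpa using this
  have h4 : (fun n => ofReal (∫ x, (v n x i - w x i) ^ 2 ∂vol)) ⇝ 0 := by
    refine tendsto_of_tendsto_of_tendsto_of_le_of_le tendsto_const_nhds h3 (fun _ => zero_le)
      fun n => ?_
    have hs : MemLp (fun x => v n x i - w x i) 2 vol := (hv n i).sub (hw i)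
    simp only
    rw [ofReal_integral_sq_eq_enorm hs]
    simp_rw [coeff_sub ((hv n i).l1) ((hw i).l1), hc]
    refine (tsum_sub_stokes_le hα m (v n · i) (f n) h i).trans
      (add_le_add_left (mul_le_mul_right (le_velErr α m (v n) (f n) i) _) _)
  refine (Tendsto.congr (fun n => ?_) ((tendsto_toReal (by simp)).comp h4))
  exact ENNReal.toReal_ofReal (integral_nonneg fun x => sq_nonneg _)

lemma tendsto_integral_mul_of_sq {f : ℕ → T2 → ℝ} {h ψ : T2 → ℝ} (hf : ∀ n, MemLp (f n) 2 vol) (hh :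
    MemLp h 2 vol) (hl : (fun n => ∫ x, (f n x - h x) ^ 2 ∂vol) ⇝ 0) (hψ : MemLp ψ 2 vol) (hC : ∀ᵐ x
    ∂vol, |ψ x| ≤ C) : (fun n => ∫ x, f n x * ψ x ∂vol) ⇝ (∫ x, h x * ψ x ∂vol) := by
  rw [tendsto_iff_norm_sub_tendsto_zero]
  have hs := ((continuous_sqrt.tendsto 0).comp hl).const_mul C
  rw [Real.sqrt_zero, mul_zero] at hs
  refine squeeze_zero (fun _ => norm_nonneg _) (fun n => ?_) hs
  have hd : MemLp (fun x => f n x - h x) 2 vol := (hf n).sub hh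
  rw [← integral_sub (integrable_mul_L2 (hf n) hψ) (integrable_mul_L2 hh hψ)]
  refine (norm_integral_le_of_norm_le ((hd.l1).abs.const_mul C) (hC.mono fun x hx => ?_)).trans ?_
  · rw [← sub_mul, norm_mul, mul_comm]
    exact mul_le_mul_of_nonneg_right hx (abs_nonneg _)
  · rw [integral_const_mul]
    exact mul_le_mul_of_nonneg_left (integral_abs_le_sqrt hd)
      ((abs_nonneg _).trans hC.exists.choose_spec)

/-- Approximate solutions converge to a Stokes-transport flow. -/
theorem StokesApprox.exists_flow (h : StokesApprox α M m K u θ θ₀n θ₀) :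
    ∃ U Θ, StokesFlow α M m U Θ θ₀ := by
  obtain ⟨φ, hφ, hvel⟩ := exists_subseq_tendsto_zero (μ := volume)
    (fun n => (h.adm n).measurable_velErr α m) (A := fun j : ℕ => Ioc (0 : ℝ) j)
    (fun a b hab => Ioc_subset_Ioc_right (Nat.cast_le.2 hab)) (fun j => h.velErr j)
  have hvel' : ∀ᵐ t ∂ℓ, (fun n => PrandtlLimit.velErr α m (u (φ n) t) (θ (φ n) t)) ⇝ 0 := by
    refine ae_Ioi_of_forall_Ioc fun T _ => ?_
    obtain ⟨j, hj⟩ := exists_nat_ge T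
    exact ae_restrict_of_ae_restrict_of_subset (Ioc_subset_Ioc_right hj) (hvel j)
  replace h := h.comp hφ
  choose c hcm hc using (fun k => measurable_limit_of_tendsto_metrizable_ae
      (μ := ℓ) (L := atTop) (f := fun n t => coeff (θ (φ n) t) k)
      (fun n => (meas_coeff (h.adm n).meas_θ k).aemeasurable)
      (h.cauchySeq_coeff.mono fun t ht => cauchySeq_tendsto_of_complete (ht k)))
  have hc' := ae_all_iff.2 hc
  set ν : Measure ℝ := (ℓ).toFinite with hν
  have hae : ae ν = ae (ℓ) := ae_toFinite
  have hherm : ∀ᵐ t ∂ν, ∀ k, c (-k) t = conj (c k t) := by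
    rw [hae]
    filter_upwards [hc'] with t ht k
    refine tendsto_nhds_unique (ht (-k)) ?_
    simp_rw [coeff_neg]
    exact (Complex.continuous_conj.tendsto _).comp (ht k)
  have hbd : ∀ᵐ t ∂ν, ∑' k, ‖c k t‖ₑ ^ 2 ≤ toNNReal (M ^ 2) := by
    rw [hae]
    filter_upwards [hc', ae_all_iff.2 h.bound] with t ht hM
    refine summable.tsum_le_of_sum_le fun S => le_of_tendsto' (tendsto_finsetSum S fun k _ =>
      ENNReal.Tendsto.pow (n := 2) ((ht k).enorm)) fun n => (sum_le_tsum S).trans ?_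
    simp_rw [← ofReal_norm_sq]
    exact tsum_coeff_sq_le (meas_slice (h.adm n).meas_θ t) (hM n)
  obtain ⟨Θ, hΘm, hΘ⟩ := exists_field ν (c := fun t k => c k t) hcm hherm hbd
  choose W hWm hW using (fun i => by
      refine exists_field ν (c := fun t k => stokesMul α k i * c k t) (B := toNNReal (M ^ 2))
        (fun k => (hcm k).const_mul _) ?_ ?_
      · filter_upwards [hherm] with t ht k
        rw [ht, stokesMul_neg, map_mul, conj_ofReal]
      · filter_upwards [hbd] with t ht
        refine (tsum_le_tsum fun k => ?_).trans ht
        rw [← ofReal_norm_sq, ← ofReal_norm_sq, norm_mul, mul_pow, norm_real, norm_eq_abs, sq_abs]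
        exact ofReal_le_ofReal
          (mul_le_of_le_one_left (sq_nonneg _) (stokesMul_sq_le_one h.alpha_gt k i)))
  rw [hae] at hΘ
  have hW' : ∀ᵐ t ∂ℓ, ∀ i, MemLp (W i t) 2 vol ∧
      ∀ k, coeff (W i t) k = stokesMul α k i * c k t := by
    rw [← hae]
    exact ae_all_iff.2 hW
  have hΘlim : ∀ᵐ t ∂ℓ, ∀ k, (fun n => coeff (θ (φ n) t) k) ⇝ (coeff (Θ t) k) := by
    filter_upwards [hc', hΘ] with t h1 h2 k
    rw [h2.2]
    exact h1 k
  have hΘM : ∀ᵐ t ∂ℓ, ∀ᵐ x ∂vol, |Θ t x| ≤ M := by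
    filter_upwards [hΘlim, hΘ, ae_all_iff.2 h.bound] with t h1 h2 h3
    exact ae_abs_le_of_coeff_tendsto (fun n => meas_slice (h.adm n).meas_θ t) h3 h2.1 h1
  set U : VectorField := fun t x i => W i t x + m i with hU
  have hU2 : ∀ᵐ t ∂ℓ, ∀ i, MemLp (U t · i) 2 vol := by
    filter_upwards [hW'] with t ht i
    exact (ht i).1.add (memLp_const _)
  have hUc : ∀ᵐ t ∂ℓ, ∀ i k, coeff (U t · i) k =
      stokesMul α k i * coeff (Θ t) k + coeff (fun _ => m i) k := by
    filter_upwards [hW', hΘ] with t h1 h2 i k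
    rw [hU, coeff_add ((h1 i).1.l1) (integrable_const _), (h1 i).2, h2.2]
  have hadm : Adm U Θ := adm_of_coeff h.alpha_gt
      (measurable_pi_iff.2 fun i => (hWm i).add_const _) hΘm hΘM hU2 hUc
  have hdist : ∀ᵐ t ∂ℓ, (fun n => hDist (θ (φ n) t) (Θ t)) ⇝ 0 := by
    refine ae_Ioi_of_forall_Ioc fun T _ => ?_
    filter_upwards [ae_all_iff.2 fun n => ae_all_iff.2 fun l => h.hDist_le T n l,
      ae_Ioc hΘlim T] with t h1 h2
    refine tendsto_of_tendsto_of_tendsto_of_le_of_le tendsto_const_nhds (h.tendsto_approxErr T)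
      (fun _ => zero_le) fun n => ?_
    refine summable.tsum_le_of_sum_le fun S => ?_
    have h4 := (h.tendsto_approxErr T).const_add
      (approxErr α M m θ₀ T (u (φ n)) (θ (φ n)) (θ₀n (φ n)))
    rw [add_zero] at h4
    exact le_of_tendsto_of_tendsto' (tendsto_finsetSum S fun k _ => tendsto_ofReal
        ((((tendsto_const_nhds.sub (h2 k)).norm).pow 2).const_mul _)) h4 fun l => (sum_le_tsum
            S).trans (h1 n l)
  refine ⟨U, Θ, hadm, hΘM, hUc, solvesTransport_of_tendsto h.M_nonneg h.adm hadm h.transport h.bound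
    h.h1 hΘlim ?_ fun ψ hψ => tendsto_integral_mul_of_sq h.memLp h.memLp₀ h.init
      (memLp_cont hψ) (ae_of_all _ (exists_abs_le_of_continuous hψ).choose_spec)⟩
  filter_upwards [hvel', hdist, hUc, hU2, ae_all_iff.2 fun n => (h.adm n).slice] with t h1 h2 h3 h4
      h5
  exact tendsto_integral_velocity_sub h.alpha_gt (fun n => (h5 n).1) h4 h3 h1 h2

end

section

/-! ### Existence and uniqueness for the Stokes-transport system -/

variable {m : Fin 2 → ℝ} {U : VectorField} {Θ : ScalarField}

lemma ae_prod_eq {E : Type*} [MeasurableSpace E] [AddGroup E] [MeasurableSingletonClass E]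
    [MeasurableSub₂ E] {f g : ℝ → T2 → E} (hf : Measurable (uncurry f)) (hg : Measurable (uncurry
    g)) (h : ∀ᵐ t ∂ℓ, f t =ᵐ[vol] g t) : ∀ᵐ p ∂(ℓ).prod vol, f p.1 p.2 = g p.1 p.2 :=
  (ae_prod_iff_ae_ae (measurableSet_eq_fun hf hg)).2 h

lemma ae_eq_of_coord (h : ∀ i, (v · i) =ᵐ[vol] fun x => w x i) : v =ᵐ[vol] w :=
  (ae_all_iff.2 h).mono fun _ hx => funext hx

lemma StokesFlow.isDivFree (h : StokesFlow α M m U Θ θ₀) : ∀ᵐ t ∂ℓ, IsDivFree (U t) := by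
  filter_upwards [h.adm.slice, h.coeff_eq] with t h1 h2
  refine isDivFree_of_coeff (fun i => (h1.1 i).l1) fun k => ?_
  simp_rw [h2]
  exact sum_mul_stokes_coeff α m _ k

lemma StokesFlow.memL1Lip (h : StokesFlow α M m U Θ θ₀) (hα : 1 / 2 < α) (hM : 0 ≤ M) (T : ℝ) :
    MemL1Lip T U := by
  refine ⟨fun _ => stokesLip α * M, integrableOn_const (by simp), ?_⟩
  rw [restrict_Icc]
  filter_upwards [ae_Ioc h.adm.slice T, ae_Ioc h.bound T, ae_Ioc h.coeff_eq T] with t h1 h2 h3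
  obtain ⟨w, hL, hb, -, hc⟩ := exists_velocity hα (meas_slice h.adm.meas_θ t) hM h2 m
  refine ⟨w, ae_eq_of_coord fun i => ae_eq_of_coeff_eq ?_ (h1.1 i) fun k => by rw [hc, h3], hL⟩
  exact memLp_bdd (continuous_of_lip fun x y => hL x y i).measurable (ae_of_all _ fun x => hb x i)

lemma StokesFlow.isWeakStokesTransport (h : StokesFlow α M m U Θ θ₀) (hα : 1 / 2 < α)
    (hα1 : α ≤ 1) (h₀ : MemLp θ₀ 2 vol) (hm : coeff θ₀ 0 = 0) :
    IsWeakStokesTransport α U Θ θ₀ where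
  velocity_mem T hT := by
    refine ⟨h.adm.meas_u.aestronglyMeasurable, ?_⟩
    obtain ⟨C, hC⟩ := h.adm.bound T hT
    rw [restrict_Icc]
    exact ⟨C, hC.mono fun t ht => ht.1⟩
  temperature_mem T _ := by
    refine memLp_top_of_bound h.adm.meas_θ.aestronglyMeasurable M ?_
    rw [volUpTo, restrict_Icc]
    exact (ae_prod_iff_ae_ae (measurableSet_le h.adm.meas_θ.norm measurable_const)).2
      (ae_Ioc h.bound T)
  divFree := h.isDivFree
  transport := h.transport
  stokes := by
    refine solvesStokes_of_coeff (by linarith) hα1 ?_ ?_ ?_ h.coeff_eq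
    · exact h.bound.mono fun t ht =>
        (memLp_bdd (meas_slice h.adm.meas_θ t) ht).l1
    · exact h.adm.slice.mono fun t ht i => (ht.1 i).l1
    · exact (h.bddTransport h₀ 1).coeff_zero.mono fun t ht => ht.trans hm

lemma StokesFlow.hasMeanOf
    (h : StokesFlow α M (fun i => ∫ x, u₀ x i ∂vol) U Θ θ₀) : HasMeanOf U u₀ := by
  filter_upwards [h.coeff_eq] with t ht i
  have := ht i 0
  rw [stokesMul_zero, coeff_const, if_pos rfl, coeff_zero_eq, ofReal_zero, zero_mul,
    zero_add] at this
  exact_mod_cast this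

lemma StokesFlow.integral_sq_eq (h : StokesFlow α M m U Θ θ₀) (hα : 1 / 2 < α) (hM : 0 ≤ M)
    (h₀ : AEMeasurable θ₀ vol) (hb : ∀ᵐ x ∂vol, |θ₀ x| ≤ M) :
    ∀ᵐ t ∂ℓ, ∫ x, Θ t x ^ 2 ∂vol = ∫ x, θ₀ x ^ 2 ∂vol :=
  integral_pow_eq_of_transport h.adm h₀ hb h.transport (fun T _ => h.memL1Lip hα hM T) h.isDivFree 2

lemma coeff_eq_of_solvesStokes {V : VectorField} {H : ScalarField} (h : Adm V H) (hs : SolvesStokes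
    α V H) (hd : ∀ᵐ t ∂ℓ, IsDivFree (V t)) (hmean : ∀ᵐ t ∂ℓ, ∀ i, ∫ x, V t x i ∂vol = m i) : ∀ᵐ t
    ∂ℓ, ∀ i k, coeff (V t · i) k = stokesMul α k i * coeff (H t) k + coeff (fun _ => m i) k := by
  refine ae_all_iff.2 fun i => ae_all_iff.2 fun k => ?_
  by_cases hk : k = 0
  · filter_upwards [hmean] with t ht
    rw [hk, stokesMul_zero, coeff_const, if_pos rfl, coeff_zero_eq, ht]
    simp
  have hf : ((freq k ^ (2 * α) : ℝ) : ℂ) ≠ 0 := by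
    exact_mod_cast (rpow_pos_of_pos (zero_lt_one.trans_le (one_le_freq hk)) _).ne'
  filter_upwards [coeff_stokes_comb h hs (sum_mul_leray k i), hd, h.slice] with t h1 h2 h3
  rw [sum_leray_mul hk (sum_mul_coeff_of_isDivFree (fun i => (h3.1 i).l1) h2 k),
    ← freq_rpow_mul_stokesMul (α := α) hk i, Complex.ofReal_mul, mul_assoc] at h1
  rw [mul_left_cancel₀ hf h1, coeff_const, if_neg hk, add_zero]

lemma StokesFlow.ae_eq (h : StokesFlow α M m U Θ θ₀) (hα : 1 / 2 < α) (hM : 0 ≤ M) (h₀ : MemLp θ₀ 2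
    vol) {V : VectorField} {H : ScalarField} (hV : Adm V H) (ht : SolvesTransport V H θ₀) (hc : ∀ᵐ t
    ∂ℓ, ∀ i k, coeff (V t · i) k = stokesMul α k i * coeff (H t) k + coeff (fun _ => m i) k) : ∀ᵐ t
    ∂ℓ, V t =ᵐ[vol] U t ∧ H t =ᵐ[vol] Θ t := by
  have key : ∀ᵐ t ∂ℓ, hDist (H t) (Θ t) = 0 := by
    refine ae_Ioi_of_forall_Ioc fun T hT => ?_
    obtain ⟨C, hC⟩ := hV.bound T hT
    have hb : BddTransport V H θ₀ T (max C M) := ⟨hV, ht, h₀.l1,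
      hC.mono fun t ht => ht.2.mono fun x hx => hx.trans (le_max_left _ _)⟩
    have hz : ∫⁻ s in Ioc 0 T, (velErr α m (V s) (H s) + velErr α m (U s) (Θ s)) = 0 := by
      rw [← lintegral_zero (μ := ℓ(T))]
      refine lintegral_congr_ae (ae_Ioc ?_ T)
      filter_upwards [hc, h.velErr_eq] with t h1 h2
      rw [h2, add_zero]
      simp [velErr, h1]
    filter_upwards [hDist_le_of_transport hα (hM.trans (le_max_right _ _)) hb
        (⟨h.adm, h.transport, hb.integrable,
        (ae_Ioc h.bound T).mono fun t ht => ht.mono fun x hx => hx.trans (le_max_right _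
            _)⟩) rfl m] with t ht
    rw [hz] at ht
    simpa [hDist] using ht
  filter_upwards [key, hc, h.coeff_eq, hV.slice, h.adm.slice, (h.bddTransport h₀ 1).coeff_zero,
    (BddTransport.coeff_zero (T := 0) (M := M) ⟨hV, ht, h₀.l1, by simp⟩)]
    with t h1 h2 h3 ⟨h4, C, h5⟩ ⟨h6, D, h7⟩ h8 h9
  have e : ∀ k, coeff (H t) k = coeff (Θ t) k := fun k => by
    by_cases hk : k = 0
    · rw [hk, h8, h9]
    · have := enorm_coeff_sub_sq_le (f := H t) (g := Θ t) hk
      rw [h1, mul_zero, nonpos_iff_eq_zero, pow_eq_zero_iff two_ne_zero, enorm_eq_zero] at this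
      exact sub_eq_zero.1 this
  exact ⟨ae_eq_of_coord fun i => ae_eq_of_coeff_eq (h4 i) (h6 i) fun k => by rw [h2, h3, e],
    ae_eq_of_coeff_eq (memLp_bdd (meas_slice hV.meas_θ t) h5)
      (memLp_bdd (meas_slice h.adm.meas_θ t) h7) e⟩

lemma StokesFlow.unique (h : StokesFlow α M (fun i => ∫ x, u₀ x i ∂vol) U Θ θ₀) (hα : 1 / 2 < α) (hM
    : 0 ≤ M) (h₀ : MemLp θ₀ 2 vol) {V : VectorField} {H : ScalarField} (hV : IsWeakStokesTransport α
    V H θ₀) (hm : HasMeanOf V u₀) : ∀ᵐ p ∂(ℓ).prod vol, V p.1 p.2 = U p.1 p.2 ∧ H p.1 p.2 = Θ p.1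
    p.2 := by
  obtain ⟨V', H', hA, hp1, hp2⟩ := exists_adm hV.velocity_mem hV.temperature_mem
  have h1 := ae_ae_of_ae_prod hp1
  have h2 := ae_ae_of_ae_prod hp2
  have hd : ∀ᵐ t ∂ℓ, IsDivFree (V' t) := by
    filter_upwards [h1, hV.divFree] with t ha hb
    exact isDivFree_congr ha hb
  have hm' : HasMeanOf V' u₀ := by
    filter_upwards [h1, hm] with t ha hb i
    rw [← hb i]
    exact integral_congr_ae (ha.mono fun x hx => by simp only [hx])
  have key := h.ae_eq hα hM h₀ hA (solvesTransport_congr h1 h2 hV.transport)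
    (coeff_eq_of_solvesStokes hA (solvesStokes_congr h1 h2 hV.stokes) hd hm')
  filter_upwards [hp1, hp2, ae_prod_eq hA.meas_u h.adm.meas_u (key.mono fun t ht => ht.1),
    ae_prod_eq hA.meas_θ h.adm.meas_θ (key.mono fun t ht => ht.2)] with p h1 h2 h3 h4
  exact ⟨h1.trans h3, h2.trans h4⟩

end

section

/-! ### Convergence to the Stokes-transport flow -/

variable {m : Fin 2 → ℝ} {u : ℕ → VectorField} {θ : ℕ → ScalarField}
  {θ₀n : ℕ → T2 → ℝ} {U : VectorField} {Θ : ScalarField}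

lemma integral_sub_sq {h : T2 → ℝ} (hf : MemLp f 2 vol) (hh : MemLp h 2 vol) : ∫ x, (f x - h x) ^ 2
    ∂vol = (∫ x, f x ^ 2 ∂vol) - 2 * (∫ x, h x * f x ∂vol) + ∫ x, h x ^ 2 ∂vol := by
  have hm := (integrable_mul_L2 hh hf).const_mul 2
  have hs : Integrable (fun x => f x ^ 2 - 2 * (h x * f x)) vol := hf.integrable_sq.sub hm
  rw [← integral_const_mul, ← integral_sub hf.integrable_sq hm, ← integral_add hs hh.integrable_sq]
  exact integral_congr_ae (ae_of_all _ fun x => by ring)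

lemma tendsto_of_enorm_sub_sq {E : Type*} [NormedAddCommGroup E] {f : ℕ → E} {a : E}
    (h : (fun n => ‖f n - a‖ₑ ^ 2) ⇝ 0) : f ⇝ a := by
  rw [tendsto_iff_edist_tendsto_0]
  refine ((h.ennrpow_const (1 / 2)).congr fun n => ?_).trans (by simp)
  rw [← rpow_natCast, ← rpow_mul, edist_eq_enorm_sub]
  norm_num

lemma tendsto_coeff_of_hDist {f : ℕ → T2 → ℝ} {h : T2 → ℝ} (h0 : ∀ n, coeff (f n) 0 = coeff h 0) (hd
    : (fun n => hDist (f n) h) ⇝ 0) (k : Z2) : (fun n => coeff (f n) k) ⇝ (coeff h k) := by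
  by_cases hk : k = 0
  · simp only [hk, h0, tendsto_const_nhds]
  have h1 := ENNReal.Tendsto.const_mul (a := ofReal (freq k ^ 2)) hd (Or.inr ofReal_ne_top)
  rw [mul_zero] at h1
  exact tendsto_of_enorm_sub_sq (tendsto_of_tendsto_of_tendsto_of_le_of_le tendsto_const_nhds h1
    (fun _ => zero_le) fun n => enorm_coeff_sub_sq_le hk)

lemma StokesApprox.tendsto_hDist (h : StokesApprox α M m K u θ θ₀n θ₀) (hU : StokesFlow α M m U Θ
    θ₀) : ∀ᵐ t ∂ℓ, (fun n => hDist (θ n t) (Θ t)) ⇝ 0 :=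
  ae_Ioi_of_forall_Ioc fun T _ => (ae_all_iff.2 (h.hDist_flow_le hU T)).mono fun _ ht =>
    tendsto_of_tendsto_of_tendsto_of_le_of_le tendsto_const_nhds (h.tendsto_approxErr T)
      (fun _ => zero_le) ht

lemma StokesApprox.tendsto_coeff (h : StokesApprox α M m K u θ θ₀n θ₀) (hU : StokesFlow α M m U Θ
    θ₀) : ∀ᵐ t ∂ℓ, ∀ k, (fun n => coeff (θ n t) k) ⇝ (coeff (Θ t) k) := by
  filter_upwards [h.tendsto_hDist hU, h.coeff_zero, (hU.bddTransport h.memLp₀ 1).coeff_zero]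
    with t h1 h2 h3
  exact tendsto_coeff_of_hDist (fun n => by rw [h2, h3, h.mean₀]) h1

/-- Weak convergence and conservation of the `L²` norm give strong convergence. -/
lemma StokesApprox.tendsto_integral_sub_sq (h : StokesApprox α M m K u θ θ₀n θ₀) (hU : StokesFlow α
    M m U Θ θ₀) (hb : ∀ᵐ x ∂vol, |θ₀ x| ≤ M) (hn : ∀ n, ∀ᵐ t ∂ℓ, ∫ x, θ n t x ^ 2 ∂vol = ∫ x, θ₀n n
    x ^ 2 ∂vol) : ∀ᵐ t ∂ℓ, (fun n => ∫ x, (θ n t x - Θ t x) ^ 2 ∂vol) ⇝ 0 := by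
  have h0 : (fun n => ∫ x, θ₀n n x ^ 2 ∂vol) ⇝ (∫ x, θ₀ x ^ 2 ∂vol) := by
    have h1 := h.init.add ((tendsto_integral_mul_of_sq h.memLp h.memLp₀ h.init h.memLp₀
        hb).const_mul 2)
    simp_rw [fun n => integral_sub_sq (h.memLp n) h.memLp₀, mul_comm (θ₀ _)] at h1
    have h2 := h1.sub_const (∫ x, θ₀ x ^ 2 ∂vol)
    simp_rw [← pow_two] at h2
    refine (h2.congr fun n => ?_).trans_eq ?_
    · ring
    · congr 1; ring
  filter_upwards [ae_all_iff.2 hn, ae_all_iff.2 h.bound, hU.bound, h.tendsto_coeff hU,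
    hU.integral_sq_eq h.alpha_gt h.M_nonneg h.memLp₀.1.aemeasurable hb] with t h1 h2 h3 h4 h5
  have hm := fun n => meas_slice (h.adm n).meas_θ t
  have hΘ := memLp_bdd (meas_slice hU.adm.meas_θ t) h3
  simp_rw [fun n => integral_sub_sq (memLp_bdd (hm n) (h2 n)) hΘ, h1, h5]
  refine ((h0.sub ((tendsto_integral_mul_of_coeff hm h2 hΘ hΘ h4).const_mul 2)).add_const
      _).trans_eq ?_
  simp_rw [← pow_two, h5]
  congr 1; ring

lemma ae_volUpTo {P : ℝ × T2 → Prop} (h : ∀ᵐ p ∂(ℓ).prod vol, P p)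
    (T : ℝ) : ∀ᵐ p ∂volUpTo T, P p := by
  rw [volUpTo, restrict_Icc]
  exact (Measure.prod_mono (Measure.restrict_mono_set _ Ioc_subset_Ioi_self)
      le_rfl).absolutelyContinuous h

/-- Along a subsequence the velocity error and the temperature converge pointwise. -/
lemma StokesApprox.exists_subseq (h : StokesApprox α M m K u θ θ₀n θ₀) (hU : StokesFlow α M m U Θ
    θ₀) (hb : ∀ᵐ x ∂vol, |θ₀ x| ≤ M) (hn : ∀ n, ∀ᵐ t ∂ℓ, ∫ x, θ n t x ^ 2 ∂vol = ∫ x, θ₀n n x ^ 2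
    ∂vol) : ∃ φ : ℕ → ℕ, StrictMono φ ∧ ∀ᵐ p ∂(ℓ).prod vol, (fun n => PrandtlLimit.velErr α m (u (φ
    n) p.1) (θ (φ n) p.1)) ⇝ 0 ∧ (fun n => θ (φ n) p.1 p.2) ⇝ (Θ p.1 p.2) := by
  have hmv : ∀ n, Measurable fun p : ℝ × T2 => PrandtlLimit.velErr α m (u n p.1) (θ n p.1) :=
    fun n => ((h.adm n).measurable_velErr α m).comp measurable_fst
  have hmd : ∀ n, Measurable fun p : ℝ × T2 => ‖θ n p.1 p.2 - Θ p.1 p.2‖ₑ ^ 2 := fun n =>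
    ((h.adm n).meas_θ.sub hU.adm.meas_θ).enorm.pow_const 2
  obtain ⟨φ, hφ, hl⟩ := exists_subseq_tendsto_zero (μ := (volume : Measure ℝ).prod vol)
    (g := fun n p => PrandtlLimit.velErr α m (u n p.1) (θ n p.1) + ‖θ n p.1 p.2 - Θ p.1 p.2‖ₑ ^ 2)
    (fun n => (hmv n).add (hmd n)) (A := fun j : ℕ => Ioc (0 : ℝ) j ×ˢ univ)
    (fun a b hab => prod_mono (Ioc_subset_Ioc_right (Nat.cast_le.2 hab)) le_rfl) (fun j => by
      have hd : (fun n => ∫⁻ t in Ioc 0 (j : ℝ), ∫⁻ x, ‖θ n t x - Θ t x‖ₑ ^ 2 ∂vol) ⇝ (∫⁻ t in Ioc 0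
          (j : ℝ), 0) := by
        refine tendsto_lintegral_of_dominated_convergence (fun _ => ofReal (2 * M) ^ 2)
          (fun n => (hmd n).lintegral_prod_right') (fun n => ?_) (by simp [mul_eq_top]) ?_
        · filter_upwards [ae_Ioc (h.bound n) j, ae_Ioc hU.bound j] with t h1 h2
          refine (lintegral_mono_ae (g := fun _ => ofReal (2 * M) ^ 2) ?_).trans (by simp)
          filter_upwards [h1, h2] with x h3 h4
          rw [Real.enorm_eq_ofReal_abs]
          exact pow_le_pow_left' (ofReal_le_ofReal ((abs_sub _ _).trans (by linarith))) 2
        · filter_upwards [ae_Ioc (h.tendsto_integral_sub_sq hU hb hn) j,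
            ae_Ioc (ae_all_iff.2 h.bound) j, ae_Ioc hU.bound j] with t h1 h2 h3
          have h4 := tendsto_ofReal h1
          rw [ENNReal.ofReal_zero] at h4
          refine h4.congr fun n => ?_
          have h5 : MemLp (fun x => θ n t x - Θ t x) 2 vol :=
            (memLp_bdd (meas_slice (h.adm n).meas_θ t) (h2 n)).sub
              (memLp_bdd (meas_slice hU.adm.meas_θ t) h3)
          rw [lintegral_enorm_sq_eq h5, ofReal_integral_sq_eq_enorm h5]
      have hs := (h.velErr j).add hd
      rw [lintegral_zero, add_zero] at hs
      refine hs.congr fun n => ?_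
      rw [← prod_restrict, restrict_univ, lintegral_add_left (hmv n),
        lintegral_prod _ (hmv n).aemeasurable, lintegral_prod _ (hmd n).aemeasurable]
      simp)
  refine ⟨φ, hφ, ?_⟩
  have e : (ℓ).prod vol =
      ((volume : Measure ℝ).prod vol).restrict (⋃ j : ℕ, Ioc (0 : ℝ) j ×ˢ univ) := by
    rw [← iUnion_prod_const, ← prod_restrict, restrict_univ]
    congr 3
    ext t
    simp only [mem_iUnion]
    exact ⟨fun ht => (exists_nat_ge t).imp fun _ hn => ⟨ht, hn⟩, fun ⟨_, ht, _⟩ => ht⟩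
  rw [e, ae_restrict_iUnion_iff]
  refine fun j => (hl j).mono fun p hp => ⟨tendsto_of_tendsto_of_tendsto_of_le_of_le
    tendsto_const_nhds hp (fun _ => zero_le) fun _ => le_self_add, tendsto_of_enorm_sub_sq
      (tendsto_of_tendsto_of_tendsto_of_le_of_le tendsto_const_nhds hp
        (fun _ => zero_le) fun _ => le_add_self)⟩

end

section

variable {m : Fin 2 → ℝ} {u : ℕ → VectorField} {θ : ℕ → ScalarField}
  {θ₀n : ℕ → T2 → ℝ} {U : VectorField} {Θ : ScalarField}

lemma weakStarLinftyH1_of_coeff (hm : ∀ n, Measurable (uncurry (u n))) (hK : ∀ n, ∀ᵐ t ∂ℓ, h1Sum (u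
    n t) ≤ K) (hc : ∀ᵐ t ∂ℓ, ∀ i k, (fun n => coeff (u n t · i) k) ⇝ (coeff (U t · i) k)) (T : ℝ) :
    WeakStarLinftyH1 T u U := by
  rintro g ⟨hg, hgi⟩ i
  rw [restrict_Icc] at hgi ⊢
  simp_rw [restrict_Icc] at hg
  have hw : ∀ k : Z2, 0 < 1 + freq k ^ 2 := fun k => by positivity
  have hS := (AEMeasurable.tsum (L := .unconditional Z2) fun k =>
      measurable_ofReal.comp_aemeasurable
    (((hg k).norm.aemeasurable.pow_const 2).const_mul (1 + freq k ^ 2)⁻¹)).pow_const (1 / 2 : ℝ)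
  have hK' : ∀ᵐ t ∂ℓ(T), ∀ n, h1NormSq (u n t · i) ≤ K := by
    filter_upwards [ae_Ioc (ae_all_iff.2 hK) T] with t ht n
    exact (single_le_sum (f := fun i => h1NormSq fun x => u n t x i) (fun _ _ => zero_le)
      (Finset.mem_univ i)).trans (ht n)
  have hfin := ae_lt_top' hS hgi.ne
  have hKt : (K : ℝ≥0∞) ^ (1 / 2 : ℝ) ≠ ⊤ := ENNReal.rpow_ne_top_of_nonneg (by norm_num) (by simp)
  refine tendsto_integral_of_dominated_convergence _ (fun n => ?_)
    (integrable_toReal_of_lintegral_ne_top (hS.mul_const ((K : ℝ≥0∞) ^ (1 / 2 : ℝ))) ?_)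
    (fun n => ?_) ?_
  · exact (AEMeasurable.tsum fun k => (hg k).aemeasurable.mul
        (Complex.continuous_conj.measurable.comp
      (meas_coeff (measurable_coord (hm n) i) k)).aemeasurable).aestronglyMeasurable
  · rw [lintegral_mul_const'' _ hS]
    exact mul_ne_top hgi.ne hKt
  · filter_upwards [hK', hfin] with t h1 h2
    rw [← toReal_enorm]
    refine ENNReal.toReal_mono (mul_ne_top h2.ne hKt) ((enorm_tsum_mul_conj_le _ _).trans ?_)
    rw [← ENNReal.mul_rpow_of_nonneg _ _ (by norm_num), one_div, ENNReal.le_rpow_inv_iff two_pos,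
      rpow_two]
    exact (tsum_enorm_mul_sq_le hw _ _).trans (mul_le_mul_right (h1 n) _)
  · filter_upwards [hK', hfin, ae_Ioc hc T] with t h1 h2 h3
    exact tendsto_tsum_mul_conj hw (Eventually.of_forall h1)
      ((ENNReal.rpow_lt_top_iff_of_pos (by norm_num)).1 h2).ne (h3 i)

lemma weakStarLinfty_of_ae (hm : ∀ n, Measurable (uncurry (θ n))) (hM : ∀ n, ∀ᵐ t ∂ℓ, ∀ᵐ x ∂vol, |θ
    n t x| ≤ M) (hl : ∀ᵐ p ∂(ℓ).prod vol, (fun n => θ n p.1 p.2) ⇝ (Θ p.1 p.2)) (T : ℝ) :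
    WeakStarLinfty T θ Θ := by
  intro g hg
  refine tendsto_integral_of_dominated_convergence (fun p => M * |g p|)
    (fun n => (hm n).aestronglyMeasurable.mul hg.1) (hg.abs.const_mul M) (fun n => ?_)
    ((ae_volUpTo hl T).mono fun p hp => hp.mul_const _)
  filter_upwards [ae_volUpTo
      ((ae_prod_iff_ae_ae (measurableSet_le (hm n).norm measurable_const)).2 (hM n)) T] with p hp
  rw [norm_mul]
  exact mul_le_mul_of_nonneg_right hp (abs_nonneg _)

lemma strongLrLq_of_ae (hm : ∀ n, Measurable (uncurry (θ n))) (hm' : Measurable (uncurry Θ)) (hM : ∀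
    n, ∀ᵐ t ∂ℓ, ∀ᵐ x ∂vol, |θ n t x| ≤ M) (hM' : ∀ᵐ t ∂ℓ, ∀ᵐ x ∂vol, |Θ t x| ≤ M) (hl : ∀ᵐ p
    ∂(ℓ).prod vol, (fun n => θ n p.1 p.2) ⇝ (Θ p.1 p.2)) (T : ℝ) {r q : ℝ} (hr : 0 < r) (hq : 0 < q)
    : StrongLrLq T r q θ Θ := by
  rw [StrongLrLq, restrict_Icc, ← lintegral_zero (μ := ℓ(T))]
  simp_rw [eLpNorm_eq_lintegral_rpow_enorm_toReal (ENNReal.ofReal_pos.2 hq).ne'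
    ofReal_ne_top, ENNReal.toReal_ofReal hq.le, ← rpow_mul]
  have hs : 0 < 1 / q * r := by positivity
  have hd : ∀ n, Measurable fun p : ℝ × T2 => ‖θ n p.1 p.2 - Θ p.1 p.2‖ₑ ^ q := fun n =>
    ((hm n).sub hm').enorm.pow_const q
  have hB : ofReal (2 * M) ^ q ≠ ⊤ := ENNReal.rpow_ne_top_of_nonneg hq.le ofReal_ne_top
  have hb : ∀ᵐ t ∂ℓ(T), ∀ n, ∀ᵐ x ∂vol, ‖θ n t x - Θ t x‖ₑ ^ q ≤ ofReal (2 * M) ^ q := by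
    filter_upwards [ae_Ioc (ae_all_iff.2 hM) T, ae_Ioc hM' T] with t h1 h2 n
    filter_upwards [h1 n, h2] with x h3 h4
    rw [Real.enorm_eq_ofReal_abs]
    exact rpow_le_rpow (ofReal_le_ofReal ((abs_sub _ _).trans (by linarith))) hq.le
  refine tendsto_lintegral_of_dominated_convergence (fun _ => (ofReal (2 * M) ^ q) ^ (1 / q * r))
    (fun n => (hd n).lintegral_prod_right'.pow_const _) (fun n => ?_) ?_ ?_
  · filter_upwards [hb] with t ht
    exact rpow_le_rpow ((lintegral_mono_ae (ht n)).trans (by simp)) hs.le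
  · rw [lintegral_const]
    exact mul_ne_top (ENNReal.rpow_ne_top_of_nonneg hs.le hB) (by simp)
  · filter_upwards [hb, ae_Ioc (ae_ae_of_ae_prod hl) T] with t h1 h2
    have h3 : (fun n => ∫⁻ x, ‖θ n t x - Θ t x‖ₑ ^ q ∂vol) ⇝ (∫⁻ _, 0 ∂vol) := by
      refine tendsto_lintegral_of_dominated_convergence (fun _ => ofReal (2 * M) ^ q)
        (fun n => (hd n).comp measurable_prodMk_left) h1 (by simpa using hB) (h2.mono fun x hx =>
            ?_)
      have h4 := ((hx.sub_const (Θ t x)).enorm).ennrpow_const q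
      rwa [sub_self, enorm_zero, ENNReal.zero_rpow_of_pos hq] at h4
    have h4 := h3.ennrpow_const (1 / q * r)
    rwa [lintegral_zero, ENNReal.zero_rpow_of_pos hs] at h4

/-- Fields that agree almost everywhere with approximate solutions converge along a subsequence to
the Stokes-transport flow. -/
theorem StokesApprox.exists_subseq_weakStar (h : StokesApprox α M m K u θ θ₀n θ₀)
    (hU : StokesFlow α M m U Θ θ₀) (hb : ∀ᵐ x ∂vol, |θ₀ x| ≤ M)
    (hn : ∀ n, ∀ᵐ t ∂ℓ, ∫ x, θ n t x ^ 2 ∂vol = ∫ x, θ₀n n x ^ 2 ∂vol)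
    {v : ℕ → VectorField} {ϑ : ℕ → ScalarField}
    (hv : ∀ n, ∀ᵐ p ∂(ℓ).prod vol, v n p.1 p.2 = u n p.1 p.2)
    (hϑ : ∀ n, ∀ᵐ p ∂(ℓ).prod vol, ϑ n p.1 p.2 = θ n p.1 p.2) :
    ∃ φ : ℕ → ℕ, StrictMono φ ∧ ∀ T > 0, WeakStarLinftyH1 T (fun n => v (φ n)) U ∧
      WeakStarLinfty T (fun n => ϑ (φ n)) Θ ∧
      ∀ r q : ℝ, 1 ≤ r → 1 ≤ q → StrongLrLq T r q (fun n => ϑ (φ n)) Θ := by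
  obtain ⟨φ, hφ, hl⟩ := h.exists_subseq hU hb hn
  have hl2 := hl.mono fun p hp => hp.2
  refine ⟨φ, hφ, fun T _ => ⟨fun g hg i => ?_, fun g hg => ?_, fun r q hr hq => ?_⟩⟩
  · refine (weakStarLinftyH1_of_coeff (fun n => (h.adm (φ n)).meas_u) (fun n => h.h1 (φ n)) ?_ T
      g hg i).congr fun n => ?_
    · filter_upwards [ae_ae_of_ae_prod hl, (h.comp hφ).tendsto_coeff hU, hU.coeff_eq]
        with t h1 h2 h3 i k
      have h5 := tendsto_of_enorm_sub_sq (a := (0 : ℂ)) (f := fun n => coeff (fun x => u (φ n) t x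
          i) k -
        stokesMul α k i * coeff (θ (φ n) t) k - coeff (fun _ => m i) k)
        (tendsto_of_tendsto_of_tendsto_of_le_of_le tendsto_const_nhds
            h1.exists.choose_spec.1 (fun _ => zero_le)
          fun n => by
            rw [sub_zero]
            exact (le_tsum k).trans (le_velErr α m (u (φ n) t) (θ (φ n) t) i))
      rw [h3, add_comm (_ * _), ← zero_add (coeff (fun _ => m i) k)]
      exact
          ((h5.add_const (coeff (fun _ => m i) k)).add ((h2 k).const_mul (stokesMul α k i :
              ℂ))).congr fun n => by ring
    · rw [restrict_Icc]
      refine integral_congr_ae ?_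
      filter_upwards [ae_Ioc (ae_ae_of_ae_prod (hv (φ n))) T] with t ht
      exact tsum_congr fun k => by
        rw [coeff_congr (g := fun x => v (φ n) t x i) (ht.mono fun x hx => by simp only [hx])]
  · refine (weakStarLinfty_of_ae (fun n => (h.adm (φ n)).meas_θ) (fun n => h.bound (φ n)) hl2 T
      g hg).congr fun n => integral_congr_ae ?_
    filter_upwards [ae_volUpTo (hϑ (φ n)) T] with p hp
    rw [hp]
  · refine (strongLrLq_of_ae (fun n => (h.adm (φ n)).meas_θ) hU.adm.meas_θ (fun n => h.bound (φ n))
      hU.bound hl2 T (by linarith) (by linarith) : StrongLrLq T r q _ Θ).congr fun n => ?_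
    rw [restrict_Icc]
    refine lintegral_congr_ae ?_
    filter_upwards [ae_Ioc (ae_ae_of_ae_prod (hϑ (φ n))) T] with t ht
    rw [eLpNorm_congr_ae (g := fun x => ϑ (φ n) t x - Θ t x) (ht.mono fun x hx => by simp only
        [hx])]

end

/-! ### The limit of vanishing inertia -/

lemma memLp_two_of_memLp_top (hf : MemLp f ⊤ vol) : MemLp f 2 vol := hf.mono_exponent le_top

lemma ae_abs_le_of_eLpNorm_le {C : ℝ≥0} (h : eLpNorm f ⊤ vol ≤ C) : ∀ᵐ x ∂vol, |f x| ≤ C := by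
  rw [eLpNorm_exponent_top] at h
  filter_upwards [ae_le_eLpNormEssSup (f := f) (μ := vol)] with x hx
  exact_mod_cast (by exact_mod_cast hx.trans h)

lemma memL1Lip_congr (h : ∀ᵐ t ∂ℓ, u t =ᵐ[vol] u' t) (hL : MemL1Lip T u) : MemL1Lip T u' := by
  obtain ⟨L, hi, hL⟩ := hL
  refine ⟨L, hi, ?_⟩
  rw [restrict_Icc] at hL ⊢
  filter_upwards [hL, ae_Ioc h T] with t ⟨w, h1, h2⟩ h3
  exact ⟨w, h1.trans h3, h2⟩

/-- Regular solutions have measurable versions to which the a priori estimates apply. -/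
lemma IsRegularBoussinesq.exists_flowData (hs : IsRegularBoussinesq α ε u θ u₀ θ₀) (hα : α ∈ Ioc (1
    / 2 : ℝ) 1) (hε : 0 < ε) (hu₀ : ∀ i, MemH1 fun x => u₀ x i) (hθ₀ : MemLp θ₀ ⊤ vol) (hM : 0 ≤ M)
    (hb : ∀ᵐ x ∂vol, |θ₀ x| ≤ M) (hdiv : IsDivFree u₀) (hmean : ∫ x, θ₀ x ∂vol = 0) : ∃ u' θ',
    FlowData α ε M u' θ' u₀ θ₀ ∧ (∀ᵐ t ∂ℓ, ∫ x, θ' t x ^ 2 ∂vol = ∫ x, θ₀ x ^ 2 ∂vol) ∧ (∀ᵐ p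
    ∂(ℓ).prod vol, u p.1 p.2 = u' p.1 p.2) ∧ ∀ᵐ p ∂(ℓ).prod vol, θ p.1 p.2 = θ' p.1 p.2 := by
  obtain ⟨u', θ', hA, hp1, hp2⟩ := exists_adm hs.velocity_mem hs.temperature_mem
  have h1 := ae_ae_of_ae_prod hp1
  have h2 := ae_ae_of_ae_prod hp2
  have ht := solvesTransport_congr h1 h2 hs.transport
  have hd : ∀ᵐ t ∂ℓ, IsDivFree (u' t) := by
    filter_upwards [h1, hs.divFree] with t ha hb
    exact isDivFree_congr ha hb
  have hL := fun T hT => memL1Lip_congr h1 (hs.velocity_lip T hT)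
  have hm := hθ₀.1.aemeasurable
  refine ⟨u', θ', ⟨⟨hα.1, hα.2, hε, hA, hM, ae_abs_le_of_transport hA hm hb hM ht hL hd, ?_,
    fun i => (hu₀ i).1, hdiv, hd, solvesMomentum_congr h1 h2 hs.momentum⟩, ht, hm, hb⟩,
    integral_pow_eq_of_transport hA hm hb ht hL hd 2, hp1, hp2⟩
  refine (BddTransport.coeff_zero (T := 0) (M := 0)
    ⟨hA, ht, (memLp_two_of_memLp_top hθ₀).l1, by simp⟩).mono fun t ht => ?_
  rw [ht, coeff_zero_eq, hmean, ofReal_zero]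

lemma enorm_coeff_zero_sq_le (f : T2 → ℝ) : ‖coeff f 0‖ₑ ^ 2 ≤ h1NormSq f := by
  refine le_trans (le_of_eq ?_) (le_tsum 0)
  simp [freq_zero]

lemma FlowData.velErr_le (h : FlowData α ε M u θ u₀ θ₀) (hv : ∀ i, MemLp (v · i) 2 vol) : ∀ᵐ t ∂ℓ,
    velErr α (fun i => ∫ x, v x i ∂vol) (u t) (θ t) ≤ residSq α u θ t + ∑ i, h1NormSq fun x => u₀ x
    i - v x i := by
  filter_upwards [ae_all_iff.2 h.mean_eq] with t ht
  have e : residSq α u θ t = ∑ i, ∑' k : Z2, if k = 0 then 0 else ‖resid α u θ k i t‖ₑ ^ 2 := by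
    rw [residSq, ← Summable.tsum_finsetSum fun _ _ => summable]
    exact tsum_congr fun k => by split_ifs <;> simp
  rw [e, ← sum_add_distrib]
  refine sum_le_sum fun i _ => ?_
  rw [← tsum_ite_eq (0 : Z2) (fun _ => h1NormSq fun x => u₀ x i - v x i), ← tsum_add]
  refine tsum_le_tsum fun k => ?_
  split_ifs with hk
  · rw [hk, stokesMul_zero, ht, coeff_const, if_pos rfl, zero_add, ofReal_zero, zero_mul,
      sub_zero, ← coeff_zero_eq, ← coeff_sub ((h.memLp i).l1) ((hv i).l1)]
    exact enorm_coeff_zero_sq_le _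
  · rw [coeff_const, if_neg hk, sub_zero, add_zero, resid]

lemma residConst_ne_top (hα : 1 / 2 < α) {N₀ : ℝ≥0} (T : ℝ) : residConst α M N₀ K T ≠ ⊤ := by
  have := prodConst_ne_top (sub_pos.2 hα)
  simp [residConst, mul_eq_top, -one_div, this]

lemma tendsto_integral_sq_of_eLpNorm_top {f : ℕ → T2 → ℝ} (hf : ∀ n, MemLp (f n) ⊤ vol) (h : (fun n
    => eLpNorm (f n) ⊤ vol) ⇝ 0) : (fun n => ∫ x, f n x ^ 2 ∂vol) ⇝ 0 := by
  have h1 := ((tendsto_toReal ENNReal.zero_ne_top).comp h).pow 2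
  rw [ENNReal.toReal_zero, zero_pow two_ne_zero] at h1
  refine squeeze_zero (fun n => integral_nonneg fun x => sq_nonneg _) (fun n => ?_) h1
  refine (integral_mono_ae (memLp_two_of_memLp_top (hf n)).integrable_sq (integrable_const _)
    ((ae_abs_le_of_eLpNorm_le (coe_toNNReal (hf n).2.ne).ge).mono fun x hx => sq_le_sq'
        (neg_le_of_abs_le hx) (le_of_abs_le hx))).trans_eq ?_
  simp [ENNReal.toReal]

/-- Solutions with vanishing inertia are approximate solutions of the Stokes-transport system. -/
lemma stokesApprox_of_flowData {e : ℕ → ℝ} {N₀ : ℝ≥0} {u : ℕ → VectorField} {θ : ℕ → ScalarField}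
    {u₀n : ℕ → T2 → Fin 2 → ℝ} {θ₀n : ℕ → T2 → ℝ} (h : ∀ n, FlowData α (e n) M (u n) (θ n) (u₀n n)
    (θ₀n n)) (he : ∀ n, e n ≤ 1) (he0 : e ⇝ 0) (hN : ∀ n, h1Sum (u₀n n) ≤ N₀) (hK : ∀ n, ∀ᵐ t ∂ℓ,
    h1Sum (u n t) ≤ K) (hu₀ : ∀ i, MemLp (u₀ · i) 2 vol) (hθn : ∀ n, MemLp (θ₀n n) ⊤ vol) (hθ₀ :
    MemLp θ₀ ⊤ vol) (hmean : ∀ n, ∫ x, θ₀n n x ∂vol = 0) (hul : ∀ i, (fun n => h1NormSq fun x => u₀n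
    n x i - u₀ x i) ⇝ 0) (hθl : (fun n => eLpNorm (fun x => θ₀n n x - θ₀ x) ⊤ vol) ⇝ 0) :
    StokesApprox α M (fun i => ∫ x, u₀ x i ∂vol) K u θ θ₀n θ₀ := by
  have h0 := h 0
  have hinit := tendsto_integral_sq_of_eLpNorm_top (fun n => (hθn n).sub hθ₀) hθl
  have h2n := fun n => memLp_two_of_memLp_top (hθn n)
  have h2 := memLp_two_of_memLp_top hθ₀
  have hc : ∀ n, coeff (θ₀n n) 0 = 0 := fun n => by rw [coeff_zero_eq, hmean, ofReal_zero]
  refine ⟨h0.alpha_gt, h0.alpha_le, h0.M_nonneg, fun n => (h n).adm, fun n => (h n).transport,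
    fun n => (h n).bound, hK, h2n, h2, hc, ?_, hinit, fun T => ?_⟩
  · have h3 : ‖coeff θ₀ 0‖ ^ 2 ≤ 0 := by
      refine ge_of_tendsto' hinit fun n => ?_
      have h5 := coeff_sub ((h2n n).l1) (h2.l1) 0
      rw [hc, zero_sub] at h5
      rw [← norm_neg, ← h5]
      exact norm_coeff_sq_le ((h2n n).sub h2) 0
    exact norm_eq_zero.1 (pow_eq_zero_iff two_ne_zero |>.1 (le_antisymm h3 (sq_nonneg _)))
  · have h3 := (ENNReal.Tendsto.mul_const (b := residConst α M N₀ K T) (tendsto_ofReal he0)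
      (Or.inr (residConst_ne_top h0.alpha_gt T))).add (ENNReal.Tendsto.mul_const
        (b := ofReal T) (tendsto_finsetSum Finset.univ fun i _ => hul i)
        (Or.inr ofReal_ne_top))
    simp only [ENNReal.ofReal_zero, zero_mul, Finset.sum_const_zero, add_zero] at h3
    refine tendsto_of_tendsto_of_tendsto_of_le_of_le tendsto_const_nhds h3 (fun _ => zero_le)
      fun n => ?_
    refine (lintegral_mono_ae (ae_Ioc ((h n).velErr_le hu₀) T)).trans ?_
    rw [lintegral_add_right _ measurable_const, setLIntegral_const, volume_Ioc, sub_zero]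
    exact add_le_add_left ((h n).lintegral_residSq_le (he n) (hN n) (hK n) T) _

end PrandtlLimit

end

theorem proposition5p1 (α : ℝ) (hα : α ∈ Ioc (1 / 2 : ℝ) 1)
    (u : ℝ → VectorField) (θ : ℝ → ScalarField)
    (u₀ε : ℝ → T2 → Fin 2 → ℝ) (θ₀ε : ℝ → T2 → ℝ)
    (u₀ : T2 → Fin 2 → ℝ) (θ₀ : T2 → ℝ)
    -- the initial data, bounded uniformly in `H¹ × L^∞`
    (hu₀ε : ∀ ε ∈ Ioc (0 : ℝ) 1, ∀ i, MemH1 fun x => u₀ε ε x i)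
    (hθ₀ε : ∀ ε ∈ Ioc (0 : ℝ) 1, MemLp (θ₀ε ε) ⊤ vol)
    (hbound : ∃ M : ℝ≥0, ∀ ε ∈ Ioc (0 : ℝ) 1,
      (∀ i, h1NormSq (fun x => u₀ε ε x i) ≤ M) ∧ eLpNorm (θ₀ε ε) ⊤ vol ≤ M)
    (hdiv : ∀ ε ∈ Ioc (0 : ℝ) 1, IsDivFree (u₀ε ε))
    (hmean : ∀ ε ∈ Ioc (0 : ℝ) 1, ∫ x, θ₀ε ε x ∂vol = 0)
    -- the initial data converge in `H¹ × L^∞`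
    (hu₀ : ∀ i, MemH1 fun x => u₀ x i) (hθ₀ : MemLp θ₀ ⊤ vol)
    (hu₀lim : ∀ i, Tendsto (fun ε => h1NormSq fun x => u₀ε ε x i - u₀ x i) (𝓝[>] 0) (𝓝 0))
    (hθ₀lim : Tendsto (fun ε => eLpNorm (fun x => θ₀ε ε x - θ₀ x) ⊤ vol) (𝓝[>] 0) (𝓝 0))
    -- the solutions of the Boussinesq-Navier-Stokes system
    (hsol : ∀ ε ∈ Ioc (0 : ℝ) 1, IsRegularBoussinesq α ε (u ε) (θ ε) (u₀ε ε) (θ₀ε ε)) :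
    ∃ (U : VectorField) (Θ : ScalarField),
      IsWeakStokesTransport α U Θ θ₀ ∧ HasMeanOf U u₀ ∧
      (∀ (V : VectorField) (H : ScalarField),
        IsWeakStokesTransport α V H θ₀ → HasMeanOf V u₀ →
          ∀ᵐ p ∂(volume.restrict (Ioi (0 : ℝ))).prod vol,
            V p.1 p.2 = U p.1 p.2 ∧ H p.1 p.2 = Θ p.1 p.2) ∧
      ∀ e : ℕ → ℝ, (∀ n, e n ∈ Ioc (0 : ℝ) 1) → Tendsto e atTop (𝓝 0) →
        ∃ σ : ℕ → ℕ, StrictMono σ ∧ ∀ T > 0,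
          WeakStarLinftyH1 T (fun n => u (e (σ n))) U ∧
          WeakStarLinfty T (fun n => θ (e (σ n))) Θ ∧
          ∀ r q : ℝ, 1 ≤ r → 1 ≤ q → StrongLrLq T r q (fun n => θ (e (σ n))) Θ := by
  obtain ⟨M₁, hM₁⟩ := hbound
  set M : ℝ≥0 := M₁ + (eLpNorm θ₀ ⊤ vol).toNNReal with hM
  have hθM : ∀ᵐ x ∂vol, |θ₀ x| ≤ M := by
    refine ae_abs_le_of_eLpNorm_le ?_
    rw [hM, ENNReal.coe_add, ENNReal.coe_toNNReal hθ₀.2.ne]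
    exact le_add_self
  have hεM : ∀ ε ∈ Ioc (0 : ℝ) 1, ∀ᵐ x ∂vol, |θ₀ε ε x| ≤ M := fun ε hε =>
    ae_abs_le_of_eLpNorm_le ((hM₁ ε hε).2.trans (ENNReal.coe_le_coe.2 le_self_add))
  choose! u' θ' hF hL hu hθ using fun ε hε => (hsol ε hε).exists_flowData hα hε.1 (hu₀ε ε hε)
    (hθ₀ε ε hε) M.2 (hεM ε hε) (hdiv ε hε) (hmean ε hε)
  obtain ⟨ε₀, hε₀, K, hK⟩ := exists_uniform_h1 hα.1 M (2 * M₁)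
  have hN : ∀ ε ∈ Ioc (0 : ℝ) 1, h1Sum (u₀ε ε) ≤ (2 * M₁ : ℝ≥0) := fun ε hε => by
    rw [h1Sum, Fin.sum_univ_two, ENNReal.coe_mul, ENNReal.coe_two, two_mul]
    exact add_le_add ((hM₁ ε hε).1 0) ((hM₁ ε hε).1 1)
  have key : ∀ e : ℕ → ℝ, (∀ n, e n ∈ Ioc (0 : ℝ) 1) → (∀ n, e n ≤ ε₀) → Tendsto e atTop (𝓝 0) →
      StokesApprox α M (fun i => ∫ x, u₀ x i ∂vol) K (fun n => u' (e n)) (fun n => θ' (e n))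
        (fun n => θ₀ε (e n)) θ₀ := fun e he he' hl => by
    have hl' : Tendsto e atTop (𝓝[>] 0) :=
      tendsto_nhdsWithin_iff.2 ⟨hl, Eventually.of_forall fun n => (he n).1⟩
    exact stokesApprox_of_flowData (fun n => hF _ (he n)) (fun n => (he n).2) hl
      (fun n => hN _ (he n)) (fun n => hK _ (he' n) _ _ _ (hF _ (he n)).toMomentumData (hN _ (he
          n)))
      (fun i => (hu₀ i).1) (fun n => hθ₀ε _ (he n)) hθ₀ (fun n => hmean _ (he n))
      (fun i => (hu₀lim i).comp hl') (hθ₀lim.comp hl')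
  have hδ : 0 < min 1 ε₀ := lt_min one_pos hε₀
  have hle : ∀ n : ℕ, min 1 ε₀ / (n + 1 : ℝ) ≤ min 1 ε₀ := fun n =>
    div_le_self hδ.le (by linarith [n.cast_nonneg (α := ℝ)])
  have h0 := key (fun n => min 1 ε₀ / (n + 1 : ℝ))
    (fun n => ⟨by positivity, (hle n).trans (min_le_left _ _)⟩)
    (fun n => (hle n).trans (min_le_right _ _)) (by
      simpa [div_eq_mul_inv] using tendsto_one_div_add_atTop_nhds_zero_nat.const_mul (min 1 ε₀))
  obtain ⟨U, Θ, hU⟩ := h0.exists_flow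
  refine ⟨U, Θ, hU.isWeakStokesTransport hα.1 hα.2 h0.memLp₀ h0.mean₀, hU.hasMeanOf,
    fun V H hV hm => hU.unique hα.1 M.2 h0.memLp₀ hV hm, fun e he hl => ?_⟩
  obtain ⟨N, hN⟩ := eventually_atTop.1 (hl.eventually (ge_mem_nhds hε₀))
  obtain ⟨φ, hφ, hc⟩ := (key (fun n => e (n + N)) (fun n => he _) (fun n => hN _ (Nat.le_add_left _
      _))
    ((tendsto_add_atTop_iff_nat N).2 hl)).exists_subseq_weakStar hU hθM (fun n => hL _ (he _))
    (fun n => hu _ (he _)) (fun n => hθ _ (he _))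
  exact ⟨fun n => φ n + N, fun a b hab => Nat.add_lt_add_right (hφ hab) N, hc⟩
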